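/- For $N\ge 1$ and $k\ge 0$ let $C_N^A=\{x\in\mathbb R^N: x_1\le\dots\le x_N\}$, and let the Bessel process $(X^N_{t,k})_{t\ge0}=(X^N_{t,k,1},\dots,X^N_{t,k,N})_{t\ge 0}$ of type $A_{N-1}$ with start in $0$ be the diffusion on $C_N^A$ with continuous paths, with $X^N_{0,k}=0$, with generator $$L f=\tfrac12\Delta f+k\sum_{i=1}^N\Bigl(\sum_{j\ne i}\frac1{x_i-x_j}\Bigr)\frac{\partial f}{\partial x_i},$$ and with reflection at the walls; that is, for every permutation invariant $f\in C_c^\infty(\mathbb R^N)$ the process $f(X^N_{t,k})-\int_0^t (Lf)(X^N_{s,k})\,ds$ is a martingale, where $Lf$ denotes its continuous extension to $C_N^A$. Let $z_{1,N}<\dots<z_{N,N}$ be the zeros of the $N$-th Hermite polynomial $H_N$ (orthogonal with respect to $e^{-x^2}dx$), let $\mathrm{Ai}$ be the Airy function, let $a_r$ be its $r$-th largest zero, and put $$\sigma^2_{max,r}=\int_0^\infty\frac{\mathrm{Ai}(x+a_r)^2}{\mathrm{Ai}'(a_r)^2\,x}\,dx .$$ Let $r\ge1$ be an integer. This integral converges,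 and for each $t>0$ $$\lim_{N\to\infty}\Bigl(\lim_{k\to\infty}N^{1/6}\sqrt{2k}\Bigl(\frac{X^N_{t,k,N-r+1}}{\sqrt{2kt}}-z_{N-r+1,N}\Bigr)\Bigr)=G_r$$ in distribution, with an $\mathcal N(0,\sigma_{max,r}^2)$-distributed random variable $G_r$; here, for every $N\ge r$, the inner limit exists in distribution. Moreover $$\frac{z_{N-r+1,N}}{\sqrt{2N}}=1-\frac{|a_r|}{2N^{2/3}}+O(N^{-1})\qquad(N\to\infty).$$ The variances satisfy $\sigma^2_{max,1}=0.834\ldots$, $\sigma^2_{max,2}=0.582\ldots$, $\sigma^2_{max,3}=0.472\ldots$, $\sigma^2_{max,4}=0.407\ldots$ (first three decimals), and $\sigma_{max,r}^2\to0$ as $r\to\infty$. -/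

import Mathlib

open MeasureTheory ProbabilityTheory Filter Topology Asymptotics
open scoped NNReal

noncomputable section

/-- The `r`-th largest zero (`r ≥ 1`) of a function `f : ℝ → ℝ`: the zero `x` of `f` such that
exactly `r` zeros `y` of `f` (including `x` itself) satisfy `x ≤ y`. -/
def rthLargestZero (f : ℝ → ℝ) (r : ℕ) : ℝ :=
  sSup {x : ℝ | f x = 0 ∧ {y : ℝ | f y = 0 ∧ x ≤ y}.ncard = r}

/-- The classical Hermite polynomials, orthogonal with respect to the density `exp (-x ^ 2)`:
`H 0 = 1`, `H 1 = 2 x`, `H (n + 2) = 2 x H (n + 1) - 2 (n + 1) H n`. -/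
def hermiteH : ℕ → Polynomial ℝ
  | 0 => 1
  | 1 => 2 * Polynomial.X
  | n + 2 => 2 * Polynomial.X * hermiteH (n + 1) - Polynomial.C (2 * ((n : ℝ) + 1)) * hermiteH n

/-- The `r`-th largest zero of the `N`-th Hermite polynomial. -/
def hermiteZero (N r : ℕ) : ℝ := rthLargestZero (fun x => (hermiteH N).eval x) r

/-- The Airy function `Ai`, through its (everywhere convergent) Maclaurin series
`Ai x = 3 ^ (-2/3) ∑ x ^ (3 n) / (9 ^ n n! Γ (n + 2/3))
  - 3 ^ (-4/3) ∑ x ^ (3 n + 1) / (9 ^ n n! Γ (n + 4/3))`. -/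
def airyAi (x : ℝ) : ℝ :=
  (3 : ℝ) ^ (-(2 / 3) : ℝ) *
      ∑' n : ℕ, x ^ (3 * n) / (9 ^ n * (n.factorial : ℝ) * Real.Gamma ((n : ℝ) + 2 / 3))
    - (3 : ℝ) ^ (-(4 / 3) : ℝ) *
      ∑' n : ℕ, x ^ (3 * n + 1) / (9 ^ n * (n.factorial : ℝ) * Real.Gamma ((n : ℝ) + 4 / 3))

/-- The `r`-th largest zero `a_r` of the Airy function. -/
def airyZero (r : ℕ) : ℝ := rthLargestZero airyAi r

/-- The function `x ↦ Ai (x + a_r) ^ 2 / (Ai' (a_r) ^ 2 x)`. -/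
def edgeIntegrand (r : ℕ) (x : ℝ) : ℝ :=
  airyAi (x + airyZero r) ^ 2 / (deriv airyAi (airyZero r) ^ 2 * x)

/-- The variance `∫_0^∞ Ai (x + a_r) ^ 2 / (Ai' (a_r) ^ 2 x) dx`. -/
def edgeVariance (r : ℕ) : ℝ := ∫ x in Set.Ioi (0 : ℝ), edgeIntegrand r x

/-- The closed Weyl chamber `x_1 ≤ ... ≤ x_N` of type `A_{N-1}`. -/
def weylChamberA (N : ℕ) : Set (EuclideanSpace ℝ (Fin N)) :=
  {x | ∀ i j : Fin N, i ≤ j → x i ≤ x j}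

/-- The open Weyl chamber `x_1 < ... < x_N` of type `A_{N-1}`. -/
def openWeylChamberA (N : ℕ) : Set (EuclideanSpace ℝ (Fin N)) :=
  {x | ∀ i j : Fin N, i < j → x i < x j}

/-- Invariance of a function on `ℝ^N` under permutations of the coordinates. -/
def IsPermInvariant {N : ℕ} (f : EuclideanSpace ℝ (Fin N) → ℝ) : Prop :=
  ∀ (σ : Equiv.Perm (Fin N)) (x : EuclideanSpace ℝ (Fin N)),
    f (WithLp.toLp 2 (fun i => x (σ i))) = f x

/-- The differential operator
`L f = (1/2) Δ f + k ∑_i (∑_{j ≠ i} 1 / (x_i - x_j)) ∂_i f` of type `A_{N-1}` with coupling `k`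
(used at points with pairwise distinct coordinates only). -/
def besselOperatorA {N : ℕ} (k : ℝ) (f : EuclideanSpace ℝ (Fin N) → ℝ)
    (x : EuclideanSpace ℝ (Fin N)) : ℝ :=
  (1 / 2) * Laplacian.laplacian f x
    + k * ∑ i : Fin N, (∑ j ∈ Finset.univ.erase i, 1 / (x i - x j))
        * fderiv ℝ f x (EuclideanSpace.single i 1)

/-- `X` is a Bessel process of type `A_{N-1}` with coupling `k ≥ 0`, started in `0`: the diffusion
with continuous paths in the closed Weyl chamber whose generator is the operator `L` above, with
reflection at the walls of the chamber. It is given by its martingale problem. The test functions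
are the smooth compactly supported permutation invariant functions `f` (invariance makes the normal
derivatives vanish at the walls, which encodes the reflection); for such `f`, the function `L f`,
defined in the open chamber, extends continuously to the closed one, and `g` is this extension. -/
structure IsBesselProcessA (N : ℕ) (k : ℝ) {Ω : Type*} [m : MeasurableSpace Ω] (P : Measure Ω)
    (X : ℝ≥0 → Ω → EuclideanSpace ℝ (Fin N)) : Prop where
  mem_chamber : ∀ t ω, X t ω ∈ weylChamberA N
  continuous_paths : ∀ ω, Continuous (fun t => X t ω)
  start_zero : ∀ᵐ ω ∂P, X 0 ω = 0
  martingale_problem : ∃ ℱ : Filtration ℝ≥0 m, StronglyAdapted ℱ X ∧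
    ∀ f g : EuclideanSpace ℝ (Fin N) → ℝ,
      ContDiff ℝ (⊤ : ℕ∞) f → HasCompactSupport f → IsPermInvariant f →
      Continuous g → Set.EqOn g (besselOperatorA k f) (openWeylChamberA N) →
      Martingale (fun (t : ℝ≥0) ω => f (X t ω) - ∫ s in (0 : ℝ)..t, g (X s.toNNReal ω)) ℱ P

end

noncomputable section

/-! ### The Airy function -/

/-- The primitive sixth root of unity `exp (i π / 3)`. -/
def airyOmega : ℂ := ⟨1 / 2, √3 / 2⟩

lemma airyOmega_sq : airyOmega ^ 2 = ⟨-1 / 2, √3 / 2⟩ := by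
  have h : √3 * √3 = 3 := Real.mul_self_sqrt (by norm_num)
  apply Complex.ext <;> simp [airyOmega, pow_two] <;> nlinarith

lemma airyOmega_cube : airyOmega ^ 3 = -1 := by
  have h : √3 * √3 = 3 := Real.mul_self_sqrt (by norm_num)
  rw [pow_succ, airyOmega_sq]
  apply Complex.ext <;> simp [airyOmega] <;> nlinarith

lemma norm_airyOmega : ‖airyOmega‖ = 1 := by
  have h := congrArg norm airyOmega_cube
  rw [norm_pow, norm_neg, norm_one] at h
  exact (pow_eq_one_iff_of_nonneg (norm_nonneg _) (by norm_num)).1 h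

/-- The integrand of the rotated Airy contour integral, weighted by `s ^ m`. -/
def airyKernel (m : ℕ) (x s : ℝ) : ℂ :=
  (s : ℂ) ^ m * Complex.exp (-((s : ℂ) ^ 3 / 3) - x * s * airyOmega)

/-- The moments of the rotated Airy contour integral. -/
def airyMoment (m : ℕ) (x : ℝ) : ℂ := ∫ s in Set.Ioi (0 : ℝ), airyKernel m x s

lemma norm_airyKernel (m : ℕ) (x : ℝ) {s : ℝ} (hs : 0 < s) :
    ‖airyKernel m x s‖ = s ^ m * Real.exp (-(s ^ 3 / 3) - x * s / 2) := by
  have : (-((s : ℂ) ^ 3 / 3) - x * s * airyOmega).re = -(s ^ 3 / 3) - x * s / 2 := by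
    have h3 : (s : ℂ) ^ 3 / 3 = ((s ^ 3 / 3 : ℝ) : ℂ) := by push_cast; ring
    have h4 : (x : ℂ) * s = ((x * s : ℝ) : ℂ) := by push_cast; ring
    rw [h3, h4, Complex.sub_re, Complex.neg_re, Complex.ofReal_re, Complex.re_ofReal_mul]
    simp [airyOmega]; ring
  rw [airyKernel, norm_mul, norm_pow, Complex.norm_exp, this, Complex.norm_real,
    Real.norm_of_nonneg hs.le]

lemma integrableOn_pow_mul_exp_neg (m : ℕ) :
    IntegrableOn (fun s : ℝ => s ^ m * Real.exp (-s)) (Set.Ioi 0) := by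
  refine (Real.GammaIntegral_convergent (s := m + 1) (by positivity)).congr_fun ?_
    measurableSet_Ioi
  intro s _
  simp [mul_comm]

lemma integrableOn_pow_mul_exp_cube (m : ℕ) (c : ℝ) :
    IntegrableOn (fun s : ℝ => s ^ m * Real.exp (-(s ^ 3 / 3) + c * s)) (Set.Ioi 0) := by
  set B := |c| + 1
  have hB : 1 ≤ B := by simp [B]
  refine Integrable.mono' ((integrableOn_pow_mul_exp_neg m).const_mul (Real.exp (B * (B + 3))))
    (by fun_prop) ?_
  refine (ae_restrict_iff' measurableSet_Ioi).2 (Eventually.of_forall fun s hs => ?_)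
  have hs : 0 < s := hs
  rw [Real.norm_of_nonneg (by positivity), mul_left_comm, ← Real.exp_add]
  refine mul_le_mul_of_nonneg_left (Real.exp_le_exp.2 ?_) (by positivity)
  have hc : c * s ≤ (B - 1) * s := by
    gcongr; simp [B, le_abs_self]
  have : B * s - s ^ 3 / 3 ≤ B * (B + 3) := by
    rcases le_total s (B + 3) with h | h
    · have : 0 < s ^ 3 := by positivity
      nlinarith
    · have h2 : (B + 3) * (B + 3) ≤ s * s := by gcongr
      have : s * (3 * B) ≤ s * (s * s) := mul_le_mul_of_nonneg_left (by nlinarith) hs.le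
      nlinarith
  linarith

lemma continuous_airyKernel (m : ℕ) (x : ℝ) : Continuous (airyKernel m x) := by
  unfold airyKernel; fun_prop

lemma integrableOn_airyKernel (m : ℕ) (x : ℝ) :
    IntegrableOn (airyKernel m x) (Set.Ioi 0) := by
  refine Integrable.mono' (integrableOn_pow_mul_exp_cube m (-x / 2))
    (continuous_airyKernel m x).aestronglyMeasurable ?_
  refine (ae_restrict_iff' measurableSet_Ioi).2 (Eventually.of_forall fun s hs => ?_)
  rw [norm_airyKernel m x hs]
  apply le_of_eq; ring_nf

lemma hasDerivAt_airyMoment (m : ℕ) (x : ℝ) :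
    HasDerivAt (airyMoment m) (-airyOmega * airyMoment (m + 1) x) x := by
  have key := hasDerivAt_integral_of_dominated_loc_of_deriv_le
    (μ := volume.restrict (Set.Ioi (0 : ℝ))) (F := airyKernel m)
    (F' := fun x s => -airyOmega * airyKernel (m + 1) x s) (x₀ := x)
    (s := Metric.ball x 1) (bound := fun s => s ^ (m + 1) * Real.exp (-(s ^ 3 / 3) + (|x| + 1) * s))
    (Metric.ball_mem_nhds x one_pos)
    (Eventually.of_forall fun y => (continuous_airyKernel m y).aestronglyMeasurable)
    (integrableOn_airyKernel m x)
    ((continuous_airyKernel (m + 1) x).const_mul _).aestronglyMeasurable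
    ?_ (integrableOn_pow_mul_exp_cube (m + 1) (|x| + 1)) ?_
  · have := key.2
    rw [integral_const_mul] at this
    exact this
  · refine (ae_restrict_iff' measurableSet_Ioi).2 (Eventually.of_forall fun s hs y hy => ?_)
    have hs : 0 < s := hs
    rw [norm_mul, norm_neg, norm_airyOmega, one_mul, norm_airyKernel _ _ hs]
    have : |y| ≤ |x| + 1 := by
      have h1 := Metric.mem_ball.1 hy
      rw [Real.dist_eq] at h1
      have := abs_sub_abs_le_abs_sub y x
      linarith
    gcongr
    have h2 := mul_le_mul_of_nonneg_right (neg_le_of_neg_le ((neg_abs_le y).trans' (neg_le_neg this)) :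
      -y ≤ |x| + 1) hs.le
    have h3 : 0 ≤ (|x| + 1) * s := by positivity
    linarith
  · refine Eventually.of_forall fun s y _ => ?_
    have h1 : HasDerivAt (fun y : ℝ => -((s : ℂ) ^ 3 / 3) - (y : ℂ) * s * airyOmega)
        (-(1 * s * airyOmega)) y := by
      have := ((Complex.ofRealCLM.hasDerivAt (x := y)).mul_const (s : ℂ)).mul_const airyOmega
      simpa using this.const_sub (-((s : ℂ) ^ 3 / 3))
    have := (h1.cexp).const_mul ((s : ℂ) ^ m)
    refine this.congr_deriv ?_
    simp only [airyKernel]; ring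

lemma norm_airyMoment_le (m : ℕ) {x : ℝ} (hx : 0 < x) :
    ‖airyMoment m x‖ ≤ m.factorial * (2 / x) ^ (m + 1) := by
  have h := Real.integral_rpow_mul_exp_neg_mul_Ioi (a := m + 1) (r := x / 2) (by positivity)
    (by positivity)
  have hint : IntegrableOn (fun s : ℝ => s ^ (((m : ℝ) + 1) - 1) * Real.exp (-(x / 2 * s)))
      (Set.Ioi 0) := by
    by_contra hc
    rw [integral_undef hc] at h
    have : 0 < (1 / (x / 2)) ^ ((m : ℝ) + 1) * Real.Gamma (m + 1) :=
      mul_pos (by positivity) (Real.Gamma_pos_of_pos (by positivity))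
    linarith
  calc ‖airyMoment m x‖ ≤ ∫ s in Set.Ioi (0 : ℝ), s ^ (((m : ℝ) + 1) - 1) *
        Real.exp (-(x / 2 * s)) := by
        refine norm_integral_le_of_norm_le hint ?_
        refine (ae_restrict_iff' measurableSet_Ioi).2 (Eventually.of_forall fun s hs => ?_)
        have hs : 0 < s := hs
        rw [norm_airyKernel _ _ hs, add_sub_cancel_right, Real.rpow_natCast]
        gcongr
        have : 0 < s ^ 3 := by positivity
        linarith
    _ = m.factorial * (2 / x) ^ (m + 1) := by
        rw [h, Real.Gamma_nat_eq_factorial, one_div_div, mul_comm]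
        congr 1
        exact_mod_cast Real.rpow_natCast (2 / x) (m + 1)

lemma integral_pow_mul_exp_cube (n : ℕ) :
    ∫ s in Set.Ioi (0 : ℝ), s ^ n * Real.exp (-(s ^ 3 / 3)) =
      (3 : ℝ) ^ (((n : ℝ) - 2) / 3) * Real.Gamma (((n : ℝ) + 1) / 3) := by
  have h := integral_rpow_mul_exp_neg_mul_rpow (p := 3) (q := n) (b := 1 / 3) (by norm_num)
    (by have : (0 : ℝ) ≤ n := n.cast_nonneg
        linarith) (by norm_num)
  rw [← (by
    refine setIntegral_congr_fun measurableSet_Ioi fun s _ => ?_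
    simp only [Real.rpow_natCast]
    norm_cast
    ring_nf : ∫ s in Set.Ioi (0 : ℝ), s ^ (n : ℝ) * Real.exp (-(1 / 3) * s ^ (3 : ℝ)) =
      ∫ s in Set.Ioi (0 : ℝ), s ^ n * Real.exp (-(s ^ 3 / 3))), h]
  congr 1
  rw [one_div, Real.inv_rpow (by norm_num), ← Real.rpow_neg (by norm_num),
    ← Real.rpow_neg_one 3, ← Real.rpow_add (by norm_num)]
  congr 1; ring

lemma hasSum_airyMoment_zero (x : ℝ) :
    HasSum (fun n : ℕ => airyOmega * (-(x * airyOmega)) ^ n / n.factorial *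
      (((3 : ℝ) ^ (((n : ℝ) - 2) / 3) * Real.Gamma (((n : ℝ) + 1) / 3) : ℝ) : ℂ))
      (airyOmega * airyMoment 0 x) := by
  have key := hasSum_integral_of_dominated_convergence
    (μ := volume.restrict (Set.Ioi (0 : ℝ)))
    (F := fun (n : ℕ) (s : ℝ) => airyOmega * (-(x * airyOmega)) ^ n / n.factorial *
      ((s ^ n * Real.exp (-(s ^ 3 / 3)) : ℝ) : ℂ))
    (f := fun s => airyOmega * airyKernel 0 x s)
    (fun n s => (|x| * s) ^ n / n.factorial * Real.exp (-(s ^ 3 / 3)))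
    (fun n => by
      refine Continuous.aestronglyMeasurable ?_
      fun_prop) ?_ ?_ ?_ ?_
  · rw [integral_const_mul] at key
    refine key.congr_fun ?_
    intro n
    rw [integral_const_mul, integral_complex_ofReal, integral_pow_mul_exp_cube]
  · intro n
    refine (ae_restrict_iff' measurableSet_Ioi).2 (Eventually.of_forall fun s hs => ?_)
    have hs : 0 < s := hs
    rw [norm_mul, norm_div, norm_mul, norm_pow, norm_neg, norm_mul, norm_airyOmega,
      Complex.norm_real, Complex.norm_real, Real.norm_of_nonneg (by positivity : 0 ≤ s ^ n * _),
      Complex.norm_natCast, Real.norm_eq_abs]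
    apply le_of_eq; ring
  · refine (ae_restrict_iff' measurableSet_Ioi).2 (Eventually.of_forall fun s hs => ?_)
    exact (Real.summable_pow_div_factorial _).mul_right _
  · refine (integrableOn_pow_mul_exp_cube 0 |x|).congr ?_
    refine (ae_restrict_iff' measurableSet_Ioi).2 (Eventually.of_forall fun s hs => ?_)
    simp only [tsum_mul_right]
    rw [← congrFun NormedSpace.exp_eq_tsum_div (|x| * s), ← Real.exp_eq_exp_ℝ, ← Real.exp_add,
      pow_zero, one_mul, add_comm]
  · refine Eventually.of_forall fun s => ?_
    have h := NormedSpace.expSeries_div_hasSum_exp (-(x * s * airyOmega) : ℂ)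
    rw [← Complex.exp_eq_exp_ℂ] at h
    have h2 := (h.mul_left (airyOmega * Complex.exp (-((s : ℂ) ^ 3 / 3))))
    have e1 : airyOmega * Complex.exp (-((s : ℂ) ^ 3 / 3)) * Complex.exp (-(x * s * airyOmega)) =
        airyOmega * airyKernel 0 x s := by
      rw [airyKernel, pow_zero, one_mul, mul_assoc, ← Complex.exp_add]; rfl
    rw [e1] at h2
    refine h2.congr_fun fun n => ?_
    push_cast
    ring

lemma gamma_product_third (m : ℕ) :
    √3 / (2 * Real.pi) * 27 ^ m * m.factorial * Real.Gamma (m + 1 / 3) * Real.Gamma (m + 2 / 3) =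
      (3 * m).factorial := by
  have h3 : √3 * √3 = 3 := Real.mul_self_sqrt (by norm_num)
  induction m with
  | zero =>
    have h := Real.Gamma_mul_Gamma_one_sub (1 / 3)
    have h2 : Real.sin (Real.pi * (1 / 3)) = √3 / 2 := by
      rw [mul_one_div, Real.sin_pi_div_three]
    rw [h2] at h
    have h4 : Real.Gamma (1 / 3) * Real.Gamma (2 / 3) = Real.pi / (√3 / 2) := by
      rw [← h]; norm_num
    simp only [Nat.cast_zero, zero_add, pow_zero, mul_one, Nat.factorial_zero, Nat.cast_one,
      mul_zero]
    rw [mul_assoc, h4]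
    field_simp
  | succ m ih =>
    have e1 : Real.Gamma ((m + 1 : ℕ) + 1 / 3) = (m + 1 / 3) * Real.Gamma (m + 1 / 3) := by
      rw [← Real.Gamma_add_one (by positivity)]; push_cast; ring_nf
    have e2 : Real.Gamma ((m + 1 : ℕ) + 2 / 3) = (m + 2 / 3) * Real.Gamma (m + 2 / 3) := by
      rw [← Real.Gamma_add_one (by positivity)]; push_cast; ring_nf
    rw [e1, e2, show 3 * (m + 1) = 3 * m + 1 + 1 + 1 by ring, Nat.factorial_succ,
      Nat.factorial_succ, Nat.factorial_succ, Nat.factorial_succ]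
    push_cast
    rw [← ih]
    ring

lemma gamma_product_two_third (m : ℕ) :
    √3 / (2 * Real.pi) * 3 * 27 ^ m * m.factorial * Real.Gamma (m + 2 / 3) *
      Real.Gamma (m + 4 / 3) = (3 * m + 1).factorial := by
  have h := gamma_product_third m
  have e : Real.Gamma (m + 4 / 3) = (m + 1 / 3) * Real.Gamma (m + 1 / 3) := by
    rw [← Real.Gamma_add_one (by positivity)]; ring_nf
  rw [e, Nat.factorial_succ]
  push_cast
  rw [← h]
  ring

lemma airyAi_eq_airyMoment (x : ℝ) :
    airyAi x = (airyOmega * airyMoment 0 x).im / Real.pi := by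
  have h := hasSum_airyMoment_zero x
  have hI := Complex.hasSum_im h
  have hs := hI.summable
  have ht := Nat.sumByResidueClasses hs 3
  have hsum : ∀ j, Summable fun m : ℕ => (airyOmega * (-(x * airyOmega)) ^ (j + 3 * m) /
      (j + 3 * m).factorial * (((3 : ℝ) ^ ((((j + 3 * m : ℕ) : ℝ) - 2) / 3) *
        Real.Gamma ((((j + 3 * m : ℕ) : ℝ) + 1) / 3) : ℝ) : ℂ)).im := fun j =>
    hs.comp_injective (i := fun m => j + 3 * m) (fun a b hab => by simpa using hab)
  have hterm : ∀ j m : ℕ, (airyOmega * (-(x * airyOmega)) ^ (j + 3 * m) /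
      (j + 3 * m).factorial * (((3 : ℝ) ^ ((((j + 3 * m : ℕ) : ℝ) - 2) / 3) *
        Real.Gamma ((((j + 3 * m : ℕ) : ℝ) + 1) / 3) : ℝ) : ℂ)).im =
      (airyOmega ^ (j + 1)).im * ((-x) ^ j * x ^ (3 * m) / (j + 3 * m).factorial *
        ((3 : ℝ) ^ ((((j + 3 * m : ℕ) : ℝ) - 2) / 3) *
        Real.Gamma ((((j + 3 * m : ℕ) : ℝ) + 1) / 3))) := by
    intro j m
    have : airyOmega * (-(x * airyOmega)) ^ (j + 3 * m) /
      (j + 3 * m).factorial = airyOmega ^ (j + 1) * (((-x) ^ j * x ^ (3 * m) /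
        (j + 3 * m).factorial : ℝ) : ℂ) := by
      rw [pow_add _ j, pow_mul _ 3, show (-(x * airyOmega)) ^ 3 = ((x ^ 3 : ℝ) : ℂ) by
        rw [neg_pow, mul_pow, airyOmega_cube]; push_cast; ring]
      push_cast
      ring
    rw [this, mul_assoc, ← Complex.ofReal_mul, Complex.im_mul_ofReal]
  rw [hI.tsum_eq] at ht
  rw [ht, show (∑ j : ZMod 3, ∑' m : ℕ, (airyOmega * (-(x * airyOmega)) ^ (j.val + 3 * m) /
      (j.val + 3 * m).factorial * (((3 : ℝ) ^ ((((j.val + 3 * m : ℕ) : ℝ) - 2) / 3) *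
        Real.Gamma ((((j.val + 3 * m : ℕ) : ℝ) + 1) / 3) : ℝ) : ℂ)).im) = _ from
    Fin.sum_univ_three _]
  have hv0 : ZMod.val (0 : ZMod 3) = 0 := rfl
  have hv1 : ZMod.val (1 : ZMod 3) = 1 := rfl
  have hv2 : ZMod.val (2 : ZMod 3) = 2 := rfl
  change _ = ((∑' m : ℕ, (airyOmega * (-(x * airyOmega)) ^ (0 + 3 * m) /
      (0 + 3 * m).factorial * (((3 : ℝ) ^ ((((0 + 3 * m : ℕ) : ℝ) - 2) / 3) *
        Real.Gamma ((((0 + 3 * m : ℕ) : ℝ) + 1) / 3) : ℝ) : ℂ)).im) +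
    (∑' m : ℕ, (airyOmega * (-(x * airyOmega)) ^ (1 + 3 * m) /
      (1 + 3 * m).factorial * (((3 : ℝ) ^ ((((1 + 3 * m : ℕ) : ℝ) - 2) / 3) *
        Real.Gamma ((((1 + 3 * m : ℕ) : ℝ) + 1) / 3) : ℝ) : ℂ)).im) +
    (∑' m : ℕ, (airyOmega * (-(x * airyOmega)) ^ (2 + 3 * m) /
      (2 + 3 * m).factorial * (((3 : ℝ) ^ ((((2 + 3 * m : ℕ) : ℝ) - 2) / 3) *
        Real.Gamma ((((2 + 3 * m : ℕ) : ℝ) + 1) / 3) : ℝ) : ℂ)).im)) / Real.pi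
  simp only [hterm]
  have w1 : (airyOmega ^ (0 + 1)).im = √3 / 2 := by simp [airyOmega]
  have w2 : (airyOmega ^ (1 + 1)).im = √3 / 2 := by rw [airyOmega_sq]
  have w3 : (airyOmega ^ (2 + 1)).im = 0 := by rw [airyOmega_cube]; simp
  rw [w1, w2, w3]
  simp only [zero_mul, tsum_zero, add_zero]
  rw [airyAi, add_div, sub_eq_add_neg, ← tsum_mul_left, ← tsum_mul_left, ← tsum_neg,
    ← tsum_div_const, ← tsum_div_const]
  have hp := Real.pi_pos
  congr 1 <;> refine tsum_congr fun m => ?_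
  · have g1 := gamma_product_third m
    have hG : 0 < Real.Gamma (m + 2 / 3) := Real.Gamma_pos_of_pos (by positivity)
    have hF : ((3 * m).factorial : ℝ) ≠ 0 := by positivity
    have hm : (m.factorial : ℝ) ≠ 0 := by positivity
    have e1 : ((((0 + 3 * m : ℕ) : ℝ) + 1) / 3) = m + 1 / 3 := by push_cast; ring
    have e2 : (3 : ℝ) ^ ((((0 + 3 * m : ℕ) : ℝ) - 2) / 3) = 3 ^ m * 3 ^ (-(2 / 3) : ℝ) := by
      rw [← Real.rpow_natCast, ← Real.rpow_add (by norm_num)]; congr 1; push_cast; ring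
    have e3 : (27 : ℝ) ^ m = 9 ^ m * 3 ^ m := by rw [← mul_pow]; norm_num
    rw [e1, e2, zero_add, ← g1, e3]
    have hG2 : 0 < Real.Gamma (m + 1 / 3) := Real.Gamma_pos_of_pos (by positivity)
    field_simp
  · have g1 := gamma_product_two_third m
    have hG : 0 < Real.Gamma (m + 2 / 3) := Real.Gamma_pos_of_pos (by positivity)
    have hG2 : 0 < Real.Gamma (m + 4 / 3) := Real.Gamma_pos_of_pos (by positivity)
    have hm : (m.factorial : ℝ) ≠ 0 := by positivity
    have e1 : ((((1 + 3 * m : ℕ) : ℝ) + 1) / 3) = m + 2 / 3 := by push_cast; ring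
    have e2 : (3 : ℝ) ^ ((((1 + 3 * m : ℕ) : ℝ) - 2) / 3) = 3 ^ m * 3 * 3 ^ (-(4 / 3) : ℝ) := by
      rw [← Real.rpow_natCast, ← Real.rpow_add_one (by norm_num), ← Real.rpow_add (by norm_num)]
      congr 1; push_cast; ring
    have e3 : (27 : ℝ) ^ m = 9 ^ m * 3 ^ m := by rw [← mul_pow]; norm_num
    rw [e1, e2, add_comm 1 (3 * m), ← g1, e3]
    field_simp
    try ring

/-- The derivative of the Airy function. -/
def airyAiDeriv (x : ℝ) : ℝ := (-airyOmega ^ 2 * airyMoment 1 x).im / Real.pi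

lemma hasDerivAt_airyAi (x : ℝ) : HasDerivAt airyAi (airyAiDeriv x) x := by
  have h := (hasDerivAt_airyMoment 0 x).const_mul airyOmega
  have h2 := (Complex.imCLM.hasFDerivAt.comp_hasDerivAt x h).div_const Real.pi
  have e : airyAi = fun x => (airyOmega * airyMoment 0 x).im / Real.pi :=
    funext airyAi_eq_airyMoment
  rw [e]
  refine h2.congr_deriv ?_
  simp only [airyAiDeriv, Complex.imCLM_apply]
  ring_nf

lemma tendsto_exp_airyPhase (x : ℝ) :
    Tendsto (fun s : ℝ => Complex.exp (-((s : ℂ) ^ 3 / 3) - x * s * airyOmega)) atTop (𝓝 0) := by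
  refine squeeze_zero_norm' (a := fun s : ℝ => Real.exp ((|x| + 1) * (|x| + 4)) * Real.exp (-s)) ?_ ?_
  · filter_upwards [eventually_gt_atTop 0] with s hs
    have := norm_airyKernel 0 x hs
    rw [airyKernel, pow_zero, one_mul, pow_zero, one_mul] at this
    rw [this, ← Real.exp_add, Real.exp_le_exp]
    set B := |x| + 1 with hB'
    have hB : 1 ≤ B := by simp [B]
    have hc : -x * s ≤ (B - 1) * s := by
      gcongr; simp [B, neg_le_abs]
    have h0 : 0 ≤ (B - 1) * s := mul_nonneg (by linarith) hs.le
    have : B * s - s ^ 3 / 3 ≤ B * (B + 3) := by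
      rcases le_total s (B + 3) with h | h
      · have : 0 < s ^ 3 := by positivity
        nlinarith
      · have h2 : (B + 3) * (B + 3) ≤ s * s := by gcongr
        have : s * (3 * B) ≤ s * (s * s) := mul_le_mul_of_nonneg_left (by nlinarith) hs.le
        nlinarith
    have e : |x| + 4 = B + 3 := by simp only [B]; ring
    rw [e]
    linarith
  · have := (Real.tendsto_exp_neg_atTop_nhds_zero).const_mul (Real.exp ((|x| + 1) * (|x| + 4)))
    simpa using this

lemma airyMoment_ode (x : ℝ) : airyMoment 2 x + x * airyOmega * airyMoment 0 x = 1 := by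
  have hd : ∀ s ∈ Set.Ioi (0 : ℝ), HasDerivAt
      (fun s : ℝ => -Complex.exp (-((s : ℂ) ^ 3 / 3) - x * s * airyOmega))
      (airyKernel 2 x s + x * airyOmega * airyKernel 0 x s) s := by
    intro s _
    have h0 : HasDerivAt (fun s : ℝ => (s : ℂ)) 1 s := Complex.ofRealCLM.hasDerivAt (x := s)
    have h1 : HasDerivAt (fun s : ℝ => -((s : ℂ) ^ 3 / 3) - x * s * airyOmega)
        (-(s : ℂ) ^ 2 - x * airyOmega) s := by
      refine (((h0.pow 3).div_const 3).neg.sub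
        ((h0.const_mul (x : ℂ)).mul_const airyOmega)).congr_deriv ?_
      push_cast
      ring
    refine (h1.cexp.neg).congr_deriv ?_
    simp only [airyKernel]
    ring
  have hi := (integrableOn_airyKernel 2 x).add ((integrableOn_airyKernel 0 x).const_mul
    (x * airyOmega))
  have := integral_Ioi_of_hasDerivAt_of_tendsto (a := (0 : ℝ))
    (f := fun s : ℝ => -Complex.exp (-((s : ℂ) ^ 3 / 3) - x * s * airyOmega))
    (Continuous.continuousWithinAt (by fun_prop)) hd hi (tendsto_exp_airyPhase x).neg
  have e := integral_add (integrableOn_airyKernel 2 x) ((integrableOn_airyKernel 0 x).const_mul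
    (x * airyOmega))
  rw [integral_const_mul] at e
  simp only [airyMoment]
  rw [← e]
  refine this.trans ?_
  simp

lemma hasDerivAt_airyAiDeriv (x : ℝ) : HasDerivAt airyAiDeriv (x * airyAi x) x := by
  have h := (hasDerivAt_airyMoment 1 x).const_mul (-airyOmega ^ 2)
  have h2 := (Complex.imCLM.hasFDerivAt.comp_hasDerivAt x h).div_const Real.pi
  refine h2.congr_deriv ?_
  rw [airyAi_eq_airyMoment, mul_div_assoc']
  congr 1
  have := airyMoment_ode x
  have e : -airyOmega ^ 2 * (-airyOmega * airyMoment (1 + 1) x) =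
      x * (airyOmega * airyMoment 0 x) - 1 := by
    rw [show -airyOmega ^ 2 * (-airyOmega * airyMoment (1 + 1) x) =
      airyOmega ^ 3 * airyMoment 2 x by ring, airyOmega_cube]
    linear_combination -this
  rw [e, mul_assoc] at *
  rw [Complex.imCLM_apply, Complex.sub_im, Complex.im_ofReal_mul]
  simp

lemma deriv_airyAi : deriv airyAi = airyAiDeriv := funext fun x => (hasDerivAt_airyAi x).deriv

lemma abs_airyAi_le {x : ℝ} (hx : 0 < x) : |airyAi x| ≤ 2 / x := by
  rw [airyAi_eq_airyMoment, abs_div, abs_of_pos Real.pi_pos]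
  have h := norm_airyMoment_le 0 hx
  have h2 := (Complex.abs_im_le_norm (airyOmega * airyMoment 0 x))
  rw [norm_mul, norm_airyOmega, one_mul] at h2
  rw [div_le_iff₀ Real.pi_pos]
  simp only [Nat.factorial_zero, Nat.cast_one, one_mul, zero_add, pow_one] at h
  have : 0 < 2 / x := by positivity
  nlinarith [Real.pi_gt_three]

lemma abs_airyAiDeriv_le {x : ℝ} (hx : 0 < x) : |airyAiDeriv x| ≤ (2 / x) ^ 2 := by
  rw [airyAiDeriv, abs_div, abs_of_pos Real.pi_pos]
  have h := norm_airyMoment_le 1 hx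
  have h2 := (Complex.abs_im_le_norm (-airyOmega ^ 2 * airyMoment 1 x))
  rw [norm_mul, norm_neg, norm_pow, norm_airyOmega, one_pow, one_mul] at h2
  rw [div_le_iff₀ Real.pi_pos]
  simp only [Nat.factorial_one, Nat.cast_one, one_mul] at h
  have : 0 < (2 / x) ^ (1 + 1) := by positivity
  nlinarith [Real.pi_gt_three]

lemma tendsto_airyAi : Tendsto airyAi atTop (𝓝 0) := by
  refine squeeze_zero_norm' (a := fun x : ℝ => 2 / x) ?_ (tendsto_const_nhds.div_atTop tendsto_id)
  filter_upwards [eventually_gt_atTop 0] with x hx using abs_airyAi_le hx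

lemma tendsto_airyAiDeriv : Tendsto airyAiDeriv atTop (𝓝 0) := by
  have h : Tendsto (fun x : ℝ => 2 / x) atTop (𝓝 0) := tendsto_const_nhds.div_atTop tendsto_id
  refine squeeze_zero_norm' (a := fun x : ℝ => (2 / x) ^ 2) ?_ (by simpa using h.pow 2)
  filter_upwards [eventually_gt_atTop 0] with x hx using abs_airyAiDeriv_le hx

lemma airyAi_zero_pos : 0 < airyAi 0 := by
  have h1 : ∑' n : ℕ, (0 : ℝ) ^ (3 * n) / (9 ^ n * (n.factorial : ℝ) *
      Real.Gamma ((n : ℝ) + 2 / 3)) = 1 / Real.Gamma (2 / 3) := by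
    rw [tsum_eq_single 0 (by intro n hn; simp [hn])]; simp
  have h2 : ∑' n : ℕ, (0 : ℝ) ^ (3 * n + 1) / (9 ^ n * (n.factorial : ℝ) *
      Real.Gamma ((n : ℝ) + 4 / 3)) = 0 := by
    simp
  rw [airyAi, h1, h2]
  have : 0 < Real.Gamma (2 / 3) := Real.Gamma_pos_of_pos (by norm_num)
  simp only [mul_zero, sub_zero]
  positivity

/-! ### Second order linear equations and Sturm comparison -/

/-- On the set `s`, the function `u` has derivative `u'` and solves `u'' = q u`. -/
def IsSturmSolution (q u u' : ℝ → ℝ) (s : Set ℝ) : Prop :=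
  ∀ x ∈ s, HasDerivAt u (u' x) x ∧ HasDerivAt u' (q x * u x) x

namespace IsSturmSolution

variable {q p u u' v v' : ℝ → ℝ} {s t : Set ℝ}

lemma mono (h : IsSturmSolution q u u' s) (hts : t ⊆ s) : IsSturmSolution q u u' t :=
  fun x hx => h x (hts hx)

lemma neg (h : IsSturmSolution q u u' s) :
    IsSturmSolution q (fun x => -u x) (fun x => -u' x) s := fun x hx =>
  ⟨(h x hx).1.neg, ((h x hx).2.neg).congr_deriv (by ring)⟩

lemma continuousOn (h : IsSturmSolution q u u' s) : ContinuousOn u s := fun x hx =>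
  (h x hx).1.continuousAt.continuousWithinAt

lemma eq_zero_right (hq : Continuous q) (h : IsSturmSolution q u u' Set.univ) {a : ℝ}
    (h0 : u a = 0) (h1 : u' a = 0) {x : ℝ} (hx : a ≤ x) : u x = 0 := by
  obtain ⟨K, hK⟩ := (isCompact_Icc (a := a) (b := x)).exists_bound_of_continuousOn hq.continuousOn
  have key := eq_zero_of_abs_deriv_le_mul_abs_self_of_eq_zero_right
    (f := fun y => (u y, u' y)) (f' := fun y => (u' y, q y * u y)) (K := max 1 K) (a := a) (b := x)
    (fun y _ => ((h y trivial).1.continuousAt.prodMk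
      (h y trivial).2.continuousAt).continuousWithinAt)
    (fun y _ => ((h y trivial).1.prodMk (h y trivial).2).hasDerivWithinAt)
    (by simp [h0, h1]) ?_ x ⟨hx, le_rfl⟩
  · exact (Prod.mk.inj key).1
  · intro y hy
    have hqy := hK y ⟨hy.1, hy.2.le⟩
    have e1 : ‖u y‖ ≤ ‖(u y, u' y)‖ := le_max_left _ _
    have e2 : ‖u' y‖ ≤ ‖(u y, u' y)‖ := le_max_right _ _
    have e3 := norm_nonneg (u y, u' y)
    refine max_le ?_ ?_
    · exact e2.trans (le_mul_of_one_le_left e3 (le_max_left _ _))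
    · change ‖q y * u y‖ ≤ _
      rw [norm_mul]
      exact mul_le_mul (hqy.trans (le_max_right _ _)) e1 (norm_nonneg _)
        (zero_le_one.trans (le_max_left _ _))

lemma eq_zero (hq : Continuous q) (h : IsSturmSolution q u u' Set.univ) {a : ℝ}
    (h0 : u a = 0) (h1 : u' a = 0) (x : ℝ) : u x = 0 := by
  rcases le_total a x with hx | hx
  · exact h.eq_zero_right hq h0 h1 hx
  · have h' : IsSturmSolution (fun y => q (-y)) (fun y => u (-y)) (fun y => -u' (-y)) Set.univ := by
      intro y _
      have hn : HasDerivAt (fun y : ℝ => -y) (-1) y := hasDerivAt_neg y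
      refine ⟨?_, ?_⟩
      · exact ((h (-y) trivial).1.comp y hn).congr_deriv (by ring)
      · exact ((h (-y) trivial).2.comp y hn).neg.congr_deriv (by ring)
    have := h'.eq_zero_right (a := -a) (x := -x) (hq.comp continuous_neg) (by simpa using h0)
      (by simpa using h1) (by linarith)
    simpa using this

lemma wronskian_hasDerivAt (hu : IsSturmSolution p u u' s) (hv : IsSturmSolution q v v' s)
    {x : ℝ} (hx : x ∈ s) : HasDerivAt (fun x => u' x * v x - u x * v' x)
      ((p x - q x) * (u x * v x)) x :=
  (((hu x hx).2.mul (hv x hx).1).sub ((hu x hx).1.mul (hv x hx).2)).congr_deriv (by ring)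

lemma wronskian_monotoneOn (hs : Convex ℝ s) (hu : IsSturmSolution p u u' s)
    (hv : IsSturmSolution q v v' s) (hpq : ∀ x ∈ s, q x ≤ p x)
    (hpos : ∀ x ∈ interior s, 0 ≤ u x * v x) :
    MonotoneOn (fun x => u' x * v x - u x * v' x) s := by
  refine monotoneOn_of_hasDerivWithinAt_nonneg hs
    (fun x hx => (hu.wronskian_hasDerivAt hv hx).continuousAt.continuousWithinAt)
    (fun x hx => (hu.wronskian_hasDerivAt hv (interior_subset hx)).hasDerivWithinAt)
    (fun x hx => mul_nonneg (sub_nonneg.2 (hpq x (interior_subset hx))) (hpos x hx))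

end IsSturmSolution

lemma pos_or_neg_of_ne_zero {f : ℝ → ℝ} {s : Set ℝ} (hs : s.OrdConnected)
    (hf : ContinuousOn f s) (h : ∀ x ∈ s, f x ≠ 0) :
    (∀ x ∈ s, 0 < f x) ∨ (∀ x ∈ s, f x < 0) := by
  by_contra! hc
  obtain ⟨⟨x, hx, hfx⟩, y, hy, hfy⟩ := hc
  obtain ⟨z, hz, hz0⟩ := hs.isPreconnected.intermediate_value hx hy hf ⟨hfx, hfy⟩
  exact h z hz hz0

lemma deriv_nonneg_of_right {u : ℝ → ℝ} {a b d : ℝ} (hab : a < b) (h : HasDerivAt u d a)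
    (h0 : u a = 0) (hpos : ∀ x ∈ Set.Ioo a b, 0 ≤ u x) : 0 ≤ d := by
  have ht := (hasDerivAt_iff_tendsto_slope.1 h).mono_left
    (nhdsWithin_mono a (show Set.Ioi a ⊆ {a}ᶜ from fun x (hx : a < x) => hx.ne'))
  refine ge_of_tendsto ht ?_
  filter_upwards [Ioo_mem_nhdsGT hab] with x hx
  rw [slope_def_field, h0, sub_zero]
  exact div_nonneg (hpos x hx) (by linarith [hx.1])

lemma deriv_nonpos_of_left {u : ℝ → ℝ} {a b d : ℝ} (hab : a < b) (h : HasDerivAt u d b)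
    (h0 : u b = 0) (hpos : ∀ x ∈ Set.Ioo a b, 0 ≤ u x) : d ≤ 0 := by
  have ht := (hasDerivAt_iff_tendsto_slope.1 h).mono_left
    (nhdsWithin_mono b (show Set.Iio b ⊆ {b}ᶜ from fun x (hx : x < b) => hx.ne))
  refine le_of_tendsto ht ?_
  filter_upwards [Ioo_mem_nhdsLT hab] with x hx
  rw [slope_def_field, h0, sub_zero]
  exact div_nonpos_of_nonneg_of_nonpos (hpos x hx) (by linarith [hx.2])

section Comparison

variable {p q u u' v v' : ℝ → ℝ}

/-- Sturm comparison: between two consecutive zeros `a < b` of a solution of `u'' = p u`, every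
solution of `v'' = q v` with `q ≤ p` has a zero. -/
lemma sturm_exists_zero {a b : ℝ} (hab : a < b)
    (hu : IsSturmSolution p u u' (Set.Icc a b)) (hv : IsSturmSolution q v v' (Set.Icc a b))
    (hpq : ∀ x ∈ Set.Icc a b, q x ≤ p x) (ha : u a = 0) (hb : u b = 0) (ha' : u' a ≠ 0)
    (hne : ∀ x ∈ Set.Ioo a b, u x ≠ 0) : ∃ x ∈ Set.Ico a b, v x = 0 := by
  by_contra! hv0
  have hIcc := Set.Ioo_subset_Icc_self (a := a) (b := b)
  have hIco : Set.Ico a b ⊆ Set.Icc a b := Set.Ico_subset_Icc_self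
  wlog hup : ∀ x ∈ Set.Ioo a b, 0 < u x generalizing u u'
  · rcases pos_or_neg_of_ne_zero Set.ordConnected_Ioo (hu.continuousOn.mono hIcc) hne with h | h
    · exact hup h
    · exact this hu.neg (by simpa using ha) (by simpa using hb) (by simpa using ha')
        (by simpa using hne) (by simpa using h)
  wlog hvp : ∀ x ∈ Set.Ico a b, 0 < v x generalizing v v'
  · rcases pos_or_neg_of_ne_zero Set.ordConnected_Ico (hv.continuousOn.mono hIco) hv0 with h | h
    · exact hvp h
    · exact this hv.neg (by simpa using hv0) (by simpa using h)
  have hmono := hu.wronskian_monotoneOn (convex_Icc a b) hv hpq (fun x hx => by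
    rw [interior_Icc] at hx
    exact (mul_pos (hup x hx) (hvp x ⟨hx.1.le, hx.2⟩)).le)
  have hle := hmono (Set.left_mem_Icc.2 hab.le) (Set.right_mem_Icc.2 hab.le) hab.le
  simp only [ha, hb, zero_mul, sub_zero] at hle
  have h1 : 0 < u' a := lt_of_le_of_ne (deriv_nonneg_of_right hab
    (hu a (Set.left_mem_Icc.2 hab.le)).1 ha fun x hx => (hup x hx).le) ha'.symm
  have h2 : u' b ≤ 0 := deriv_nonpos_of_left hab (hu b (Set.right_mem_Icc.2 hab.le)).1 hb
    fun x hx => (hup x hx).le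
  have h3 : 0 ≤ v b := by
    have hcl : b ∈ closure (Set.Ico a b) := by
      rw [closure_Ico hab.ne]; exact Set.right_mem_Icc.2 hab.le
    exact ContinuousWithinAt.closure_le hcl (f := fun _ => (0 : ℝ)) continuousWithinAt_const
      ((hv b (Set.right_mem_Icc.2 hab.le)).1.continuousAt.continuousWithinAt)
      fun x hx => (hvp x hx).le
  have h4 := mul_pos h1 (hvp a ⟨le_rfl, hab⟩)
  have h5 := mul_nonpos_of_nonpos_of_nonneg h2 h3
  linarith

/-- Sturm comparison on a half line, beyond the last zero. -/
lemma sturm_exists_zero_Ici {a : ℝ}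
    (hu : IsSturmSolution p u u' (Set.Ici a)) (hv : IsSturmSolution q v v' (Set.Ici a))
    (hpq : ∀ x ∈ Set.Ici a, q x ≤ p x) (ha : u a = 0) (ha' : u' a ≠ 0)
    (hne : ∀ x ∈ Set.Ioi a, u x ≠ 0)
    (hW : Tendsto (fun x => u' x * v x - u x * v' x) atTop (𝓝 0)) : ∃ x, a ≤ x ∧ v x = 0 := by
  by_contra! hv0
  replace hv0 : ∀ x ∈ Set.Ici a, v x ≠ 0 := hv0
  wlog hup : ∀ x ∈ Set.Ioi a, 0 < u x generalizing u u'
  · rcases pos_or_neg_of_ne_zero Set.ordConnected_Ioi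
      (hu.continuousOn.mono Set.Ioi_subset_Ici_self) hne with h | h
    · exact hup h
    · refine this hu.neg (by simpa using ha) (by simpa using ha')
        (by simpa using hne) ?_ (by simpa using h)
      have := hW.neg
      rw [neg_zero] at this
      exact this.congr fun x => by ring
  wlog hvp : ∀ x ∈ Set.Ici a, 0 < v x generalizing v v'
  · rcases pos_or_neg_of_ne_zero Set.ordConnected_Ici hv.continuousOn hv0 with h | h
    · exact hvp h
    · refine this hv.neg (by simpa using hv0) ?_ (by simpa using h)
      have := hW.neg
      rw [neg_zero] at this
      exact this.congr fun x => by ring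
  have hmono := hu.wronskian_monotoneOn (convex_Ici a) hv hpq (fun x hx => by
    rw [interior_Ici] at hx
    exact (mul_pos (hup x hx) (hvp x (Set.Ioi_subset_Ici_self hx))).le)
  have h1 : 0 < u' a := lt_of_le_of_ne (deriv_nonneg_of_right (lt_add_one a)
    (hu a Set.self_mem_Ici).1 ha fun x hx => (hup x hx.1).le) ha'.symm
  have h4 := mul_pos h1 (hvp a Set.self_mem_Ici)
  have : u' a * v a - u a * v' a ≤ 0 := by
    refine ge_of_tendsto hW ?_
    filter_upwards [eventually_ge_atTop a] with x hx
    exact hmono Set.self_mem_Ici hx hx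
  rw [ha, zero_mul, sub_zero] at this
  linarith

/-- Sturm comparison: on a half line the solution of `v'' = q v` has at least as many zeros as the
solution of `u'' = p u` if `q ≤ p`. -/
theorem sturm_card_zeros {c : ℝ}
    (hu : IsSturmSolution p u u' (Set.Ici c)) (hv : IsSturmSolution q v v' (Set.Ici c))
    (hpq : ∀ x ∈ Set.Ici c, q x ≤ p x)
    (hsimple : ∀ x, c ≤ x → u x = 0 → u' x ≠ 0)
    (hW : Tendsto (fun x => u' x * v x - u x * v' x) atTop (𝓝 0))
    (hfin : {y | u y = 0 ∧ c ≤ y}.Finite) :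
    ∃ Z : Finset ℝ, Z.card = {y | u y = 0 ∧ c ≤ y}.ncard ∧
      ∀ x ∈ Z, v x = 0 ∧ ∃ y, u y = 0 ∧ c ≤ y ∧ y ≤ x := by
  set S := hfin.toFinset with hS
  have hmem : ∀ y, y ∈ S ↔ u y = 0 ∧ c ≤ y := fun y => by simp [S]
  have key : ∀ s ∈ S, ∃ x, s ≤ x ∧ v x = 0 ∧ ∀ s' ∈ S, s < s' → x < s' := by
    intro s hs
    obtain ⟨hs0, hsc⟩ := (hmem s).1 hs
    by_cases hne : (S.filter (s < ·)).Nonempty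
    · set b := (S.filter (s < ·)).min' hne with hb
      have hbS := Finset.min'_mem _ hne
      rw [← hb, Finset.mem_filter] at hbS
      have hsub : Set.Icc s b ⊆ Set.Ici c := fun x hx => hsc.trans hx.1
      obtain ⟨x, hx, hx0⟩ := sturm_exists_zero hbS.2 (hu.mono hsub) (hv.mono hsub)
        (fun x hx => hpq x (hsub hx)) hs0 ((hmem b).1 hbS.1).1 (hsimple s hsc hs0) (by
          intro x hx hx0
          have : b ≤ x := Finset.min'_le _ _ (by
            rw [Finset.mem_filter]
            exact ⟨(hmem x).2 ⟨hx0, hsc.trans hx.1.le⟩, hx.1⟩)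
          exact absurd hx.2 (not_lt.2 this))
      refine ⟨x, hx.1, hx0, fun s' hs' hlt => hx.2.trans_le ?_⟩
      exact Finset.min'_le _ _ (by rw [Finset.mem_filter]; exact ⟨hs', hlt⟩)
    · have hsub : Set.Ici s ⊆ Set.Ici c := fun x hx => hsc.trans hx
      rw [Finset.not_nonempty_iff_eq_empty, Finset.filter_eq_empty_iff] at hne
      obtain ⟨x, hx, hx0⟩ := sturm_exists_zero_Ici (hu.mono hsub) (hv.mono hsub)
        (fun x hx => hpq x (hsub hx)) hs0 (hsimple s hsc hs0) (by
          intro x hx hx0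
          exact hne ((hmem x).2 ⟨hx0, hsc.trans (le_of_lt hx)⟩) hx) hW
      exact ⟨x, hx, hx0, fun s' hs' hlt => absurd hlt (hne hs')⟩
  choose! ζ h1 h2 h3 using key
  refine ⟨S.image ζ, ?_, ?_⟩
  · rw [Finset.card_image_of_injOn, Set.ncard_eq_toFinset_card _ hfin]
    intro s hs s' hs' he
    by_contra hne
    rcases lt_or_gt_of_ne hne with hlt | hlt
    · have := h3 s hs s' hs' hlt
      have := h1 s' hs'
      linarith
    · have := h3 s' hs' s hs hlt
      have := h1 s hs
      linarith
  · intro x hx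
    obtain ⟨s, hs, rfl⟩ := Finset.mem_image.1 hx
    exact ⟨h2 s hs, s, ((hmem s).1 hs).1, ((hmem s).1 hs).2, h1 s hs⟩

end Comparison

lemma finite_zeros_of_simple {u u' : ℝ → ℝ} {a b : ℝ}
    (h : ∀ x ∈ Set.Icc a b, HasDerivAt u (u' x) x)
    (hs : ∀ x ∈ Set.Icc a b, u x = 0 → u' x ≠ 0) : {x | x ∈ Set.Icc a b ∧ u x = 0}.Finite := by
  by_contra hinf
  obtain ⟨z, hz, hacc⟩ := Set.Infinite.exists_accPt_of_subset_isCompact hinf isCompact_Icc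
    (fun x hx => hx.1)
  rw [accPt_iff_frequently_nhdsNE] at hacc
  have hz0 : u z = 0 := by
    by_contra hne
    have := ((h z hz).continuousAt.eventually_ne hne).filter_mono (nhdsWithin_le_nhds (s := {z}ᶜ))
    obtain ⟨y, hy1, hy2⟩ := (hacc.and_eventually this).exists
    exact hy2 hy1.2
  obtain ⟨y, hy1, hy2⟩ := (hacc.and_eventually ((h z hz).eventually_ne (c := 0)
    (hs z hz hz0))).exists
  exact hy2 hy1.2

/-! ### The `r`-th largest zero -/

lemma rthLargestZero_eq {f : ℝ → ℝ} {r : ℕ} (hr : 1 ≤ r) {x : ℝ} (hx : f x = 0)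
    (hcard : {y | f y = 0 ∧ x ≤ y}.ncard = r) : rthLargestZero f r = x := by
  have : {x : ℝ | f x = 0 ∧ {y : ℝ | f y = 0 ∧ x ≤ y}.ncard = r} = {x} := by
    have hlt : ∀ a b, f a = 0 → f b = 0 → {y : ℝ | f y = 0 ∧ a ≤ y}.ncard = r →
        {y : ℝ | f y = 0 ∧ b ≤ y}.ncard = r → ¬ a < b := by
      intro a b ha hb hca hcb hab
      have hfin : {y : ℝ | f y = 0 ∧ a ≤ y}.Finite := Set.finite_of_ncard_pos (by omega)
      have := Set.ncard_lt_ncard (s := {y : ℝ | f y = 0 ∧ b ≤ y})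
        (t := {y : ℝ | f y = 0 ∧ a ≤ y}) ⟨fun y hy => ⟨hy.1, hab.le.trans hy.2⟩, fun hsub =>
          absurd (hsub (show a ∈ _ from ⟨ha, le_rfl⟩)).2 (not_le.2 hab)⟩ hfin
      omega
    ext w
    simp only [Set.mem_ofPred_eq, Set.mem_singleton_iff]
    constructor
    · rintro ⟨hw, hcw⟩
      exact le_antisymm (not_lt.1 (hlt _ _ hx hw hcard hcw)) (not_lt.1 (hlt _ _ hw hx hcw hcard))
    · rintro rfl
      exact ⟨hx, hcard⟩
  rw [rthLargestZero, this, csSup_singleton]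

lemma exists_zero_ncard {f : ℝ → ℝ} {r : ℕ} (hr : 1 ≤ r) : ∀ (n : ℕ) (c : ℝ),
    {y | f y = 0 ∧ c ≤ y}.Finite → {y | f y = 0 ∧ c ≤ y}.ncard = n → r ≤ n →
    ∃ x, c ≤ x ∧ f x = 0 ∧ {y | f y = 0 ∧ x ≤ y}.ncard = r := by
  intro n
  induction n using Nat.strong_induction_on with
  | _ n ih =>
    intro c hfin hn hrn
    have hne : {y | f y = 0 ∧ c ≤ y}.Nonempty := by
      rw [← Set.ncard_pos hfin]; omega
    obtain ⟨x, hx, hmin⟩ := Set.exists_min_image _ id hfin hne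
    have hset : {y | f y = 0 ∧ x ≤ y} = {y | f y = 0 ∧ c ≤ y} := by
      ext y
      exact ⟨fun hy => ⟨hy.1, hx.2.trans hy.2⟩, fun hy => ⟨hy.1, hmin y hy⟩⟩
    rcases hrn.eq_or_lt with rfl | hlt
    · exact ⟨x, hx.2, hx.1, by rw [hset, hn]⟩
    · have hdel : {y | f y = 0 ∧ c ≤ y} \ {x} ⊆ {y | f y = 0 ∧ c ≤ y} := Set.sdiff_subset
      have hcd : ({y | f y = 0 ∧ c ≤ y} \ {x}).ncard = n - 1 := by
        rw [Set.ncard_sdiff_singleton_of_mem hx, hn]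
      have hfd := hfin.subset hdel
      have hned : ({y | f y = 0 ∧ c ≤ y} \ {x}).Nonempty := by
        rw [← Set.ncard_pos hfd]; omega
      obtain ⟨x', hx', hmin'⟩ := Set.exists_min_image _ id hfd hned
      have hset' : {y | f y = 0 ∧ x' ≤ y} = {y | f y = 0 ∧ c ≤ y} \ {x} := by
        ext y
        constructor
        · intro hy
          refine ⟨⟨hy.1, hx'.1.2.trans hy.2⟩, fun hyx => ?_⟩
          have h1 := hmin x' hx'.1
          have : y = x := hyx
          subst this
          exact hx'.2 (le_antisymm hy.2 h1)
        · intro hy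
          exact ⟨hy.1.1, hmin' y hy⟩
      obtain ⟨w, hw1, hw2, hw3⟩ := ih (n - 1) (by omega) x' (by rw [hset']; exact hfd)
        (by rw [hset', hcd]) (by omega)
      exact ⟨w, hx'.1.2.trans hw1, hw2, hw3⟩

lemma rthLargestZero_spec {f : ℝ → ℝ} {r : ℕ} (hr : 1 ≤ r) {c : ℝ}
    (hfin : {y | f y = 0 ∧ c ≤ y}.Finite) (hcard : r ≤ {y | f y = 0 ∧ c ≤ y}.ncard) :
    c ≤ rthLargestZero f r ∧ f (rthLargestZero f r) = 0 ∧
      {y | f y = 0 ∧ rthLargestZero f r ≤ y}.ncard = r := by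
  obtain ⟨x, h1, h2, h3⟩ := exists_zero_ncard hr _ c hfin rfl hcard
  rw [rthLargestZero_eq hr h2 h3]
  exact ⟨h1, h2, h3⟩

/-! ### Zeros of the Airy function -/

lemma isSturmSolution_airyAi (s : Set ℝ) : IsSturmSolution id airyAi airyAiDeriv s :=
  fun x _ => ⟨hasDerivAt_airyAi x, hasDerivAt_airyAiDeriv x⟩

lemma continuous_airyAi : Continuous airyAi :=
  continuous_iff_continuousAt.2 fun x => (hasDerivAt_airyAi x).continuousAt

lemma continuous_airyAiDeriv : Continuous airyAiDeriv :=
  continuous_iff_continuousAt.2 fun x => (hasDerivAt_airyAiDeriv x).continuousAt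

lemma airyAiDeriv_ne_zero {x : ℝ} (hx : airyAi x = 0) : airyAiDeriv x ≠ 0 := fun h =>
  airyAi_zero_pos.ne' ((isSturmSolution_airyAi Set.univ).eq_zero continuous_id hx h 0)

lemma airyAi_mul_deriv_monotoneOn :
    MonotoneOn (fun x => airyAi x * airyAiDeriv x) (Set.Ici 0) := by
  refine monotoneOn_of_hasDerivWithinAt_nonneg (convex_Ici 0)
    (continuous_airyAi.mul continuous_airyAiDeriv).continuousOn
    (fun x _ => ((hasDerivAt_airyAi x).mul (hasDerivAt_airyAiDeriv x)).hasDerivWithinAt)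
    fun x hx => ?_
  rw [interior_Ici] at hx
  have hx : 0 < x := hx
  have : 0 ≤ x * (airyAi x * airyAi x) := mul_nonneg hx.le (mul_self_nonneg _)
  nlinarith [mul_self_nonneg (airyAiDeriv x)]

lemma airyAi_mul_deriv_nonpos {x : ℝ} (hx : 0 ≤ x) : airyAi x * airyAiDeriv x ≤ 0 := by
  have h := tendsto_airyAi.mul tendsto_airyAiDeriv
  rw [mul_zero] at h
  refine ge_of_tendsto h ?_
  filter_upwards [eventually_ge_atTop x] with y hy
  exact airyAi_mul_deriv_monotoneOn hx (hx.trans hy) hy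

lemma airyAi_mul_deriv_ne_zero {x : ℝ} (hx : 0 ≤ x) : airyAi x * airyAiDeriv x ≠ 0 := by
  intro h0
  have hconst : ∀ y, x ≤ y → airyAi y * airyAiDeriv y = 0 := fun y hy =>
    le_antisymm (airyAi_mul_deriv_nonpos (hx.trans hy))
      (h0 ▸ airyAi_mul_deriv_monotoneOn hx (hx.trans hy : (0 : ℝ) ≤ y) hy)
  have hd := ((hasDerivAt_airyAi (x + 1)).mul (hasDerivAt_airyAiDeriv (x + 1)))
  have he : (fun y => airyAi y * airyAiDeriv y) =ᶠ[𝓝 (x + 1)] fun _ => 0 := by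
    filter_upwards [Ioi_mem_nhds (lt_add_one x)] with y hy using hconst y (le_of_lt hy)
  have h1 := hd.unique ((hasDerivAt_const (x + 1) (0 : ℝ)).congr_of_eventuallyEq he)
  have h2 : 0 ≤ airyAi (x + 1) * airyAi (x + 1) := mul_self_nonneg _
  have h3 : 0 ≤ airyAiDeriv (x + 1) * airyAiDeriv (x + 1) := mul_self_nonneg _
  have h4 : 0 ≤ x * (airyAi (x + 1) * airyAi (x + 1)) := mul_nonneg hx h2
  have h5 : airyAi (x + 1) * airyAi (x + 1) = 0 := by nlinarith
  have h6 : airyAiDeriv (x + 1) * airyAiDeriv (x + 1) = 0 := by nlinarith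
  exact airyAiDeriv_ne_zero (mul_self_eq_zero.1 h5) (mul_self_eq_zero.1 h6)

lemma airyAi_pos {x : ℝ} (hx : 0 ≤ x) : 0 < airyAi x := by
  rcases pos_or_neg_of_ne_zero (s := Set.Ici 0) Set.ordConnected_Ici
    continuous_airyAi.continuousOn
    (fun y hy => left_ne_zero_of_mul (airyAi_mul_deriv_ne_zero hy)) with h | h
  · exact h x hx
  · exact absurd (h 0 Set.self_mem_Ici) (not_lt.2 airyAi_zero_pos.le)

lemma airyAiDeriv_neg {x : ℝ} (hx : 0 ≤ x) : airyAiDeriv x < 0 := by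
  have h := lt_of_le_of_ne (airyAi_mul_deriv_nonpos hx) (airyAi_mul_deriv_ne_zero hx)
  exact (pos_iff_neg_of_mul_neg h).1 (airyAi_pos hx)

lemma neg_of_airyAi_eq_zero {x : ℝ} (hx : airyAi x = 0) : x < 0 := by
  by_contra! h
  exact (airyAi_pos h).ne' hx

lemma finite_airyAi_zeros (c : ℝ) : {y | airyAi y = 0 ∧ c ≤ y}.Finite := by
  refine (finite_zeros_of_simple (a := c) (b := 0) (fun x _ => hasDerivAt_airyAi x)
    (fun x _ => airyAiDeriv_ne_zero)).subset fun y hy => ⟨⟨hy.2, ?_⟩, hy.1⟩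
  exact (neg_of_airyAi_eq_zero hy.1).le

lemma isSturmSolution_sin (κ η : ℝ) (s : Set ℝ) :
    IsSturmSolution (fun _ => -κ ^ 2) (fun x => Real.sin (κ * x + η))
      (fun x => κ * Real.cos (κ * x + η)) s := by
  intro x _
  have h : HasDerivAt (fun x : ℝ => κ * x + η) κ x := by
    simpa using ((hasDerivAt_id x).const_mul κ).add_const η
  exact ⟨h.sin.congr_deriv (by ring), (h.cos.const_mul κ).congr_deriv (by ring)⟩

lemma exists_airyAi_zero_lt {c : ℝ} (hc : c ≤ -1) : ∃ x < c, airyAi x = 0 := by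
  have hlt : c - Real.pi < c := by linarith [Real.pi_pos]
  obtain ⟨x, hx, hx0⟩ := sturm_exists_zero hlt
    (isSturmSolution_sin 1 (Real.pi - c) _) (isSturmSolution_airyAi _)
    (fun x hx => by have := hx.2; simp only [id]; linarith)
    (by ring_nf; simp) (by ring_nf; simp) (by ring_nf; simp) (by
      intro x hx
      refine (Real.sin_pos_of_pos_of_lt_pi ?_ ?_).ne' <;> linarith [hx.1, hx.2])
  exact ⟨x, hx.2, hx0⟩

lemma infinite_airyAi_zeros : {y | airyAi y = 0}.Infinite := by
  intro hfin
  obtain ⟨b, hb⟩ := hfin.bddBelow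
  obtain ⟨x, hx, hx0⟩ := exists_airyAi_zero_lt (min_le_right b (-1))
  have := hb hx0
  linarith [min_le_left b (-1)]

lemma airyZero_spec {r : ℕ} (hr : 1 ≤ r) : airyAi (airyZero r) = 0 ∧
    {y | airyAi y = 0 ∧ airyZero r ≤ y}.ncard = r := by
  obtain ⟨t, ht, hcard⟩ := infinite_airyAi_zeros.exists_subset_card_eq r
  obtain ⟨c, hc⟩ := t.finite_toSet.bddBelow
  refine (rthLargestZero_spec hr (finite_airyAi_zeros c) ?_).2
  rw [← hcard, ← Set.ncard_coe_finset]
  exact Set.ncard_le_ncard (fun x hx => ⟨ht hx, hc hx⟩) (finite_airyAi_zeros c)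

lemma airyZero_neg {r : ℕ} (hr : 1 ≤ r) : airyZero r < 0 :=
  neg_of_airyAi_eq_zero (airyZero_spec hr).1

lemma le_airyZero {r : ℕ} (hr : 1 ≤ r) {c : ℝ} (Z : Finset ℝ)
    (hZ : ∀ x ∈ Z, airyAi x = 0 ∧ c ≤ x) (hcard : r ≤ Z.card) : c ≤ airyZero r := by
  refine (rthLargestZero_spec hr (finite_airyAi_zeros c) (hcard.trans ?_)).1
  rw [← Set.ncard_coe_finset]
  exact Set.ncard_le_ncard hZ (finite_airyAi_zeros c)

lemma tendsto_airyZero : Tendsto airyZero atTop atBot := by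
  refine tendsto_atBot.2 fun c => ?_
  filter_upwards [eventually_gt_atTop ({y | airyAi y = 0 ∧ c ≤ y}.ncard),
    eventually_ge_atTop 1] with r hr hr1
  by_contra! hlt
  have := Set.ncard_le_ncard (s := {y | airyAi y = 0 ∧ airyZero r ≤ y})
    (t := {y | airyAi y = 0 ∧ c ≤ y}) (fun y hy => ⟨hy.1, hlt.le.trans hy.2⟩)
    (finite_airyAi_zeros c)
  rw [(airyZero_spec hr1).2] at this
  omega

lemma pi_le_airyAi_zero_gap {x y : ℝ} (hxy : x < y) (hx : airyAi x = 0) (hy : airyAi y = 0) :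
    Real.pi ≤ √(-x) * (y - x) := by
  by_contra! hlt
  set κ := √(-x)
  have hκ2 : κ ^ 2 = -x := Real.sq_sqrt (by linarith [neg_of_airyAi_eq_zero hx])
  have hκ0 : 0 ≤ κ := Real.sqrt_nonneg _
  have hfin : {w | airyAi w = 0 ∧ x < w}.Finite :=
    (finite_airyAi_zeros x).subset fun w hw => ⟨hw.1, hw.2.le⟩
  obtain ⟨b, hb, hmin⟩ := Set.exists_min_image _ id hfin ⟨y, hy, hxy⟩
  have hby : b ≤ y := hmin y ⟨hy, hxy⟩
  set η := (Real.pi - κ * (y - x)) / 2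
  obtain ⟨w, hw, hw0⟩ := sturm_exists_zero hb.2 (isSturmSolution_airyAi _)
    (isSturmSolution_sin κ (η - κ * x) _) (fun w hw => by
      have := hw.1; simp only [id]; linarith) hx hb.1 (airyAiDeriv_ne_zero hx)
    (fun w hw hw0 => absurd (hmin w ⟨hw0, hw.1⟩) (not_le.2 hw.2))
  have h1 : κ * (w - x) ≤ κ * (y - x) := by
    gcongr; exact hw.2.le.trans hby
  have h2 : 0 ≤ κ * (w - x) := mul_nonneg hκ0 (by linarith [hw.1])
  refine (Real.sin_pos_of_pos_of_lt_pi ?_ ?_).ne' hw0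
  · simp only [η]; linarith
  · simp only [η]; linarith

/-! ### The normalised Airy eigenfunctions -/

/-- The Airy function shifted to its `r`-th largest zero, with slope `1` at the origin. -/
def edgeProfile (r : ℕ) (x : ℝ) : ℝ := airyAi (x + airyZero r) / airyAiDeriv (airyZero r)

/-- The derivative of `edgeProfile`. -/
def edgeProfileDeriv (r : ℕ) (x : ℝ) : ℝ :=
  airyAiDeriv (x + airyZero r) / airyAiDeriv (airyZero r)

variable {r : ℕ}

lemma hasDerivAt_edgeProfile (r : ℕ) (x : ℝ) :
    HasDerivAt (edgeProfile r) (edgeProfileDeriv r x) x :=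
  ((hasDerivAt_airyAi (x + airyZero r)).comp_add_const x (airyZero r)).div_const _

lemma hasDerivAt_edgeProfileDeriv (r : ℕ) (x : ℝ) :
    HasDerivAt (edgeProfileDeriv r) ((x + airyZero r) * edgeProfile r x) x :=
  (((hasDerivAt_airyAiDeriv (x + airyZero r)).comp_add_const x (airyZero r)).div_const
    _).congr_deriv (by rw [edgeProfile]; ring)

lemma continuous_edgeProfile (r : ℕ) : Continuous (edgeProfile r) :=
  continuous_iff_continuousAt.2 fun x => (hasDerivAt_edgeProfile r x).continuousAt

lemma airyAiDeriv_airyZero_ne_zero (hr : 1 ≤ r) : airyAiDeriv (airyZero r) ≠ 0 :=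
  airyAiDeriv_ne_zero (airyZero_spec hr).1

lemma edgeProfile_zero (hr : 1 ≤ r) : edgeProfile r 0 = 0 := by
  rw [edgeProfile, zero_add, (airyZero_spec hr).1, zero_div]

lemma edgeProfileDeriv_zero (hr : 1 ≤ r) : edgeProfileDeriv r 0 = 1 := by
  rw [edgeProfileDeriv, zero_add, div_self (airyAiDeriv_airyZero_ne_zero hr)]

lemma edgeIntegrand_eq (r : ℕ) (x : ℝ) : edgeIntegrand r x = edgeProfile r x ^ 2 / x := by
  rw [edgeIntegrand, edgeProfile, deriv_airyAi, div_pow, div_div]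

lemma hasDerivAt_edgeEnergy (r : ℕ) (x : ℝ) :
    HasDerivAt (fun x => (x + airyZero r) * edgeProfile r x ^ 2 - edgeProfileDeriv r x ^ 2)
      (edgeProfile r x ^ 2) x := by
  refine ((((hasDerivAt_id x).add_const (airyZero r)).mul
    ((hasDerivAt_edgeProfile r x).pow 2)).sub
    ((hasDerivAt_edgeProfileDeriv r x).pow 2)).congr_deriv ?_
  simp only [id, Nat.cast_ofNat, Nat.add_one_sub_one, pow_one, Pi.pow_apply]
  ring

lemma tendsto_edgeEnergy (r : ℕ) : Tendsto
    (fun x => (x + airyZero r) * edgeProfile r x ^ 2 - edgeProfileDeriv r x ^ 2) atTop (𝓝 0) := by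
  have h1 : Tendsto (fun x : ℝ => x * airyAi x ^ 2) atTop (𝓝 0) := by
    refine squeeze_zero' (g := fun x : ℝ => 4 / x) ?_ ?_
      (tendsto_const_nhds.div_atTop tendsto_id)
    · filter_upwards [eventually_gt_atTop 0] with x hx
      positivity
    · filter_upwards [eventually_gt_atTop 0] with x hx
      have h := abs_airyAi_le hx
      have h2 : airyAi x ^ 2 ≤ (2 / x) ^ 2 := by
        rw [← sq_abs]; gcongr
      calc x * airyAi x ^ 2 ≤ x * (2 / x) ^ 2 := by gcongr
        _ = 4 / x := by field_simp; norm_num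
  have h2 := tendsto_airyAiDeriv.pow 2
  have hsh : Tendsto (fun x : ℝ => x + airyZero r) atTop atTop :=
    tendsto_atTop_add_const_right _ _ tendsto_id
  have := ((h1.comp hsh).sub (h2.comp hsh)).div_const (airyAiDeriv (airyZero r) ^ 2)
  simp only [ne_eq, OfNat.ofNat_ne_zero, not_false_eq_true, zero_pow, sub_zero, zero_div] at this
  refine this.congr fun x => ?_
  simp only [Function.comp, edgeProfile, edgeProfileDeriv]
  ring

lemma integrableOn_edgeProfile_sq (r : ℕ) :
    IntegrableOn (fun x => edgeProfile r x ^ 2) (Set.Ioi 0) :=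
  integrableOn_Ioi_deriv_of_nonneg
    (hasDerivAt_edgeEnergy r 0).continuousAt.continuousWithinAt
    (fun x _ => hasDerivAt_edgeEnergy r x) (fun _ _ => sq_nonneg _) (tendsto_edgeEnergy r)

lemma integral_Ioi_edgeProfile_sq (hr : 1 ≤ r) :
    ∫ x in Set.Ioi 0, edgeProfile r x ^ 2 = 1 := by
  rw [integral_Ioi_of_hasDerivAt_of_nonneg
    (hasDerivAt_edgeEnergy r 0).continuousAt.continuousWithinAt
    (fun x _ => hasDerivAt_edgeEnergy r x) (fun _ _ => sq_nonneg _) (tendsto_edgeEnergy r),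
    edgeProfile_zero hr, edgeProfileDeriv_zero hr]
  norm_num

lemma edgeEnergy_le (hr : 1 ≤ r) {x : ℝ} (hx : 0 ≤ x) :
    edgeProfileDeriv r x ^ 2 - (x + airyZero r) * edgeProfile r x ^ 2 ≤ 1 := by
  have hm : Monotone (fun x => (x + airyZero r) * edgeProfile r x ^ 2 -
      edgeProfileDeriv r x ^ 2) :=
    monotone_of_hasDerivAt_nonneg (hasDerivAt_edgeEnergy r) fun _ => sq_nonneg _
  have := hm hx
  simp only [edgeProfile_zero hr, edgeProfileDeriv_zero hr] at this
  linarith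

lemma abs_edgeProfile_le_of_le (hr : 1 ≤ r) {x : ℝ} (hx : 0 ≤ x) (hxa : x ≤ -airyZero r) :
    |edgeProfile r x| ≤ x := by
  have h := norm_image_sub_le_of_norm_deriv_le_segment' (f := edgeProfile r) (a := 0) (b := x)
    (C := 1) (fun y _ => (hasDerivAt_edgeProfile r y).hasDerivWithinAt) (fun y hy => by
      have h1 := edgeEnergy_le hr hy.1
      have h2 : 0 ≤ (-airyZero r - y) * edgeProfile r y ^ 2 :=
        mul_nonneg (by linarith [hy.2]) (sq_nonneg _)
      have h3 : edgeProfileDeriv r y ^ 2 ≤ 1 := by linarith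
      exact (sq_le_one_iff_abs_le_one _).1 h3) x ⟨hx, le_rfl⟩
  rw [edgeProfile_zero hr] at h
  simpa using h

lemma abs_edgeProfile_le (hr : 1 ≤ r) {x : ℝ} (hx : 0 ≤ x) : |edgeProfile r x| ≤ x := by
  rcases le_total x (-airyZero r) with h | h
  · exact abs_edgeProfile_le_of_le hr hx h
  · have h0 := abs_edgeProfile_le_of_le hr (x := -airyZero r)
      (by linarith [airyZero_neg hr]) le_rfl
    refine le_trans ?_ (h0.trans h)
    rw [edgeProfile, edgeProfile, abs_div, abs_div]
    refine div_le_div_of_nonneg_right ?_ (abs_nonneg _)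
    rw [neg_add_cancel, abs_of_pos (airyAi_pos le_rfl),
      abs_of_pos (airyAi_pos (by linarith))]
    have hanti : AntitoneOn airyAi (Set.Ici 0) :=
      antitoneOn_of_hasDerivWithinAt_nonpos (convex_Ici 0) continuous_airyAi.continuousOn
        (fun x _ => (hasDerivAt_airyAi x).hasDerivWithinAt) (fun x hx => by
          rw [interior_Ici] at hx
          exact (airyAiDeriv_neg (le_of_lt hx)).le)
    exact hanti Set.self_mem_Ici (by simp only [Set.mem_Ici]; linarith) (by linarith)

lemma edgeIntegrand_nonneg (r : ℕ) {x : ℝ} (hx : 0 ≤ x) : 0 ≤ edgeIntegrand r x := by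
  rw [edgeIntegrand_eq]; positivity

lemma edgeIntegrand_le_self (hr : 1 ≤ r) {x : ℝ} (hx : 0 ≤ x) : edgeIntegrand r x ≤ x := by
  rw [edgeIntegrand_eq]
  rcases hx.eq_or_lt with rfl | hx0
  · simp
  · rw [div_le_iff₀ hx0, ← sq_abs, sq]
    have := abs_edgeProfile_le hr hx
    gcongr

lemma edgeIntegrand_le_div {M x : ℝ} (hM : 0 < M) (hx : M ≤ x) :
    edgeIntegrand r x ≤ edgeProfile r x ^ 2 / M := by
  rw [edgeIntegrand_eq]; gcongr

lemma measurable_edgeIntegrand (r : ℕ) : Measurable (edgeIntegrand r) := by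
  rw [show edgeIntegrand r = fun x => edgeProfile r x ^ 2 / x from funext (edgeIntegrand_eq r)]
  exact ((continuous_edgeProfile r).measurable.pow_const 2).div measurable_id

lemma integrableOn_edgeIntegrand (hr : 1 ≤ r) :
    IntegrableOn (edgeIntegrand r) (Set.Ioi 0) := by
  rw [← Set.Ioc_union_Ioi_eq_Ioi (zero_le_one' ℝ)]
  refine IntegrableOn.union ?_ ?_
  · refine Integrable.mono' (g := fun _ => (1 : ℝ)) (by simp)
      (measurable_edgeIntegrand r).aestronglyMeasurable ?_
    refine (ae_restrict_iff' measurableSet_Ioc).2 (Eventually.of_forall fun x hx => ?_)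
    rw [Real.norm_of_nonneg (edgeIntegrand_nonneg r hx.1.le)]
    exact (edgeIntegrand_le_self hr hx.1.le).trans hx.2
  · refine Integrable.mono' ((integrableOn_edgeProfile_sq r).mono_set
      (Set.Ioi_subset_Ioi (zero_le_one' ℝ))) (measurable_edgeIntegrand r).aestronglyMeasurable ?_
    refine (ae_restrict_iff' measurableSet_Ioi).2 (Eventually.of_forall fun x hx => ?_)
    have hx : 1 < x := hx
    rw [Real.norm_of_nonneg (edgeIntegrand_nonneg r (by linarith))]
    simpa using edgeIntegrand_le_div (r := r) one_pos hx.le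

/-- Beyond `M`, the integral of the edge density is controlled by the remaining mass. -/
lemma edgeVariance_le_add (hr : 1 ≤ r) {M : ℝ} (hM : 0 < M) :
    edgeVariance r ≤ (∫ x in Set.Ioc 0 M, edgeIntegrand r x) +
      (1 - ∫ x in Set.Ioc 0 M, edgeProfile r x ^ 2) / M := by
  have hi := integrableOn_edgeIntegrand hr
  have hs := integrableOn_edgeProfile_sq r
  have hu := Set.Ioc_union_Ioi_eq_Ioi hM.le
  have hsub1 : Set.Ioc 0 M ⊆ Set.Ioi 0 := fun x hx => hx.1
  have hsub2 : Set.Ioi M ⊆ Set.Ioi 0 := Set.Ioi_subset_Ioi hM.le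
  have h1 := integral_Ioi_edgeProfile_sq hr
  rw [← hu, setIntegral_union (Set.Ioc_disjoint_Ioi le_rfl) measurableSet_Ioi
    (hs.mono_set hsub1) (hs.mono_set hsub2)] at h1
  rw [edgeVariance, ← hu, setIntegral_union (Set.Ioc_disjoint_Ioi le_rfl) measurableSet_Ioi
    (hi.mono_set hsub1) (hi.mono_set hsub2), ← h1, add_sub_cancel_left, ← integral_div]
  gcongr 1
  exact setIntegral_mono_on (hi.mono_set hsub2) ((hs.mono_set hsub2).div_const M)
    measurableSet_Ioi fun x hx => edgeIntegrand_le_div hM (le_of_lt hx)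

lemma setIntegral_Ioc_le_edgeVariance (hr : 1 ≤ r) (M : ℝ) :
    ∫ x in Set.Ioc 0 M, edgeIntegrand r x ≤ edgeVariance r := by
  refine setIntegral_mono_set (integrableOn_edgeIntegrand hr) ?_
    (Eventually.of_forall fun x hx => hx.1)
  exact (ae_restrict_iff' measurableSet_Ioi).2 (Eventually.of_forall fun x hx =>
    edgeIntegrand_nonneg r (le_of_lt hx))

lemma edgeVariance_nonneg (r : ℕ) : 0 ≤ edgeVariance r :=
  setIntegral_nonneg measurableSet_Ioi fun _ hx => edgeIntegrand_nonneg r (le_of_lt hx)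

lemma edgeVariance_le (hr : 1 ≤ r) {M : ℝ} (hM : 0 < M) (ha : 2 * M ≤ -airyZero r) :
    edgeVariance r ≤ M * √(2 / -airyZero r) + 1 / M := by
  refine (edgeVariance_le_add hr hM).trans ?_
  have ha0 : 0 < -airyZero r := by linarith
  gcongr
  · have : ∫ x in Set.Ioc 0 M, edgeIntegrand r x ≤ ∫ x in Set.Ioc 0 M, √(2 / -airyZero r) := by
      refine setIntegral_mono_on ((integrableOn_edgeIntegrand hr).mono_set fun x hx => hx.1)
        (by simp) measurableSet_Ioc fun x hx => ?_
      have h1 := edgeEnergy_le hr hx.1.le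
      have h2 : edgeProfile r x ^ 2 ≤ 2 / -airyZero r := by
        rw [le_div_iff₀ ha0]
        have h3 : (-airyZero r) / 2 * edgeProfile r x ^ 2 ≤
            (-airyZero r - x) * edgeProfile r x ^ 2 := by
          gcongr; linarith [hx.2]
        nlinarith [sq_nonneg (edgeProfileDeriv r x)]
      have h3 := Real.abs_le_sqrt h2
      rw [edgeIntegrand_eq, div_le_iff₀ hx.1, ← sq_abs, sq]
      exact mul_le_mul h3 (abs_edgeProfile_le hr hx.1.le) (abs_nonneg _) (Real.sqrt_nonneg _)
    refine this.trans ?_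
    simp [hM.le]
  · have : 0 ≤ ∫ x in Set.Ioc 0 M, edgeProfile r x ^ 2 :=
      setIntegral_nonneg measurableSet_Ioc fun x _ => sq_nonneg _
    linarith

lemma tendsto_edgeVariance : Tendsto edgeVariance atTop (𝓝 0) := by
  have hn : Tendsto (fun r => -airyZero r) atTop atTop := tendsto_neg_atBot_atTop.comp tendsto_airyZero
  have key : ∀ M : ℝ, 0 < M → ∀ᶠ r in atTop, edgeVariance r < 2 / M := by
    intro M hM
    have h1 : Tendsto (fun r => M * √(2 / -airyZero r) + 1 / M) atTop (𝓝 (M * √0 + 1 / M)) :=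
      (((hn.const_div_atTop 2).sqrt).const_mul M).add_const _
    have h2 : M * √0 + 1 / M < 2 / M := by
      rw [Real.sqrt_zero, mul_zero, zero_add]; gcongr; norm_num
    filter_upwards [h1.eventually_lt_const h2, hn.eventually_ge_atTop (2 * M),
      eventually_ge_atTop 1] with r hr1 hr2 hr3
    exact (edgeVariance_le hr3 hM hr2).trans_lt hr1
  rw [Metric.tendsto_atTop']
  intro ε hε
  obtain ⟨n, hn⟩ := eventually_atTop.1 (key (2 / ε) (by positivity))
  refine ⟨n, fun r hr => ?_⟩
  have := hn r hr.le
  rw [div_div_cancel₀ (by norm_num)] at this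
  rw [Real.dist_0_eq_abs, abs_of_nonneg (edgeVariance_nonneg r)]
  exact this

/-! ### Integer polynomials given by coefficient lists -/

/-- Evaluation of the polynomial with integer coefficients `l`. -/
def evalList : List ℤ → ℝ → ℝ
  | [], _ => 0
  | c :: l, t => c + t * evalList l t

/-- Coefficientwise sum. -/
def addList : List ℤ → List ℤ → List ℤ
  | [], m => m
  | l, [] => l
  | a :: l, b :: m => (a + b) :: addList l m

/-- Scalar multiple. -/
def smulList (c : ℤ) : List ℤ → List ℤ
  | [] => []
  | a :: l => (c * a) :: smulList c l

/-- Coefficients of `t ^ (1 - n)` times the derivative of `t ^ n` times the polynomial. -/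
def derivListAux : ℕ → List ℤ → List ℤ
  | _, [] => []
  | n, c :: l => ((n : ℤ) * c) :: derivListAux (n + 1) l

/-- Derivative. -/
def derivList (l : List ℤ) : List ℤ := derivListAux 1 l.tail

/-- Product. -/
def mulList : List ℤ → List ℤ → List ℤ
  | [], _ => []
  | a :: l, m => addList (smulList a m) (0 :: mulList l m)

/-- Sum of the absolute values of the coefficients. -/
def absSumList : List ℤ → ℤ
  | [] => 0
  | c :: l => |c| + absSumList l

/-- Value at `1`. -/
def sumList : List ℤ → ℤ
  | [] => 0
  | c :: l => c + sumList l

/-- Lower bound for the integral of `t ^ (n - 1)` times the polynomial over `[0, 1]`. -/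
def integralList : ℕ → List ℤ → ℤ
  | _, [] => 0
  | n, c :: l => c / (n : ℤ) + integralList (n + 1) l

lemma evalList_addList (l m : List ℤ) (t : ℝ) :
    evalList (addList l m) t = evalList l t + evalList m t := by
  induction l generalizing m with
  | nil => simp [addList, evalList]
  | cons a l ih =>
    cases m with
    | nil => simp [addList, evalList]
    | cons b m => simp only [addList, evalList, ih]; push_cast; ring

lemma evalList_smulList (c : ℤ) (l : List ℤ) (t : ℝ) :
    evalList (smulList c l) t = c * evalList l t := by
  induction l with
  | nil => simp [smulList, evalList]
  | cons a l ih => simp only [smulList, evalList, ih]; push_cast; ring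

lemma evalList_mulList (l m : List ℤ) (t : ℝ) :
    evalList (mulList l m) t = evalList l t * evalList m t := by
  induction l with
  | nil => simp [mulList, evalList]
  | cons a l ih =>
    simp only [mulList, evalList_addList, evalList_smulList, evalList, ih]; push_cast; ring

lemma evalList_one (l : List ℤ) : evalList l 1 = sumList l := by
  induction l with
  | nil => simp [sumList, evalList]
  | cons a l ih => simp only [sumList, evalList, ih]; push_cast; ring

lemma continuous_evalList (l : List ℤ) : Continuous (evalList l) := by
  induction l with
  | nil => exact continuous_const
  | cons a l ih => exact continuous_const.add (continuous_id.mul ih)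

lemma hasDerivAt_pow_mul_evalList (l : List ℤ) (n : ℕ) (t : ℝ) :
    HasDerivAt (fun t => t ^ (n + 1) * evalList l t)
      (t ^ n * evalList (derivListAux (n + 1) l) t) t := by
  induction l generalizing n with
  | nil => simpa [evalList, derivListAux] using hasDerivAt_const t (0 : ℝ)
  | cons c l ih =>
    have h1 := ((hasDerivAt_pow (n + 1) t).mul_const (c : ℝ)).add (ih (n + 1))
    refine (h1.congr_deriv ?_).congr_of_eventuallyEq (Eventually.of_forall fun s => ?_)
    · simp only [evalList, derivListAux, Nat.add_sub_cancel]; push_cast; ring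
    · simp only [evalList, Pi.add_apply]; ring

lemma hasDerivAt_evalList (l : List ℤ) (t : ℝ) :
    HasDerivAt (evalList l) (evalList (derivList l) t) t := by
  cases l with
  | nil => exact hasDerivAt_const t (0 : ℝ)
  | cons c l =>
    have h := (hasDerivAt_pow_mul_evalList l 0 t).const_add (c : ℝ)
    refine (h.congr_deriv ?_).congr_of_eventuallyEq (Eventually.of_forall fun s => ?_)
    · simp [derivList]
    · simp [evalList]

lemma abs_evalList_le (l : List ℤ) {t : ℝ} (ht : t ∈ Set.Icc (0 : ℝ) 1) :
    |evalList l t| ≤ absSumList l := by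
  induction l with
  | nil => simp [evalList, absSumList]
  | cons c l ih =>
    simp only [evalList, absSumList]
    push_cast
    refine (abs_add_le _ _).trans ?_
    gcongr
    rw [abs_mul, abs_of_nonneg ht.1]
    exact (mul_le_of_le_one_left (abs_nonneg _) ht.2).trans ih

lemma integralList_le (l : List ℤ) (n : ℕ) :
    (integralList (n + 1) l : ℝ) ≤ ∫ t in (0 : ℝ)..1, t ^ n * evalList l t ∧
      ∫ t in (0 : ℝ)..1, t ^ n * evalList l t ≤ integralList (n + 1) l + l.length := by
  induction l generalizing n with
  | nil => simp [evalList, integralList]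
  | cons c l ih =>
    have h1 : ∫ t in (0 : ℝ)..1, t ^ n * evalList (c :: l) t =
        (c : ℝ) / ((n + 1 : ℕ) : ℝ) + ∫ t in (0 : ℝ)..1, t ^ (n + 1) * evalList l t := by
      rw [show (c : ℝ) / ((n + 1 : ℕ) : ℝ) = ∫ t in (0 : ℝ)..1, t ^ n * (c : ℝ) by
        rw [intervalIntegral.integral_mul_const, integral_pow]; push_cast; simp; ring]
      rw [← intervalIntegral.integral_add]
      · refine intervalIntegral.integral_congr fun t _ => ?_
        simp only [evalList]; ring
      · exact (by fun_prop : Continuous fun t : ℝ => t ^ n * (c : ℝ)).intervalIntegrable _ _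
      · exact ((continuous_pow _).mul (continuous_evalList l)).intervalIntegrable _ _
    have hn : (0 : ℤ) < ((n + 1 : ℕ) : ℤ) := by positivity
    have hn' : (0 : ℝ) < ((n + 1 : ℕ) : ℝ) := by positivity
    have e1 : ((c / ((n + 1 : ℕ) : ℤ) : ℤ) : ℝ) ≤ (c : ℝ) / ((n + 1 : ℕ) : ℝ) := by
      rw [le_div_iff₀ hn']
      exact_mod_cast Int.ediv_mul_le c hn.ne'
    have e2 : (c : ℝ) / ((n + 1 : ℕ) : ℝ) ≤ ((c / ((n + 1 : ℕ) : ℤ) : ℤ) : ℝ) + 1 := by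
      rw [div_le_iff₀ hn']
      exact_mod_cast (Int.lt_ediv_add_one_mul_self c hn).le
    obtain ⟨i1, i2⟩ := ih (n + 1)
    rw [h1]
    simp only [integralList, List.length_cons]
    push_cast at *
    constructor <;> linarith

/-! ### Grönwall bounds for second order equations on the unit interval -/

lemma sl_gronwall {Q f e e' : ℝ → ℝ} {w ε δ : ℝ} (hw : 0 < w) (hε : 0 ≤ ε)
    (he : ∀ t ∈ Set.Icc (0 : ℝ) 1, HasDerivAt e (e' t) t)
    (he' : ∀ t ∈ Set.Icc (0 : ℝ) 1, HasDerivAt e' (Q t * e t + f t) t)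
    (hQ : ∀ t ∈ Set.Icc (0 : ℝ) 1, |Q t| ≤ w ^ 2) (hf : ∀ t ∈ Set.Icc (0 : ℝ) 1, |f t| ≤ ε)
    (h0 : w * |e 0| ≤ δ) (h0' : |e' 0| ≤ δ) {t : ℝ} (ht : t ∈ Set.Icc (0 : ℝ) 1) :
    w * |e t| ≤ gronwallBound δ w ε t ∧ |e' t| ≤ gronwallBound δ w ε t := by
  have habs : ∀ y, |w * y| = w * |y| := fun y => by rw [abs_mul, abs_of_pos hw]
  have key := norm_le_gronwallBound_of_norm_deriv_right_le
    (f := fun t => (w * e t, e' t)) (f' := fun t => (w * e' t, Q t * e t + f t))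
    (δ := δ) (K := w) (ε := ε) (a := 0) (b := 1)
    (fun t ht => (((he t ht).const_mul w).continuousAt.prodMk
      (he' t ht).continuousAt).continuousWithinAt)
    (fun t ht => (((he t (Set.Ico_subset_Icc_self ht)).const_mul w).prodMk
      (he' t (Set.Ico_subset_Icc_self ht))).hasDerivWithinAt)
    (max_le (by simpa only [Real.norm_eq_abs, habs] using h0) h0') (fun t ht => by
      have ht := Set.Ico_subset_Icc_self ht
      have e1 : w * |e t| ≤ ‖(w * e t, e' t)‖ := by rw [← habs]; exact le_max_left _ _
      have e2 : |e' t| ≤ ‖(w * e t, e' t)‖ := le_max_right _ _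
      refine max_le ?_ ?_
      · change |w * e' t| ≤ _
        rw [habs]
        have := mul_le_mul_of_nonneg_left e2 hw.le
        linarith
      · change |Q t * e t + f t| ≤ _
        refine (abs_add_le _ _).trans (add_le_add ?_ (hf t ht))
        rw [abs_mul]
        calc |Q t| * |e t| ≤ w ^ 2 * |e t| := by gcongr; exact hQ t ht
          _ = w * (w * |e t|) := by ring
          _ ≤ _ := by gcongr) t ht
  rw [sub_zero] at key
  refine ⟨?_, (le_max_right _ _).trans key⟩
  rw [← habs]
  exact (le_max_left _ _).trans key

lemma exp_natCast_le_three_pow (K : ℕ) : Real.exp K ≤ 3 ^ K := by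
  rw [← mul_one (K : ℝ), Real.exp_nat_mul]
  gcongr
  exact (Real.exp_one_lt_d9.trans (by norm_num)).le

/-- `q` times the residual of the polynomial `l` in the equation `p'' = (β t + α / q) p`. -/
def residualList (α β q : ℤ) (l : List ℤ) : List ℤ :=
  addList (smulList q (derivList (derivList l)))
    (smulList (-1) (addList (smulList α l) (0 :: smulList (q * β) l)))

lemma evalList_residualList {α β q : ℤ} (hq : 0 < q) (l : List ℤ) (t : ℝ) :
    evalList (derivList (derivList l)) t = (β * t + α / q) * evalList l t +
      evalList (residualList α β q l) t / q := by
  have hq' : (q : ℝ) ≠ 0 := by exact_mod_cast hq.ne'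
  simp only [residualList, evalList_addList, evalList_smulList, evalList]
  push_cast
  field_simp
  ring

/-- The rounded Taylor coefficients of the solution of `p'' = (β t + α / q) p` which starts with
the coefficients `a, b, c` (at positions `n - 1, n, n + 1`). -/
def taylorList (α β q : ℤ) : ℕ → ℕ → ℤ → ℤ → ℤ → List ℤ
  | 0, _, _, _, _ => []
  | f + 1, n, a, b, c => a :: taylorList α β q f (n + 1) b c
      ((α * b + q * β * a) / (q * ((n + 3) * (n + 2))))

/-- The check behind `airyAi_sign`. -/
def airySignCheck (s a q M : ℤ) (K : ℕ) (l : List ℤ) : Bool :=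
  decide (0 < q ∧ 0 < K ∧ 0 < M * q + a ∧ M ^ 2 * (M * q + a) ≤ K ^ 2 * q ∧ -a * M ^ 2 ≤ K ^ 2 * q ∧
    l.head? = some 0 ∧ 0 < (derivList l).headI ∧
    3 ^ K * absSumList (residualList (a * M ^ 2) (M ^ 3) q l) < q * (s * sumList l) ∧
    3 ^ K * absSumList (residualList (a * M ^ 2) (M ^ 3) q l) < q * (s * sumList (derivList l)))

lemma evalList_zero (l : List ℤ) : evalList l 0 = l.headI := by
  cases l <;> simp [evalList]

lemma abs_affine_le {u v w t : ℝ} (ht : t ∈ Set.Icc (0 : ℝ) 1) (h0 : |v| ≤ w)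
    (h1 : |u + v| ≤ w) : |u * t + v| ≤ w := by
  rw [abs_le] at *
  have h2 := ht.1
  have h3 := ht.2
  constructor <;> nlinarith [h0.1, h0.2, h1.1, h1.2]

/-- The sign of the Airy function at the rational point `a / q` can be read off from an
approximate polynomial solution of the Airy equation. -/
lemma airyAi_sign {s a q M : ℤ} {K : ℕ} {l : List ℤ} (hs : s = 1 ∨ s = -1) (hM0 : 0 < M)
    (h : airySignCheck s a q M K l = true) : 0 < s * airyAi (a / q) := by
  simp only [airySignCheck, decide_eq_true_eq] at h
  obtain ⟨hq, hK, hX, hb1, hb2, hl0, hc, hs1, hs2⟩ := h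
  set R := residualList (a * M ^ 2) (M ^ 3) q l with hR
  have hqr : (0 : ℝ) < q := by exact_mod_cast hq
  have hMr : (0 : ℝ) < M := by exact_mod_cast hM0
  have hKr : (0 : ℝ) < K := by exact_mod_cast hK
  set α : ℝ := ((a * M ^ 2 : ℤ) : ℝ) / q with hα
  set β : ℝ := ((M ^ 3 : ℤ) : ℝ) with hβ
  have hXr : (0 : ℝ) < M + a / q := by
    have : (0 : ℝ) < M * q + a := by exact_mod_cast hX
    have h2 : (M : ℝ) + a / q = (M * q + a) / q := by field_simp
    rw [h2]; positivity
  set B : ℝ → ℝ := fun t => airyAi (M * t + a / q) with hB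
  set B' : ℝ → ℝ := fun t => M * airyAiDeriv (M * t + a / q) with hB'
  have hlin : ∀ t : ℝ, HasDerivAt (fun t : ℝ => M * t + (a : ℝ) / q) M t := fun t => by
    simpa using ((hasDerivAt_id t).const_mul (M : ℝ)).add_const ((a : ℝ) / q)
  have hBd : ∀ t, HasDerivAt B (B' t) t := fun t =>
    ((hasDerivAt_airyAi _).comp t (hlin t)).congr_deriv (by simp only [hB']; ring)
  have hBd' : ∀ t, HasDerivAt B' ((β * t + α) * B t) t := fun t =>
    (((hasDerivAt_airyAiDeriv _).comp t (hlin t)).const_mul (M : ℝ)).congr_deriv (by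
      simp only [hB, hα, hβ]; push_cast; field_simp)
  have hQ : ∀ t ∈ Set.Icc (0 : ℝ) 1, |β * t + α| ≤ (K : ℝ) ^ 2 := by
    intro t ht
    have e1 : (M : ℝ) ^ 2 * (M * q + a) ≤ (K : ℝ) ^ 2 * q := by exact_mod_cast hb1
    have e2 : -(a : ℝ) * M ^ 2 ≤ (K : ℝ) ^ 2 * q := by exact_mod_cast hb2
    have e3 : (0 : ℝ) < M ^ 3 * q := by positivity
    have e4 : (0 : ℝ) < M * q + a := by exact_mod_cast hX
    have e5 : (0 : ℝ) < M ^ 2 * (M * q + a) := by positivity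
    have f2 : β = (M : ℝ) ^ 3 := by simp only [hβ]; push_cast; rfl
    have f1 : α * q = a * M ^ 2 := by simp only [hα]; push_cast; field_simp
    refine abs_affine_le ht ?_ ?_ <;> rw [abs_le] <;> constructor <;>
      refine le_of_mul_le_mul_right ?_ hqr <;> nlinarith
  -- bound of `B` on `[0, 1]` by its data at `1`
  have hB1 : 0 < B 1 := airyAi_pos (by rw [mul_one]; exact hXr.le)
  have hB1' : B' 1 < 0 := mul_neg_of_pos_of_neg hMr (airyAiDeriv_neg (by rw [mul_one]; exact hXr.le))
  have hK1 : (1 : ℝ) ≤ K := by exact_mod_cast hK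
  have hrev : ∀ t ∈ Set.Icc (0 : ℝ) 1, |B t| ≤ 3 ^ K * (B 1 - B' 1) := by
    intro t ht
    have hn : ∀ t : ℝ, HasDerivAt (fun t : ℝ => 1 - t) (-1) t := fun t => by
      simpa using (hasDerivAt_id t).const_sub 1
    have hmem : ∀ t ∈ Set.Icc (0 : ℝ) 1, 1 - t ∈ Set.Icc (0 : ℝ) 1 := fun t ht =>
      ⟨by linarith [ht.2], by linarith [ht.1]⟩
    have hg := (sl_gronwall (Q := fun t => β * (1 - t) + α) (f := fun _ => 0)
      (e := fun t => B (1 - t)) (e' := fun t => -B' (1 - t)) (w := K) (ε := 0)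
      (δ := K * (B 1 - B' 1)) hKr le_rfl
      (fun t _ => ((hBd _).comp t (hn t)).congr_deriv (by ring))
      (fun t _ => (((hBd' _).comp t (hn t)).neg).congr_deriv (by ring))
      (fun t ht => hQ _ (hmem t ht)) (by simp)
      (by simp only [sub_zero]; rw [abs_of_pos hB1]; gcongr; linarith)
      (by simp only [sub_zero]; rw [abs_neg, abs_of_neg hB1']; nlinarith) (hmem t ht)).1
    rw [sub_sub_cancel, gronwallBound_ε0, mul_assoc] at hg
    have h2 := le_of_mul_le_mul_left hg hKr
    refine h2.trans ?_
    rw [mul_comm]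
    have : 0 < B 1 - B' 1 := by linarith
    gcongr
    refine le_trans (Real.exp_le_exp.2 ?_) (exp_natCast_le_three_pow K)
    nlinarith [ht.1]
  -- the Wronskian
  set p := evalList l
  set p' := evalList (derivList l)
  set W : ℝ → ℝ := fun t => s * (B t * p' t - B' t * p t) with hW
  have hWd : ∀ t, HasDerivAt W (s * (B t * (evalList R t / q))) t := fun t => by
    refine ((((hBd t).mul (hasDerivAt_evalList (derivList l) t)).sub
      ((hBd' t).mul (hasDerivAt_evalList l t))).const_mul (s : ℝ)).congr_deriv ?_
    rw [evalList_residualList hq (α := a * M ^ 2) (β := M ^ 3)]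
    simp only [hα, hβ, hR]
    ring
  have habs_s : |(s : ℝ)| = 1 := by rcases hs with rfl | rfl <;> simp
  set ρ : ℝ := ((absSumList R : ℤ) : ℝ)
  have hbound := norm_image_sub_le_of_norm_deriv_le_segment' (f := W) (a := 0) (b := 1)
    (C := 3 ^ K * (B 1 - B' 1) * (ρ / q)) (fun t _ => (hWd t).hasDerivWithinAt) (fun t ht => by
      have ht := Set.Ico_subset_Icc_self ht
      rw [Real.norm_eq_abs, abs_mul, habs_s, one_mul, abs_mul, abs_div, abs_of_pos hqr]
      have h1 := hrev t ht
      have h2 := abs_evalList_le R ht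
      have h3 : 0 ≤ |B t| := abs_nonneg _
      have h4 := h3.trans h1
      gcongr) 1 ⟨zero_le_one, le_rfl⟩
  have hp0 : p 0 = 0 := by
    simp only [p, evalList_zero]
    cases l with
    | nil => simp at hl0
    | cons c l => simpa using hl0
  have hW0 : W 0 = s * airyAi (a / q) * (derivList l).headI := by
    simp only [hW, hp0, p', evalList_zero, hB]
    ring_nf
  have hW1 : 3 ^ K * (B 1 - B' 1) * (ρ / q) < W 1 := by
    have e1 : (3 : ℝ) ^ K * ρ < q * (s * sumList l) := by simp only [ρ]; exact_mod_cast hs1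
    have e2 : (3 : ℝ) ^ K * ρ < q * (s * sumList (derivList l)) := by simp only [ρ]; exact_mod_cast hs2
    simp only [hW, p, p', evalList_one]
    have h3 : (3 : ℝ) ^ K * (B 1 - B' 1) * (ρ / q) = B 1 * (3 ^ K * ρ / q) + (-B' 1) * (3 ^ K * ρ / q) := by
      ring
    have h4 : 3 ^ K * ρ / q < s * sumList l := by rw [div_lt_iff₀ hqr]; linarith
    have h5 : 3 ^ K * ρ / q < s * sumList (derivList l) := by rw [div_lt_iff₀ hqr]; linarith
    have h6 := mul_lt_mul_of_pos_left h5 hB1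
    have h7 := mul_lt_mul_of_pos_left h4 (neg_pos.2 hB1')
    rw [h3]
    linarith
  rw [Real.norm_eq_abs, sub_zero, mul_one] at hbound
  have h8 := (abs_le.1 hbound).2
  have h9 : 0 < W 0 := by linarith
  rw [hW0] at h9
  have hcr : (0 : ℝ) < (derivList l).headI := by exact_mod_cast hc
  exact pos_of_mul_pos_left h9 hcr.le

/-! ### The first zeros of the Airy function -/

lemma le_airyZero_one {y : ℝ} (hy : airyAi y = 0) : y ≤ airyZero 1 := by
  by_contra! hlt
  have h := airyZero_spec (r := 1) le_rfl
  obtain ⟨w, hw⟩ := Set.ncard_eq_one.1 h.2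
  have h1 : airyZero 1 = w := by
    have : airyZero 1 ∈ {y | airyAi y = 0 ∧ airyZero 1 ≤ y} := ⟨h.1, le_rfl⟩
    rw [hw] at this; exact this
  have h2 : y = w := by
    have : y ∈ {y | airyAi y = 0 ∧ airyZero 1 ≤ y} := ⟨hy, hlt.le⟩
    rw [hw] at this; exact this
  linarith

lemma airyZero_one_lt : airyZero 1 < -1 := by
  by_contra! hge
  have hneg := airyZero_neg (r := 1) le_rfl
  have hslope : ∀ x ∈ Set.Icc 0 (-airyZero 1), 0 ≤ edgeProfileDeriv 1 x := by
    intro x hx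
    have h := norm_image_sub_le_of_norm_deriv_le_segment'
      (f := edgeProfileDeriv 1) (a := 0) (b := x) (C := x)
      (fun y _ => (hasDerivAt_edgeProfileDeriv 1 y).hasDerivWithinAt) (fun y hy => by
        have h1 := abs_edgeProfile_le (r := 1) le_rfl hy.1
        rw [Real.norm_eq_abs, abs_mul]
        have h2 : |y + airyZero 1| ≤ 1 := by
          rw [abs_le]; constructor <;> linarith [hy.1, hy.2, hx.2]
        calc |y + airyZero 1| * |edgeProfile 1 y| ≤ 1 * y := by gcongr
          _ ≤ x := by rw [one_mul]; exact hy.2.le) x ⟨hx.1, le_rfl⟩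
    rw [edgeProfileDeriv_zero le_rfl] at h
    have := (abs_le.1 h).1
    nlinarith [hx.1, hx.2]
  have hmono : MonotoneOn (edgeProfile 1) (Set.Icc 0 (-airyZero 1)) :=
    monotoneOn_of_hasDerivWithinAt_nonneg (convex_Icc _ _) (continuous_edgeProfile 1).continuousOn
      (fun x _ => (hasDerivAt_edgeProfile 1 x).hasDerivWithinAt)
      fun x hx => hslope x (interior_subset hx)
  have h0 : (0 : ℝ) ≤ -airyZero 1 := by linarith
  have h1 := hmono ⟨le_rfl, h0⟩ ⟨h0, le_rfl⟩ h0
  have h2 := hslope _ ⟨h0, le_rfl⟩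
  rw [edgeProfile_zero le_rfl] at h1
  have h3 := mul_nonneg h1 h2
  rw [edgeProfile, edgeProfileDeriv, neg_add_cancel, div_mul_div_comm] at h3
  have h4 : airyAi 0 * airyAiDeriv 0 < 0 :=
    mul_neg_of_pos_of_neg (airyAi_pos le_rfl) (airyAiDeriv_neg le_rfl)
  exact absurd (div_neg_of_neg_of_pos h4
    (mul_self_pos.2 (airyAiDeriv_airyZero_ne_zero le_rfl))) (not_lt.2 h3)

lemma nine_le_airyAi_zero_gap {x y s : ℝ} (hxy : x < y) (hx : airyAi x = 0) (hy : airyAi y = 0)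
    (hs : y - x ≤ s) : 9 ≤ -x * s ^ 2 := by
  have h := pi_le_airyAi_zero_gap hxy hx hy
  have hx0 := neg_of_airyAi_eq_zero hx
  have h1 : 3 ≤ √(-x) * s :=
    Real.pi_gt_three.le.trans (h.trans (mul_le_mul_of_nonneg_left hs (Real.sqrt_nonneg _)))
  have h2 : (√(-x) * s) ^ 2 = -x * s ^ 2 := by rw [mul_pow, Real.sq_sqrt (by linarith)]
  nlinarith

lemma airyZero_one_eq {ζ : ℝ} (hζ : airyAi ζ = 0) (h : -ζ * (1 + ζ) ^ 2 < 9) :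
    airyZero 1 = ζ := by
  refine rthLargestZero_eq le_rfl hζ (Set.ncard_eq_one.2 ⟨ζ, ?_⟩)
  ext y
  constructor
  · rintro ⟨hy, hle⟩
    by_contra hne
    have hlt : ζ < y := lt_of_le_of_ne hle (Ne.symm hne)
    have h1 := nine_le_airyAi_zero_gap hlt hζ hy (s := -(1 + ζ))
      (by linarith [le_airyZero_one hy, airyZero_one_lt])
    rw [neg_sq] at h1
    linarith
  · rintro rfl
    exact ⟨hζ, le_rfl⟩

lemma airyZero_succ_eq {r : ℕ} (hr : 1 ≤ r) {ζ : ℝ} (hζ : airyAi ζ = 0) (hlt : ζ < airyZero r)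
    (h : -ζ * (airyZero r - ζ) ^ 2 < 36) : airyZero (r + 1) = ζ := by
  have hspec := airyZero_spec hr
  refine rthLargestZero_eq (by omega) hζ ?_
  have hset : {y | airyAi y = 0 ∧ ζ ≤ y} = insert ζ {y | airyAi y = 0 ∧ airyZero r ≤ y} := by
    ext y
    constructor
    · rintro ⟨hy, hle⟩
      by_contra hne
      rw [Set.mem_insert_iff, not_or] at hne
      have h1 : ζ < y := lt_of_le_of_ne hle (Ne.symm hne.1)
      have h2 : y < airyZero r := by
        by_contra! h2
        exact hne.2 ⟨hy, h2⟩
      have hζ0 := neg_of_airyAi_eq_zero hζ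
      have hy0 := neg_of_airyAi_eq_zero hy
      rcases le_total (y - ζ) ((airyZero r - ζ) / 2) with hc | hc
      · have := nine_le_airyAi_zero_gap h1 hζ hy hc
        nlinarith
      · have := nine_le_airyAi_zero_gap h2 hy hspec.1 (s := (airyZero r - ζ) / 2) (by linarith)
        have h3 : -y * ((airyZero r - ζ) / 2) ^ 2 ≤ -ζ * ((airyZero r - ζ) / 2) ^ 2 := by
          gcongr
        nlinarith
    · rintro (rfl | hy)
      · exact ⟨hζ, le_rfl⟩
      · exact ⟨hy.1, hlt.le.trans hy.2⟩
  rw [hset, Set.ncard_insert_of_notMem (fun hm => absurd hm.2 (not_le.2 hlt))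
    (finite_airyAi_zeros _), hspec.2]

lemma exists_airyAi_zero_of_sign {s a b : ℝ} (hab : a ≤ b) (ha : 0 < -s * airyAi a)
    (hb : 0 < s * airyAi b) : ∃ ζ ∈ Set.Icc a b, airyAi ζ = 0 := by
  have hc : ContinuousOn (fun x => s * airyAi x) (Set.Icc a b) :=
    (continuous_const.mul continuous_airyAi).continuousOn
  obtain ⟨ζ, hζ, h0⟩ := intermediate_value_Icc hab hc
    (show (0 : ℝ) ∈ _ from ⟨by linarith, by linarith⟩)
  refine ⟨ζ, hζ, ?_⟩
  rcases mul_eq_zero.1 h0 with h | h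
  · rw [h] at hb; simp at hb
  · exact h

/-- The polynomial used to bracket zeros of the Airy function. -/
def airyTaylor (a q M S : ℤ) (f : ℕ) : List ℤ := taylorList (a * M ^ 2) (M ^ 3) q f 0 0 S 0

set_option maxRecDepth 10000 in
lemma exists_airyAi_zero_near_one : ∃ ζ ∈ Set.Icc (-23381074104597671 / 10 ^ 16 : ℝ)
    (-23381074104597670 / 10 ^ 16), airyAi ζ = 0 := by
  have h1 := airyAi_sign (s := -1) (a := -23381074104597671) (q := 10 ^ 16) (M := 12) (K := 38)
    (l := airyTaylor (-23381074104597671) (10 ^ 16) 12 (10 ^ 36) 200)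
    (Or.inr rfl) (by norm_num) (by decide +kernel)
  have h2 := airyAi_sign (s := 1) (a := -23381074104597670) (q := 10 ^ 16) (M := 12) (K := 38)
    (l := airyTaylor (-23381074104597670) (10 ^ 16) 12 (10 ^ 36) 200)
    (Or.inl rfl) (by norm_num) (by decide +kernel)
  refine exists_airyAi_zero_of_sign (s := 1) (by norm_num) ?_ ?_
  · convert h1 using 3 <;> norm_num
  · convert h2 using 3 <;> norm_num

set_option maxRecDepth 10000 in
lemma exists_airyAi_zero_near_two : ∃ ζ ∈ Set.Icc (-4087949444130970617 / 10 ^ 18 : ℝ)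
    (-4087949444130970616 / 10 ^ 18), airyAi ζ = 0 := by
  have h1 := airyAi_sign (s := 1) (a := -4087949444130970617) (q := 10 ^ 18) (M := 14) (K := 45)
    (l := airyTaylor (-4087949444130970617) (10 ^ 18) 14 (10 ^ 40) 260)
    (Or.inl rfl) (by norm_num) (by decide +kernel)
  have h2 := airyAi_sign (s := -1) (a := -4087949444130970616) (q := 10 ^ 18) (M := 14) (K := 45)
    (l := airyTaylor (-4087949444130970616) (10 ^ 18) 14 (10 ^ 40) 260)
    (Or.inr rfl) (by norm_num) (by decide +kernel)
  refine exists_airyAi_zero_of_sign (s := -1) (by norm_num) ?_ ?_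
  · convert h1 using 3 <;> norm_num
  · convert h2 using 3 <;> norm_num

set_option maxRecDepth 10000 in
lemma exists_airyAi_zero_near_three : ∃ ζ ∈ Set.Icc (-552055982809555105913 / 10 ^ 20 : ℝ)
    (-552055982809555105912 / 10 ^ 20), airyAi ζ = 0 := by
  have h1 := airyAi_sign (s := -1) (a := -552055982809555105913) (q := 10 ^ 20) (M := 17) (K := 58)
    (l := airyTaylor (-552055982809555105913) (10 ^ 20) 17 (10 ^ 48) 340)
    (Or.inr rfl) (by norm_num) (by decide +kernel)
  have h2 := airyAi_sign (s := 1) (a := -552055982809555105912) (q := 10 ^ 20) (M := 17) (K := 58)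
    (l := airyTaylor (-552055982809555105912) (10 ^ 20) 17 (10 ^ 48) 340)
    (Or.inl rfl) (by norm_num) (by decide +kernel)
  refine exists_airyAi_zero_of_sign (s := 1) (by norm_num) ?_ ?_
  · convert h1 using 3 <;> norm_num
  · convert h2 using 3 <;> norm_num

set_option maxRecDepth 10000 in
lemma exists_airyAi_zero_near_four : ∃ ζ ∈ Set.Icc (-67867080900717589987803 / 10 ^ 22 : ℝ)
    (-67867080900717589987802 / 10 ^ 22), airyAi ζ = 0 := by
  have h1 := airyAi_sign (s := 1) (a := -67867080900717589987803) (q := 10 ^ 22) (M := 18) (K := 61)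
    (l := airyTaylor (-67867080900717589987803) (10 ^ 22) 18 (10 ^ 52) 360)
    (Or.inl rfl) (by norm_num) (by decide +kernel)
  have h2 := airyAi_sign (s := -1) (a := -67867080900717589987802) (q := 10 ^ 22) (M := 18) (K := 61)
    (l := airyTaylor (-67867080900717589987802) (10 ^ 22) 18 (10 ^ 52) 360)
    (Or.inr rfl) (by norm_num) (by decide +kernel)
  refine exists_airyAi_zero_of_sign (s := -1) (by norm_num) ?_ ?_
  · convert h1 using 3 <;> norm_num
  · convert h2 using 3 <;> norm_num

lemma airyZero_one_mem : airyZero 1 ∈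
    Set.Icc (-23381074104597671 / 10 ^ 16 : ℝ) (-23381074104597670 / 10 ^ 16) := by
  obtain ⟨ζ, hζ, h0⟩ := exists_airyAi_zero_near_one
  rwa [airyZero_one_eq h0]
  norm_num at hζ
  nlinarith [hζ.1, hζ.2]

lemma airyZero_succ_mem {r : ℕ} (hr : 1 ≤ r) {a b L : ℝ} (ha : a ≤ airyZero r)
    (hb : airyZero r ≤ b) {c d : ℝ} (h : ∃ ζ ∈ Set.Icc c d, airyAi ζ = 0) (hda : d < a)
    (hL : b - c ≤ L) (hlt : -c * L ^ 2 < 36) : airyZero (r + 1) ∈ Set.Icc c d := by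
  obtain ⟨ζ, hζ, h0⟩ := h
  have h1 : ζ < airyZero r := by linarith [hζ.2]
  rwa [airyZero_succ_eq hr h0 h1]
  have hζ0 := neg_of_airyAi_eq_zero h0
  have h2 : airyZero r - ζ ≤ L := by linarith [hζ.1]
  calc -ζ * (airyZero r - ζ) ^ 2 ≤ -c * L ^ 2 := by
        have := hζ.1
        have h3 : 0 ≤ airyZero r - ζ := by linarith
        gcongr
        linarith
    _ < 36 := hlt

lemma airyZero_two_mem : airyZero 2 ∈
    Set.Icc (-4087949444130970617 / 10 ^ 18 : ℝ) (-4087949444130970616 / 10 ^ 18) :=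
  airyZero_succ_mem (L := 2) le_rfl airyZero_one_mem.1 airyZero_one_mem.2
    exists_airyAi_zero_near_two (by norm_num) (by norm_num) (by norm_num)

lemma airyZero_three_mem : airyZero 3 ∈
    Set.Icc (-552055982809555105913 / 10 ^ 20 : ℝ) (-552055982809555105912 / 10 ^ 20) :=
  airyZero_succ_mem (L := 2) one_le_two airyZero_two_mem.1 airyZero_two_mem.2
    exists_airyAi_zero_near_three (by norm_num) (by norm_num) (by norm_num)

lemma airyZero_four_mem : airyZero 4 ∈
    Set.Icc (-67867080900717589987803 / 10 ^ 22 : ℝ) (-67867080900717589987802 / 10 ^ 22) :=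
  airyZero_succ_mem (L := 2) (by norm_num) airyZero_three_mem.1 airyZero_three_mem.2
    exists_airyAi_zero_near_four (by norm_num) (by norm_num) (by norm_num)

/-! ### Numerical values of the edge variances -/

/-- The check behind `edgeVariance_mem_of_check`. -/
def edgeVarianceCheck (a q M : ℤ) (K n : ℕ) (l : List ℤ) : Bool :=
  let S := (derivList l).headI
  let d := mulList l.tail l.tail
  let J := integralList 2 d
  decide (0 < q ∧ 0 < K ∧ 0 < M ∧ M ≤ 40 ∧ M ^ 2 * (M * q + a) ≤ K ^ 2 * q ∧
    -a * M ^ 2 ≤ K ^ 2 * q ∧ -(K ^ 2 * q) ≤ M ^ 2 * (M * q + a) ∧ a * M ^ 2 ≤ K ^ 2 * q ∧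
    l.head? = some 0 ∧ 0 < S ∧
    3 ^ K * (M ^ 3 * S + M * absSumList (residualList (a * M ^ 2) (M ^ 3) q l)) * 10 ^ 7 ≤ q * S ∧
    n * 100 * S ^ 2 + S ^ 2 ≤ 10 ^ 5 * M ^ 2 * J ∧
    10 ^ 5 * M ^ 3 * (J + d.length - integralList 3 d) + 2 * M * S ^ 2 + 10 ^ 5 * S ^ 2 <
      (n + 1) * 100 * M * S ^ 2)

lemma edgeProfile_approx {r : ℕ} (hr : 1 ≤ r) {a q M S : ℤ} {K : ℕ} {l : List ℤ}
    (ha : |airyZero r - a / q| ≤ 1 / q) (hq : 0 < q) (hK : 0 < K) (hM : 0 < M)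
    (hb1 : M ^ 2 * (M * q + a) ≤ K ^ 2 * q) (hb2 : -a * M ^ 2 ≤ K ^ 2 * q)
    (hb3 : -(K ^ 2 * q) ≤ M ^ 2 * (M * q + a)) (hb4 : a * M ^ 2 ≤ K ^ 2 * q)
    (hl0 : evalList l 0 = 0) (hS0 : evalList (derivList l) 0 = S) (hS : 0 < S)
    (herr : 3 ^ K * (M ^ 3 * S + M * absSumList (residualList (a * M ^ 2) (M ^ 3) q l)) * 10 ^ 7
      ≤ q * S) :
    ∀ t ∈ Set.Icc (0 : ℝ) 1,
      |edgeProfile r (M * t) - M / S * evalList l t| ≤ 1 / 10 ^ 7 * t := by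
  have hqr : (0 : ℝ) < q := by exact_mod_cast hq
  have hMr : (0 : ℝ) < M := by exact_mod_cast hM
  have hKr : (0 : ℝ) < K := by exact_mod_cast hK
  have hK1 : (1 : ℝ) ≤ K := by exact_mod_cast hK
  have hSr : (0 : ℝ) < S := by exact_mod_cast hS
  obtain ⟨R, hR⟩ : ∃ R, R = residualList (a * M ^ 2) (M ^ 3) q l := ⟨_, rfl⟩
  rw [← hR] at herr
  obtain ⟨α, hα⟩ : ∃ α : ℝ, α = ((a * M ^ 2 : ℤ) : ℝ) / q := ⟨_, rfl⟩
  obtain ⟨ρ, hρ⟩ : ∃ ρ : ℝ, ρ = ((absSumList R : ℤ) : ℝ) := ⟨_, rfl⟩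
  have hα' : α = a / q * (M : ℝ) ^ 2 := by rw [hα]; push_cast; ring
  have hβ' : ((M ^ 3 : ℤ) : ℝ) = (M : ℝ) ^ 3 := by push_cast; rfl
  have hQ : ∀ t ∈ Set.Icc (0 : ℝ) 1, |(M : ℝ) ^ 3 * t + α| ≤ (K : ℝ) ^ 2 := by
    intro t ht
    have e1 : (M : ℝ) ^ 2 * (M * q + a) ≤ (K : ℝ) ^ 2 * q := by exact_mod_cast hb1
    have e2 : -(a : ℝ) * M ^ 2 ≤ (K : ℝ) ^ 2 * q := by exact_mod_cast hb2
    have e3 : -((K : ℝ) ^ 2 * q) ≤ (M : ℝ) ^ 2 * (M * q + a) := by exact_mod_cast hb3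
    have e4 : (a : ℝ) * M ^ 2 ≤ (K : ℝ) ^ 2 * q := by exact_mod_cast hb4
    have f1 : α * q = a * M ^ 2 := by rw [hα']; field_simp
    refine abs_affine_le ht ?_ ?_ <;> rw [abs_le] <;> constructor <;>
      refine le_of_mul_le_mul_right ?_ hqr <;> linarith
  have hlin : ∀ t : ℝ, HasDerivAt (fun t : ℝ => (M : ℝ) * t) M t := fun t => by
    simpa using (hasDerivAt_id t).const_mul (M : ℝ)
  have hyd : ∀ t, HasDerivAt (fun t => edgeProfile r (M * t))
      (M * edgeProfileDeriv r (M * t)) t := fun t =>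
    ((hasDerivAt_edgeProfile r _).comp t (hlin t)).congr_deriv (by ring)
  have hyd' : ∀ t, HasDerivAt (fun t => M * edgeProfileDeriv r (M * t))
      (((M : ℝ) ^ 3 * t + airyZero r * M ^ 2) * edgeProfile r (M * t)) t := fun t =>
    (((hasDerivAt_edgeProfileDeriv r _).comp t (hlin t)).const_mul (M : ℝ)).congr_deriv (by ring)
  obtain ⟨e, he⟩ : ∃ e : ℝ → ℝ, e = fun t => edgeProfile r (M * t) - M / S * evalList l t :=
    ⟨_, rfl⟩
  obtain ⟨e', he'⟩ : ∃ e' : ℝ → ℝ, e' = fun t =>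
    M * edgeProfileDeriv r (M * t) - M / S * evalList (derivList l) t := ⟨_, rfl⟩
  obtain ⟨f, hf⟩ : ∃ f : ℝ → ℝ, f = fun t =>
    (airyZero r * M ^ 2 - α) * edgeProfile r (M * t) - M / S * (evalList R t / q) := ⟨_, rfl⟩
  have hed : ∀ t, HasDerivAt e (e' t) t := fun t => by
    rw [he, he']; exact (hyd t).sub ((hasDerivAt_evalList l t).const_mul _)
  have hed' : ∀ t, HasDerivAt e' (((M : ℝ) ^ 3 * t + α) * e t + f t) t := fun t => by
    rw [he']
    refine ((hyd' t).sub ((hasDerivAt_evalList (derivList l) t).const_mul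
      ((M : ℝ) / S))).congr_deriv ?_
    rw [evalList_residualList hq (α := a * M ^ 2) (β := M ^ 3), ← hR, ← hα, hβ', he, hf]
    ring
  obtain ⟨ε, hε⟩ : ∃ ε : ℝ, ε = M ^ 3 / q + M / S * (ρ / q) := ⟨_, rfl⟩
  have hρ0 : 0 ≤ ρ := hρ ▸ (abs_nonneg _).trans (abs_evalList_le R ⟨le_rfl, zero_le_one⟩)
  have hε0 : 0 ≤ ε := by rw [hε]; positivity
  have hfb : ∀ t ∈ Set.Icc (0 : ℝ) 1, |f t| ≤ ε := by
    intro t ht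
    have h1 : |(airyZero r * M ^ 2 - α) * edgeProfile r (M * t)| ≤ M ^ 3 / q := by
      rw [abs_mul, hα', ← sub_mul, abs_mul, abs_of_pos (pow_pos hMr 2)]
      have h2 : |edgeProfile r (M * t)| ≤ M :=
        (abs_edgeProfile_le hr (mul_nonneg hMr.le ht.1)).trans (mul_le_of_le_one_right hMr.le ht.2)
      calc |airyZero r - a / q| * M ^ 2 * |edgeProfile r (M * t)| ≤ 1 / q * M ^ 2 * M := by gcongr
        _ = _ := by ring
    have h2 : |M / S * (evalList R t / q)| ≤ M / S * (ρ / q) := by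
      rw [abs_mul, abs_div, abs_div, abs_of_pos hMr, abs_of_pos hSr, abs_of_pos hqr, hρ]
      have := abs_evalList_le R ht
      gcongr
    rw [hf, hε]
    exact (abs_sub _ _).trans (add_le_add h1 h2)
  have hη7 : 3 ^ K * ε ≤ 1 / 10 ^ 7 := by
    have h1 : (3 : ℝ) ^ K * (M ^ 3 * S + M * ρ) * 10 ^ 7 ≤ q * S := by
      rw [hρ]; exact_mod_cast herr
    have h2 : 3 ^ K * ε = 3 ^ K * (M ^ 3 * S + M * ρ) / (q * S) := by
      rw [hε]; field_simp
    rw [h2, div_le_div_iff₀ (by positivity) (by positivity), one_mul]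
    exact h1
  have e0 : e 0 = 0 := by simp [he, hl0, edgeProfile_zero hr]
  have e0' : e' 0 = 0 := by
    simp only [he', mul_zero, edgeProfileDeriv_zero hr, hS0]
    rw [div_mul_cancel₀ _ hSr.ne']; simp
  have heb' : ∀ t ∈ Set.Icc (0 : ℝ) 1, |e' t| ≤ 1 / 10 ^ 7 := by
    intro t ht
    have hg := (sl_gronwall (Q := fun t => (M : ℝ) ^ 3 * t + α) (f := f) (e := e) (e' := e')
      (w := K) (ε := ε) (δ := 0) hKr hε0 (fun t _ => hed t) (fun t _ => hed' t) hQ hfb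
      (by simp [e0]) (by simp [e0']) ht).2
    refine hg.trans (le_trans ?_ hη7)
    rw [gronwallBound_of_K_ne_0 hKr.ne']
    simp only [zero_mul, zero_add]
    have h1 : Real.exp (K * t) ≤ 3 ^ K :=
      le_trans (Real.exp_le_exp.2 (mul_le_of_le_one_right hKr.le ht.2)) (exp_natCast_le_three_pow K)
    have h2 : 1 ≤ Real.exp (K * t) := Real.one_le_exp (mul_nonneg hKr.le ht.1)
    have h3 : ε / K ≤ ε := div_le_self hε0 hK1
    calc ε / K * (Real.exp (K * t) - 1) ≤ ε * 3 ^ K :=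
          mul_le_mul h3 (by linarith) (by linarith) hε0
      _ = _ := mul_comm _ _
  intro t ht
  have h := norm_image_sub_le_of_norm_deriv_le_segment' (f := e) (a := 0) (b := 1) (C := 1 / 10 ^ 7)
    (fun t _ => (hed t).hasDerivWithinAt) (fun t ht => heb' t (Set.Ico_subset_Icc_self ht)) t ht
  rw [e0, sub_zero, sub_zero, Real.norm_eq_abs, he] at h
  exact h

lemma edgeProfile_sq_approx {r : ℕ} (hr : 1 ≤ r) {M B : ℝ} (hM : 0 < M) (hM40 : M ≤ 40)
    {p : ℝ → ℝ} (h : ∀ t ∈ Set.Icc (0 : ℝ) 1, |edgeProfile r (M * t) - B * p t| ≤ 1 / 10 ^ 7 * t) :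
    ∀ t ∈ Set.Icc (0 : ℝ) 1,
      |edgeProfile r (M * t) ^ 2 - B ^ 2 * p t ^ 2| ≤ 1 / 10 ^ 5 * t := by
  intro t ht
  have h1 := h t ht
  have h3 := abs_edgeProfile_le hr (mul_nonneg hM.le ht.1)
  have h4 : |edgeProfile r (M * t) + B * p t| ≤ 81 := by
    have h5 : edgeProfile r (M * t) + B * p t =
      2 * edgeProfile r (M * t) - (edgeProfile r (M * t) - B * p t) := by ring
    rw [h5]
    refine (abs_sub _ _).trans ?_
    rw [abs_mul, abs_two]
    have : M * t ≤ 40 := (mul_le_of_le_one_right hM.le ht.2).trans hM40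
    linarith [ht.2]
  rw [← mul_pow, sq_sub_sq, abs_mul, mul_comm]
  calc |edgeProfile r (M * t) - B * p t| * |edgeProfile r (M * t) + B * p t|
      ≤ (1 / 10 ^ 7 * t) * 81 := mul_le_mul h1 h4 (abs_nonneg _) (by have := ht.1; positivity)
    _ ≤ 1 / 10 ^ 5 * t := by linarith [ht.1]

lemma edgeVariance_mem_of_approx {r : ℕ} (hr : 1 ≤ r) {M A : ℝ} (hM : 0 < M) {g : ℝ → ℝ}
    (hg : Continuous g) (hcmp : ∀ t ∈ Set.Icc (0 : ℝ) 1,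
      |edgeProfile r (M * t) ^ 2 - A * (t ^ 2 * g t)| ≤ 1 / 10 ^ 5 * t) :
    A * (∫ t in (0 : ℝ)..1, t ^ 1 * g t) - 1 / 10 ^ 5 ≤ edgeVariance r ∧
    edgeVariance r ≤ A * (∫ t in (0 : ℝ)..1, t ^ 1 * g t) -
      A * (∫ t in (0 : ℝ)..1, t ^ 2 * g t) + 1 / M + 2 / 10 ^ 5 := by
  have hI1 : ∫ x in Set.Ioc 0 M, edgeIntegrand r x =
      ∫ t in (0 : ℝ)..1, edgeProfile r (M * t) ^ 2 / t := by
    rw [← intervalIntegral.integral_of_le hM.le]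
    have := intervalIntegral.smul_integral_comp_mul_left (a := 0) (b := 1) (edgeIntegrand r) M
    rw [mul_zero, mul_one] at this
    rw [← this, smul_eq_mul, ← intervalIntegral.integral_const_mul]
    refine intervalIntegral.integral_congr fun t _ => ?_
    simp only [edgeIntegrand_eq]
    rw [mul_div_assoc', mul_div_mul_left _ _ hM.ne']
  have hI0 : ∫ x in Set.Ioc 0 M, edgeProfile r x ^ 2 =
      M * ∫ t in (0 : ℝ)..1, edgeProfile r (M * t) ^ 2 := by
    rw [← intervalIntegral.integral_of_le hM.le]
    have := intervalIntegral.smul_integral_comp_mul_left (a := 0) (b := 1)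
      (fun x => edgeProfile r x ^ 2) M
    rw [mul_zero, mul_one] at this
    rw [← this, smul_eq_mul]
  have hcy : Continuous fun t => edgeProfile r (M * t) :=
    (continuous_edgeProfile r).comp (continuous_const.mul continuous_id)
  have hint1 : IntervalIntegrable (fun t => edgeProfile r (M * t) ^ 2 / t) volume 0 1 := by
    rw [intervalIntegrable_iff_integrableOn_Ioc_of_le zero_le_one]
    refine Integrable.mono' (g := fun _ => M ^ 2) (by simp)
      ((hcy.measurable.pow_const 2).div measurable_id).aestronglyMeasurable ?_
    refine (ae_restrict_iff' measurableSet_Ioc).2 (Eventually.of_forall fun t ht => ?_)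
    have h1 := abs_edgeProfile_le hr (mul_nonneg hM.le ht.1.le)
    rw [Real.norm_of_nonneg (div_nonneg (sq_nonneg _) ht.1.le), div_le_iff₀ ht.1, ← sq_abs]
    have h2 : t * t ≤ t := mul_le_of_le_one_right ht.1.le ht.2
    calc |edgeProfile r (M * t)| ^ 2 ≤ (M * t) ^ 2 := by gcongr
      _ = M ^ 2 * (t * t) := by ring
      _ ≤ M ^ 2 * t := by gcongr
  have hint2 : IntervalIntegrable (fun t => A * (t ^ 1 * g t)) volume 0 1 :=
    Continuous.intervalIntegrable (by fun_prop) _ _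
  have hint3 : IntervalIntegrable (fun t => A * (t ^ 2 * g t)) volume 0 1 :=
    Continuous.intervalIntegrable (by fun_prop) _ _
  have hint4 : IntervalIntegrable (fun t => edgeProfile r (M * t) ^ 2) volume 0 1 :=
    Continuous.intervalIntegrable (by fun_prop) _ _
  have hD1 : |(∫ t in (0 : ℝ)..1, edgeProfile r (M * t) ^ 2 / t) -
      A * ∫ t in (0 : ℝ)..1, t ^ 1 * g t| ≤ 1 / 10 ^ 5 := by
    rw [← intervalIntegral.integral_const_mul, ← intervalIntegral.integral_sub hint1 hint2]
    have := intervalIntegral.norm_integral_le_of_norm_le_const (a := 0) (b := 1)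
      (f := fun t => edgeProfile r (M * t) ^ 2 / t - A * (t ^ 1 * g t)) (C := 1 / 10 ^ 5)
      (fun t ht => by
        rw [Set.uIoc_of_le zero_le_one] at ht
        have h2 : edgeProfile r (M * t) ^ 2 / t - A * (t ^ 1 * g t) =
            (edgeProfile r (M * t) ^ 2 - A * (t ^ 2 * g t)) / t := by
          have := ht.1.ne'
          field_simp
        rw [h2, Real.norm_eq_abs, abs_div, abs_of_pos ht.1, div_le_iff₀ ht.1]
        exact hcmp t ⟨ht.1.le, ht.2⟩)
    simpa using this
  have hD0 : |(∫ t in (0 : ℝ)..1, edgeProfile r (M * t) ^ 2) -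
      A * ∫ t in (0 : ℝ)..1, t ^ 2 * g t| ≤ 1 / 10 ^ 5 := by
    rw [← intervalIntegral.integral_const_mul, ← intervalIntegral.integral_sub hint4 hint3]
    have := intervalIntegral.norm_integral_le_of_norm_le_const (a := 0) (b := 1)
      (f := fun t => edgeProfile r (M * t) ^ 2 - A * (t ^ 2 * g t)) (C := 1 / 10 ^ 5)
      (fun t ht => by
        rw [Set.uIoc_of_le zero_le_one] at ht
        refine (hcmp t ⟨ht.1.le, ht.2⟩).trans ?_
        have := ht.2
        linarith)
    simpa using this
  have hub := edgeVariance_le_add hr hM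
  have hlb := setIntegral_Ioc_le_edgeVariance hr M
  rw [hI1] at hub hlb
  rw [hI0] at hub
  have h1 : (1 - M * ∫ t in (0 : ℝ)..1, edgeProfile r (M * t) ^ 2) / M =
      1 / M - ∫ t in (0 : ℝ)..1, edgeProfile r (M * t) ^ 2 := by
    field_simp
  rw [h1] at hub
  rw [abs_le] at hD1 hD0
  constructor <;> linarith [hD1.1, hD1.2, hD0.1]

lemma edgeVariance_mem_of_check {r : ℕ} (hr : 1 ≤ r) {a q M : ℤ} {K n : ℕ} {l : List ℤ}
    (ha : |airyZero r - a / q| ≤ 1 / q) (h : edgeVarianceCheck a q M K n l = true) :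
    edgeVariance r ∈ Set.Ico (n / 1000 : ℝ) ((n + 1) / 1000) := by
  simp only [edgeVarianceCheck, decide_eq_true_eq] at h
  obtain ⟨hq, hK, hM0, hM40, hb1, hb2, hb3, hb4, hl0, hS, herr, hlo, hhi⟩ := h
  have hMr : (0 : ℝ) < M := by exact_mod_cast hM0
  have hp0 : evalList l 0 = 0 := by
    rw [evalList_zero]
    cases l with
    | nil => simp at hl0
    | cons c l => simpa using hl0
  have hpg : ∀ t, evalList l t = t * evalList l.tail t := by
    intro t
    cases l with
    | nil => simp at hl0
    | cons c l =>
      have : c = 0 := by simpa using hl0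
      simp [evalList, this]
  have happ := edgeProfile_sq_approx hr hMr (by exact_mod_cast hM40)
    (edgeProfile_approx hr ha hq hK hM0 hb1 hb2 hb3 hb4 hp0 (evalList_zero _) hS herr)
  obtain ⟨d, hd⟩ : ∃ d, d = mulList l.tail l.tail := ⟨_, rfl⟩
  obtain ⟨S, hSd⟩ : ∃ S, S = (derivList l).headI := ⟨_, rfl⟩
  rw [← hSd] at hS happ hlo hhi
  rw [← hd] at hlo hhi
  have hSr : (0 : ℝ) < S := by exact_mod_cast hS
  obtain ⟨hlb, hub⟩ := edgeVariance_mem_of_approx hr hMr (A := (M / S : ℝ) ^ 2)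
    (continuous_evalList d) fun t ht => by
      have h1 := happ t ht
      rwa [hpg, show (t * evalList l.tail t) ^ 2 = t ^ 2 * evalList d t by
        rw [hd, evalList_mulList]; ring] at h1
  have hJ1 := (integralList_le d 1)
  have hJ0 := (integralList_le d 2).1
  have c1 : (n : ℝ) * 100 * S ^ 2 + S ^ 2 ≤ 10 ^ 5 * M ^ 2 * integralList 2 d := by
    exact_mod_cast hlo
  have c2 : (10 : ℝ) ^ 5 * M ^ 3 * (integralList 2 d + d.length - integralList 3 d) +
      2 * M * S ^ 2 + 10 ^ 5 * S ^ 2 < (n + 1) * 100 * M * S ^ 2 := by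
    exact_mod_cast hhi
  generalize (∫ t in (0 : ℝ)..1, t ^ 1 * evalList d t) = G1 at *
  generalize (∫ t in (0 : ℝ)..1, t ^ 2 * evalList d t) = G0 at *
  have hS2 : (0 : ℝ) < S ^ 2 := by positivity
  rw [div_pow] at hlb hub
  constructor
  · have h1 : (n : ℝ) / 1000 + 1 / 10 ^ 5 ≤ M ^ 2 / S ^ 2 * G1 := by
      have h2 : (n : ℝ) / 1000 + 1 / 10 ^ 5 = (n * 100 * S ^ 2 + S ^ 2) / (10 ^ 5 * S ^ 2) := by
        field_simp; ring
      rw [h2, div_le_iff₀ (by positivity)]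
      have h3 : M ^ 2 / S ^ 2 * G1 * (10 ^ 5 * S ^ 2) = 10 ^ 5 * M ^ 2 * G1 := by
        field_simp
      rw [h3]
      refine c1.trans ?_
      have := hJ1.1
      gcongr
    linarith
  · refine hub.trans_lt ?_
    have h3 : M ^ 2 / S ^ 2 * G1 - M ^ 2 / S ^ 2 * G0 + 1 / M + 2 / 10 ^ 5 =
        (10 ^ 5 * M ^ 3 * (G1 - G0) + 2 * M * S ^ 2 + 10 ^ 5 * S ^ 2) / (10 ^ 5 * M * S ^ 2) := by
      field_simp; ring
    rw [h3, div_lt_iff₀ (by positivity)]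
    have h4 : ((n : ℝ) + 1) / 1000 * (10 ^ 5 * M * S ^ 2) = (n + 1) * 100 * M * S ^ 2 := by ring
    rw [h4]
    refine lt_of_le_of_lt ?_ c2
    have h5 : G1 - G0 ≤ integralList 2 d + d.length - integralList 3 d := by
      have h6 : G1 ≤ integralList 2 d + d.length := hJ1.2
      have h7 : integralList 3 d ≤ G0 := hJ0
      linarith
    gcongr

set_option maxRecDepth 10000 in
lemma edgeVariance_one_mem : edgeVariance 1 ∈ Set.Ico (0.834 : ℝ) 0.835 := by
  have h := edgeVariance_mem_of_check (r := 1) le_rfl (a := -23381074104597670) (q := 10 ^ 16)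
    (M := 5) (K := 9) (n := 834) (l := airyTaylor (-23381074104597670) (10 ^ 16) 5 (10 ^ 18) 66)
    (by obtain ⟨h1, h2⟩ := airyZero_one_mem
        push_cast
        rw [abs_le]; constructor <;> linarith) (by decide +kernel)
  norm_num at h ⊢
  exact h

set_option maxRecDepth 10000 in
lemma edgeVariance_two_mem : edgeVariance 2 ∈ Set.Ico (0.582 : ℝ) 0.583 := by
  have h := edgeVariance_mem_of_check (r := 2) (by norm_num) (a := -4087949444130970616)
    (q := 10 ^ 18) (M := 6) (K := 13) (n := 582)
    (l := airyTaylor (-4087949444130970616) (10 ^ 18) 6 (10 ^ 22) 86)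
    (by obtain ⟨h1, h2⟩ := airyZero_two_mem
        push_cast
        rw [abs_le]; constructor <;> linarith) (by decide +kernel)
  norm_num at h ⊢
  exact h

set_option maxRecDepth 10000 in
lemma edgeVariance_three_mem : edgeVariance 3 ∈ Set.Ico (0.472 : ℝ) 0.473 := by
  have h := edgeVariance_mem_of_check (r := 3) (by norm_num) (a := -552055982809555105912)
    (q := 10 ^ 20) (M := 8) (K := 19) (n := 472)
    (l := airyTaylor (-552055982809555105912) (10 ^ 20) 8 (10 ^ 24) 122)
    (by obtain ⟨h1, h2⟩ := airyZero_three_mem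
        push_cast
        rw [abs_le]; constructor <;> linarith) (by decide +kernel)
  norm_num at h ⊢
  exact h

set_option maxRecDepth 10000 in
lemma edgeVariance_four_mem : edgeVariance 4 ∈ Set.Ico (0.407 : ℝ) 0.408 := by
  have h := edgeVariance_mem_of_check (r := 4) (by norm_num) (a := -67867080900717589987802)
    (q := 10 ^ 22) (M := 9) (K := 24) (n := 407)
    (l := airyTaylor (-67867080900717589987802) (10 ^ 22) 9 (10 ^ 26) 146)
    (by obtain ⟨h1, h2⟩ := airyZero_four_mem
        push_cast
        rw [abs_le]; constructor <;> linarith) (by decide +kernel)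
  norm_num at h ⊢
  exact h

/-! ### Hermite polynomials -/

open Polynomial in
lemma hermiteH_add_two (n : ℕ) :
    hermiteH (n + 2) = 2 * X * hermiteH (n + 1) - C (2 * ((n : ℝ) + 1)) * hermiteH n := by
  rw [hermiteH]

open Polynomial in
lemma derivative_hermiteH_succ (n : ℕ) :
    derivative (hermiteH (n + 1)) = C (2 * ((n : ℝ) + 1)) * hermiteH n := by
  have two : (2 : ℝ[X]) = C 2 := rfl
  induction n using Nat.strong_induction_on with
  | _ n ih =>
    match n with
    | 0 => simp [hermiteH, two]
    | 1 =>
      simp only [hermiteH, two, derivative_sub, derivative_mul, derivative_C, derivative_X]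
      simp only [← two]
      push_cast
      simp only [map_mul, map_add, map_one, map_zero, map_ofNat, derivative_one]
      ring
    | m + 2 =>
      have h1 := ih (m + 1) (by omega)
      have h0 := ih m (by omega)
      rw [hermiteH_add_two (m + 1), derivative_sub, derivative_mul, derivative_mul, derivative_mul,
        h1, h0, hermiteH_add_two m]
      simp only [two, derivative_C, derivative_X]
      simp only [← two]
      push_cast
      simp only [map_mul, map_add, map_one, map_ofNat]
      ring

open Polynomial in
lemma hermiteH_succ (n : ℕ) : hermiteH (n + 1) = 2 * X * hermiteH n - derivative (hermiteH n) := by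
  cases n with
  | zero => simp [hermiteH]
  | succ n => rw [derivative_hermiteH_succ, hermiteH_add_two]

lemma eval_hermiteH_add_two (n : ℕ) (x : ℝ) : (hermiteH (n + 2)).eval x =
    2 * x * (hermiteH (n + 1)).eval x - 2 * ((n : ℝ) + 1) * (hermiteH n).eval x := by
  rw [hermiteH_add_two]; simp

lemma eval_hermiteH_zero (x : ℝ) : (hermiteH 0).eval x = 1 := by simp [hermiteH]

lemma eval_hermiteH_one (x : ℝ) : (hermiteH 1).eval x = 2 * x := by simp [hermiteH]

lemma hermiteH_natDegree_le_and_coeff (n : ℕ) :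
    (hermiteH n).natDegree ≤ n ∧ (hermiteH n).coeff n = 2 ^ n := by
  induction n with
  | zero => simp [hermiteH]
  | succ n ih =>
    rw [hermiteH_succ]
    have h2 : (2 : Polynomial ℝ) = Polynomial.C 2 := rfl
    constructor
    · refine (Polynomial.natDegree_sub_le _ _).trans (max_le ?_ ?_)
      · rw [mul_assoc, h2]
        refine (Polynomial.natDegree_C_mul_le _ _).trans ?_
        refine Polynomial.natDegree_mul_le.trans ?_
        rw [Polynomial.natDegree_X]; omega
      · exact (Polynomial.natDegree_derivative_le _).trans (by omega)
    · rw [Polynomial.coeff_sub, mul_assoc, h2, Polynomial.coeff_C_mul, Polynomial.coeff_X_mul,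
        ih.2, Polynomial.coeff_derivative,
        Polynomial.coeff_eq_zero_of_natDegree_lt (lt_of_le_of_lt ih.1 (by omega))]
      ring

lemma hermiteH_coeff_self (n : ℕ) : (hermiteH n).coeff n = 2 ^ n :=
  (hermiteH_natDegree_le_and_coeff n).2

lemma hermiteH_natDegree (n : ℕ) : (hermiteH n).natDegree = n :=
  Polynomial.natDegree_eq_of_le_of_coeff_ne_zero (hermiteH_natDegree_le_and_coeff n).1
    (by rw [hermiteH_coeff_self]; positivity)

lemma hermiteH_ne_zero (n : ℕ) : hermiteH n ≠ 0 := fun h => by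
  have := hermiteH_coeff_self n
  rw [h, Polynomial.coeff_zero] at this
  exact (pow_pos two_pos n).ne this

/-- The Hermite function `exp (-x ^ 2 / 2) * H n x`. -/
def hermiteFun (n : ℕ) (x : ℝ) : ℝ := Real.exp (-x ^ 2 / 2) * (hermiteH n).eval x

/-- The derivative of `hermiteFun`. -/
def hermiteFunDeriv (n : ℕ) (x : ℝ) : ℝ :=
  Real.exp (-x ^ 2 / 2) * (x * (hermiteH n).eval x - (hermiteH (n + 1)).eval x)

lemma hasDerivAt_exp_neg_sq_half (x : ℝ) :
    HasDerivAt (fun x : ℝ => Real.exp (-x ^ 2 / 2)) (Real.exp (-x ^ 2 / 2) * -x) x := by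
  have : HasDerivAt (fun x : ℝ => -x ^ 2 / 2) (-x) x :=
    (((hasDerivAt_pow 2 x).neg).div_const 2).congr_deriv (by simp; ring)
  exact this.exp

lemma isSturmSolution_hermiteFun (n : ℕ) (s : Set ℝ) :
    IsSturmSolution (fun x => x ^ 2 - (2 * n + 1)) (hermiteFun n) (hermiteFunDeriv n) s := by
  intro x _
  have h0 : (hermiteH n).derivative.eval x =
      2 * x * (hermiteH n).eval x - (hermiteH (n + 1)).eval x := by
    rw [hermiteH_succ]; simp
  have h1 : (hermiteH (n + 1)).derivative.eval x = 2 * ((n : ℝ) + 1) * (hermiteH n).eval x := by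
    rw [derivative_hermiteH_succ]; simp
  have hd := (hermiteH n).hasDerivAt x
  have hd1 := (hermiteH (n + 1)).hasDerivAt x
  rw [h0] at hd
  rw [h1] at hd1
  have he := hasDerivAt_exp_neg_sq_half x
  exact ⟨(he.mul hd).congr_deriv (by rw [hermiteFunDeriv]; ring),
    (he.mul (((hasDerivAt_id x).mul hd).sub hd1)).congr_deriv (by
      simp only [hermiteFun, id, Pi.sub_apply, Pi.mul_apply]; ring)⟩

lemma hermiteFun_eq_zero_iff {n : ℕ} {x : ℝ} : hermiteFun n x = 0 ↔ (hermiteH n).eval x = 0 := by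
  simp [hermiteFun, (Real.exp_pos _).ne']

lemma hermiteFunDeriv_ne_zero {n : ℕ} {x : ℝ} (hx : hermiteFun n x = 0) :
    hermiteFunDeriv n x ≠ 0 := fun h => by
  have h0 := (isSturmSolution_hermiteFun n Set.univ).eq_zero (by fun_prop) hx h
  refine hermiteH_ne_zero n (Polynomial.funext fun x => ?_)
  rw [Polynomial.eval_zero]
  exact hermiteFun_eq_zero_iff.1 (h0 x)

lemma tendsto_polynomial_mul_exp_neg_sq (p : Polynomial ℝ) :
    Tendsto (fun x => p.eval x * Real.exp (-x ^ 2 / 2)) atTop (𝓝 0) := by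
  refine squeeze_zero_norm' ?_ (tendsto_norm_zero.comp p.tendsto_div_exp_atTop)
  filter_upwards [eventually_ge_atTop 2] with x hx
  simp only [Function.comp, norm_mul, div_eq_mul_inv, ← Real.exp_neg, Real.norm_eq_abs,
    Real.abs_exp]
  gcongr
  nlinarith

lemma tendsto_hermiteFun (n : ℕ) : Tendsto (hermiteFun n) atTop (𝓝 0) :=
  (tendsto_polynomial_mul_exp_neg_sq (hermiteH n)).congr fun x => by rw [hermiteFun, mul_comm]

lemma tendsto_hermiteFunDeriv (n : ℕ) : Tendsto (hermiteFunDeriv n) atTop (𝓝 0) :=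
  (tendsto_polynomial_mul_exp_neg_sq
    (Polynomial.X * hermiteH n - hermiteH (n + 1))).congr fun x => by
      rw [hermiteFunDeriv]; simp [mul_comm]

open Polynomial in
lemma roots_card_eq_of_le {p : ℝ[X]} (h : p.natDegree ≤ p.roots.card + 1) :
    p.roots.card = p.natDegree := by
  obtain ⟨q, hq, hdeg, hroots⟩ := exists_prod_multiset_X_sub_C_mul p
  by_contra hne
  have hq1 : q.natDegree = 1 := by have := p.card_roots'; omega
  have hq0 : q ≠ 0 := by rintro rfl; simp at hq1
  obtain ⟨x, hx⟩ := exists_root_of_degree_eq_one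
    ((degree_eq_iff_natDegree_eq_of_pos one_pos).2 hq1)
  have : x ∈ q.roots := (mem_roots hq0).2 hx
  rw [hroots] at this
  simp at this

lemma hermiteH_roots_nodup (n : ℕ) : (hermiteH n).roots.Nodup := by
  rw [Multiset.nodup_iff_count_le_one]
  intro x
  rw [Polynomial.count_roots]
  by_contra! h
  obtain ⟨h0, h1⟩ := (Polynomial.one_lt_rootMultiplicity_iff_isRoot (hermiteH_ne_zero n)).1 h
  refine hermiteFunDeriv_ne_zero (hermiteFun_eq_zero_iff.2 h0) ?_
  have h2 : (hermiteH n).derivative.eval x = 0 := h1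
  have h3 : (hermiteH n).eval x = 0 := h0
  rw [hermiteFunDeriv, hermiteH_succ]
  simp [h2, h3]

lemma mem_hermiteH_roots_toFinset {n : ℕ} {x : ℝ} :
    x ∈ (hermiteH n).roots.toFinset ↔ (hermiteH n).eval x = 0 := by
  rw [Multiset.mem_toFinset, Polynomial.mem_roots (hermiteH_ne_zero n), Polynomial.IsRoot.def]

lemma hermiteFun_zeros_eq (n : ℕ) (c : ℝ) : {y | hermiteFun n y = 0 ∧ c ≤ y} =
    ((hermiteH n).roots.toFinset.filter (c ≤ ·) : Finset ℝ) := by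
  ext y
  simp only [Set.mem_ofPred_eq, hermiteFun_eq_zero_iff, Finset.coe_filter,
    mem_hermiteH_roots_toFinset]

lemma finite_hermiteFun_zeros (n : ℕ) (c : ℝ) : {y | hermiteFun n y = 0 ∧ c ≤ y}.Finite := by
  rw [hermiteFun_zeros_eq]; exact Finset.finite_toSet _

lemma hermiteH_card_roots (n : ℕ) : (hermiteH n).roots.card = n := by
  induction n with
  | zero => simp [hermiteH]
  | succ n ih =>
    obtain ⟨c, hc⟩ := (hermiteH n).roots.toFinset.bddBelow
    obtain ⟨Z, hZ, hZ0⟩ := sturm_card_zeros (c := c) (isSturmSolution_hermiteFun n _)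
      (isSturmSolution_hermiteFun (n + 1) _) (fun x _ => by push_cast; linarith)
      (fun x _ hx => hermiteFunDeriv_ne_zero hx)
      (by
        simpa using ((tendsto_hermiteFunDeriv n).mul (tendsto_hermiteFun (n + 1))).sub
          ((tendsto_hermiteFun n).mul (tendsto_hermiteFunDeriv (n + 1))))
      (finite_hermiteFun_zeros n c)
    rw [hermiteFun_zeros_eq, Set.ncard_coe_finset, Finset.filter_true_of_mem (fun x hx => hc hx),
      Multiset.toFinset_card_of_nodup (hermiteH_roots_nodup n), ih] at hZ
    have h1 : Z ⊆ (hermiteH (n + 1)).roots.toFinset := fun x hx =>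
      mem_hermiteH_roots_toFinset.2 (hermiteFun_eq_zero_iff.1 (hZ0 x hx).1)
    have h2 := (Finset.card_le_card h1).trans (Multiset.toFinset_card_le _)
    rw [roots_card_eq_of_le (by rw [hermiteH_natDegree]; omega), hermiteH_natDegree]

lemma hermiteH_card_roots_toFinset (n : ℕ) : (hermiteH n).roots.toFinset.card = n := by
  rw [Multiset.toFinset_card_of_nodup (hermiteH_roots_nodup n), hermiteH_card_roots]

/-- The zeros of the `N`-th Hermite polynomial in increasing order. -/
def hermiteRoot (N : ℕ) : Fin N → ℝ :=
  (hermiteH N).roots.toFinset.orderEmbOfFin (hermiteH_card_roots_toFinset N)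

lemma hermiteRoot_strictMono (N : ℕ) : StrictMono (hermiteRoot N) :=
  ((hermiteH N).roots.toFinset.orderEmbOfFin (hermiteH_card_roots_toFinset N)).strictMono

lemma eval_hermiteH_eq_zero_iff {N : ℕ} {x : ℝ} :
    (hermiteH N).eval x = 0 ↔ ∃ i, hermiteRoot N i = x := by
  rw [← mem_hermiteH_roots_toFinset, ← Set.mem_range, hermiteRoot, Finset.range_orderEmbOfFin,
    Finset.mem_coe]

lemma eval_hermiteRoot (N : ℕ) (i : Fin N) : (hermiteH N).eval (hermiteRoot N i) = 0 :=
  eval_hermiteH_eq_zero_iff.2 ⟨i, rfl⟩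

lemma hermiteZero_eq {N r : ℕ} (hr : 1 ≤ r) (hN : r ≤ N) :
    hermiteZero N r = hermiteRoot N ⟨N - r, by omega⟩ := by
  refine rthLargestZero_eq hr (eval_hermiteRoot N _) ?_
  have : {y | (hermiteH N).eval y = 0 ∧ hermiteRoot N ⟨N - r, by omega⟩ ≤ y} =
      hermiteRoot N '' (Finset.Ici (⟨N - r, by omega⟩ : Fin N) : Finset (Fin N)) := by
    ext y
    simp only [Set.mem_ofPred_eq, eval_hermiteH_eq_zero_iff, Set.mem_image, Finset.coe_Ici,
      Set.mem_Ici]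
    constructor
    · rintro ⟨⟨i, rfl⟩, h⟩
      exact ⟨i, (hermiteRoot_strictMono N).le_iff_le.1 h, rfl⟩
    · rintro ⟨i, h, rfl⟩
      exact ⟨⟨i, rfl⟩, (hermiteRoot_strictMono N).le_iff_le.2 h⟩
  rw [this, Set.ncard_image_of_injective _ (hermiteRoot_strictMono N).injective,
    Set.ncard_coe_finset, Fin.card_Ici]
  simp only
  omega

open Polynomial in
lemma prod_X_sub_hermiteRoot (N : ℕ) :
    C ((2 : ℝ) ^ N) * ∏ i, (X - C (hermiteRoot N i)) = hermiteH N := by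
  have h := C_leadingCoeff_mul_prod_multiset_X_sub_C (p := hermiteH N)
    (by rw [hermiteH_card_roots, hermiteH_natDegree])
  have h2 : (Multiset.map (fun a => X - C a) (hermiteH N).roots).prod =
      ∏ i, (X - C (hermiteRoot N i)) := by
    have h3 : (hermiteH N).roots.toFinset = Finset.univ.image (hermiteRoot N) := by
      ext x; simp [mem_hermiteH_roots_toFinset, eval_hermiteH_eq_zero_iff,
        -Multiset.mem_toFinset]
    rw [← Finset.prod_image (g := hermiteRoot N) (f := fun a => X - C a)
      (fun a _ b _ hab => (hermiteRoot_strictMono N).injective hab), ← h3,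
      Finset.prod_multiset_map_count, ]
    refine Finset.prod_congr rfl fun x hx => ?_
    rw [Multiset.count_eq_one_of_mem (hermiteH_roots_nodup N) (Multiset.mem_toFinset.1 hx), pow_one]
  rwa [h2, leadingCoeff, hermiteH_natDegree, hermiteH_coeff_self] at h

/-- The squared norm of the `n`-th Hermite polynomial (up to the factor `√π`). -/
def hermiteNorm (n : ℕ) : ℝ := 2 ^ n * n.factorial

lemma hermiteNorm_pos (n : ℕ) : 0 < hermiteNorm n := by unfold hermiteNorm; positivity

lemma hermiteNorm_succ (n : ℕ) : hermiteNorm (n + 1) = 2 * (n + 1) * hermiteNorm n := by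
  simp only [hermiteNorm, Nat.factorial_succ]; push_cast; ring

lemma christoffel_darboux (n : ℕ) (x y : ℝ) :
    2 * hermiteNorm n * ((x - y) * ∑ l ∈ Finset.range (n + 1),
      (hermiteH l).eval x * (hermiteH l).eval y / hermiteNorm l) =
    (hermiteH (n + 1)).eval x * (hermiteH n).eval y -
      (hermiteH n).eval x * (hermiteH (n + 1)).eval y := by
  induction n with
  | zero => simp [hermiteNorm, eval_hermiteH_one, eval_hermiteH_zero]; ring
  | succ n ih =>
    rw [Finset.sum_range_succ, mul_add, mul_add, hermiteNorm_succ]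
    have h1 : 2 * (2 * (↑n + 1) * hermiteNorm n) * ((x - y) * ∑ l ∈ Finset.range (n + 1),
        (hermiteH l).eval x * (hermiteH l).eval y / hermiteNorm l) = 2 * (n + 1) *
        (2 * hermiteNorm n * ((x - y) * ∑ l ∈ Finset.range (n + 1),
        (hermiteH l).eval x * (hermiteH l).eval y / hermiteNorm l)) := by ring
    rw [h1, ih, ← hermiteNorm_succ, eval_hermiteH_add_two, eval_hermiteH_add_two]
    have := (hermiteNorm_pos (n + 1)).ne'
    field_simp
    ring

lemma christoffel_darboux_diag (n : ℕ) (x : ℝ) :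
    2 * hermiteNorm n * ∑ l ∈ Finset.range (n + 1), (hermiteH l).eval x ^ 2 / hermiteNorm l =
    2 * (n + 1) * (hermiteH n).eval x ^ 2
      - 2 * x * (hermiteH n).eval x * (hermiteH (n + 1)).eval x + (hermiteH (n + 1)).eval x ^ 2 := by
  induction n with
  | zero => simp [hermiteNorm, eval_hermiteH_one, eval_hermiteH_zero]; ring
  | succ n ih =>
    rw [Finset.sum_range_succ, mul_add, hermiteNorm_succ]
    have h1 : 2 * (2 * (↑n + 1) * hermiteNorm n) * ∑ l ∈ Finset.range (n + 1),
        (hermiteH l).eval x ^ 2 / hermiteNorm l = 2 * (n + 1) *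
        (2 * hermiteNorm n * ∑ l ∈ Finset.range (n + 1),
        (hermiteH l).eval x ^ 2 / hermiteNorm l) := by ring
    rw [h1, ih, ← hermiteNorm_succ, eval_hermiteH_add_two]
    have := (hermiteNorm_pos (n + 1)).ne'
    field_simp
    push_cast
    ring

/-- The Christoffel-Darboux kernel on the diagonal. -/
def hermiteKernel (N : ℕ) (x : ℝ) : ℝ :=
  ∑ l ∈ Finset.range N, (hermiteH l).eval x ^ 2 / hermiteNorm l

lemma hermiteKernel_pos {N : ℕ} (hN : 0 < N) (x : ℝ) : 0 < hermiteKernel N x := by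
  obtain ⟨n, rfl⟩ : ∃ n, N = n + 1 := ⟨N - 1, by omega⟩
  rw [hermiteKernel, Finset.sum_range_succ']
  have : 0 ≤ ∑ l ∈ Finset.range n, (hermiteH (l + 1)).eval x ^ 2 / hermiteNorm (l + 1) :=
    Finset.sum_nonneg fun l _ => div_nonneg (sq_nonneg _) (hermiteNorm_pos _).le
  have h0 : (hermiteH 0).eval x ^ 2 / hermiteNorm 0 = 1 := by
    simp [eval_hermiteH_zero, hermiteNorm]
  linarith

lemma hermiteKernel_root (n : ℕ) (i : Fin (n + 1)) :
    hermiteNorm n * hermiteKernel (n + 1) (hermiteRoot (n + 1) i) =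
      (n + 1) * (hermiteH n).eval (hermiteRoot (n + 1) i) ^ 2 := by
  have := christoffel_darboux_diag n (hermiteRoot (n + 1) i)
  rw [eval_hermiteRoot] at this
  rw [hermiteKernel]
  linarith

lemma eval_hermiteH_root_ne_zero (n : ℕ) (i : Fin (n + 1)) :
    (hermiteH n).eval (hermiteRoot (n + 1) i) ≠ 0 := fun h => by
  have h1 := hermiteKernel_root n i
  rw [h] at h1
  have := mul_pos (hermiteNorm_pos n) (hermiteKernel_pos n.succ_pos (hermiteRoot (n + 1) i))
  simp at h1
  rcases h1 with h1 | h1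
  · exact (hermiteNorm_pos n).ne' h1
  · exact (hermiteKernel_pos n.succ_pos _).ne' h1

lemma hermite_dual_orthogonality {N : ℕ} (l m : Fin N) :
    ∑ i, (hermiteH l).eval (hermiteRoot N i) * (hermiteH m).eval (hermiteRoot N i) /
      hermiteKernel N (hermiteRoot N i) = if l = m then hermiteNorm l else 0 := by
  obtain ⟨n, rfl⟩ : ∃ n, N = n + 1 := ⟨N - 1, by have := l.2; omega⟩
  set z := hermiteRoot (n + 1)
  let A : Matrix (Fin (n + 1)) (Fin (n + 1)) ℝ := fun i k =>
    (hermiteH k).eval (z i) / hermiteKernel (n + 1) (z i)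
  let B : Matrix (Fin (n + 1)) (Fin (n + 1)) ℝ := fun k j =>
    (hermiteH k).eval (z j) / hermiteNorm k
  have hAB : A * B = 1 := by
    ext i j
    rw [Matrix.mul_apply]
    have hK := (hermiteKernel_pos n.succ_pos (z i)).ne'
    have h1 : ∑ k : Fin (n + 1), A i k * B k j = (∑ l ∈ Finset.range (n + 1),
        (hermiteH l).eval (z i) * (hermiteH l).eval (z j) / hermiteNorm l) /
          hermiteKernel (n + 1) (z i) := by
      rw [Finset.sum_div, Finset.sum_range]
      refine Finset.sum_congr rfl fun k _ => ?_
      simp only [A, B]; ring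
    rw [h1]
    by_cases hij : i = j
    · subst hij
      rw [Matrix.one_apply_eq, hermiteKernel, div_eq_one_iff_eq]
      · simp only [sq]
      · exact hK
    · rw [Matrix.one_apply_ne hij]
      have h2 := christoffel_darboux n (z i) (z j)
      simp only [z, eval_hermiteRoot] at h2
      rw [zero_mul, mul_zero, sub_zero, ← mul_assoc] at h2
      have h3 : 2 * hermiteNorm n * (z i - z j) ≠ 0 :=
        mul_ne_zero (mul_ne_zero two_ne_zero (hermiteNorm_pos n).ne')
          (sub_ne_zero.2 fun h => hij ((hermiteRoot_strictMono _).injective h))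
      rw [(mul_eq_zero.1 h2).resolve_left h3, zero_div]
  have hBA : B * A = 1 := mul_eq_one_comm.1 hAB
  have h := congrFun (congrFun hBA l) m
  rw [Matrix.mul_apply] at h
  have hl := (hermiteNorm_pos l).ne'
  have h4 : ∑ i, (hermiteH l).eval (z i) * (hermiteH m).eval (z i) / hermiteKernel (n + 1) (z i) =
      hermiteNorm l * ∑ j, B l j * A j m := by
    rw [Finset.mul_sum]
    refine Finset.sum_congr rfl fun i _ => ?_
    simp only [A, B]
    field_simp
  rw [h4, h]
  rw [Matrix.one_apply, mul_ite, mul_one, mul_zero]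

/-! ### Asymptotics of the largest Hermite zeros -/

lemma hermiteZero_spec {N r : ℕ} (hr : 1 ≤ r) (hN : r ≤ N) :
    (hermiteH N).eval (hermiteZero N r) = 0 ∧
      {y | hermiteFun N y = 0 ∧ hermiteZero N r ≤ y}.ncard = r := by
  obtain ⟨c, hc⟩ := (hermiteH N).roots.toFinset.bddBelow
  have h : ∀ x, (hermiteH N).eval x = 0 ↔ hermiteFun N x = 0 := fun x =>
    hermiteFun_eq_zero_iff.symm
  have := (rthLargestZero_spec (f := fun x => (hermiteH N).eval x) hr (c := c)
    (by simp only [h]; exact finite_hermiteFun_zeros N c) (by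
      simp only [h]
      rwa [hermiteFun_zeros_eq, Set.ncard_coe_finset, Finset.filter_true_of_mem fun x hx => hc hx,
        hermiteH_card_roots_toFinset])).2
  simp only [h] at this
  exact ⟨(h _).2 this.1, this.2⟩

lemma le_hermiteZero {N r : ℕ} (hr : 1 ≤ r) {c : ℝ} (Z : Finset ℝ)
    (hZ : ∀ x ∈ Z, hermiteFun N x = 0 ∧ c ≤ x) (hcard : r ≤ Z.card) : c ≤ hermiteZero N r := by
  have h : ∀ x, (hermiteH N).eval x = 0 ↔ hermiteFun N x = 0 := fun x =>
    hermiteFun_eq_zero_iff.symm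
  refine (rthLargestZero_spec (f := fun x => (hermiteH N).eval x) hr (c := c)
    (by simp only [h]; exact finite_hermiteFun_zeros N c) ?_).1
  simp only [h]
  refine hcard.trans ?_
  rw [← Set.ncard_coe_finset]
  exact Set.ncard_le_ncard hZ (finite_hermiteFun_zeros N c)

lemma isSturmSolution_hermiteFun_rescaled {N : ℕ} {b c : ℝ} (hb : b ^ 2 = 2 * N + 1)
    (hbc : 2 * c ^ 3 * b = 1) (s : Set ℝ) :
    IsSturmSolution (fun x => x + c ^ 4 * x ^ 2) (fun x => hermiteFun N (b + c * x))
      (fun x => c * hermiteFunDeriv N (b + c * x)) s := by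
  intro x _
  obtain ⟨h1, h2⟩ := isSturmSolution_hermiteFun N Set.univ (b + c * x) trivial
  have hl : HasDerivAt (fun x : ℝ => b + c * x) c x := by
    simpa using ((hasDerivAt_id x).const_mul c).const_add b
  have h3 := h1.comp x hl
  have h4 := (h2.comp x hl).const_mul c
  refine ⟨h3.congr_deriv (mul_comm _ _), h4.congr_deriv ?_⟩
  have : c * c * ((b + c * x) ^ 2 - (2 * N + 1)) = x + c ^ 4 * x ^ 2 := by
    linear_combination c * c * hb + x * hbc
  beta_reduce
  rw [← this]; ring

lemma tendsto_hermite_rescaled_arg (b : ℝ) {c : ℝ} (hc : 0 < c) :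
    Tendsto (fun x : ℝ => b + c * x) atTop atTop :=
  tendsto_atTop_add_const_left _ _ (tendsto_id.const_mul_atTop hc)

lemma hermiteZero_rescaled_le {N r : ℕ} (hr : 1 ≤ r) (hN : r ≤ N) {b c : ℝ} (hc : 0 < c)
    (hb : b ^ 2 = 2 * N + 1) (hbc : 2 * c ^ 3 * b = 1) :
    (hermiteZero N r - b) / c ≤ airyZero r := by
  have hiff : ∀ y, (hermiteZero N r - b) / c ≤ y ↔ hermiteZero N r ≤ b + c * y := fun y => by
    rw [div_le_iff₀ hc]; constructor <;> intro <;> linarith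
  have hset : {y | hermiteFun N (b + c * y) = 0 ∧ (hermiteZero N r - b) / c ≤ y} =
      (fun y => (y - b) / c) '' {y | hermiteFun N y = 0 ∧ hermiteZero N r ≤ y} := by
    ext y
    simp only [Set.mem_ofPred_eq, hiff, Set.mem_image]
    constructor
    · intro h
      exact ⟨b + c * y, h, by field_simp; ring⟩
    · rintro ⟨x, h, rfl⟩
      rwa [mul_div_cancel₀ _ hc.ne', add_sub_cancel]
  have hinj : Function.Injective fun y : ℝ => (y - b) / c := fun x y h => by
    have := (div_left_inj' hc.ne').1 h
    linarith
  have hw := tendsto_hermite_rescaled_arg b hc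
  obtain ⟨Z, hZ, hZ0⟩ := sturm_card_zeros (c := (hermiteZero N r - b) / c)
    (isSturmSolution_hermiteFun_rescaled hb hbc _) (isSturmSolution_airyAi _)
    (fun x _ => by simp only [id]; nlinarith [sq_nonneg (c ^ 2 * x)])
    (fun x _ hx => mul_ne_zero hc.ne' (hermiteFunDeriv_ne_zero hx))
    (by simpa using (((((tendsto_hermiteFunDeriv N).comp hw).const_mul c).mul tendsto_airyAi).sub
          (((tendsto_hermiteFun N).comp hw).mul tendsto_airyAiDeriv)))
    (by rw [hset]; exact (finite_hermiteFun_zeros N _).image _)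
  refine le_airyZero hr Z (fun x hx => ?_) ?_
  · obtain ⟨h1, y, _, h3, h4⟩ := hZ0 x hx
    exact ⟨h1, h3.trans h4⟩
  · rw [hZ, hset, Set.ncard_image_of_injective _ hinj, (hermiteZero_spec hr hN).2]

/-- The change of variables of the Liouville-Green comparison. -/
def langerMap (ε x : ℝ) : ℝ := x + ε * (x ^ 2 / 5 + 1)

lemma hasDerivAt_langerMap (ε x : ℝ) : HasDerivAt (langerMap ε) (1 + 2 * ε * x / 5) x :=
  ((hasDerivAt_id x).add ((((hasDerivAt_pow 2 x).div_const 5).add_const 1).const_mul ε)).congr_deriv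
    (by simp; ring)

lemma isSturmSolution_langer {ε : ℝ} {s : Set ℝ} (hs : ∀ x ∈ s, 0 < 1 + 2 * ε * x / 5) :
    IsSturmSolution (fun x => langerMap ε x * (1 + 2 * ε * x / 5) ^ 2 +
        3 * (ε / 5) ^ 2 / (1 + 2 * ε * x / 5) ^ 2)
      (fun x => airyAi (langerMap ε x) / √(1 + 2 * ε * x / 5))
      (fun x => airyAiDeriv (langerMap ε x) * √(1 + 2 * ε * x / 5) -
        airyAi (langerMap ε x) * (ε / 5) / √(1 + 2 * ε * x / 5) ^ 3) s := by
  intro x hx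
  have hpos := hs x hx
  have hm0 : 0 < √(1 + 2 * ε * x / 5) := Real.sqrt_pos.2 hpos
  have hm2 : √(1 + 2 * ε * x / 5) ^ 2 = 1 + 2 * ε * x / 5 := Real.sq_sqrt hpos.le
  have hl : HasDerivAt (fun x : ℝ => 1 + 2 * ε * x / 5) (2 * ε / 5) x := by
    simpa using (((hasDerivAt_id x).const_mul (2 * ε)).div_const 5).const_add 1
  have hm : HasDerivAt (fun x : ℝ => √(1 + 2 * ε * x / 5)) (ε / 5 / √(1 + 2 * ε * x / 5)) x :=
    (hl.sqrt hpos.ne').congr_deriv (by field_simp)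
  have hA := (hasDerivAt_airyAi (langerMap ε x)).comp x (hasDerivAt_langerMap ε x)
  have hA' := (hasDerivAt_airyAiDeriv (langerMap ε x)).comp x (hasDerivAt_langerMap ε x)
  rw [← hm2] at hA hA'
  constructor
  · refine (hA.div hm hm0.ne').congr_deriv ?_
    simp only [Function.comp]
    field_simp
  · beta_reduce
    refine ((hA'.mul hm).sub ((hA.mul_const (ε / 5)).div (hm.pow 3)
      (pow_ne_zero 3 hm0.ne'))).congr_deriv ?_
    simp only [Function.comp, Pi.pow_apply]
    rw [← hm2, Real.sqrt_sq hm0.le]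
    generalize √(1 + 2 * ε * x / 5) = m at hm0
    field_simp
    push_cast
    ring

lemma le_langer_coefficient {ε S x : ℝ} (hε : 0 < ε) (hx : -S ≤ x)
    (h : ε * (4 * S / 5 + 8 * S ^ 3 / 25) ≤ 1) :
    x + ε * x ^ 2 ≤ langerMap ε x * (1 + 2 * ε * x / 5) ^ 2 +
        3 * (ε / 5) ^ 2 / (1 + 2 * ε * x / 5) ^ 2 := by
  have h1 : 0 ≤ 3 * (ε / 5) ^ 2 / (1 + 2 * ε * x / 5) ^ 2 := by positivity
  have h2 : langerMap ε x * (1 + 2 * ε * x / 5) ^ 2 - (x + ε * x ^ 2) =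
      ε * (1 + ε * (4 * x / 5 + 8 * x ^ 3 / 25)) + ε ^ 3 * (4 * x ^ 4 / 125 + 4 * x ^ 2 / 25) := by
    rw [langerMap]; ring
  have h3 : 0 ≤ 1 + ε * (4 * x / 5 + 8 * x ^ 3 / 25) := by
    have h4 : (-S) ^ 3 ≤ x ^ 3 := Odd.strictMono_pow (by decide) |>.monotone hx
    have h5 : -(4 * S / 5 + 8 * S ^ 3 / 25) ≤ 4 * x / 5 + 8 * x ^ 3 / 25 := by
      have : (-S) ^ 3 = -S ^ 3 := by ring
      linarith
    have := mul_le_mul_of_nonneg_left h5 hε.le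
    linarith
  have h6 : 0 ≤ ε ^ 3 * (4 * x ^ 4 / 125 + 4 * x ^ 2 / 25) := by positivity
  have := mul_nonneg hε.le h3
  linarith

lemma tendsto_langer {ε : ℝ} (hε : 0 < ε) (hε1 : ε ≤ 1) :
    Tendsto (fun x => airyAi (langerMap ε x) / √(1 + 2 * ε * x / 5)) atTop (𝓝 0) ∧
    Tendsto (fun x => airyAiDeriv (langerMap ε x) * √(1 + 2 * ε * x / 5) -
        airyAi (langerMap ε x) * (ε / 5) / √(1 + 2 * ε * x / 5) ^ 3) atTop (𝓝 0) := by
  have hφ : ∀ x, x ≤ langerMap ε x := fun x => by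
    rw [langerMap]; have : 0 ≤ ε * (x ^ 2 / 5 + 1) := by positivity
    linarith
  have h8 : Tendsto (fun x : ℝ => 2 / x + 8 / x) atTop (𝓝 0) := by
    simpa using (tendsto_const_nhds.div_atTop tendsto_id).add
      (tendsto_const_nhds.div_atTop (tendsto_id (x := atTop (α := ℝ))))
  have hm : ∀ x : ℝ, 1 ≤ x → 1 ≤ √(1 + 2 * ε * x / 5) ∧ √(1 + 2 * ε * x / 5) ≤ 2 * x := by
    intro x hx
    have h0 : 0 ≤ ε * x := by positivity
    have h1 : ε * x ≤ x := by nlinarith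
    have h2 : 1 ≤ √(1 + 2 * ε * x / 5) := Real.one_le_sqrt.2 (by linarith)
    refine ⟨h2, ?_⟩
    rw [Real.sqrt_le_left (by linarith)]
    nlinarith
  have hA : ∀ x : ℝ, 1 ≤ x → |airyAi (langerMap ε x)| ≤ 2 / x := fun x hx =>
    (abs_airyAi_le (by linarith [hφ x])).trans (by have := hφ x; gcongr)
  constructor
  · refine squeeze_zero_norm' ?_ h8
    filter_upwards [eventually_ge_atTop 1] with x hx
    obtain ⟨h1, h2⟩ := hm x hx
    rw [norm_div, Real.norm_eq_abs, Real.norm_eq_abs, abs_of_pos (by linarith : (0:ℝ) < √_)]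
    refine (div_le_self (abs_nonneg _) h1).trans ((hA x hx).trans ?_)
    have : 0 ≤ 8 / x := by positivity
    linarith
  · refine squeeze_zero_norm' ?_ h8
    filter_upwards [eventually_ge_atTop 1] with x hx
    obtain ⟨h1, h2⟩ := hm x hx
    have hx0 : 0 < x := by linarith
    rw [add_comm (2 / x)]
    refine (norm_sub_le _ _).trans (add_le_add ?_ ?_)
    · rw [norm_mul, Real.norm_eq_abs, Real.norm_eq_abs, abs_of_pos (by linarith : (0:ℝ) < √_)]
      have h3 : |airyAiDeriv (langerMap ε x)| ≤ (2 / x) ^ 2 :=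
        (abs_airyAiDeriv_le (by linarith [hφ x])).trans (by
          have := hφ x
          have : 0 < langerMap ε x := hx0.trans_le this
          gcongr)
      calc _ ≤ (2 / x) ^ 2 * (2 * x) := by gcongr
        _ = 8 / x := by field_simp; norm_num
    · rw [norm_div, norm_mul, Real.norm_eq_abs, Real.norm_eq_abs, Real.norm_eq_abs,
        abs_of_pos (pow_pos (by linarith : (0:ℝ) < √_) 3), abs_of_pos (by positivity : 0 < ε / 5)]
      refine (div_le_self (by positivity) (one_le_pow₀ h1)).trans ?_
      calc _ ≤ 2 / x * 1 := mul_le_mul (hA x hx) (by linarith) (by positivity) (by positivity)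
        _ = _ := mul_one _

lemma le_hermiteZero_rescaled {N r : ℕ} (hr : 1 ≤ r) {b c S : ℝ} (hc : 0 < c) (hc1 : c ≤ 1)
    (hb : b ^ 2 = 2 * N + 1) (hbc : 2 * c ^ 3 * b = 1) (hS : S = 1 - airyZero r)
    (h1 : c ^ 4 * (4 * S / 5 + 8 * S ^ 3 / 25) ≤ 1) (h2 : c ^ 4 * (S ^ 2 / 5 + 1) ≤ 1) :
    airyZero r - c ^ 4 * (S ^ 2 / 5 + 1) ≤ (hermiteZero N r - b) / c := by
  obtain ⟨ε, hε⟩ : ∃ ε, ε = c ^ 4 := ⟨_, rfl⟩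
  rw [← hε] at h1 h2 ⊢
  have hε0 : 0 < ε := by rw [hε]; positivity
  have hε1 : ε ≤ 1 := by rw [hε]; exact pow_le_one₀ hc.le hc1
  have ha := airyZero_neg hr
  have hS1 : 1 ≤ S := by linarith
  have hpos : ∀ x, -S ≤ x → 0 < 1 + 2 * ε * x / 5 := fun x hx => by
    have h3 : ε * (4 * S / 5) ≤ 1 := le_trans (by gcongr; have := pow_pos (by linarith : 0 < S) 3; linarith) h1
    nlinarith
  have hmono : StrictMonoOn (langerMap ε) (Set.Ici (-S)) := by
    refine strictMonoOn_of_deriv_pos (convex_Ici _)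
      (fun x _ => (hasDerivAt_langerMap ε x).continuousAt.continuousWithinAt) fun x hx => ?_
    rw [(hasDerivAt_langerMap ε x).deriv]
    exact hpos x (interior_subset hx)
  have hcont : Continuous (langerMap ε) := by unfold langerMap; fun_prop
  have hself : ∀ x, x ≤ langerMap ε x := fun x => by
    rw [langerMap]; have : 0 ≤ ε * (x ^ 2 / 5 + 1) := by positivity
    linarith
  have hsurj : ∀ y, airyZero r ≤ y → ∃ x, -S ≤ x ∧ langerMap ε x = y := by
    intro y hy
    have h3 : langerMap ε (-S) ≤ y := by rw [langerMap, neg_sq]; linarith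
    obtain ⟨x, hx, hxy⟩ := intermediate_value_Icc (show -S ≤ max y (-S) from le_max_right _ _)
      hcont.continuousOn (show y ∈ _ from ⟨h3, (le_max_left _ _).trans (hself _)⟩)
    exact ⟨x, hx.1, hxy⟩
  obtain ⟨s0, hs0, hs0a⟩ := hsurj _ le_rfl
  have hs0_le : s0 ≤ airyZero r := hs0a ▸ hself s0
  have hs0_ge : airyZero r - ε * (S ^ 2 / 5 + 1) ≤ s0 := by
    have h3 : s0 ^ 2 ≤ S ^ 2 := sq_le_sq' hs0 (by linarith)
    have h4 : airyZero r = s0 + ε * (s0 ^ 2 / 5 + 1) := hs0a.symm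
    have h5 : ε * (s0 ^ 2 / 5 + 1) ≤ ε * (S ^ 2 / 5 + 1) := by gcongr
    linarith
  refine hs0_ge.trans ?_
  have hzero : ∀ x, -S ≤ x → (airyAi (langerMap ε x) / √(1 + 2 * ε * x / 5) = 0 ↔
      airyAi (langerMap ε x) = 0) := fun x hx => by
    rw [div_eq_zero_iff, or_iff_left (Real.sqrt_pos.2 (hpos x hx)).ne']
  have hset : langerMap ε '' {x | airyAi (langerMap ε x) / √(1 + 2 * ε * x / 5) = 0 ∧ s0 ≤ x} =
      {y | airyAi y = 0 ∧ airyZero r ≤ y} := by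
    ext y
    constructor
    · rintro ⟨x, ⟨hx0, hx⟩, rfl⟩
      refine ⟨(hzero x (hs0.trans hx)).1 hx0, ?_⟩
      rw [← hs0a]
      exact hmono.monotoneOn hs0 (hs0.trans hx : -S ≤ x) hx
    · rintro ⟨hy0, hy⟩
      obtain ⟨x, hx, rfl⟩ := hsurj y hy
      refine ⟨x, ⟨(hzero x hx).2 hy0, ?_⟩, rfl⟩
      rw [← hs0a] at hy
      exact (hmono.le_iff_le hs0 hx).1 hy
  have hinj : Set.InjOn (langerMap ε)
      {x | airyAi (langerMap ε x) / √(1 + 2 * ε * x / 5) = 0 ∧ s0 ≤ x} :=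
    hmono.injOn.mono fun x hx => hs0.trans hx.2
  have hw := tendsto_hermite_rescaled_arg b hc
  obtain ⟨hu, hu'⟩ := tendsto_langer hε0 hε1
  have hv := isSturmSolution_hermiteFun_rescaled hb hbc (Set.Ici s0)
  rw [← hε] at hv
  obtain ⟨Z, hZ, hZ0⟩ := sturm_card_zeros (c := s0)
    (isSturmSolution_langer (ε := ε) fun x hx => hpos x (hs0.trans hx)) hv
    (fun x hx => le_langer_coefficient hε0 (hs0.trans hx) h1)
    (fun x hx h0 => by
      have hA := (hzero x (hs0.trans hx)).1 h0
      simp only [hA, zero_mul, zero_div, sub_zero]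
      exact mul_ne_zero (airyAiDeriv_ne_zero hA) (Real.sqrt_pos.2 (hpos x (hs0.trans hx))).ne')
    (by simpa using (hu'.mul ((tendsto_hermiteFun N).comp hw)).sub
          (hu.mul (((tendsto_hermiteFunDeriv N).comp hw).const_mul c)))
    (Set.Finite.of_finite_image (by rw [hset]; exact finite_airyAi_zeros _) hinj)
  rw [← hinj.ncard_image, hset, (airyZero_spec hr).2] at hZ
  rw [le_div_iff₀ hc, le_sub_iff_add_le]
  have hinj2 : Function.Injective fun x : ℝ => b + c * x := fun x y h =>
    mul_left_cancel₀ hc.ne' (add_left_cancel h)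
  refine le_hermiteZero hr (Z.image fun x => b + c * x) (fun y hy => ?_)
    (by rw [Finset.card_image_of_injective _ hinj2, hZ])
  obtain ⟨x, hx, rfl⟩ := Finset.mem_image.1 hy
  obtain ⟨h3, y, _, h4, h5⟩ := hZ0 x hx
  exact ⟨h3, by nlinarith⟩

set_option maxHeartbeats 1000000 in
theorem hermiteZero_isBigO {r : ℕ} (hr : 1 ≤ r) :
    (fun N : ℕ => hermiteZero N r / √(2 * (N : ℝ))
          - (1 - |airyZero r| / (2 * (N : ℝ) ^ (2 / 3 : ℝ))))
        =O[atTop] (fun N : ℕ => ((N : ℝ))⁻¹) := by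
  obtain ⟨S, hS⟩ : ∃ S, S = 1 - airyZero r := ⟨_, rfl⟩
  have ha := airyZero_neg hr
  have hS0 : 0 < S := by linarith
  obtain ⟨A, hA⟩ : ∃ A, A = (4 * S / 5 + 8 * S ^ 3 / 25) + (S ^ 2 / 5 + 1) := ⟨_, rfl⟩
  have hA0 : 0 < A := by rw [hA]; positivity
  refine IsBigO.of_bound (1 + A + |airyZero r|) ?_
  have hsq : Tendsto (fun N : ℕ => √(2 * (N : ℝ))) atTop atTop :=
    Real.tendsto_sqrt_atTop.comp (tendsto_natCast_atTop_atTop.const_mul_atTop two_pos)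
  filter_upwards [eventually_ge_atTop r, eventually_ge_atTop 1, hsq.eventually_ge_atTop A]
    with N hNr hN1 hNA
  have hn : (1 : ℝ) ≤ N := by exact_mod_cast hN1
  obtain ⟨n, hnN⟩ : ∃ n : ℝ, n = N := ⟨_, rfl⟩
  rw [← hnN] at hn hNA ⊢
  have hn0 : 0 < n := by linarith
  obtain ⟨m, hm⟩ : ∃ m, m = √(2 * n) := ⟨_, rfl⟩
  have hm2 : m ^ 2 = 2 * n := by rw [hm]; exact Real.sq_sqrt (by positivity)
  have hm0 : 0 < m := by rw [hm]; positivity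
  obtain ⟨b, hbd⟩ : ∃ b, b = √(2 * n + 1) := ⟨_, rfl⟩
  have hb2 : b ^ 2 = 2 * n + 1 := by rw [hbd]; exact Real.sq_sqrt (by positivity)
  have hmb : m ≤ b := by rw [hm, hbd]; exact Real.sqrt_le_sqrt (by linarith)
  have hb0 : 0 < b := hm0.trans_le hmb
  have hb1 : 1 ≤ b := by rw [hbd]; exact Real.one_le_sqrt.2 (by linarith)
  obtain ⟨c, hcd⟩ : ∃ c : ℝ, c = (2 * b) ^ (-(1 / 3) : ℝ) := ⟨_, rfl⟩
  have hc0 : 0 < c := by rw [hcd]; positivity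
  have hc3 : c ^ 3 = (2 * b)⁻¹ := by
    rw [hcd, ← Real.rpow_natCast, ← Real.rpow_mul (by positivity)]
    norm_num [Real.rpow_neg_one]
  have hbc : 2 * c ^ 3 * b = 1 := by rw [hc3]; field_simp
  have hc1 : c ≤ 1 := by
    rw [hcd]; exact Real.rpow_le_one_of_one_le_of_nonpos (by linarith) (by norm_num)
  have hc4 : c ^ 4 ≤ (2 * b)⁻¹ := by
    rw [← hc3]; exact pow_le_pow_of_le_one hc0.le hc1 (by norm_num)
  have hc4A : c ^ 4 * A ≤ 1 := by
    calc c ^ 4 * A ≤ (2 * b)⁻¹ * (2 * b) := by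
          gcongr; rw [← hm] at hNA; linarith
      _ = 1 := inv_mul_cancel₀ (by positivity)
  have hX0 : 0 ≤ 4 * S / 5 + 8 * S ^ 3 / 25 := by positivity
  have hY0 : 0 ≤ S ^ 2 / 5 + 1 := by positivity
  have hup := hermiteZero_rescaled_le hr hNr hc0 (by rw [hb2, hnN]) hbc
  have hlo := le_hermiteZero_rescaled (N := N) hr hc0 hc1 (by rw [hb2, hnN]) hbc hS
    (le_trans (by gcongr; linarith) hc4A) (le_trans (by gcongr; linarith) hc4A)
  obtain ⟨D, hD⟩ : ∃ D : ℝ, D = 1 / (2 * n ^ (2 / 3 : ℝ)) := ⟨_, rfl⟩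
  have hD0 : 0 < D := by rw [hD]; positivity
  have hn3 : (n ^ (2 / 3 : ℝ)) ^ 3 = n ^ 2 := by
    rw [← Real.rpow_natCast, ← Real.rpow_mul hn0.le, ← Real.rpow_natCast]; norm_num
  have hD3 : D ^ 3 * (8 * n ^ 2) = 1 := by
    rw [hD, div_pow, mul_pow, hn3]; field_simp; norm_num
  have hD1 : D ≤ 1 := by
    rw [hD, div_le_one (by positivity)]
    have : 1 ≤ n ^ (2 / 3 : ℝ) := Real.one_le_rpow hn (by norm_num)
    linarith
  obtain ⟨z, hz⟩ : ∃ z, z = hermiteZero N r := ⟨_, rfl⟩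
  obtain ⟨q, hq⟩ : ∃ q, q = b / m := ⟨_, rfl⟩
  have hq1 : 1 ≤ q := by rw [hq, one_le_div hm0]; exact hmb
  have hq2 : q ^ 2 = 1 + (2 * n)⁻¹ := by rw [hq, div_pow, hb2, hm2]; field_simp
  have hninv : 0 < n⁻¹ := by positivity
  have hq3 : q - 1 ≤ n⁻¹ / 2 := by
    have h1 : (2 * n)⁻¹ = n⁻¹ / 2 := by field_simp
    have h2 : q ≤ q ^ 2 := le_self_pow₀ hq1 two_ne_zero
    linarith
  obtain ⟨t, ht⟩ : ∃ t, t = c / (D * m) := ⟨_, rfl⟩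
  have ht0 : 0 < t := by rw [ht]; positivity
  have ht3 : t ^ 3 * q = 1 := by
    have hDm : (D * m) ^ 3 * (2 * m) = 1 := by
      have h4 : m ^ 4 = 4 * n ^ 2 := by
        rw [show m ^ 4 = (m ^ 2) ^ 2 by ring, hm2]; ring
      calc (D * m) ^ 3 * (2 * m) = 2 * D ^ 3 * m ^ 4 := by ring
        _ = D ^ 3 * (8 * n ^ 2) := by rw [h4]; ring
        _ = 1 := hD3
    calc t ^ 3 * q = (2 * c ^ 3 * b) / ((D * m) ^ 3 * (2 * m)) := by rw [ht, hq]; field_simp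
      _ = 1 := by rw [hbc, hDm, div_one]
  have ht1 : t ≤ 1 := by
    by_contra! h
    have h1 : 1 < t ^ 3 := one_lt_pow₀ h (by norm_num)
    have h2 : t ^ 3 * 1 ≤ t ^ 3 * q := mul_le_mul_of_nonneg_left hq1 (by linarith)
    linarith
  have ht2 : 1 - t ≤ n⁻¹ / 2 := by
    have h3 : t ^ 3 ≤ t := by
      simpa using pow_le_pow_of_le_one ht0.le ht1 (show 1 ≤ 3 by norm_num)
    have h4 : t ^ 3 * (q - 1) ≤ 1 * (q - 1) :=
      mul_le_mul_of_nonneg_right (h3.trans ht1) (by linarith)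
    linarith
  have hkey : z / m - (1 - |airyZero r| * D) = (q - 1) + c * ((z - b) / c - airyZero r) / m
      - airyZero r * (D * (1 - t)) := by
    rw [abs_of_neg ha, hq, ht]
    field_simp
    ring
  have hgoal : z / √(2 * n) - (1 - |airyZero r| / (2 * n ^ (2 / 3 : ℝ))) =
      z / m - (1 - |airyZero r| * D) := by rw [hm, hD, mul_one_div]
  rw [← hz] at hup hlo ⊢
  rw [hgoal, hkey, Real.norm_eq_abs, Real.norm_eq_abs, abs_of_pos hninv]
  have e1 : |q - 1| ≤ n⁻¹ := by rw [abs_of_nonneg (by linarith)]; linarith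
  have e2 : |c * ((z - b) / c - airyZero r) / m| ≤ A * n⁻¹ := by
    rw [abs_div, abs_mul, abs_of_pos hc0, abs_of_pos hm0, div_le_iff₀ hm0]
    have h5 : |(z - b) / c - airyZero r| ≤ c ^ 4 * A := by
      rw [abs_of_nonpos (by linarith)]
      have : c ^ 4 * (S ^ 2 / 5 + 1) ≤ c ^ 4 * A := by gcongr; linarith
      linarith
    calc c * |(z - b) / c - airyZero r| ≤ 1 * ((2 * b)⁻¹ * A) := by
          gcongr
          exact h5.trans (by gcongr)
      _ ≤ A * (2 * m)⁻¹ := by rw [one_mul, mul_comm]; gcongr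
      _ ≤ A * n⁻¹ * m := by
          have : (2 * m)⁻¹ = n⁻¹ * m / 4 := by
            field_simp; rw [hm2]; ring
          rw [this]
          have : 0 ≤ A * (n⁻¹ * m) := by positivity
          linarith
  have e3 : |airyZero r * (D * (1 - t))| ≤ |airyZero r| * n⁻¹ := by
    rw [abs_mul]
    gcongr
    rw [abs_of_nonneg (mul_nonneg hD0.le (by linarith))]
    exact (mul_le_of_le_one_left (by linarith) hD1).trans (by linarith)
  calc _ ≤ |q - 1| + |c * ((z - b) / c - airyZero r) / m| + |airyZero r * (D * (1 - t))| :=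
        (abs_sub _ _).trans (by gcongr; exact abs_add_le _ _)
    _ ≤ _ := by linarith

lemma tendsto_hermiteZero {r : ℕ} (hr : 1 ≤ r) :
    Tendsto (fun N : ℕ => (N : ℝ) ^ (2 / 3 : ℝ) * (hermiteZero N r / √(2 * (N : ℝ)) - 1)) atTop
      (𝓝 (airyZero r / 2)) := by
  have h : Tendsto (fun N : ℕ => ((N : ℝ)) ^ (2 / 3 : ℝ) * (N : ℝ)⁻¹) atTop (𝓝 0) := by
    have h1 : Tendsto (fun N : ℕ => (N : ℝ) ^ (-(1 / 3) : ℝ)) atTop (𝓝 0) :=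
      (tendsto_rpow_neg_atTop (by norm_num)).comp tendsto_natCast_atTop_atTop
    refine h1.congr' ?_
    filter_upwards [eventually_gt_atTop 0] with N hN
    have : (0 : ℝ) < N := by exact_mod_cast hN
    rw [← Real.rpow_neg_one, ← Real.rpow_add this]; norm_num
  have h2 := ((isBigO_refl (fun N : ℕ => (N : ℝ) ^ (2 / 3 : ℝ)) atTop).mul
    (hermiteZero_isBigO hr)).trans_tendsto h
  have h3 := h2.add_const (airyZero r / 2)
  rw [zero_add] at h3
  refine h3.congr' ?_
  filter_upwards [eventually_gt_atTop 0] with N hN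
  have : (0 : ℝ) < (N : ℝ) ^ (2 / 3 : ℝ) := by positivity
  rw [abs_of_neg (airyZero_neg hr)]
  field_simp
  ring

/-! ### A discrete Airy equation -/

lemma symplectic_discrete_gronwall {y g : ℕ → ℝ} {h K η : ℝ} (hh : 0 ≤ h) (hh1 : h ≤ 1) (hK : 0 ≤ K)
    (hη : 0 ≤ η) (y0 : y 0 = 0) (g0 : g 0 = 0) {n : ℕ}
    (hy : ∀ j < n, |y (j + 1) - y j| ≤ h * (K * |g j| + η))
    (hg : ∀ j < n, |g (j + 1) - g j| ≤ h * (K * |y (j + 1)| + η)) :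
    ∀ j ≤ n, |y j| ≤ j * h * ((K * Real.exp ((K + K ^ 2 + 2) * (n * h)) + 1) * η) := by
  have key : ∀ j ≤ n, |y j| + |g j| + η ≤ (1 + h * (K + K ^ 2 + 2)) ^ j * η := by
    intro j
    induction j with
    | zero => intro _; simp [y0, g0]
    | succ j ih =>
      intro hj
      have h1 := ih (by omega)
      have h2 := hy j (by omega)
      have h3 := hg j (by omega)
      have h4 : |y (j + 1)| ≤ |y j| + h * (K * |g j| + η) := by
        have := abs_sub_abs_le_abs_sub (y (j + 1)) (y j); linarith
      have h5 : |g (j + 1)| ≤ |g j| + h * (K * |y (j + 1)| + η) := by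
        have := abs_sub_abs_le_abs_sub (g (j + 1)) (g j); linarith
      have hy0 := abs_nonneg (y j)
      have hg0 := abs_nonneg (g j)
      have h6 : |y (j + 1)| ≤ |y j| + (K * |g j| + η) := h4.trans (by
        have : h * (K * |g j| + η) ≤ 1 * (K * |g j| + η) := by gcongr
        linarith)
      have h7 : |g (j + 1)| ≤ |g j| + h * (K * (|y j| + (K * |g j| + η)) + η) :=
        h5.trans (by gcongr)
      rw [pow_succ, mul_right_comm]
      calc |y (j + 1)| + |g (j + 1)| + η
          ≤ (|y j| + |g j| + η) + h * ((K + K ^ 2) * |g j| + K * |y j| + (K + 2) * η) := by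
            linarith
        _ ≤ (|y j| + |g j| + η) + h * ((K + K ^ 2 + 2) * (|y j| + |g j| + η)) := by
            gcongr
            have e1 : 0 ≤ K ^ 2 * |y j| := by positivity
            have e2 : 0 ≤ K ^ 2 * η := by positivity
            linarith
        _ = (|y j| + |g j| + η) * (1 + h * (K + K ^ 2 + 2)) := by ring
        _ ≤ _ := by gcongr
  have hg' : ∀ j ≤ n, |g j| ≤ Real.exp ((K + K ^ 2 + 2) * (n * h)) * η := by
    intro j hj
    have h1 := key j hj
    have h2 : (1 + h * (K + K ^ 2 + 2)) ^ j ≤ Real.exp ((K + K ^ 2 + 2) * (n * h)) := by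
      have h3 : 1 + h * (K + K ^ 2 + 2) ≤ Real.exp (h * (K + K ^ 2 + 2)) := by
        rw [add_comm]; exact Real.add_one_le_exp _
      have h4 : 1 ≤ 1 + h * (K + K ^ 2 + 2) := by
        have : 0 ≤ h * (K + K ^ 2 + 2) := by positivity
        linarith
      calc _ ≤ (1 + h * (K + K ^ 2 + 2)) ^ n := pow_le_pow_right₀ h4 hj
        _ ≤ Real.exp (h * (K + K ^ 2 + 2)) ^ n := by gcongr
        _ = _ := by rw [← Real.exp_nat_mul]; ring_nf
    have h5 := mul_le_mul_of_nonneg_right h2 hη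
    have := abs_nonneg (y j)
    linarith
  intro j
  induction j with
  | zero => intro _; simp [y0]
  | succ j ih =>
    intro hj
    have h1 := ih (by omega)
    have h2 := hy j (by omega)
    have h3 := hg' j (by omega)
    have h4 : |y (j + 1)| ≤ |y j| + h * (K * |g j| + η) := by
      have := abs_sub_abs_le_abs_sub (y (j + 1)) (y j); linarith
    have h5 : h * (K * |g j| + η) ≤
        h * ((K * Real.exp ((K + K ^ 2 + 2) * (n * h)) + 1) * η) := by
      gcongr
      have := mul_le_mul_of_nonneg_left h3 hK
      linarith
    push_cast
    linarith

/-- The recurrence of the normalized Hermite functions, read downwards from the index `N`. -/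
structure IsHermiteRecurrence (N : ℕ) (ζ : ℝ) (u : ℕ → ℝ) : Prop where
  zero : u 0 = 0
  one : u 1 = 1
  succ : ∀ j < N, √((N : ℝ) - j) * u j + √((N : ℝ) - (j + 1)) * u (j + 2) = ζ * u (j + 1)

lemma IsHermiteRecurrence.energy {N : ℕ} {ζ : ℝ} {u : ℕ → ℝ} (hu : IsHermiteRecurrence N ζ u) :
    ∑ j ∈ Finset.range N, (ζ - √((N : ℝ) - j) - √((N : ℝ) - (j + 1))) * u (j + 1) ^ 2 ≤ 0 := by
  have key : ∀ n ≤ N, ∑ j ∈ Finset.range n,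
      (ζ - √((N : ℝ) - j) - √((N : ℝ) - (j + 1))) * u (j + 1) ^ 2 =
      √((N : ℝ) - n) * (u (n + 1) - u n) * u n -
        ∑ j ∈ Finset.range n, √((N : ℝ) - j) * (u (j + 1) - u j) ^ 2 := by
    intro n
    induction n with
    | zero => intro _; simp [hu.zero]
    | succ n ih =>
      intro hn
      rw [Finset.sum_range_succ, Finset.sum_range_succ, ih (by omega)]
      have := hu.succ n (by omega)
      push_cast
      linear_combination (-u (n + 1)) * this
  rw [key N le_rfl, sub_self, Real.sqrt_zero, zero_mul, zero_mul, zero_sub, neg_nonpos]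
  exact Finset.sum_nonneg fun j _ => mul_nonneg (Real.sqrt_nonneg _) (sq_nonneg _)

lemma sqrt_sub_le {n j : ℝ} (hn : 0 < n) (hj : j ≤ n) : √(n - j) ≤ √n - j / (2 * √n) := by
  have hs := Real.sqrt_pos.2 hn
  have h2 := Real.sq_sqrt hn.le
  have h3 := Real.sq_sqrt (sub_nonneg.2 hj)
  have h4 : √n - j / (2 * √n) - √(n - j) = (√n - √(n - j)) ^ 2 / (2 * √n) := by
    field_simp
    linear_combination h2 - h3
  have h5 : 0 ≤ (√n - √(n - j)) ^ 2 / (2 * √n) := by positivity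
  linarith

lemma le_sqrt_sub {n j : ℝ} (hn : 0 < n) (hj : j ≤ n) (hj0 : 0 ≤ j) :
    √n - j / (2 * √n) - j ^ 2 / (2 * n * √n) ≤ √(n - j) := by
  have hs := Real.sqrt_pos.2 hn
  have h2 := Real.sq_sqrt hn.le
  have h3 := Real.sq_sqrt (sub_nonneg.2 hj)
  have h4 : √n - j / (2 * √n) - √(n - j) = (√n - √(n - j)) ^ 2 / (2 * √n) := by
    field_simp
    linear_combination h2 - h3
  have h6 : (√n - √(n - j)) * √n ≤ j := by
    have h7 : √(n - j) ≤ √n := Real.sqrt_le_sqrt (by linarith)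
    have := Real.sqrt_nonneg (n - j)
    nlinarith
  have h8 : 0 ≤ √n - √(n - j) := sub_nonneg.2 (Real.sqrt_le_sqrt (by linarith))
  have h9 : ((√n - √(n - j)) * √n) ^ 2 ≤ j ^ 2 := by gcongr
  have h5 : (√n - √(n - j)) ^ 2 / (2 * √n) ≤ j ^ 2 / (2 * n * √n) := by
    rw [div_le_div_iff₀ (by positivity) (by positivity)]
    calc (√n - √(n - j)) ^ 2 * (2 * n * √n) = ((√n - √(n - j)) * √n) ^ 2 * (2 * √n) := by
          rw [mul_pow, h2]; ring
      _ ≤ _ := by gcongr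
  linarith

lemma IsHermiteRecurrence.tight {N : ℕ} {ζ : ℝ} {u : ℕ → ℝ} (hu : IsHermiteRecurrence N ζ u)
    (hN : 0 < N) : ∑ j ∈ Finset.range N, ((j : ℝ) + 1) * u (j + 1) ^ 2 ≤
      2 * √N * (2 * √N - ζ) * ∑ j ∈ Finset.range N, u (j + 1) ^ 2 := by
  have hn : (0 : ℝ) < N := by exact_mod_cast hN
  have hs := Real.sqrt_pos.2 hn
  have h1 : ∑ j ∈ Finset.range N, (((j : ℝ) + 1) / (2 * √N) - (2 * √N - ζ)) * u (j + 1) ^ 2 ≤ 0 := by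
    refine le_trans (Finset.sum_le_sum fun j hj => ?_) hu.energy
    have hjN : (j : ℝ) + 1 ≤ N := by exact_mod_cast Finset.mem_range.1 hj
    have h2 := sqrt_sub_le hn (show (j : ℝ) ≤ N by linarith)
    have h3 := sqrt_sub_le hn hjN
    have h4 : 0 ≤ (j : ℝ) / (2 * √N) := by positivity
    exact mul_le_mul_of_nonneg_right (by linarith) (sq_nonneg _)
  have h2 : ∑ j ∈ Finset.range N, (((j : ℝ) + 1) / (2 * √N) - (2 * √N - ζ)) * u (j + 1) ^ 2 =
      (∑ j ∈ Finset.range N, ((j : ℝ) + 1) * u (j + 1) ^ 2) / (2 * √N) -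
        (2 * √N - ζ) * ∑ j ∈ Finset.range N, u (j + 1) ^ 2 := by
    rw [Finset.sum_div, Finset.mul_sum, ← Finset.sum_sub_distrib]
    exact Finset.sum_congr rfl fun j _ => by ring
  rw [h2, sub_nonpos, div_le_iff₀ (by positivity)] at h1
  linarith

lemma abs_sub_sub_mul_le {f f' : ℝ → ℝ} {a b c C : ℝ} (hab : a ≤ b) (hc : c ∈ Set.Icc a b)
    (hf : ∀ x, HasDerivAt f (f' x) x)
    (hC : ∀ x ∈ Set.Icc a b, ∀ y ∈ Set.Icc a b, |f' x - f' y| ≤ C * (b - a)) :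
    |f b - f a - (b - a) * f' c| ≤ C * (b - a) * (b - a) := by
  have h := norm_image_sub_le_of_norm_deriv_le_segment' (f := fun x => f x - x * f' c) (a := a)
    (b := b) (C := C * (b - a)) (f' := fun x => f' x - f' c)
    (fun x _ => ((hf x).sub (((hasDerivAt_id x).mul_const (f' c)).congr_deriv
      (one_mul _))).hasDerivWithinAt)
    (fun x hx => hC x (Set.Ico_subset_Icc_self hx) c hc) b ⟨hab, le_rfl⟩
  rw [Real.norm_eq_abs] at h
  convert h using 2
  ring

lemma IsHermiteRecurrence.coefficient_approx {N : ℕ} {t ζ a δ M : ℝ} (ht : 1 ≤ t)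
    (htN : t ^ 6 = N) (hδ : |t * (ζ - 2 * t ^ 3) - a| ≤ δ) {j : ℕ}
    (hjM : ((j : ℝ) + 1) / t ^ 2 ≤ M) (hjN : (j : ℝ) + 1 ≤ N) :
    |t * (ζ - √((N : ℝ) - j) - √((N : ℝ) - (j + 1))) - (((j : ℝ) + 1) / t ^ 2 + a)| ≤
      δ + (M ^ 2 + 1) * (1 / t ^ 2) := by
  have ht0 : 0 < t := by linarith
  have hn : (0 : ℝ) < N := by rw [← htN]; positivity
  have hsq : √(N : ℝ) = t ^ 3 := by
    rw [← htN, show t ^ 6 = (t ^ 3) ^ 2 by ring, Real.sqrt_sq (by positivity)]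
  have hj0 : (0 : ℝ) ≤ j := Nat.cast_nonneg j
  have a1 := sqrt_sub_le hn (show (j : ℝ) ≤ N by linarith)
  have a2 := sqrt_sub_le hn hjN
  have a3 := le_sqrt_sub hn (show (j : ℝ) ≤ N by linarith) hj0
  have a4 := le_sqrt_sub hn hjN (by linarith)
  rw [hsq] at a1 a2 a3 a4
  generalize √((N : ℝ) - j) = s1 at *
  generalize √((N : ℝ) - (j + 1)) = s2 at *
  rw [← htN] at a3 a4
  have b1 : t * (2 * t ^ 3 - s1 - s2) - ((j : ℝ) + 1) / t ^ 2 ≤ M ^ 2 * (1 / t ^ 2) := by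
    have c1 : 2 * t ^ 3 - s1 - s2 ≤ ((j : ℝ) + 1) / t ^ 3 + ((j : ℝ) + 1) ^ 2 / t ^ 9 := by
      have d1 : (j : ℝ) / (2 * t ^ 3) + ((j : ℝ) + 1) / (2 * t ^ 3) ≤ ((j : ℝ) + 1) / t ^ 3 := by
        rw [← add_div, div_le_div_iff₀ (by positivity) (by positivity)]
        have : 0 < t ^ 3 := by positivity
        nlinarith
      have d2 : (j : ℝ) ^ 2 / (2 * t ^ 6 * t ^ 3) + ((j : ℝ) + 1) ^ 2 / (2 * t ^ 6 * t ^ 3) ≤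
          ((j : ℝ) + 1) ^ 2 / t ^ 9 := by
        rw [← add_div, show 2 * t ^ 6 * t ^ 3 = 2 * t ^ 9 by ring,
          div_le_div_iff₀ (by positivity) (by positivity)]
        have : 0 < t ^ 9 := by positivity
        have h2 : (j : ℝ) ^ 2 ≤ ((j : ℝ) + 1) ^ 2 := by gcongr; linarith
        nlinarith
      linarith
    have c2 : t * (((j : ℝ) + 1) / t ^ 3 + ((j : ℝ) + 1) ^ 2 / t ^ 9) - ((j : ℝ) + 1) / t ^ 2 =
        (((j : ℝ) + 1) / t ^ 2) ^ 2 * (1 / t ^ 4) := by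
      field_simp; ring
    have c3 : (((j : ℝ) + 1) / t ^ 2) ^ 2 * (1 / t ^ 4) ≤ M ^ 2 * (1 / t ^ 2) := by
      have : t ^ 2 ≤ t ^ 4 := pow_le_pow_right₀ ht (by norm_num)
      gcongr
    have := mul_le_mul_of_nonneg_left c1 ht0.le
    linarith
  have b2 : -(1 / t ^ 2) ≤ t * (2 * t ^ 3 - s1 - s2) - ((j : ℝ) + 1) / t ^ 2 := by
    have c1 : (j : ℝ) / t ^ 3 ≤ 2 * t ^ 3 - s1 - s2 := by
      have d1 : (j : ℝ) / t ^ 3 ≤ (j : ℝ) / (2 * t ^ 3) + ((j : ℝ) + 1) / (2 * t ^ 3) := by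
        rw [← add_div, div_le_div_iff₀ (by positivity) (by positivity)]
        have : 0 < t ^ 3 := by positivity
        nlinarith
      linarith
    have := mul_le_mul_of_nonneg_left c1 ht0.le
    have c2 : t * ((j : ℝ) / t ^ 3) = ((j : ℝ) + 1) / t ^ 2 - 1 / t ^ 2 := by field_simp; ring
    linarith
  have hp : 0 < 1 / t ^ 2 := by positivity
  have hp2 : 0 ≤ M ^ 2 * (1 / t ^ 2) := by positivity
  rw [abs_le] at hδ ⊢
  constructor <;> linarith [hδ.1, hδ.2]

lemma IsHermiteRecurrence.approx {N : ℕ} {t ζ a δ M C : ℝ} {u : ℕ → ℝ} {Y Y' : ℝ → ℝ}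
    (hu : IsHermiteRecurrence N ζ u) (ht : 1 ≤ t) (htN : t ^ 6 = N) (hM : 0 < M)
    (hMt : 2 * M ≤ t ^ 4) (hδ : |t * (ζ - 2 * t ^ 3) - a| ≤ δ) (hδ1 : δ ≤ 1)
    (hY : ∀ x, HasDerivAt Y (Y' x) x) (hY' : ∀ x, HasDerivAt Y' ((x + a) * Y x) x)
    (hY0 : Y 0 = 0) (hY'0 : Y' 0 = 1) (hC : 0 ≤ C)
    (hYC : ∀ x ∈ Set.Icc 0 M, |Y x| ≤ C) (hY'C : ∀ x ∈ Set.Icc 0 M, |Y' x| ≤ C)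
    (hL : ∀ x ∈ Set.Icc 0 M, ∀ y ∈ Set.Icc 0 M, |Y' x - Y' y| ≤ C * |x - y|)
    (hL' : ∀ x ∈ Set.Icc 0 M, ∀ y ∈ Set.Icc 0 M,
      |(x + a) * Y x - (y + a) * Y y| ≤ C * |x - y|) {j : ℕ} (hj : j * (1 / t ^ 2) ≤ M) :
    |1 / t ^ 2 * u j - Y (j * (1 / t ^ 2))| ≤ j * (1 / t ^ 2) *
      (((M + |a| + M ^ 2 + 4) * Real.exp (((M + |a| + M ^ 2 + 4) + (M + |a| + M ^ 2 + 4) ^ 2 + 2) * M)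
        + 1) * (C * (2 * M + M ^ 2 + 3) * (1 / t ^ 2 + δ))) := by
  obtain ⟨K, hK⟩ : ∃ K, K = M + |a| + M ^ 2 + 4 := ⟨_, rfl⟩
  obtain ⟨η, hη⟩ : ∃ η, η = C * (2 * M + M ^ 2 + 3) * (1 / t ^ 2 + δ) := ⟨_, rfl⟩
  rw [← hK, ← hη]
  have ht0 : 0 < t := by linarith
  obtain ⟨h, hh⟩ : ∃ h, h = 1 / t ^ 2 := ⟨_, rfl⟩
  have hh0 : 0 < h := by rw [hh]; positivity
  have hh1 : h ≤ 1 := by rw [hh, div_le_one (by positivity)]; exact one_le_pow₀ ht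
  have hδ0 : 0 ≤ δ := (abs_nonneg _).trans hδ
  have hK0 : 0 ≤ K := by rw [hK]; positivity
  have hη0 : 0 ≤ η := by rw [hη]; positivity
  have hn : (0 : ℝ) < N := by rw [← htN]; positivity
  have hsq : √(N : ℝ) = t ^ 3 := by
    rw [← htN, show t ^ 6 = (t ^ 3) ^ 2 by ring, Real.sqrt_sq (by positivity)]
  rw [← hh] at hj ⊢
  have hn1 : ∀ i < j, ((i : ℝ) + 1) * h ≤ M := fun i hi => le_trans (by
    gcongr; exact_mod_cast hi) hj
  have hn2 : ∀ i < j, 2 * ((i : ℝ) + 1) ≤ N := fun i hi => by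
    have h1 := hn1 i hi
    rw [hh, mul_one_div, div_le_iff₀ (by positivity)] at h1
    rw [← htN]
    calc 2 * ((i : ℝ) + 1) ≤ 2 * M * t ^ 2 := by linarith
      _ ≤ t ^ 4 * t ^ 2 := by gcongr
      _ = t ^ 6 := by ring
  obtain ⟨y, hyd⟩ : ∃ y : ℕ → ℝ, y = fun j => h * u j - Y (j * h) := ⟨_, rfl⟩
  obtain ⟨g, hgd⟩ : ∃ g : ℕ → ℝ, g = fun j : ℕ =>
    √((N : ℝ) - j) * (u (j + 1) - u j) / t ^ 3 - Y' (j * h) := ⟨_, rfl⟩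
  have hmem : ∀ i < j, Set.Icc (i * h) (((i : ℝ) + 1) * h) ⊆ Set.Icc 0 M := fun i hi =>
    Set.Icc_subset_Icc (by positivity) (hn1 i hi)
  have hlen : ∀ i : ℕ, ((i : ℝ) + 1) * h - i * h = h := fun i => by ring
  have hle : ∀ i : ℕ, (i : ℝ) * h ≤ ((i : ℝ) + 1) * h := fun i => by linarith [hlen i]
  have hdist : ∀ i : ℕ, ∀ x ∈ Set.Icc (i * h) (((i : ℝ) + 1) * h),
      ∀ z ∈ Set.Icc (i * h) (((i : ℝ) + 1) * h), |x - z| ≤ ((i : ℝ) + 1) * h - i * h := by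
    intro i x hx z hz
    rw [abs_le]; constructor <;> linarith [hx.1, hx.2, hz.1, hz.2]
  have hMη : C * (2 * M + 1) * h ≤ η ∧ C * ((δ + (M ^ 2 + 1) * h) + h) ≤ η := by
    rw [hη, ← hh]
    constructor
    · rw [mul_assoc, mul_assoc]
      refine mul_le_mul_of_nonneg_left ?_ hC
      have : 0 ≤ (M ^ 2 + 2) * h + (2 * M + M ^ 2 + 3) * δ := by positivity
      linarith
    · rw [mul_assoc]
      gcongr
      have : 0 ≤ (2 * M + 1) * h + (2 * M + M ^ 2 + 2) * δ := by positivity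
      linarith
  have hfin := symplectic_discrete_gronwall (y := y) (g := g) (n := j) hh0.le hh1 hK0 hη0
    (by simp [hyd, hu.zero, hY0])
    (by simp only [hgd, hu.zero, hu.one, CharP.cast_eq_zero, sub_zero, zero_mul, hY'0, zero_add]
        rw [hsq, mul_one, div_self (by positivity), sub_self])
    (fun i hi => by
      have hA := abs_sub_sub_mul_le (hle i) (Set.left_mem_Icc.2 (hle i)) hY (C := C)
        fun x hx z hz => (hL x (hmem i hi hx) z (hmem i hi hz)).trans
          (mul_le_mul_of_nonneg_left (hdist i x hx z hz) hC)
      rw [hlen] at hA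
      have hNi : (0 : ℝ) < N - i := by linarith [hn2 i hi, (Nat.cast_nonneg i : (0 : ℝ) ≤ i)]
      have hs := Real.sqrt_pos.2 hNi
      obtain ⟨ρ, hρ⟩ : ∃ ρ, ρ = t ^ 3 / √((N : ℝ) - i) := ⟨_, rfl⟩
      have hρ1 : 1 ≤ ρ := by
        rw [hρ, one_le_div hs, ← hsq]
        exact Real.sqrt_le_sqrt (by linarith [(Nat.cast_nonneg i : (0 : ℝ) ≤ i)])
      have hρ2 : ρ ^ 2 ≤ 1 + 2 * M * h := by
        rw [hρ, div_pow, Real.sq_sqrt hNi.le, div_le_iff₀ hNi, ← pow_mul,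
          show 3 * 2 = 6 from rfl, htN]
        have e1 : (i : ℝ) ≤ M * h * N := by
          have e2 := hn1 i hi
          rw [hh, mul_one_div, div_le_iff₀ (by positivity)] at e2
          have e3 : M * h * N = M * t ^ 4 := by rw [hh, ← htN]; field_simp
          have e4 : M * t ^ 2 ≤ M * t ^ 4 :=
            mul_le_mul_of_nonneg_left (pow_le_pow_right₀ ht (by norm_num)) hM.le
          linarith
        have e5 : M * h * (2 * i) ≤ M * h * N := by
          gcongr; linarith [hn2 i hi]
        linarith
      have hρ3 : ρ - 1 ≤ 2 * M * h := by nlinarith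
      have hρ4 : ρ ≤ 2 := by
        have : ρ ^ 2 ≤ 2 := by
          rw [hρ, div_pow, Real.sq_sqrt hNi.le, div_le_iff₀ hNi, ← pow_mul,
            show 3 * 2 = 6 from rfl, htN]
          linarith [hn2 i hi]
        nlinarith
      have hid : y (i + 1) - y i = h * (ρ * g i + (ρ - 1) * Y' (i * h)) -
          (Y (((i : ℝ) + 1) * h) - Y (i * h) - h * Y' (i * h)) := by
        simp only [hyd, hgd, hρ]
        push_cast
        field_simp
        ring
      have hY'i := hY'C _ (hmem i hi (Set.left_mem_Icc.2 (hle i)))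
      rw [hid]
      refine (abs_sub _ _).trans ?_
      rw [abs_mul, abs_of_pos hh0]
      have e6 : |ρ * g i + (ρ - 1) * Y' (i * h)| ≤ 2 * |g i| + 2 * M * h * C := by
        refine (abs_add_le _ _).trans ?_
        rw [abs_mul, abs_mul, abs_of_nonneg (by linarith : 0 ≤ ρ),
          abs_of_nonneg (by linarith : 0 ≤ ρ - 1)]
        gcongr
      calc _ ≤ h * (2 * |g i| + 2 * M * h * C) + C * h * h := by gcongr
        _ = h * (2 * |g i| + C * (2 * M + 1) * h) := by ring
        _ ≤ h * (K * |g i| + η) := by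
          gcongr
          · rw [hK]; have := abs_nonneg a; have := sq_nonneg M; linarith
          · exact hMη.1)
    (fun i hi => by
      have hA := abs_sub_sub_mul_le (hle i) (Set.right_mem_Icc.2 (hle i)) hY' (C := C)
        fun x hx z hz => (hL' x (hmem i hi hx) z (hmem i hi hz)).trans
          (mul_le_mul_of_nonneg_left (hdist i x hx z hz) hC)
      rw [hlen] at hA
      have hiN : (i : ℝ) + 1 ≤ N := by linarith [hn2 i hi, (Nat.cast_nonneg i : (0 : ℝ) ≤ i)]
      have hq := coefficient_approx ht htN hδ (j := i) (M := M)
        (by have := hn1 i hi; rwa [hh, mul_one_div] at this) hiN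
      have hrec := hu.succ i (by exact_mod_cast hiN)
      rw [← hh, show ((i : ℝ) + 1) / t ^ 2 = ((i : ℝ) + 1) * h by rw [hh, mul_one_div]] at hq
      obtain ⟨q, hqd⟩ : ∃ q, q = t * (ζ - √((N : ℝ) - i) - √((N : ℝ) - (i + 1))) := ⟨_, rfl⟩
      rw [← hqd] at hq
      have hid : g (i + 1) - g i = h * (q * y (i + 1) +
          (q - (((i : ℝ) + 1) * h + a)) * Y (((i : ℝ) + 1) * h)) -
          (Y' (((i : ℝ) + 1) * h) - Y' (i * h) -
            h * ((((i : ℝ) + 1) * h + a) * Y (((i : ℝ) + 1) * h))) := by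
        have e1 : h * h * q = (ζ - √((N : ℝ) - i) - √((N : ℝ) - (i + 1))) / t ^ 3 := by
          rw [hh, hqd]; field_simp
        have e2 : √((N : ℝ) - (i + 1)) * (u (i + 1 + 1) - u (i + 1)) / t ^ 3 -
            √((N : ℝ) - i) * (u (i + 1) - u i) / t ^ 3 = h * h * q * u (i + 1) := by
          rw [e1]; field_simp; linear_combination hrec
        simp only [hyd, hgd]
        push_cast
        linear_combination e2
      have hYi := hYC _ (hmem i hi (Set.right_mem_Icc.2 (hle i)))
      rw [hid]
      refine (abs_sub _ _).trans ?_
      rw [abs_mul, abs_of_pos hh0]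
      have hqK : |q| ≤ K := by
        have e1 : |q| ≤ |q - (((i : ℝ) + 1) * h + a)| + |((i : ℝ) + 1) * h + a| := by
          have := abs_add_le (q - (((i : ℝ) + 1) * h + a)) (((i : ℝ) + 1) * h + a)
          rwa [sub_add_cancel] at this
        have e2 : |((i : ℝ) + 1) * h + a| ≤ M + |a| := by
          refine (abs_add_le _ _).trans ?_
          rw [abs_of_nonneg (by positivity : 0 ≤ ((i : ℝ) + 1) * h)]
          gcongr
          exact hn1 i hi
        have e3 : (M ^ 2 + 1) * h ≤ M ^ 2 + 1 := mul_le_of_le_one_right (by positivity) hh1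
        rw [hK]; linarith
      have e6 : |q * y (i + 1) + (q - (((i : ℝ) + 1) * h + a)) * Y (((i : ℝ) + 1) * h)| ≤
          K * |y (i + 1)| + (δ + (M ^ 2 + 1) * h) * C := by
        refine (abs_add_le _ _).trans ?_
        rw [abs_mul, abs_mul]
        gcongr
      calc _ ≤ h * (K * |y (i + 1)| + (δ + (M ^ 2 + 1) * h) * C) + C * h * h := by gcongr
        _ = h * (K * |y (i + 1)| + C * ((δ + (M ^ 2 + 1) * h) + h)) := by ring
        _ ≤ h * (K * |y (i + 1)| + η) := by
          gcongr
          exact hMη.2) j le_rfl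
  rw [hyd] at hfin
  refine hfin.trans ?_
  gcongr

lemma tendsto_riemann_sum {f : ℝ → ℝ} {M : ℝ} (hM : 0 < M) (hf : ContinuousOn f (Set.Icc 0 M)) :
    Tendsto (fun h : ℝ => h * ∑ j ∈ Finset.range ⌊M / h⌋₊, f (((j : ℝ) + 1) * h)) (𝓝[>] 0)
      (𝓝 (∫ x in (0 : ℝ)..M, f x)) := by
  obtain ⟨C, hC⟩ := isCompact_Icc.exists_bound_of_continuousOn hf
  have hC0 : 0 ≤ C := (norm_nonneg _).trans (hC 0 ⟨le_rfl, hM.le⟩)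
  rw [Metric.tendsto_nhds]
  intro ε hε
  have hu := isCompact_Icc.uniformContinuousOn_of_continuous hf
  rw [Metric.uniformContinuousOn_iff_le] at hu
  obtain ⟨δ, hδ, hδu⟩ := hu (ε / (2 * M)) (by positivity)
  filter_upwards [self_mem_nhdsWithin,
    mem_nhdsWithin_of_mem_nhds (Iio_mem_nhds hδ),
    mem_nhdsWithin_of_mem_nhds (Iio_mem_nhds (show 0 < ε / (2 * (C + 1)) by positivity))]
    with h hh hhδ hhC
  have hh : 0 < h := hh
  obtain ⟨n, hn⟩ : ∃ n, n = ⌊M / h⌋₊ := ⟨_, rfl⟩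
  have hnM : n * h ≤ M := by
    rw [hn, ← le_div_iff₀ hh]; exact Nat.floor_le (by positivity)
  have hnM2 : M ≤ n * h + h := by
    have := Nat.lt_floor_add_one (M / h)
    rw [← hn, div_lt_iff₀ hh] at this
    linarith
  rw [← hn]
  have hI : ∀ c d, 0 ≤ c → c ≤ d → d ≤ M → IntervalIntegrable f volume c d := fun c d h1 h2 h3 =>
    (hf.mono (by rw [Set.uIcc_of_le h2]; exact Set.Icc_subset_Icc h1 h3)).intervalIntegrable
  have hj : ∀ j < n, ((j : ℝ) + 1) * h ≤ M := fun j hj => le_trans (by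
    gcongr; exact_mod_cast hj) hnM
  have hsum := intervalIntegral.sum_integral_adjacent_intervals (f := f) (μ := volume)
    (a := fun j : ℕ => (j : ℝ) * h) (n := n) fun j hjn => hI _ _ (by positivity)
      (by push_cast; linarith) (by push_cast; exact hj j hjn)
  have hsplit := intervalIntegral.integral_add_adjacent_intervals
    (hI 0 (n * h) le_rfl (by positivity) hnM) (hI (n * h) M (by positivity) hnM le_rfl)
  simp only [CharP.cast_eq_zero, zero_mul] at hsum
  rw [← hsplit, ← hsum, Real.dist_eq, Finset.mul_sum, ← sub_sub, ← Finset.sum_sub_distrib]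
  have h1 : |∑ j ∈ Finset.range n, (h * f (((j : ℝ) + 1) * h) -
      ∫ x in (j : ℝ) * h..((j + 1 : ℕ) : ℝ) * h, f x)| ≤ ε / 2 := by
    refine (Finset.abs_sum_le_sum_abs _ _).trans ?_
    have h2 : ∀ j ∈ Finset.range n, |h * f (((j : ℝ) + 1) * h) -
        ∫ x in (j : ℝ) * h..((j + 1 : ℕ) : ℝ) * h, f x| ≤ ε / (2 * M) * h := by
      intro j hjn
      have hjM := hj j (Finset.mem_range.1 hjn)
      have e1 : ((j : ℝ) + 1) * h - j * h = h := by ring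
      have hle : (j : ℝ) * h ≤ ((j : ℝ) + 1) * h := by linarith
      push_cast
      have e2 : h * f (((j : ℝ) + 1) * h) =
          ∫ x in (j : ℝ) * h..((j : ℝ) + 1) * h, f (((j : ℝ) + 1) * h) := by
        rw [intervalIntegral.integral_const, e1, smul_eq_mul]
      rw [e2, ← intervalIntegral.integral_sub (by simp) (hI _ _ (by positivity) hle hjM)]
      have e3 := intervalIntegral.norm_integral_le_of_norm_le_const (a := (j : ℝ) * h)
        (b := ((j : ℝ) + 1) * h) (C := ε / (2 * M))
        (f := fun x => f (((j : ℝ) + 1) * h) - f x) fun x hx => by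
          rw [Set.uIoc_of_le hle] at hx
          refine hδu _ ⟨by positivity, hjM⟩ x ⟨?_, hx.2.trans hjM⟩ ?_
          · exact le_trans (by positivity) hx.1.le
          · rw [Real.dist_eq, abs_of_nonneg (by linarith [hx.2])]
            have : h < δ := hhδ
            linarith [hx.1]
      rwa [e1, abs_of_pos hh] at e3
    refine (Finset.sum_le_sum h2).trans ?_
    rw [Finset.sum_const, Finset.card_range, nsmul_eq_mul]
    calc (n : ℝ) * (ε / (2 * M) * h) = ε / (2 * M) * (n * h) := by ring
      _ ≤ ε / (2 * M) * M := by gcongr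
      _ = ε / 2 := by field_simp
  have h2 : |∫ x in (n : ℝ) * h..M, f x| < ε / 2 := by
    have e3 := intervalIntegral.norm_integral_le_of_norm_le_const (a := (n : ℝ) * h)
        (b := M) (C := C) (f := f) fun x hx => by
          rw [Set.uIoc_of_le hnM] at hx
          exact hC x ⟨le_trans (by positivity) hx.1.le, hx.2⟩
    rw [Real.norm_eq_abs, abs_of_nonneg (show 0 ≤ M - n * h by linarith)] at e3
    refine e3.trans_lt ?_
    have e4 : h < ε / (2 * (C + 1)) := hhC
    rw [lt_div_iff₀ (by positivity)] at e4
    have : C * (M - n * h) ≤ C * h := by gcongr; linarith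
    linarith
  have := abs_sub (∑ j ∈ Finset.range n, (h * f (((j : ℝ) + 1) * h) -
      ∫ x in (j : ℝ) * h..((j + 1 : ℕ) : ℝ) * h, f x)) (∫ x in (n : ℝ) * h..M, f x)
  linarith

/-- The scale `N ^ (1 / 6)`. -/
def edgeScale (N : ℕ) : ℝ := (N : ℝ) ^ (1 / 6 : ℝ)

lemma edgeScale_pow (N : ℕ) : edgeScale N ^ 6 = N := by
  rw [edgeScale, ← Real.rpow_natCast, ← Real.rpow_mul (Nat.cast_nonneg N)]; norm_num

lemma one_le_edgeScale {N : ℕ} (hN : 1 ≤ N) : 1 ≤ edgeScale N :=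
  Real.one_le_rpow (by exact_mod_cast hN) (by norm_num)

lemma tendsto_edgeScale : Tendsto edgeScale atTop atTop :=
  (tendsto_rpow_atTop (by norm_num)).comp tendsto_natCast_atTop_atTop

lemma sqrt_natCast_eq_edgeScale {N : ℕ} (hN : 1 ≤ N) : √(N : ℝ) = edgeScale N ^ 3 := by
  have := one_le_edgeScale hN
  rw [← edgeScale_pow N, show edgeScale N ^ 6 = (edgeScale N ^ 3) ^ 2 by ring,
    Real.sqrt_sq (by positivity)]

lemma tendsto_inv_edgeScale_sq : Tendsto (fun N => 1 / edgeScale N ^ 2) atTop (𝓝[>] 0) := by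
  refine tendsto_nhdsWithin_iff.2 ⟨?_, ?_⟩
  · exact tendsto_const_nhds.div_atTop ((tendsto_pow_atTop two_ne_zero).comp tendsto_edgeScale)
  · filter_upwards [eventually_ge_atTop 1] with N hN
    have := one_le_edgeScale hN
    exact Set.mem_Ioi.2 (by positivity)

lemma eventually_hermite_recurrence_approx {r : ℕ} (hr : 1 ≤ r) {ζ : ℕ → ℝ} {u : ℕ → ℕ → ℝ}
    (hu : ∀ᶠ N in atTop, IsHermiteRecurrence N (ζ N) (u N))
    (hζ : Tendsto (fun N => edgeScale N * (ζ N - 2 * edgeScale N ^ 3)) atTop (𝓝 (airyZero r)))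
    {M ε : ℝ} (hM : 0 < M) (hε : 0 < ε) : ∀ᶠ N in atTop, ∀ j : ℕ, j * (1 / edgeScale N ^ 2) ≤ M →
      |1 / edgeScale N ^ 2 * u N j - edgeProfile r (j * (1 / edgeScale N ^ 2))| ≤
        ε * (j * (1 / edgeScale N ^ 2)) := by
  have hlip : ∀ (f f' : ℝ → ℝ), (∀ x, HasDerivAt f (f' x) x) → Continuous f' →
      ∃ C, 0 ≤ C ∧ ∀ x ∈ Set.Icc 0 M, ∀ y ∈ Set.Icc 0 M, |f x - f y| ≤ C * |x - y| := by
    intro f f' hf hf'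
    obtain ⟨C, hC⟩ := (isCompact_Icc (a := 0) (b := M)).exists_bound_of_continuousOn
      hf'.continuousOn
    exact ⟨C, (norm_nonneg _).trans (hC 0 ⟨le_rfl, hM.le⟩), fun x hx y hy =>
      (convex_Icc 0 M).norm_image_sub_le_of_norm_hasDerivWithin_le
        (fun z _ => (hf z).hasDerivWithinAt) hC hy hx⟩
  have hcY := continuous_edgeProfile r
  have hcY' : Continuous (edgeProfileDeriv r) :=
    continuous_iff_continuousAt.2 fun x => (hasDerivAt_edgeProfileDeriv r x).continuousAt
  obtain ⟨C1, hC1, hL1⟩ := hlip _ _ (hasDerivAt_edgeProfileDeriv r) (by fun_prop)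
  obtain ⟨C2, hC2, hL2⟩ := hlip (fun x => (x + airyZero r) * edgeProfile r x)
    (fun x => 1 * edgeProfile r x + (x + airyZero r) * edgeProfileDeriv r x)
    (fun x => ((hasDerivAt_id x).add_const _).mul (hasDerivAt_edgeProfile r x)) (by fun_prop)
  obtain ⟨C3, hC3⟩ := (isCompact_Icc (a := 0) (b := M)).exists_bound_of_continuousOn
    hcY'.continuousOn
  have hC30 : 0 ≤ C3 := (norm_nonneg _).trans (hC3 0 ⟨le_rfl, hM.le⟩)
  obtain ⟨C, hC⟩ : ∃ C, C = C1 + C2 + C3 + M := ⟨_, rfl⟩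
  obtain ⟨E, hE⟩ : ∃ E, E = (((M + |airyZero r| + M ^ 2 + 4) *
    Real.exp (((M + |airyZero r| + M ^ 2 + 4) + (M + |airyZero r| + M ^ 2 + 4) ^ 2 + 2) * M)
        + 1)) := ⟨_, rfl⟩
  have hδ : Tendsto (fun N => |edgeScale N * (ζ N - 2 * edgeScale N ^ 3) - airyZero r|) atTop
      (𝓝 0) := by
    simpa using (hζ.sub_const (airyZero r)).abs
  have hsmall : Tendsto (fun N => E * (C * (2 * M + M ^ 2 + 3) * (1 / edgeScale N ^ 2 +
      |edgeScale N * (ζ N - 2 * edgeScale N ^ 3) - airyZero r|))) atTop (𝓝 0) := by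
    have := ((tendsto_nhdsWithin_iff.1 tendsto_inv_edgeScale_sq).1.add hδ).const_mul
      (E * (C * (2 * M + M ^ 2 + 3)))
    rw [add_zero, mul_zero] at this
    exact this.congr fun N => by ring
  have h4 : ∀ᶠ N in atTop, 2 * M ≤ edgeScale N ^ 4 :=
    ((tendsto_pow_atTop (by norm_num)).comp tendsto_edgeScale).eventually_ge_atTop _
  filter_upwards [hu, eventually_ge_atTop 1, h4, hδ.eventually_le_const one_pos,
    hsmall.eventually_le_const hε] with N hN hN1 hN4 hN5 hN6 j hj
  have h := hN.approx (one_le_edgeScale hN1) (edgeScale_pow N) hM hN4 le_rfl hN5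
    (hasDerivAt_edgeProfile r) (hasDerivAt_edgeProfileDeriv r) (edgeProfile_zero hr)
    (edgeProfileDeriv_zero hr) (C := C) (by rw [hC]; positivity)
    (fun x hx => (abs_edgeProfile_le hr hx.1).trans (by rw [hC]; linarith [hx.2]))
    (fun x hx => (hC3 x hx).trans (by rw [hC]; linarith))
    (fun x hx y hy => (hL1 x hx y hy).trans (by gcongr; rw [hC]; linarith))
    (fun x hx y hy => (hL2 x hx y hy).trans (by gcongr; rw [hC]; linarith)) hj
  rw [← hE] at h
  refine h.trans ?_
  rw [mul_comm ε]
  exact mul_le_mul_of_nonneg_left hN6 (by have := one_le_edgeScale hN1; positivity)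

lemma abs_sq_sub_sq_le {v y x ε : ℝ} (h : |v - y| ≤ ε * x) (hy : |y| ≤ x) :
    |v ^ 2 - y ^ 2| ≤ ε * (ε + 2) * x ^ 2 := by
  have h1 : |v + y| ≤ (ε + 2) * x := by
    have : v + y = (v - y) + 2 * y := by ring
    rw [this]
    refine (abs_add_le _ _).trans ?_
    rw [abs_mul, abs_two]
    linarith
  rw [sq_sub_sq, abs_mul, mul_comm]
  calc |v - y| * |v + y| ≤ (ε * x) * ((ε + 2) * x) :=
        mul_le_mul h h1 (abs_nonneg _) ((abs_nonneg _).trans h)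
    _ = _ := by ring

/-- Riemann sums of an approximation to the squared edge profile, with a weight. -/
lemma tendsto_weighted_sum {r : ℕ} (hr : 1 ≤ r) {u : ℕ → ℕ → ℝ} {M : ℝ} (hM : 0 < M)
    (happ : ∀ ε > 0, ∀ᶠ N in atTop, ∀ j : ℕ, j * (1 / edgeScale N ^ 2) ≤ M →
      |1 / edgeScale N ^ 2 * u N j - edgeProfile r (j * (1 / edgeScale N ^ 2))| ≤
        ε * (j * (1 / edgeScale N ^ 2))) {w : ℝ → ℝ} {B : ℝ}
    (hw : ∀ x ∈ Set.Ioc 0 M, |w x| * x ^ 2 ≤ B)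
    (hcont : ContinuousOn (fun x => w x * edgeProfile r x ^ 2) (Set.Icc 0 M)) :
    Tendsto (fun N => 1 / edgeScale N ^ 2 * ∑ j ∈ Finset.range ⌊M / (1 / edgeScale N ^ 2)⌋₊,
      w (((j : ℝ) + 1) * (1 / edgeScale N ^ 2)) * (1 / edgeScale N ^ 2 * u N (j + 1)) ^ 2) atTop
      (𝓝 (∫ x in (0 : ℝ)..M, w x * edgeProfile r x ^ 2)) := by
  have h0 := (tendsto_riemann_sum hM hcont).comp tendsto_inv_edgeScale_sq
  have hB : 0 ≤ B := (by positivity : 0 ≤ |w M| * M ^ 2).trans (hw M ⟨hM, le_rfl⟩)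
  have h1 : Tendsto (fun N => 1 / edgeScale N ^ 2 * ∑ j ∈ Finset.range ⌊M / (1 / edgeScale N ^ 2)⌋₊,
      w (((j : ℝ) + 1) * (1 / edgeScale N ^ 2)) * (1 / edgeScale N ^ 2 * u N (j + 1)) ^ 2 -
      1 / edgeScale N ^ 2 * ∑ j ∈ Finset.range ⌊M / (1 / edgeScale N ^ 2)⌋₊,
      w (((j : ℝ) + 1) * (1 / edgeScale N ^ 2)) *
        edgeProfile r (((j : ℝ) + 1) * (1 / edgeScale N ^ 2)) ^ 2) atTop (𝓝 0) := by
    rw [Metric.tendsto_nhds]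
    intro ε' hε'
    obtain ⟨ε, hε, hεε⟩ : ∃ ε > 0, ε * (ε + 2) * B * M < ε' := by
      refine ⟨min 1 (ε' / (3 * (B * M + 1))), by positivity, ?_⟩
      have e1 : min 1 (ε' / (3 * (B * M + 1))) ≤ 1 := min_le_left _ _
      have e2 : min 1 (ε' / (3 * (B * M + 1))) ≤ ε' / (3 * (B * M + 1)) := min_le_right _ _
      have e3 : 0 < min 1 (ε' / (3 * (B * M + 1))) := by positivity
      rw [le_div_iff₀ (by positivity)] at e2
      generalize min 1 (ε' / (3 * (B * M + 1))) = ε at *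
      have e4 : 0 ≤ ε * (B * M) := by positivity
      calc ε * (ε + 2) * B * M = (ε * (B * M)) * (ε + 2) := by ring
        _ ≤ (ε * (B * M)) * 3 := by gcongr; linarith
        _ < ε' := by linarith
    filter_upwards [happ ε hε, eventually_ge_atTop 1] with N hN hN1
    have ht := one_le_edgeScale hN1
    have hh : 0 < 1 / edgeScale N ^ 2 := by positivity
    generalize 1 / edgeScale N ^ 2 = h at *
    obtain ⟨n, hn⟩ : ∃ n, n = ⌊M / h⌋₊ := ⟨_, rfl⟩
    have hnM : n * h ≤ M := by
      rw [hn, ← le_div_iff₀ hh]; exact Nat.floor_le (by positivity)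
    rw [← hn, dist_zero_right, Real.norm_eq_abs, ← mul_sub, ← Finset.sum_sub_distrib, abs_mul,
      abs_of_pos hh]
    refine lt_of_le_of_lt ?_ hεε
    have h2 : ∀ j ∈ Finset.range n, |w (((j : ℝ) + 1) * h) * (h * u N (j + 1)) ^ 2 -
        w (((j : ℝ) + 1) * h) * edgeProfile r (((j : ℝ) + 1) * h) ^ 2| ≤ ε * (ε + 2) * B := by
      intro j hj
      have hjM : ((j : ℝ) + 1) * h ≤ M := le_trans (by
        gcongr; exact_mod_cast Finset.mem_range.1 hj) hnM
      have hx : 0 < ((j : ℝ) + 1) * h := by positivity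
      have h3 := hN (j + 1) (by push_cast; exact hjM)
      push_cast at h3
      have h4 := abs_sq_sub_sq_le h3 (abs_edgeProfile_le hr hx.le)
      rw [← mul_sub, abs_mul]
      calc _ ≤ |w (((j : ℝ) + 1) * h)| * (ε * (ε + 2) * (((j : ℝ) + 1) * h) ^ 2) := by gcongr
        _ = ε * (ε + 2) * (|w (((j : ℝ) + 1) * h)| * (((j : ℝ) + 1) * h) ^ 2) := by ring
        _ ≤ _ := by
          have := hw _ ⟨hx, hjM⟩
          gcongr
    calc h * |_| ≤ h * ∑ j ∈ Finset.range n, ε * (ε + 2) * B := by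
          gcongr
          exact (Finset.abs_sum_le_sum_abs _ _).trans (Finset.sum_le_sum h2)
      _ = ε * (ε + 2) * B * (n * h) := by
          rw [Finset.sum_const, Finset.card_range, nsmul_eq_mul]; ring
      _ ≤ _ := by gcongr
  have := h1.add h0
  rw [zero_add] at this
  exact this.congr fun N => by simp only [Function.comp]; ring

lemma ratio_bounds {N n : ℕ} {s : ℕ → ℝ} {t M C : ℝ} (hs : ∀ j, 0 ≤ s j) (hs0 : 0 < s 0)
    (ht : 0 < t) (hM : 0 < M) (hnN : n ≤ N) (hn1 : 1 ≤ n) (hn : M * t ^ 2 < n + 1)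
    (htight : ∑ j ∈ Finset.range N, ((j : ℝ) + 1) * s j ≤
      C * t ^ 2 * ∑ j ∈ Finset.range N, s j) :
    (1 - C / M) * ((∑ j ∈ Finset.range n, s j / (j + 1)) / ∑ j ∈ Finset.range n, s j) ≤
      (∑ j ∈ Finset.range N, s j / (j + 1)) / (∑ j ∈ Finset.range N, s j) ∧
    t ^ 2 * ((∑ j ∈ Finset.range N, s j / (j + 1)) / (∑ j ∈ Finset.range N, s j)) ≤
      t ^ 2 * ((∑ j ∈ Finset.range n, s j / (j + 1)) / ∑ j ∈ Finset.range n, s j) + 1 / M := by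
  have e0 : ∀ f : ℕ → ℝ, ∑ j ∈ Finset.range N, f j =
      ∑ j ∈ Finset.range n, f j + ∑ j ∈ Finset.Ico n N, f j := fun f =>
    (Finset.sum_range_add_sum_Ico f hnN).symm
  have hpos : 0 < ∑ j ∈ Finset.range n, s j := Finset.sum_pos' (fun j _ => hs j)
    ⟨0, Finset.mem_range.2 hn1, hs0⟩
  have hposN : 0 < ∑ j ∈ Finset.range N, s j := Finset.sum_pos' (fun j _ => hs j)
    ⟨0, Finset.mem_range.2 (by omega), hs0⟩
  have hw0 : ∀ j : ℕ, 0 ≤ s j / (j + 1) := fun j => div_nonneg (hs j) (by positivity)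
  have hj : ∀ j ∈ Finset.Ico n N, M * t ^ 2 ≤ (j : ℝ) + 1 := fun j hj => by
    have : (n : ℝ) ≤ j := by exact_mod_cast (Finset.mem_Ico.1 hj).1
    linarith
  have h1 : M * t ^ 2 * ∑ j ∈ Finset.Ico n N, s j ≤ C * t ^ 2 * ∑ j ∈ Finset.range N, s j := by
    refine le_trans ?_ htight
    rw [e0, Finset.mul_sum]
    have h2 : 0 ≤ ∑ j ∈ Finset.range n, ((j : ℝ) + 1) * s j :=
      Finset.sum_nonneg fun j _ => mul_nonneg (by positivity) (hs j)
    have h3 : ∑ j ∈ Finset.Ico n N, M * t ^ 2 * s j ≤ ∑ j ∈ Finset.Ico n N, ((j : ℝ) + 1) * s j :=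
      Finset.sum_le_sum fun j hjm => mul_le_mul_of_nonneg_right (hj j hjm) (hs j)
    linarith
  have h2 : (1 - C / M) * ∑ j ∈ Finset.range N, s j ≤ ∑ j ∈ Finset.range n, s j := by
    have h3 : ∑ j ∈ Finset.Ico n N, s j ≤ C / M * ∑ j ∈ Finset.range N, s j := by
      rw [div_mul_eq_mul_div, le_div_iff₀ hM]
      have : 0 < t ^ 2 := by positivity
      nlinarith
    have := e0 s
    linarith
  have h4 : M * t ^ 2 * ∑ j ∈ Finset.Ico n N, s j / (j + 1) ≤ ∑ j ∈ Finset.range N, s j := by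
    rw [e0 s, Finset.mul_sum]
    have h5 : ∑ j ∈ Finset.Ico n N, M * t ^ 2 * (s j / (j + 1)) ≤ ∑ j ∈ Finset.Ico n N, s j :=
      Finset.sum_le_sum fun j hjm => by
        rw [← mul_div_assoc, div_le_iff₀ (by positivity), mul_comm (s j)]
        exact mul_le_mul_of_nonneg_right (hj j hjm) (hs j)
    linarith
  have hle : ∑ j ∈ Finset.range n, s j / (j + 1) ≤ ∑ j ∈ Finset.range N, s j / ((j : ℝ) + 1) := by
    rw [e0]
    exact le_add_of_nonneg_right (Finset.sum_nonneg fun j _ => hw0 j)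
  have hle' : ∑ j ∈ Finset.range n, s j ≤ ∑ j ∈ Finset.range N, s j := by
    rw [e0 s]
    exact le_add_of_nonneg_right (Finset.sum_nonneg fun j _ => hs j)
  have hA0 : 0 ≤ ∑ j ∈ Finset.range n, s j / ((j : ℝ) + 1) := Finset.sum_nonneg fun j _ => hw0 j
  have e1 := e0 fun j => s j / ((j : ℝ) + 1)
  generalize ∑ j ∈ Finset.range n, s j / ((j : ℝ) + 1) = A' at *
  generalize ∑ j ∈ Finset.range N, s j / ((j : ℝ) + 1) = A at *
  generalize ∑ j ∈ Finset.Ico n N, s j / ((j : ℝ) + 1) = A'' at *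
  generalize ∑ j ∈ Finset.range n, s j = B' at *
  generalize ∑ j ∈ Finset.range N, s j = B at *
  constructor
  · rw [le_div_iff₀ hposN]
    calc (1 - C / M) * (A' / B') * B = (A' / B') * ((1 - C / M) * B) := by ring
      _ ≤ (A' / B') * B' := by gcongr
      _ = A' := by field_simp
      _ ≤ A := hle
  · have h6 : t ^ 2 * (A / B) = t ^ 2 * (A' / B) + t ^ 2 * A'' / B := by rw [e1]; ring
    have h7 : t ^ 2 * A'' / B ≤ 1 / M := by
      rw [div_le_div_iff₀ hposN hM]; linarith
    have h8 : A' / B ≤ A' / B' := by gcongr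
    have h9 : t ^ 2 * (A' / B) ≤ t ^ 2 * (A' / B') := by gcongr
    linarith

lemma continuousOn_edgeIntegrand {r : ℕ} (hr : 1 ≤ r) (M : ℝ) :
    ContinuousOn (fun x => x⁻¹ * edgeProfile r x ^ 2) (Set.Icc 0 M) := by
  intro x hx
  rcases hx.1.eq_or_lt with h0 | h0
  · subst h0
    rw [ContinuousWithinAt, edgeProfile_zero hr]
    simp only [ne_eq, OfNat.ofNat_ne_zero, not_false_eq_true, zero_pow, mul_zero]
    refine squeeze_zero_norm' (a := fun x => x) ?_ (tendsto_nhdsWithin_of_tendsto_nhds tendsto_id)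
    filter_upwards [self_mem_nhdsWithin] with y hy
    rw [norm_mul, norm_pow, norm_inv, Real.norm_eq_abs, Real.norm_eq_abs, abs_of_nonneg hy.1]
    rcases hy.1.eq_or_lt with h | h
    · subst h; simp
    · have := abs_edgeProfile_le hr hy.1
      rw [inv_mul_le_iff₀ h, ← sq]
      gcongr
  · exact ((continuousAt_inv₀ h0.ne').mul
      ((continuous_edgeProfile r).continuousAt.pow 2)).continuousWithinAt

theorem tendsto_hermite_recurrence_ratio {r : ℕ} (hr : 1 ≤ r) {ζ : ℕ → ℝ} {u : ℕ → ℕ → ℝ}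
    (hu : ∀ᶠ N in atTop, IsHermiteRecurrence N (ζ N) (u N))
    (hζ : Tendsto (fun N => edgeScale N * (ζ N - 2 * edgeScale N ^ 3)) atTop (𝓝 (airyZero r))) :
    Tendsto (fun N => edgeScale N ^ 2 * ((∑ j ∈ Finset.range N, u N (j + 1) ^ 2 / (j + 1)) /
      ∑ j ∈ Finset.range N, u N (j + 1) ^ 2)) atTop (𝓝 (edgeVariance r)) := by
  obtain ⟨C, hC⟩ : ∃ C, C = 2 * (1 - airyZero r) := ⟨_, rfl⟩
  have ha := airyZero_neg hr
  obtain ⟨α, hα⟩ : ∃ α : ℝ → ℝ, α = fun M => ∫ x in (0 : ℝ)..M, x⁻¹ * edgeProfile r x ^ 2 :=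
    ⟨_, rfl⟩
  obtain ⟨β, hβ⟩ : ∃ β : ℝ → ℝ, β = fun M => ∫ x in (0 : ℝ)..M, 1 * edgeProfile r x ^ 2 :=
    ⟨_, rfl⟩
  have hαlim : Tendsto α atTop (𝓝 (edgeVariance r)) := by
    rw [hα]
    have := intervalIntegral_tendsto_integral_Ioi 0 (integrableOn_edgeIntegrand hr) tendsto_id
    refine this.congr fun M => intervalIntegral.integral_congr fun x _ => ?_
    rw [edgeIntegrand_eq, div_eq_inv_mul]
  have hβlim : Tendsto β atTop (𝓝 1) := by
    rw [hβ]
    have := intervalIntegral_tendsto_integral_Ioi 0 (integrableOn_edgeProfile_sq r) tendsto_id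
    rw [integral_Ioi_edgeProfile_sq hr] at this
    refine this.congr fun M => intervalIntegral.integral_congr fun x _ => ?_
    rw [one_mul]
  have hlim : ∀ M, 0 < M → 0 < β M →
      Tendsto (fun N => edgeScale N ^ 2 * ((∑ j ∈ Finset.range ⌊M * edgeScale N ^ 2⌋₊,
        u N (j + 1) ^ 2 / (j + 1)) / ∑ j ∈ Finset.range ⌊M * edgeScale N ^ 2⌋₊,
        u N (j + 1) ^ 2)) atTop (𝓝 (α M / β M)) := by
    intro M hM hβM
    have happ := fun ε (hε : 0 < ε) => eventually_hermite_recurrence_approx hr hu hζ hM hε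
    have h1 := tendsto_weighted_sum hr hM happ (w := fun x => x⁻¹) (B := M)
      (fun x hx => by
        rw [abs_of_pos (inv_pos.2 hx.1), sq, inv_mul_cancel_left₀ hx.1.ne']; exact hx.2)
      (continuousOn_edgeIntegrand hr M)
    have h2 := tendsto_weighted_sum hr hM happ (w := fun x => 1) (B := M ^ 2)
      (fun x hx => by
        rw [abs_one, one_mul]; have := hx.1; have := hx.2; gcongr)
      (by have := continuous_edgeProfile r; fun_prop)
    have hβM' := hβM.ne'
    rw [hβ] at hβM'
    rw [hα, hβ]
    refine (h1.div h2 hβM').congr' ?_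
    filter_upwards [eventually_ge_atTop 1] with N hN
    have ht : 0 < edgeScale N := by linarith [one_le_edgeScale hN]
    simp only [Pi.div_apply]
    generalize edgeScale N = t at *
    rw [show M / (1 / t ^ 2) = M * t ^ 2 by rw [div_div_eq_mul_div, div_one]]
    have e1 : 1 / t ^ 2 * ∑ j ∈ Finset.range ⌊M * t ^ 2⌋₊,
        ((((j : ℝ) + 1) * (1 / t ^ 2))⁻¹ * (1 / t ^ 2 * u N (j + 1)) ^ 2) =
        (1 / t ^ 2) ^ 2 * ∑ j ∈ Finset.range ⌊M * t ^ 2⌋₊, u N (j + 1) ^ 2 / (j + 1) := by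
      rw [Finset.mul_sum, Finset.mul_sum]
      refine Finset.sum_congr rfl fun j _ => ?_
      have : (0 : ℝ) < (j : ℝ) + 1 := by positivity
      field_simp
    have e2 : 1 / t ^ 2 * ∑ j ∈ Finset.range ⌊M * t ^ 2⌋₊,
        (1 * (1 / t ^ 2 * u N (j + 1)) ^ 2) =
        (1 / t ^ 2) ^ 3 * ∑ j ∈ Finset.range ⌊M * t ^ 2⌋₊, u N (j + 1) ^ 2 := by
      rw [Finset.mul_sum, Finset.mul_sum]
      exact Finset.sum_congr rfl fun j _ => by ring
    rw [e1, e2, pow_succ _ 2, mul_assoc, mul_div_mul_left _ _ (by positivity)]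
    field_simp
  have hbounds : ∀ M, 0 < M → 1 ≤ M → ∀ᶠ N in atTop,
      (1 - C / M) * (edgeScale N ^ 2 * ((∑ j ∈ Finset.range ⌊M * edgeScale N ^ 2⌋₊,
        u N (j + 1) ^ 2 / (j + 1)) / ∑ j ∈ Finset.range ⌊M * edgeScale N ^ 2⌋₊,
        u N (j + 1) ^ 2)) ≤
      edgeScale N ^ 2 * ((∑ j ∈ Finset.range N, u N (j + 1) ^ 2 / (j + 1)) /
        ∑ j ∈ Finset.range N, u N (j + 1) ^ 2) ∧
      edgeScale N ^ 2 * ((∑ j ∈ Finset.range N, u N (j + 1) ^ 2 / (j + 1)) /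
        ∑ j ∈ Finset.range N, u N (j + 1) ^ 2) ≤
      edgeScale N ^ 2 * ((∑ j ∈ Finset.range ⌊M * edgeScale N ^ 2⌋₊,
        u N (j + 1) ^ 2 / (j + 1)) / ∑ j ∈ Finset.range ⌊M * edgeScale N ^ 2⌋₊,
        u N (j + 1) ^ 2) + 1 / M := by
    intro M hM hM1
    have h4 : ∀ᶠ N in atTop, M ≤ edgeScale N ^ 4 :=
      ((tendsto_pow_atTop (by norm_num)).comp tendsto_edgeScale).eventually_ge_atTop _
    filter_upwards [hu, eventually_ge_atTop 1, h4,
      hζ.eventually_const_le (show airyZero r - 1 < airyZero r by linarith)] with N hN hN1 hN4 hNζ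
    have ht1 := one_le_edgeScale hN1
    have ht := edgeScale_pow N
    have hT := hN.tight (by omega)
    rw [sqrt_natCast_eq_edgeScale hN1] at hT
    generalize edgeScale N = t at *
    have ht0 : 0 < t := by linarith
    have h5 := ratio_bounds (N := N) (n := ⌊M * t ^ 2⌋₊) (s := fun j => u N (j + 1) ^ 2) (t := t)
      (M := M) (C := C) (fun j => sq_nonneg _) (by simp [hN.one]) ht0 hM
      (by
        refine Nat.floor_le_of_le ?_
        rw [← ht]
        calc M * t ^ 2 ≤ t ^ 4 * t ^ 2 := by gcongr
          _ = t ^ 6 := by ring)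
      (by
        rw [Nat.one_le_floor_iff]
        have : 1 ≤ t ^ 2 := one_le_pow₀ ht1
        nlinarith)
      (Nat.lt_floor_add_one _)
      (hT.trans (by
        refine mul_le_mul_of_nonneg_right ?_ (Finset.sum_nonneg fun j _ => sq_nonneg _)
        have e1 : 2 * t ^ 3 * (2 * t ^ 3 - ζ N) = 2 * t ^ 2 * -(t * (ζ N - 2 * t ^ 3)) := by ring
        have e2 : C * t ^ 2 = 2 * t ^ 2 * -(airyZero r - 1) := by rw [hC]; ring
        rw [e1, e2]
        gcongr))
    refine ⟨?_, h5.2⟩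
    rw [mul_left_comm]
    exact mul_le_mul_of_nonneg_left h5.1 (by positivity)
  have hCM : Tendsto (fun M : ℝ => 1 - C / M) atTop (𝓝 1) := by
    simpa using (tendsto_const_nhds (x := (1 : ℝ))).sub
      ((tendsto_const_nhds (x := C)).div_atTop (tendsto_id (α := ℝ) (x := atTop)))
  have hMinv : Tendsto (fun M : ℝ => 1 / M) atTop (𝓝 0) :=
    tendsto_const_nhds.div_atTop tendsto_id
  have hratio : Tendsto (fun M => α M / β M) atTop (𝓝 (edgeVariance r)) := by
    have h := hαlim.div hβlim one_ne_zero
    rw [div_one] at h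
    exact h
  have hlow : Tendsto (fun M => (1 - C / M) * (α M / β M)) atTop (𝓝 (edgeVariance r)) := by
    simpa using hCM.mul hratio
  have hupp : Tendsto (fun M => α M / β M + 1 / M) atTop (𝓝 (edgeVariance r)) := by
    simpa using hratio.add hMinv
  rw [tendsto_order]
  constructor
  · intro b hb
    obtain ⟨M, hM1, hM2, hM3⟩ := ((hlow.eventually_const_lt hb).and
      ((hβlim.eventually_const_lt one_pos).and (eventually_ge_atTop 1))).exists
    have hM0 : 0 < M := by linarith
    filter_upwards [hbounds M hM0 hM3,
      ((hlim M hM0 hM2).const_mul (1 - C / M)).eventually_const_lt hM1] with N h1 h2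
    exact h2.trans_le h1.1
  · intro b hb
    obtain ⟨M, hM1, hM2, hM3⟩ := ((hupp.eventually_lt_const hb).and
      ((hβlim.eventually_const_lt one_pos).and (eventually_ge_atTop 1))).exists
    have hM0 : 0 < M := by linarith
    filter_upwards [hbounds M hM0 hM3,
      ((hlim M hM0 hM2).add_const (1 / M)).eventually_lt_const hM1] with N h1 h2
    exact h1.2.trans_lt h2

/-- The variance of the limit, as the coupling goes to infinity, at a Hermite zero `z`. -/
def hermiteVariance (N : ℕ) (z : ℝ) : ℝ :=
  (∑ l ∈ Finset.range N, (hermiteH l).eval z ^ 2 / hermiteNorm l / ((N : ℝ) - l)) /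
    hermiteKernel N z

/-- The orthonormal Hermite functions at `z`, read downwards from the index `N`. -/
def hermiteDescending (N : ℕ) (z : ℝ) (j : ℕ) : ℝ :=
  ((hermiteH (N - j)).eval z / √(hermiteNorm (N - j))) /
    ((hermiteH (N - 1)).eval z / √(hermiteNorm (N - 1)))

lemma isHermiteRecurrence_hermiteDescending {N : ℕ} (hN : 1 ≤ N) (i : Fin N) :
    IsHermiteRecurrence N (√2 * hermiteRoot N i) (hermiteDescending N (hermiteRoot N i)) := by
  obtain ⟨n, rfl⟩ : ∃ n, N = n + 1 := ⟨N - 1, by omega⟩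
  have hne := eval_hermiteH_root_ne_zero n i
  have hz := eval_hermiteRoot (n + 1) i
  obtain ⟨z, hzd⟩ : ∃ z, z = hermiteRoot (n + 1) i := ⟨_, rfl⟩
  rw [← hzd] at hne hz ⊢
  have hκ := fun n => Real.sqrt_pos.2 (hermiteNorm_pos n)
  refine ⟨by simp [hermiteDescending, hz], ?_, fun j hj => ?_⟩
  · rw [hermiteDescending, div_self]
    exact div_ne_zero hne (hκ _).ne'
  · have e1 : ∀ m : ℕ, √(hermiteNorm (m + 1)) = √2 * √((m : ℝ) + 1) * √(hermiteNorm m) := fun m => by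
      rw [hermiteNorm_succ, Real.sqrt_mul (by positivity), Real.sqrt_mul (by positivity)]
    have h2 : √2 * √2 = (2 : ℝ) := Real.mul_self_sqrt (by norm_num)
    obtain ⟨m, hm⟩ : ∃ m, n = j + m := ⟨n - j, by omega⟩
    subst hm
    have hd : (hermiteH (j + m)).eval z / √(hermiteNorm (j + m)) ≠ 0 := div_ne_zero hne (hκ _).ne'
    simp only [hermiteDescending, Nat.add_sub_cancel]
    rw [show j + m + 1 - j = m + 1 by omega, show j + m + 1 - (j + 1) = m by omega,
      show j + m + 1 - (j + 2) = m - 1 by omega]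
    push_cast
    rw [show (j : ℝ) + m + 1 - j = m + 1 by ring, show (j : ℝ) + m + 1 - (j + 1) = m by ring, e1]
    generalize (hermiteH (j + m)).eval z / √(hermiteNorm (j + m)) = d at hd
    have hs2 : (0 : ℝ) < √2 := by positivity
    have hsm : (0 : ℝ) < √((m : ℝ) + 1) := by positivity
    have hκm := hκ m
    have h3 : √2 ^ 2 = (2 : ℝ) := by rw [sq, h2]
    cases m with
    | zero =>
      simp only [Nat.cast_zero, Real.sqrt_zero, zero_mul, add_zero, zero_add,
        eval_hermiteH_one, eval_hermiteH_zero]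
      field_simp
      rw [h3, mul_comm]
    | succ k =>
      rw [show k + 1 - 1 = k by omega, eval_hermiteH_add_two, e1 k]
      have hsk : (0 : ℝ) < √((k : ℝ) + 1) := by positivity
      have hκk := hκ k
      have h4 : √((k : ℝ) + 1) ^ 2 = k + 1 := Real.sq_sqrt (by positivity)
      push_cast at hsm ⊢
      field_simp
      rw [h3, h4]
      ring

lemma hermiteVariance_eq {N : ℕ} (hN : 1 ≤ N) (i : Fin N) :
    hermiteVariance N (hermiteRoot N i) =
      (∑ j ∈ Finset.range N, hermiteDescending N (hermiteRoot N i) (j + 1) ^ 2 / (j + 1)) /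
        ∑ j ∈ Finset.range N, hermiteDescending N (hermiteRoot N i) (j + 1) ^ 2 := by
  obtain ⟨n, rfl⟩ : ∃ n, N = n + 1 := ⟨N - 1, by omega⟩
  have hne := eval_hermiteH_root_ne_zero n i
  obtain ⟨z, hzd⟩ : ∃ z, z = hermiteRoot (n + 1) i := ⟨_, rfl⟩
  rw [← hzd] at hne ⊢
  obtain ⟨A, hA⟩ : ∃ A, A = (hermiteH n).eval z ^ 2 / hermiteNorm n := ⟨_, rfl⟩
  have hA0 : A ≠ 0 := by rw [hA]; have := hermiteNorm_pos n; positivity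
  have hd : ∀ j, hermiteDescending (n + 1) z (j + 1) ^ 2 =
      (hermiteH (n - j)).eval z ^ 2 / hermiteNorm (n - j) / A := fun j => by
    rw [hermiteDescending, hA, div_pow, div_pow, div_pow, Real.sq_sqrt (hermiteNorm_pos _).le,
      Real.sq_sqrt (hermiteNorm_pos _).le, Nat.add_sub_add_right, Nat.add_sub_cancel]
  simp_rw [hd]
  rw [hermiteVariance, hermiteKernel, ← Finset.sum_range_reflect, ← Finset.sum_range_reflect
    (fun l => (hermiteH l).eval z ^ 2 / hermiteNorm l), ← Finset.sum_div]
  have e1 : ∑ j ∈ Finset.range (n + 1),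
      (hermiteH (n - j)).eval z ^ 2 / hermiteNorm (n - j) / A / ((j : ℝ) + 1) =
      (∑ j ∈ Finset.range (n + 1), (hermiteH (n + 1 - 1 - j)).eval z ^ 2 /
        hermiteNorm (n + 1 - 1 - j) / (((n + 1 : ℕ) : ℝ) - ((n + 1 - 1 - j : ℕ) : ℝ))) / A := by
    rw [Finset.sum_div]
    refine Finset.sum_congr rfl fun j hj => ?_
    rw [Nat.add_sub_cancel, Nat.cast_sub (by have := Finset.mem_range.1 hj; omega)]
    push_cast
    rw [show (n : ℝ) + 1 - (n - j) = j + 1 by ring, div_right_comm]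
  rw [e1, div_div_div_cancel_right₀ hA0]
  simp only [Nat.add_sub_cancel]

theorem tendsto_hermiteVariance {r : ℕ} (hr : 1 ≤ r) :
    Tendsto (fun N => edgeScale N ^ 2 * hermiteVariance N (hermiteZero N r)) atTop
      (𝓝 (edgeVariance r)) := by
  have h := tendsto_hermite_recurrence_ratio hr (ζ := fun N => √2 * hermiteZero N r)
    (u := fun N => hermiteDescending N (hermiteZero N r)) (by
      filter_upwards [eventually_ge_atTop r] with N hN
      rw [hermiteZero_eq hr hN]
      exact isHermiteRecurrence_hermiteDescending (by omega) _) (by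
      have h1 := (tendsto_hermiteZero hr).const_mul 2
      rw [mul_div_cancel₀ _ two_ne_zero] at h1
      refine h1.congr' ?_
      filter_upwards [eventually_ge_atTop 1] with N hN
      have ht : 0 < edgeScale N := by linarith [one_le_edgeScale hN]
      have h2 : (N : ℝ) ^ (2 / 3 : ℝ) = edgeScale N ^ 4 := by
        rw [edgeScale, ← Real.rpow_natCast, ← Real.rpow_mul (Nat.cast_nonneg N)]; norm_num
      have h3 : √(2 : ℝ) * √2 = 2 := Real.mul_self_sqrt (by norm_num)
      rw [h2, Real.sqrt_mul (by norm_num), sqrt_natCast_eq_edgeScale hN]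
      field_simp
      linear_combination (-hermiteZero N r) * h3)
  refine h.congr' ?_
  filter_upwards [eventually_ge_atTop r] with N hN
  rw [hermiteZero_eq hr hN, hermiteVariance_eq (by omega)]

/-! ### Heat polynomials -/

open Polynomial in
/-- The polynomials `exp (-σ D ^ 2 / 4) X ^ n`. -/
def heatPoly : ℕ → ℝ → ℝ[X]
  | 0, _ => 1
  | 1, _ => X
  | n + 2, σ => X * heatPoly (n + 1) σ - C (σ * ((n : ℝ) + 1) / 2) * heatPoly n σ

open Polynomial in
lemma heatPoly_add_two (n : ℕ) (σ : ℝ) : heatPoly (n + 2) σ =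
    X * heatPoly (n + 1) σ - C (σ * ((n : ℝ) + 1) / 2) * heatPoly n σ := by rw [heatPoly]

open Polynomial in
lemma derivative_heatPoly_succ (n : ℕ) (σ : ℝ) :
    derivative (heatPoly (n + 1) σ) = C ((n : ℝ) + 1) * heatPoly n σ := by
  induction n using Nat.strong_induction_on with
  | _ n ih =>
    match n with
    | 0 => simp [heatPoly]
    | 1 =>
      rw [heatPoly_add_two]
      simp only [heatPoly, derivative_sub, derivative_mul, derivative_C, derivative_X,
        derivative_one]
      simp only [map_add, map_one]
      push_cast
      simp only [map_one]
      ring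
    | m + 2 =>
      have h1 := ih (m + 1) (by omega)
      have h0 := ih m (by omega)
      rw [heatPoly_add_two (m + 1), derivative_sub, derivative_mul, derivative_mul,
        h1, h0, heatPoly_add_two m]
      simp only [derivative_C, derivative_X]
      push_cast
      have e1 : C (σ * ((m : ℝ) + 1 + 1) / 2) * (C ((m : ℝ) + 1)) =
          (C ((m : ℝ) + 2) * C (σ * ((m : ℝ) + 1) / 2) : ℝ[X]) := by
        rw [← C_mul, ← C_mul]; congr 1; ring
      have e2 : (C ((m : ℝ) + 2 + 1) : ℝ[X]) = 1 + C ((m : ℝ) + 2) := by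
        rw [← C_1, ← C_add]; congr 1; ring
      have e3 : (C ((m : ℝ) + 1 + 1) : ℝ[X]) = C ((m : ℝ) + 2) := by congr 1; ring
      rw [e2, e3]
      linear_combination (-heatPoly m σ) * e1

lemma heatPoly_zero_right (n : ℕ) : heatPoly n 0 = Polynomial.X ^ n := by
  induction n using Nat.strong_induction_on with
  | _ n ih =>
    match n with
    | 0 => simp [heatPoly]
    | 1 => simp [heatPoly]
    | m + 2 => rw [heatPoly_add_two, ih (m + 1) (by omega)]; simp; ring

lemma eval_heatPoly_scale (n : ℕ) (c w : ℝ) :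
    (heatPoly n (c ^ 2)).eval (c * w) = (c / 2) ^ n * (hermiteH n).eval w := by
  induction n using Nat.strong_induction_on with
  | _ n ih =>
    match n with
    | 0 => simp [heatPoly, hermiteH]
    | 1 => simp [heatPoly, hermiteH]; ring
    | m + 2 =>
      rw [heatPoly_add_two, eval_hermiteH_add_two]
      simp only [Polynomial.eval_sub, Polynomial.eval_mul, Polynomial.eval_X, Polynomial.eval_C]
      rw [ih (m + 1) (by omega), ih m (by omega)]
      ring

lemma hasDerivAt_heatPoly (n : ℕ) (y σ : ℝ) :
    HasDerivAt (fun σ => (heatPoly n σ).eval y)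
      (-((n : ℝ) * (n - 1) / 4) * (heatPoly (n - 2) σ).eval y) σ := by
  induction n using Nat.strong_induction_on with
  | _ n ih =>
    match n with
    | 0 => simpa [heatPoly] using hasDerivAt_const σ (1 : ℝ)
    | 1 => simpa [heatPoly] using hasDerivAt_const σ y
    | m + 2 =>
      have h1 := ih (m + 1) (by omega)
      have h0 := ih m (by omega)
      have hl : HasDerivAt (fun σ : ℝ => σ * ((m : ℝ) + 1) / 2) (((m : ℝ) + 1) / 2) σ := by
        simpa using ((hasDerivAt_id σ).mul_const ((m : ℝ) + 1)).div_const 2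
      have h := (h1.const_mul y).sub (hl.mul h0)
      have he : (fun σ => (heatPoly (m + 2) σ).eval y) = fun σ =>
          y * (heatPoly (m + 1) σ).eval y - σ * ((m : ℝ) + 1) / 2 * (heatPoly m σ).eval y := by
        funext σ
        rw [heatPoly_add_two]; simp
      rw [he]
      refine h.congr_deriv ?_
      rw [show m + 2 - 2 = m by omega, show m + 1 - 2 = m - 1 by omega]
      push_cast
      match m with
      | 0 => simp [heatPoly]; ring
      | 1 => simp [heatPoly]; ring
      | l + 2 =>
        rw [show l + 2 - 1 = l + 1 by omega, show l + 2 - 2 = l by omega, heatPoly_add_two l]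
        simp only [Polynomial.eval_sub, Polynomial.eval_mul, Polynomial.eval_X, Polynomial.eval_C]
        push_cast
        ring

open Polynomial in
/-- The linear functional `p ↦ (exp (-σ D ^ 2 / 4) p) (y)`. -/
def heatEval (σ y : ℝ) : ℝ[X] →ₗ[ℝ] ℝ :=
  Polynomial.lsum fun n => (heatPoly n σ).eval y • LinearMap.id

open Polynomial in
lemma heatEval_monomial (σ y : ℝ) (n : ℕ) (c : ℝ) :
    heatEval σ y (monomial n c) = c * (heatPoly n σ).eval y := by
  rw [heatEval, lsum_apply, sum_monomial_index _ _ (by simp)]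
  simp [mul_comm]

lemma heatEval_X_pow (σ y : ℝ) (n : ℕ) :
    heatEval σ y (Polynomial.X ^ n) = (heatPoly n σ).eval y := by
  rw [Polynomial.X_pow_eq_monomial, heatEval_monomial, one_mul]

open Polynomial in
lemma hasDerivAt_heatEval (p : ℝ[X]) (y σ : ℝ) : HasDerivAt (fun σ => heatEval σ y p)
    (-(1 / 4) * heatEval σ y (derivative (derivative p))) σ := by
  induction p using Polynomial.induction_on' with
  | add p q hp hq =>
    simp only [map_add]
    exact (hp.add hq).congr_deriv (by ring)
  | monomial n c =>
    simp only [derivative_monomial, heatEval_monomial]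
    refine ((hasDerivAt_heatPoly n y σ).const_mul c).congr_deriv ?_
    rw [show n - 1 - 1 = n - 2 by omega]
    rcases n with _ | n
    · simp
    · rw [Nat.add_sub_cancel]
      push_cast
      rcases n with _ | n
      · simp
      · push_cast
        ring

open Polynomial in
lemma heatEval_zero (y : ℝ) (p : ℝ[X]) : heatEval 0 y p = p.eval y := by
  induction p using Polynomial.induction_on' with
  | add p q hp hq => simp only [map_add, eval_add, hp, hq]
  | monomial n c => rw [heatEval_monomial, heatPoly_zero_right]; simp

open Polynomial in
lemma heatEval_heatPoly (l : ℕ) (σ τ y : ℝ) :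
    heatEval σ y (heatPoly l τ) = (heatPoly l (σ + τ)).eval y := by
  induction l using Nat.strong_induction_on generalizing σ with
  | _ l ih =>
    have hd : ∀ σ, HasDerivAt (fun σ => heatEval σ y (heatPoly l τ) -
        (heatPoly l (σ + τ)).eval y) 0 σ := by
      intro σ
      refine ((hasDerivAt_heatEval (heatPoly l τ) y σ).sub
        ((hasDerivAt_heatPoly l y (σ + τ)).comp_add_const σ τ)).congr_deriv ?_
      match l with
      | 0 => simp [heatPoly]
      | 1 => simp [heatPoly]
      | m + 2 =>
        rw [derivative_heatPoly_succ, derivative_C_mul, derivative_heatPoly_succ,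
          ← mul_assoc, ← C_mul, ← smul_eq_C_mul, map_smul, ih m (by omega), smul_eq_mul,
          show m + 2 - 2 = m by omega]
        push_cast
        ring
    have hc := is_const_of_deriv_eq_zero (fun σ => (hd σ).differentiableAt)
      (fun σ => (hd σ).deriv) σ 0
    simp only [heatEval_zero, zero_add, sub_self] at hc
    linarith

/-! ### The limiting quadratic variation -/

open Polynomial in
lemma prod_erase_hermiteRoot (n : ℕ) (j : Fin (n + 1)) {c : ℝ} (hc : c ≠ 0) :
    ∏ m ∈ Finset.univ.erase j, (X - C (c * hermiteRoot (n + 1) m)) =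
      ∑ l ∈ Finset.range (n + 1), C (c ^ (n - l) * (2 ^ l / 2 ^ n) * hermiteNorm n *
        (hermiteH l).eval (hermiteRoot (n + 1) j) /
        ((hermiteH n).eval (hermiteRoot (n + 1) j) * hermiteNorm l)) * heatPoly l (c ^ 2) := by
  have hH := eval_hermiteH_root_ne_zero n j
  refine mul_left_cancel₀ (X_sub_C_ne_zero (c * hermiteRoot (n + 1) j)) ?_
  rw [Finset.mul_prod_erase Finset.univ (fun m => X - C (c * hermiteRoot (n + 1) m))
    (Finset.mem_univ j)]
  refine Polynomial.funext fun x' => ?_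
  obtain ⟨x, rfl⟩ : ∃ x, x' = c * x := ⟨x' / c, by field_simp⟩
  have h1 : ∏ m, (c * x - c * hermiteRoot (n + 1) m) =
      c ^ (n + 1) / 2 ^ (n + 1) * (hermiteH (n + 1)).eval x := by
    rw [← prod_X_sub_hermiteRoot (n + 1)]
    simp only [eval_mul, eval_C, eval_prod, eval_sub, eval_X, ← mul_sub, Finset.prod_mul_distrib,
      Finset.prod_const, Finset.card_univ, Fintype.card_fin]
    field_simp
  have h2 := christoffel_darboux n x (hermiteRoot (n + 1) j)
  rw [eval_hermiteRoot, mul_zero, sub_zero] at h2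
  simp only [eval_prod, eval_mul, eval_sub, eval_X, eval_C, eval_finsetSum, eval_heatPoly_scale]
  rw [h1]
  have h3 : ∑ l ∈ Finset.range (n + 1), c ^ (n - l) * (2 ^ l / 2 ^ n) * hermiteNorm n *
        (hermiteH l).eval (hermiteRoot (n + 1) j) /
        ((hermiteH n).eval (hermiteRoot (n + 1) j) * hermiteNorm l) *
        ((c / 2) ^ l * (hermiteH l).eval x) = c ^ n / 2 ^ n * hermiteNorm n /
          (hermiteH n).eval (hermiteRoot (n + 1) j) * ∑ l ∈ Finset.range (n + 1),
          (hermiteH l).eval x * (hermiteH l).eval (hermiteRoot (n + 1) j) / hermiteNorm l := by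
    rw [Finset.mul_sum]
    refine Finset.sum_congr rfl fun l hl => ?_
    have hln : l ≤ n := by have := Finset.mem_range.1 hl; omega
    have e1 : c ^ n = c ^ (n - l) * c ^ l := by rw [← pow_add]; congr 1; omega
    rw [e1, div_pow]
    have := (hermiteNorm_pos l).ne'
    field_simp
  rw [h3]
  generalize ∑ l ∈ Finset.range (n + 1),
    (hermiteH l).eval x * (hermiteH l).eval (hermiteRoot (n + 1) j) / hermiteNorm l = S at h2
  field_simp
  rw [pow_succ, pow_succ]
  linear_combination (-c ^ n * c * 2 ^ n) * h2

/-- The quadratic variation density, in the limit, of `heatEval (1 - τ) z` along the process. -/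
def hermiteBracket (n : ℕ) (z τ : ℝ) : ℝ :=
  (n + 1) * hermiteNorm n / 4 ^ n *
    ∑ l ∈ Finset.range (n + 1), τ ^ (n - l) * ((hermiteH l).eval z ^ 2 / hermiteNorm l)

lemma continuous_hermiteBracket (n : ℕ) (z : ℝ) : Continuous (hermiteBracket n z) := by
  unfold hermiteBracket; fun_prop

lemma heatEval_prod_erase_hermiteRoot (n : ℕ) (i j : Fin (n + 1)) {c : ℝ} (hc : c ≠ 0) :
    heatEval (1 - c ^ 2) (hermiteRoot (n + 1) i) (∏ m ∈ Finset.univ.erase j,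
      (Polynomial.X - Polynomial.C (c * hermiteRoot (n + 1) m))) =
    hermiteNorm n / 2 ^ n / (hermiteH n).eval (hermiteRoot (n + 1) j) *
      ∑ l : Fin (n + 1), c ^ (n - l : ℕ) * (hermiteH l).eval (hermiteRoot (n + 1) i) /
        hermiteNorm l * (hermiteH l).eval (hermiteRoot (n + 1) j) := by
  rw [prod_erase_hermiteRoot n j hc, map_sum, Finset.mul_sum, Finset.sum_range]
  refine Finset.sum_congr rfl fun l _ => ?_
  have h1 : (heatPoly l 1).eval (hermiteRoot (n + 1) i) =
      (1 / 2) ^ (l : ℕ) * (hermiteH l).eval (hermiteRoot (n + 1) i) := by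
    simpa using eval_heatPoly_scale l 1 (hermiteRoot (n + 1) i)
  rw [← Polynomial.smul_eq_C_mul, map_smul, heatEval_heatPoly, sub_add_cancel, h1, smul_eq_mul]
  have := (hermiteNorm_pos l).ne'
  have := eval_hermiteH_root_ne_zero n j
  rw [div_pow, one_pow]
  field_simp

lemma sum_heatEval_sq (n : ℕ) (i : Fin (n + 1)) {c : ℝ} (hc : c ≠ 0) :
    ∑ j, heatEval (1 - c ^ 2) (hermiteRoot (n + 1) i) (∏ m ∈ Finset.univ.erase j,
      (Polynomial.X - Polynomial.C (c * hermiteRoot (n + 1) m))) ^ 2 =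
    hermiteBracket n (hermiteRoot (n + 1) i) (c ^ 2) := by
  simp only [heatEval_prod_erase_hermiteRoot n i _ hc, mul_pow]
  obtain ⟨b, hb⟩ : ∃ b : Fin (n + 1) → ℝ, b = fun l : Fin (n + 1) =>
    c ^ (n - l : ℕ) * (hermiteH l).eval (hermiteRoot (n + 1) i) / hermiteNorm l := ⟨_, rfl⟩
  have hw : ∀ j, (hermiteNorm n / 2 ^ n / (hermiteH n).eval (hermiteRoot (n + 1) j)) ^ 2 =
      (n + 1) * hermiteNorm n / 4 ^ n / hermiteKernel (n + 1) (hermiteRoot (n + 1) j) := by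
    intro j
    have h1 := hermiteKernel_root n j
    have h2 := eval_hermiteH_root_ne_zero n j
    have h3 := hermiteKernel_pos n.succ_pos (hermiteRoot (n + 1) j)
    have h4 : (4 : ℝ) ^ n = 2 ^ n * 2 ^ n := by rw [← mul_pow]; norm_num
    rw [h4]
    field_simp
    linear_combination hermiteNorm n * h1
  have h1 : ∀ j, (∑ l : Fin (n + 1), c ^ (n - l : ℕ) * (hermiteH l).eval (hermiteRoot (n + 1) i) /
        hermiteNorm l * (hermiteH l).eval (hermiteRoot (n + 1) j)) ^ 2 =
      ∑ l, ∑ m, b l * b m * ((hermiteH l).eval (hermiteRoot (n + 1) j) *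
        (hermiteH m).eval (hermiteRoot (n + 1) j)) := by
    intro j
    rw [sq, Finset.sum_mul_sum]
    refine Finset.sum_congr rfl fun l _ => Finset.sum_congr rfl fun m _ => ?_
    rw [hb]; ring
  simp only [hw, h1]
  have h2 : ∑ j, (n + 1) * hermiteNorm n / 4 ^ n / hermiteKernel (n + 1) (hermiteRoot (n + 1) j) *
      ∑ l, ∑ m, b l * b m * ((hermiteH l).eval (hermiteRoot (n + 1) j) *
        (hermiteH m).eval (hermiteRoot (n + 1) j)) =
      (n + 1) * hermiteNorm n / 4 ^ n * ∑ l, ∑ m, b l * b m *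
        ∑ j, (hermiteH l).eval (hermiteRoot (n + 1) j) *
        (hermiteH m).eval (hermiteRoot (n + 1) j) / hermiteKernel (n + 1) (hermiteRoot (n + 1) j) := by
    simp only [Finset.mul_sum]
    rw [Finset.sum_comm]
    refine Finset.sum_congr rfl fun l _ => ?_
    rw [Finset.sum_comm]
    refine Finset.sum_congr rfl fun m _ => Finset.sum_congr rfl fun j _ => ?_
    ring
  rw [h2, hermiteBracket, Finset.sum_range]
  congr 1
  refine Finset.sum_congr rfl fun l _ => ?_
  simp only [hermite_dual_orthogonality, mul_ite, mul_zero, Finset.sum_ite_eq, Finset.mem_univ,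
    if_true]
  rw [hb]
  have := (hermiteNorm_pos l).ne'
  field_simp
  ring

lemma integral_hermiteBracket (n : ℕ) (z : ℝ) : ∫ τ in (0 : ℝ)..1, hermiteBracket n z τ =
    (n + 1) * hermiteNorm n / 4 ^ n * ∑ l ∈ Finset.range (n + 1),
      (hermiteH l).eval z ^ 2 / hermiteNorm l / (((n + 1 : ℕ) : ℝ) - l) := by
  unfold hermiteBracket
  rw [intervalIntegral.integral_const_mul, intervalIntegral.integral_finsetSum
    (fun l _ => Continuous.intervalIntegrable (by fun_prop) _ _)]
  congr 1
  refine Finset.sum_congr rfl fun l hl => ?_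
  have hln : l ≤ n := by have := Finset.mem_range.1 hl; omega
  rw [intervalIntegral.integral_mul_const, integral_pow, Nat.cast_sub hln]
  push_cast
  rw [show (n : ℝ) - l + 1 = n + 1 - l by ring]
  simp
  ring

lemma prod_root_sub (n : ℕ) (i : Fin (n + 1)) :
    ∏ j ∈ Finset.univ.erase i, (hermiteRoot (n + 1) i - hermiteRoot (n + 1) j) =
      (n + 1) * (hermiteH n).eval (hermiteRoot (n + 1) i) / 2 ^ n := by
  have h := congrArg (fun p => (Polynomial.derivative p).eval (hermiteRoot (n + 1) i))
    (prod_X_sub_hermiteRoot (n + 1))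
  simp only [derivative_hermiteH_succ, Polynomial.derivative_C_mul, Polynomial.derivative_prod_finset]
    at h
  simp only [Polynomial.eval_mul, Polynomial.eval_C, Polynomial.eval_finsetSum,
    Polynomial.derivative_X_sub_C, mul_one, Polynomial.eval_prod, Polynomial.eval_sub,
    Polynomial.eval_X] at h
  rw [Finset.sum_eq_single i (fun j _ hji => Finset.prod_eq_zero (i := i)
    (Finset.mem_erase.2 ⟨hji.symm, Finset.mem_univ _⟩) (sub_self _)) (by simp)] at h
  rw [eq_div_iff (by positivity)]
  rw [pow_succ] at h
  linarith

lemma prod_root_sub_ne_zero (n : ℕ) (i : Fin (n + 1)) :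
    ∏ j ∈ Finset.univ.erase i, (hermiteRoot (n + 1) i - hermiteRoot (n + 1) j) ≠ 0 :=
  Finset.prod_ne_zero_iff.2 fun _ hj => sub_ne_zero.2 fun h =>
    (Finset.ne_of_mem_erase hj) ((hermiteRoot_strictMono _).injective h).symm

lemma hermiteVariance_eq_integral (n : ℕ) (i : Fin (n + 1)) :
    hermiteVariance (n + 1) (hermiteRoot (n + 1) i) =
      (∫ τ in (0 : ℝ)..1, hermiteBracket n (hermiteRoot (n + 1) i) τ) /
        (∏ j ∈ Finset.univ.erase i, (hermiteRoot (n + 1) i - hermiteRoot (n + 1) j)) ^ 2 := by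
  rw [integral_hermiteBracket, prod_root_sub, hermiteVariance]
  have h1 := hermiteKernel_root n i
  have h2 := eval_hermiteH_root_ne_zero n i
  have h3 : 0 < hermiteKernel (n + 1) (hermiteRoot (n + 1) i) := hermiteKernel_pos n.succ_pos _
  have h4 : (4 : ℝ) ^ n = 2 ^ n * 2 ^ n := by rw [← mul_pow]; norm_num
  rw [h4, div_eq_div_iff h3.ne' (by positivity)]
  generalize ∑ l ∈ Finset.range (n + 1), (hermiteH l).eval (hermiteRoot (n + 1) i) ^ 2 /
    hermiteNorm l / (((n + 1 : ℕ) : ℝ) - l) = A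
  field_simp
  linear_combination (-A) * h1

/-! ### The generator on functions of characteristic polynomials -/

open Polynomial in
/-- The polynomial `∏ i ∈ s, (X - x i)`. -/
def rootPoly {N : ℕ} (s : Finset (Fin N)) (x : EuclideanSpace ℝ (Fin N)) : ℝ[X] :=
  ∏ i ∈ s, (X - C (x i))

open Polynomial in
lemma rootPoly_eq_mul_erase {N : ℕ} {s : Finset (Fin N)} (x : EuclideanSpace ℝ (Fin N)) {i : Fin N}
    (hi : i ∈ s) : rootPoly s x = (X - C (x i)) * rootPoly (s.erase i) x :=
  (Finset.mul_prod_erase s _ hi).symm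

open Polynomial in
lemma map_rootPoly_insert {N : ℕ} {s : Finset (Fin N)} (x : EuclideanSpace ℝ (Fin N)) {i : Fin N}
    (hi : i ∉ s) (Λ : ℝ[X] →ₗ[ℝ] ℝ) : Λ (rootPoly (insert i s) x) =
      (Λ ∘ₗ LinearMap.mulLeft ℝ (X : ℝ[X])) (rootPoly s x) - x i * Λ (rootPoly s x) := by
  rw [rootPoly, Finset.prod_insert hi, sub_mul, map_sub, ← smul_eq_C_mul, map_smul]
  rfl

open Polynomial in
lemma contDiff_rootPoly {N : ℕ} (s : Finset (Fin N)) (Λ : ℝ[X] →ₗ[ℝ] ℝ) {n : WithTop ℕ∞} :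
    ContDiff ℝ n (fun x => Λ (rootPoly s x)) := by
  induction s using Finset.induction_on generalizing Λ with
  | empty => simpa [rootPoly] using contDiff_const
  | insert i s hi ih =>
    simp only [map_rootPoly_insert _ hi]
    exact (ih _).sub ((contDiff_euclidean.1 contDiff_id i).mul (ih _))

open Polynomial in
lemma continuous_rootPoly {N : ℕ} {T : Type*} [TopologicalSpace T] (s : Finset (Fin N))
    (Λ : T → ℝ[X] →ₗ[ℝ] ℝ) (hΛ : ∀ p, Continuous fun τ => Λ τ p) :
    Continuous (fun q : T × EuclideanSpace ℝ (Fin N) => Λ q.1 (rootPoly s q.2)) := by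
  induction s using Finset.induction_on generalizing Λ with
  | empty =>
    simp only [rootPoly, Finset.prod_empty]
    exact (hΛ 1).comp continuous_fst
  | insert i s hi ih =>
    simp only [map_rootPoly_insert _ hi]
    refine (ih (fun τ => Λ τ ∘ₗ LinearMap.mulLeft ℝ (X : ℝ[X])) fun p => hΛ (X * p)).sub
      (Continuous.mul ?_ (ih Λ hΛ))
    fun_prop

open Polynomial in
lemma rootPoly_perm {N : ℕ} (σ : Equiv.Perm (Fin N)) (x : EuclideanSpace ℝ (Fin N)) :
    rootPoly Finset.univ (WithLp.toLp 2 (fun i => x (σ i))) = rootPoly Finset.univ x :=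
  Equiv.prod_comp σ (fun i => X - C (x i))

lemma norm_sq_perm {N : ℕ} (σ : Equiv.Perm (Fin N)) (x : EuclideanSpace ℝ (Fin N)) :
    ‖(WithLp.toLp 2 (fun i => x (σ i)) : EuclideanSpace ℝ (Fin N))‖ ^ 2 = ‖x‖ ^ 2 := by
  rw [EuclideanSpace.real_norm_sq_eq, EuclideanSpace.real_norm_sq_eq]
  exact Equiv.sum_comp σ (fun i => x i ^ 2)

/-- The product of a function of a linear statistic of the polynomial `∏ (X - x i)` and a function
of `‖x‖ ^ 2`. -/
def polyTest {N : ℕ} (Λ : Polynomial ℝ →ₗ[ℝ] ℝ) (φ ψ : ℝ → ℝ) (x : EuclideanSpace ℝ (Fin N)) : ℝ :=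
  φ (Λ (rootPoly Finset.univ x)) * ψ (‖x‖ ^ 2)

lemma contDiff_polyTest {N : ℕ} (Λ : Polynomial ℝ →ₗ[ℝ] ℝ) {φ ψ : ℝ → ℝ} {n : WithTop ℕ∞}
    (hφ : ContDiff ℝ n φ) (hψ : ContDiff ℝ n ψ) :
    ContDiff ℝ n (polyTest (N := N) Λ φ ψ) :=
  (hφ.comp (contDiff_rootPoly _ Λ)).mul (hψ.comp (contDiff_norm_sq ℝ))

lemma isPermInvariant_polyTest {N : ℕ} (Λ : Polynomial ℝ →ₗ[ℝ] ℝ) (φ ψ : ℝ → ℝ) :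
    IsPermInvariant (polyTest (N := N) Λ φ ψ) := fun σ x => by
  rw [polyTest, rootPoly_perm, norm_sq_perm]; rfl

lemma rootPoly_erase_line {N : ℕ} (x : EuclideanSpace ℝ (Fin N)) (i : Fin N) (t : ℝ) :
    rootPoly (Finset.univ.erase i) (x + t • EuclideanSpace.single i 1) =
      rootPoly (Finset.univ.erase i) x := by
  refine Finset.prod_congr rfl fun j hj => ?_
  simp [Finset.ne_of_mem_erase hj]

open Polynomial in
lemma map_rootPoly_line {N : ℕ} (Λ : ℝ[X] →ₗ[ℝ] ℝ) (x : EuclideanSpace ℝ (Fin N)) (i : Fin N)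
    (t : ℝ) : Λ (rootPoly Finset.univ (x + t • EuclideanSpace.single i 1)) =
      Λ (rootPoly Finset.univ x) - t * Λ (rootPoly (Finset.univ.erase i) x) := by
  rw [rootPoly_eq_mul_erase _ (Finset.mem_univ i), rootPoly_erase_line,
    rootPoly_eq_mul_erase x (Finset.mem_univ i), ← smul_eq_mul (a := t), ← map_smul, ← map_sub]
  congr 1
  rw [smul_eq_C_mul]
  simp
  ring

lemma norm_sq_line {N : ℕ} (x : EuclideanSpace ℝ (Fin N)) (i : Fin N) (t : ℝ) :
    ‖x + t • EuclideanSpace.single i (1 : ℝ)‖ ^ 2 = ‖x‖ ^ 2 + 2 * t * x i + t ^ 2 := by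
  rw [norm_add_sq_real, inner_smul_right, norm_smul,
    EuclideanSpace.inner_single_right]
  simp
  ring

lemma hasDerivAt_polyTest_line {N : ℕ} (Λ : Polynomial ℝ →ₗ[ℝ] ℝ) {φ ψ : ℝ → ℝ}
    (hφ : Differentiable ℝ φ) (hψ : Differentiable ℝ ψ) (x : EuclideanSpace ℝ (Fin N)) (i : Fin N)
    (t : ℝ) :
    HasDerivAt (fun t : ℝ => φ (Λ (rootPoly Finset.univ (x + t • EuclideanSpace.single i 1))) *
        ψ (‖x + t • EuclideanSpace.single i (1 : ℝ)‖ ^ 2))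
      (deriv φ (Λ (rootPoly Finset.univ (x + t • EuclideanSpace.single i 1))) *
          (-Λ (rootPoly (Finset.univ.erase i) x)) *
          ψ (‖x + t • EuclideanSpace.single i (1 : ℝ)‖ ^ 2) +
        φ (Λ (rootPoly Finset.univ (x + t • EuclideanSpace.single i 1))) *
          (deriv ψ (‖x + t • EuclideanSpace.single i (1 : ℝ)‖ ^ 2) * (2 * (x i + t)))) t := by
  simp only [map_rootPoly_line, norm_sq_line]
  have h1 : HasDerivAt (fun t => Λ (rootPoly Finset.univ x) -
      t * Λ (rootPoly (Finset.univ.erase i) x)) (-Λ (rootPoly (Finset.univ.erase i) x)) t := by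
    simpa using ((hasDerivAt_id t).mul_const (Λ (rootPoly (Finset.univ.erase i) x))).const_sub
      (Λ (rootPoly Finset.univ x))
  have h2 : HasDerivAt (fun t : ℝ => ‖x‖ ^ 2 + 2 * t * x i + t ^ 2) (2 * (x i + t)) t := by
    have := ((((hasDerivAt_id t).const_mul 2).mul_const (x i)).const_add (‖x‖ ^ 2)).add
      ((hasDerivAt_id t).pow 2)
    refine this.congr_deriv ?_
    simp; ring
  have h3 := (hφ (Λ (rootPoly Finset.univ x) -
      t * Λ (rootPoly (Finset.univ.erase i) x))).hasDerivAt.comp t h1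
  have h4 := (hψ (‖x‖ ^ 2 + 2 * t * x i + t ^ 2)).hasDerivAt.comp t h2
  exact h3.mul h4

lemma fderiv_polyTest {N : ℕ} (Λ : Polynomial ℝ →ₗ[ℝ] ℝ) {φ ψ : ℝ → ℝ}
    (hφ : ContDiff ℝ 2 φ) (hψ : ContDiff ℝ 2 ψ) (x : EuclideanSpace ℝ (Fin N)) (i : Fin N) :
    fderiv ℝ (polyTest Λ φ ψ) x (EuclideanSpace.single i 1) =
      deriv φ (Λ (rootPoly Finset.univ x)) * (-Λ (rootPoly (Finset.univ.erase i) x)) *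
          ψ (‖x‖ ^ 2) +
        φ (Λ (rootPoly Finset.univ x)) * (deriv ψ (‖x‖ ^ 2) * (2 * x i)) := by
  have hd : DifferentiableAt ℝ (polyTest Λ φ ψ) x :=
    (contDiff_polyTest Λ hφ hψ).differentiable (by norm_num) x
  have h1 := hd.hasFDerivAt.hasLineDerivAt (EuclideanSpace.single i 1)
  have h2 := hasDerivAt_polyTest_line Λ (hφ.differentiable (by norm_num))
    (hψ.differentiable (by norm_num)) x i 0
  have h3 := HasDerivAt.unique h1 h2
  simpa using h3

lemma iteratedFDeriv_polyTest {N : ℕ} (Λ : Polynomial ℝ →ₗ[ℝ] ℝ) {φ ψ : ℝ → ℝ}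
    (hφ : ContDiff ℝ 2 φ) (hψ : ContDiff ℝ 2 ψ) (x : EuclideanSpace ℝ (Fin N)) (i : Fin N) :
    iteratedFDeriv ℝ 2 (polyTest Λ φ ψ) x
        ![EuclideanSpace.single i 1, EuclideanSpace.single i 1] =
      deriv (deriv φ) (Λ (rootPoly Finset.univ x)) * Λ (rootPoly (Finset.univ.erase i) x) ^ 2 *
          ψ (‖x‖ ^ 2) -
        4 * deriv φ (Λ (rootPoly Finset.univ x)) * deriv ψ (‖x‖ ^ 2) *
          (Λ (rootPoly (Finset.univ.erase i) x) * x i) +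
        φ (Λ (rootPoly Finset.univ x)) *
          (4 * deriv (deriv ψ) (‖x‖ ^ 2) * x i ^ 2 + 2 * deriv ψ (‖x‖ ^ 2)) := by
  have hF := contDiff_polyTest (N := N) Λ hφ hψ
  have hφ' : ContDiff ℝ 1 (deriv φ) := (contDiff_succ_iff_deriv (n := 1)).1 hφ |>.2.2
  have hψ' : ContDiff ℝ 1 (deriv ψ) := (contDiff_succ_iff_deriv (n := 1)).1 hψ |>.2.2
  rw [iteratedFDeriv_two_apply]
  simp only [Matrix.cons_val_zero, Matrix.cons_val_one]
  have hd : DifferentiableAt ℝ (fderiv ℝ (polyTest Λ φ ψ)) x :=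
    ((hF.fderiv_right (m := 1) (by norm_num)).differentiable (by norm_num)) x
  have h1 := hd.hasFDerivAt.hasLineDerivAt (EuclideanSpace.single i 1)
  have h1' : HasDerivAt (fun t : ℝ => fderiv ℝ (polyTest Λ φ ψ)
      (x + t • EuclideanSpace.single i 1) (EuclideanSpace.single i 1))
      (fderiv ℝ (fderiv ℝ (polyTest Λ φ ψ)) x (EuclideanSpace.single i 1)
        (EuclideanSpace.single i 1)) 0 :=
    HasDerivAt.clm_apply h1 (hasDerivAt_const 0 (EuclideanSpace.single i (1 : ℝ))) |>.congr_deriv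
      (by simp)
  simp only [fderiv_polyTest Λ hφ hψ, rootPoly_erase_line] at h1'
  have h2 := (((hasDerivAt_polyTest_line Λ (hφ'.differentiable (by norm_num))
    (hψ.differentiable (by norm_num)) x i 0).mul_const
      (-Λ (rootPoly (Finset.univ.erase i) x))).add
    ((hasDerivAt_polyTest_line Λ (hφ.differentiable (by norm_num))
      (hψ'.differentiable (by norm_num)) x i 0).mul
      (((hasDerivAt_id (0 : ℝ)).const_add (x i)).const_mul 2)))
  have h3 := h1'.unique (h2.congr_of_eventuallyEq (.of_forall fun t => ?_))
  · rw [h3]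
    simp
    ring
  · simp
    ring

open Polynomial in
lemma sum_sum_map_rootPoly {N : ℕ} (Λ : ℝ[X] →ₗ[ℝ] ℝ) {x : EuclideanSpace ℝ (Fin N)}
    (hx : x ∈ openWeylChamberA N) :
    ∑ i : Fin N, (∑ j ∈ Finset.univ.erase i, 1 / (x i - x j)) *
        Λ (rootPoly (Finset.univ.erase i) x) =
      (1 / 2) * Λ (derivative (derivative (rootPoly Finset.univ x))) := by
  have hne : ∀ i j, i ≠ j → x i - x j ≠ 0 := fun i j hij => by
    rcases lt_or_gt_of_ne hij with h | h
    · exact (sub_neg.2 (hx i j h)).ne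
    · exact (sub_pos.2 (hx j i h)).ne'
  have hdd : derivative (derivative (rootPoly Finset.univ x)) =
      ∑ i : Fin N, ∑ j ∈ Finset.univ.erase i, rootPoly ((Finset.univ.erase i).erase j) x := by
    simp only [rootPoly, derivative_prod_finset, derivative_sum, derivative_X_sub_C, mul_one]
  have hA : ∑ i : Fin N, (∑ j ∈ Finset.univ.erase i, 1 / (x i - x j)) *
        Λ (rootPoly (Finset.univ.erase i) x) =
      ∑ i : Fin N, ∑ j : Fin N, if i ≠ j then
        1 / (x i - x j) * Λ (rootPoly (Finset.univ.erase i) x) else 0 := by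
    refine Finset.sum_congr rfl fun i _ => ?_
    rw [Finset.sum_mul, ← Finset.sum_filter]
    refine Finset.sum_congr ?_ fun _ _ => rfl
    ext j; simp [eq_comm]
  have hB : Λ (derivative (derivative (rootPoly Finset.univ x))) =
      ∑ i : Fin N, ∑ j : Fin N, if i ≠ j then
        Λ (rootPoly ((Finset.univ.erase i).erase j) x) else 0 := by
    rw [hdd, map_sum]
    refine Finset.sum_congr rfl fun i _ => ?_
    rw [map_sum, ← Finset.sum_filter]
    refine Finset.sum_congr ?_ fun _ _ => rfl
    ext j; simp [eq_comm]
  have hA' := hA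
  rw [Finset.sum_comm] at hA'
  rw [hB]
  have : ∑ i : Fin N, ∑ j : Fin N, (if i ≠ j then
        Λ (rootPoly ((Finset.univ.erase i).erase j) x) else 0) =
      ∑ i : Fin N, ∑ j : Fin N, (if i ≠ j then
        1 / (x i - x j) * Λ (rootPoly (Finset.univ.erase i) x) else 0) +
      ∑ i : Fin N, ∑ j : Fin N, (if j ≠ i then
        1 / (x j - x i) * Λ (rootPoly (Finset.univ.erase j) x) else 0) := by
    rw [← Finset.sum_add_distrib]
    refine Finset.sum_congr rfl fun i _ => ?_
    rw [← Finset.sum_add_distrib]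
    refine Finset.sum_congr rfl fun j _ => ?_
    by_cases hij : i = j
    · simp [hij]
    have h1 := hne i j hij
    have e : rootPoly (Finset.univ.erase i) x - rootPoly (Finset.univ.erase j) x =
        (x i - x j) • rootPoly ((Finset.univ.erase i).erase j) x := by
      rw [rootPoly_eq_mul_erase (s := Finset.univ.erase i) x (i := j) (by simp [Ne.symm hij]),
        rootPoly_eq_mul_erase (s := Finset.univ.erase j) x (i := i) (by simp [hij]),
        Finset.erase_right_comm (a := j) (b := i), smul_eq_C_mul, C_sub]
      ring
    have e2 : Λ (rootPoly (Finset.univ.erase i) x) - Λ (rootPoly (Finset.univ.erase j) x) =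
        (x i - x j) * Λ (rootPoly ((Finset.univ.erase i).erase j) x) := by
      rw [← map_sub, e, map_smul, smul_eq_mul]
    simp only [ne_eq, hij, Ne.symm hij, not_false_eq_true, if_true]
    rw [← neg_sub (x i) (x j), one_div, one_div, inv_neg]
    field_simp
    linarith
  rw [this, ← hA, ← hA']
  ring

lemma sum_sum_coord {N : ℕ} {x : EuclideanSpace ℝ (Fin N)} (hx : x ∈ openWeylChamberA N) :
    ∑ i : Fin N, (∑ j ∈ Finset.univ.erase i, 1 / (x i - x j)) * x i =
      (N : ℝ) * (N - 1) / 2 := by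
  have hne : ∀ i j, i ≠ j → x i - x j ≠ 0 := fun i j hij => by
    rcases lt_or_gt_of_ne hij with h | h
    · exact (sub_neg.2 (hx i j h)).ne
    · exact (sub_pos.2 (hx j i h)).ne'
  have hA : ∑ i : Fin N, (∑ j ∈ Finset.univ.erase i, 1 / (x i - x j)) * x i =
      ∑ i : Fin N, ∑ j : Fin N, if i ≠ j then 1 / (x i - x j) * x i else 0 := by
    refine Finset.sum_congr rfl fun i _ => ?_
    rw [Finset.sum_mul, ← Finset.sum_filter]
    refine Finset.sum_congr ?_ fun _ _ => rfl
    ext j; simp [eq_comm]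
  have hA' := hA
  rw [Finset.sum_comm] at hA'
  have hC : ∑ i : Fin N, ∑ j : Fin N, (if i ≠ j then (1 : ℝ) else 0) = (N : ℝ) * (N - 1) := by
    have : ∀ i : Fin N, ∑ j : Fin N, (if i ≠ j then (1 : ℝ) else 0) = N - 1 := fun i => by
      have : ∀ j : Fin N, (if i ≠ j then (1 : ℝ) else 0) = 1 - if i = j then 1 else 0 := by
        intro j; split_ifs <;> simp_all
      simp [this]
    simp_rw [this]
    simp
    ring
  have : ∑ i : Fin N, ∑ j : Fin N, (if i ≠ j then (1 : ℝ) else 0) =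
      ∑ i : Fin N, ∑ j : Fin N, (if i ≠ j then 1 / (x i - x j) * x i else 0) +
      ∑ i : Fin N, ∑ j : Fin N, (if j ≠ i then 1 / (x j - x i) * x j else 0) := by
    rw [← Finset.sum_add_distrib]
    refine Finset.sum_congr rfl fun i _ => ?_
    rw [← Finset.sum_add_distrib]
    refine Finset.sum_congr rfl fun j _ => ?_
    by_cases hij : i = j
    · simp [hij]
    have h1 := hne i j hij
    simp only [ne_eq, hij, Ne.symm hij, not_false_eq_true, if_true]
    rw [← neg_sub (x i) (x j), one_div, one_div, inv_neg]
    field_simp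
    ring
  rw [hC, ← hA', ← hA] at this
  linarith

/-- The continuous extension of `L (polyTest Λ φ ψ) / (2 k)`. -/
def polyTestGen {N : ℕ} (k : ℝ) (Λ : Polynomial ℝ →ₗ[ℝ] ℝ) (φ ψ : ℝ → ℝ)
    (x : EuclideanSpace ℝ (Fin N)) : ℝ :=
  1 / (4 * k) * (deriv (deriv φ) (Λ (rootPoly Finset.univ x)) *
      (∑ i, Λ (rootPoly (Finset.univ.erase i) x) ^ 2) * ψ (‖x‖ ^ 2) -
    4 * deriv φ (Λ (rootPoly Finset.univ x)) * deriv ψ (‖x‖ ^ 2) *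
      (∑ i, Λ (rootPoly (Finset.univ.erase i) x) * x i) +
    φ (Λ (rootPoly Finset.univ x)) *
      (4 * deriv (deriv ψ) (‖x‖ ^ 2) * ‖x‖ ^ 2 + 2 * N * deriv ψ (‖x‖ ^ 2))) -
  1 / 4 * Λ (Polynomial.derivative (Polynomial.derivative (rootPoly Finset.univ x))) *
    deriv φ (Λ (rootPoly Finset.univ x)) * ψ (‖x‖ ^ 2) +
  (N : ℝ) * (N - 1) / 2 * φ (Λ (rootPoly Finset.univ x)) * deriv ψ (‖x‖ ^ 2)

lemma besselOperatorA_polyTest {N : ℕ} {k : ℝ} (hk : 0 < k) (Λ : Polynomial ℝ →ₗ[ℝ] ℝ)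
    {φ ψ : ℝ → ℝ} (hφ : ContDiff ℝ 2 φ) (hψ : ContDiff ℝ 2 ψ) {x : EuclideanSpace ℝ (Fin N)}
    (hx : x ∈ openWeylChamberA N) :
    1 / (2 * k) * besselOperatorA k (polyTest Λ φ ψ) x = polyTestGen k Λ φ ψ x := by
  rw [besselOperatorA, InnerProductSpace.laplacian_eq_iteratedFDeriv_orthonormalBasis _
    (EuclideanSpace.basisFun (Fin N) ℝ)]
  simp only [EuclideanSpace.basisFun_apply, iteratedFDeriv_polyTest Λ hφ hψ,
    fderiv_polyTest Λ hφ hψ]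
  have e1 := sum_sum_map_rootPoly Λ hx
  have e2 := sum_sum_coord hx
  have e3 := EuclideanSpace.real_norm_sq_eq x
  rw [polyTestGen]
  generalize deriv (deriv φ) (Λ (rootPoly Finset.univ x)) = φ2 at *
  generalize deriv φ (Λ (rootPoly Finset.univ x)) = φ1 at *
  generalize φ (Λ (rootPoly Finset.univ x)) = φ0 at *
  generalize deriv (deriv ψ) (‖x‖ ^ 2) = ψ2 at *
  generalize deriv ψ (‖x‖ ^ 2) = ψ1 at *
  generalize ψ (‖x‖ ^ 2) = ψ0 at *
  generalize ‖x‖ ^ 2 = V at *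
  generalize Λ (Polynomial.derivative (Polynomial.derivative (rootPoly Finset.univ x))) = D at *
  obtain ⟨m, hm⟩ : ∃ m : Fin N → ℝ, ∀ i, Λ (rootPoly (Finset.univ.erase i) x) = m i :=
    ⟨_, fun _ => rfl⟩
  obtain ⟨b, hb⟩ : ∃ b : Fin N → ℝ, ∀ i, ∑ j ∈ Finset.univ.erase i, 1 / (x i - x j) = b i :=
    ⟨_, fun _ => rfl⟩
  simp only [hm, hb] at e1 e2 ⊢
  have s1 : ∑ i, (φ2 * m i ^ 2 * ψ0 - 4 * φ1 * ψ1 * (m i * x i) +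
      φ0 * (4 * ψ2 * x i ^ 2 + 2 * ψ1)) = φ2 * (∑ i, m i ^ 2) * ψ0 -
      4 * φ1 * ψ1 * (∑ i, m i * x i) + φ0 * (4 * ψ2 * V + 2 * N * ψ1) := by
    simp only [e3, Finset.sum_add_distrib, Finset.sum_sub_distrib, ← Finset.mul_sum,
      ← Finset.sum_mul, Finset.sum_const, Finset.card_univ, Fintype.card_fin, nsmul_eq_mul]
    ring
  have s2 : ∑ i, b i * (φ1 * -m i * ψ0 + φ0 * (ψ1 * (2 * x i))) =
      -φ1 * ψ0 * (∑ i, b i * m i) + 2 * φ0 * ψ1 * ∑ i, b i * x i := by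
    simp only [Finset.mul_sum, ← Finset.sum_add_distrib]
    exact Finset.sum_congr rfl fun i _ => by ring
  rw [s1, s2, e1, e2]
  field_simp
  ring

/-! ### Dynkin's formula for the rescaled Bessel process -/

/-- A continuous process in the Weyl chamber that satisfies Dynkin's formula for the operator
`L / (2 k)` with start in `0`. -/
structure IsScaledBessel (N : ℕ) (k : ℝ) {Ω : Type*} [MeasurableSpace Ω] (P : Measure Ω)
    (U : ℝ → Ω → EuclideanSpace ℝ (Fin N)) : Prop where
  measurable : ∀ τ, Measurable (U τ)
  continuous_paths : ∀ ω, Continuous fun τ => U τ ω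
  mem_chamber : ∀ τ ω, U τ ω ∈ weylChamberA N
  dynkin : ∀ F G : EuclideanSpace ℝ (Fin N) → ℝ,
    ContDiff ℝ (⊤ : ℕ∞) F → HasCompactSupport F → IsPermInvariant F →
    Continuous G → HasCompactSupport G →
    Set.EqOn G (fun x => 1 / (2 * k) * besselOperatorA k F x) (openWeylChamberA N) →
    ∀ τ, 0 ≤ τ → ∫ ω, F (U τ ω) ∂P = F 0 + ∫ σ in (0 : ℝ)..τ, ∫ ω, G (U σ ω) ∂P

lemma besselOperatorA_comp_smul {N : ℕ} (k : ℝ) {F : EuclideanSpace ℝ (Fin N) → ℝ}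
    (hF : ContDiff ℝ 2 F) {a : ℝ} (ha : a ≠ 0) (x : EuclideanSpace ℝ (Fin N)) :
    besselOperatorA k (fun x => F (a • x)) x = a ^ 2 * besselOperatorA k F (a • x) := by
  have hfd : fderiv ℝ (fun x => F (a • x)) = fun x => a • fderiv ℝ F (a • x) :=
    funext fun x => fderiv_comp_smul a
  have hfd2 : ∀ u v, fderiv ℝ (fderiv ℝ (fun x => F (a • x))) x u v =
      a ^ 2 * fderiv ℝ (fderiv ℝ F) (a • x) u v := by
    intro u v
    have hd : DifferentiableAt ℝ (fun x => fderiv ℝ F (a • x)) x := by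
      have : Differentiable ℝ (fderiv ℝ F) :=
        (hF.fderiv_right (m := 1) (by norm_num)).differentiable (by norm_num)
      exact (this (a • x)).comp x (differentiableAt_id.const_smul a)
    rw [hfd, fderiv_fun_const_smul hd, fderiv_comp_smul (f := fderiv ℝ F) a]
    simp only [_root_.smul_apply, smul_eq_mul]
    ring
  rw [besselOperatorA, besselOperatorA,
    InnerProductSpace.laplacian_eq_iteratedFDeriv_orthonormalBasis _
      (EuclideanSpace.basisFun (Fin N) ℝ),
    InnerProductSpace.laplacian_eq_iteratedFDeriv_orthonormalBasis _
      (EuclideanSpace.basisFun (Fin N) ℝ)]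
  simp only [iteratedFDeriv_two_apply, hfd2, Matrix.cons_val_zero, Matrix.cons_val_one]
  simp only [hfd]
  rw [mul_add, mul_left_comm (a ^ 2) k]
  congr 1
  · rw [← Finset.mul_sum]
    ring
  · congr 1
    rw [Finset.mul_sum Finset.univ _ (a ^ 2)]
    refine Finset.sum_congr rfl fun i _ => ?_
    have : ∀ j, 1 / (x i - x j) = a * (1 / ((a • x) i - (a • x) j)) := fun j => by
      simp only [PiLp.smul_apply, smul_eq_mul, ← mul_sub]
      rw [one_div, one_div, mul_inv, mul_inv_cancel_left₀ ha]
    simp only [this, ← Finset.mul_sum, _root_.smul_apply, smul_eq_mul]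
    ring

lemma smul_mem_openWeylChamberA {N : ℕ} {a : ℝ} (ha : 0 < a) {x : EuclideanSpace ℝ (Fin N)}
    (hx : x ∈ openWeylChamberA N) : a • x ∈ openWeylChamberA N := fun i j hij => by
  simpa using mul_lt_mul_of_pos_left (hx i j hij) ha

lemma smul_mem_weylChamberA {N : ℕ} {a : ℝ} (ha : 0 ≤ a) {x : EuclideanSpace ℝ (Fin N)}
    (hx : x ∈ weylChamberA N) : a • x ∈ weylChamberA N := fun i j hij => by
  simpa using mul_le_mul_of_nonneg_left (hx i j hij) ha

lemma IsBesselProcessA.measurable {N : ℕ} {k : ℝ} {Ω : Type*} [MeasurableSpace Ω] {P : Measure Ω}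
    {X : ℝ≥0 → Ω → EuclideanSpace ℝ (Fin N)} (hX : IsBesselProcessA N k P X) (t : ℝ≥0) :
    Measurable (X t) := by
  obtain ⟨ℱ, had, -⟩ := hX.martingale_problem
  exact ((had t).mono (ℱ.le t)).measurable

lemma exists_bound_of_hasCompactSupport {E : Type*} [TopologicalSpace E] {f : E → ℝ}
    (hf : Continuous f) (hc : HasCompactSupport f) : ∃ C, ∀ x, ‖f x‖ ≤ C := by
  obtain ⟨C, hC⟩ := hc.exists_bound_of_continuous hf
  exact ⟨C, hC⟩

lemma IsBesselProcessA.integral_eq {N : ℕ} {k : ℝ} {Ω : Type*} [MeasurableSpace Ω] {P : Measure Ω}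
    [IsProbabilityMeasure P] {X : ℝ≥0 → Ω → EuclideanSpace ℝ (Fin N)}
    (hX : IsBesselProcessA N k P X) {f g : EuclideanSpace ℝ (Fin N) → ℝ}
    (hf : ContDiff ℝ (⊤ : ℕ∞) f) (hfc : HasCompactSupport f) (hfp : IsPermInvariant f)
    (hg : Continuous g) (hgc : HasCompactSupport g)
    (hfg : Set.EqOn g (besselOperatorA k f) (openWeylChamberA N)) (t : ℝ≥0) :
    ∫ ω, f (X t ω) ∂P = f 0 + ∫ s in (0 : ℝ)..t, ∫ ω, g (X s.toNNReal ω) ∂P := by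
  have hm := hX.measurable
  obtain ⟨ℱ, had, hM⟩ := hX.martingale_problem
  have hM := hM f g hf hfc hfp hg hfg
  have h1 := hM.setIntegral_eq (zero_le (a := t)) MeasurableSet.univ
  simp only [setIntegral_univ] at h1
  obtain ⟨Cf, hCf⟩ := exists_bound_of_hasCompactSupport hf.continuous hfc
  obtain ⟨Cg, hCg⟩ := exists_bound_of_hasCompactSupport hg hgc
  have h0 : ∫ ω, (f (X 0 ω) - ∫ s in (0 : ℝ)..((0 : ℝ≥0) : ℝ), g (X s.toNNReal ω)) ∂P = f 0 := by
    have : (fun ω => f (X 0 ω) - ∫ s in (0 : ℝ)..((0 : ℝ≥0) : ℝ), g (X s.toNNReal ω)) =ᵐ[P]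
        fun _ => f 0 := by
      filter_upwards [hX.start_zero] with ω hω
      simp [hω]
    rw [integral_congr_ae this]
    simp
  have hjoint : Measurable (Function.uncurry fun (s : ℝ) ω => g (X s.toNNReal ω)) :=
    hg.measurable.comp (measurable_uncurry_of_continuous_of_measurable
      (u := fun (s : ℝ) ω => X s.toNNReal ω)
      (fun ω => (hX.continuous_paths ω).comp continuous_real_toNNReal) fun s => hm _)
  have : IsFiniteMeasure (volume.restrict (Set.uIoc (0 : ℝ) t)) := ⟨by simp [Set.uIoc]⟩
  have hint : Integrable (Function.uncurry fun (s : ℝ) ω => g (X s.toNNReal ω))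
      ((volume.restrict (Set.uIoc (0 : ℝ) t)).prod P) :=
    Integrable.of_bound hjoint.aestronglyMeasurable Cg (.of_forall fun _ => hCg _)
  have hswap := intervalIntegral_integral_swap hint
  have hfi : Integrable (fun ω => f (X t ω)) P :=
    Integrable.of_bound (hf.continuous.measurable.comp (hm t)).aestronglyMeasurable Cf
      (.of_forall fun _ => hCf _)
  have hgi : Integrable (fun ω => ∫ s in (0 : ℝ)..t, g (X s.toNNReal ω)) P := by
    have := hint.integral_prod_right
    simpa [intervalIntegral.integral_of_le, Set.uIoc_of_le] using this
  rw [h0, integral_sub hfi hgi] at h1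
  rw [hswap]
  linarith

/-- The rescaled process `X (T τ) / √(2 k T)`. -/
def scaledProcess {N : ℕ} {Ω : Type*} (X : ℝ≥0 → Ω → EuclideanSpace ℝ (Fin N)) (k T : ℝ) (τ : ℝ)
    (ω : Ω) : EuclideanSpace ℝ (Fin N) :=
  (√(2 * k * T))⁻¹ • X (T * τ).toNNReal ω

lemma IsBesselProcessA.isScaledBessel {N : ℕ} {k T : ℝ} (hk : 0 < k) (hT : 0 < T) {Ω : Type*}
    [MeasurableSpace Ω] {P : Measure Ω} [IsProbabilityMeasure P]
    {X : ℝ≥0 → Ω → EuclideanSpace ℝ (Fin N)} (hX : IsBesselProcessA N k P X) :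
    IsScaledBessel N k P (scaledProcess X k T) := by
  have hpos : 0 < (√(2 * k * T))⁻¹ := by positivity
  have hsq : ((√(2 * k * T))⁻¹) ^ 2 = (2 * k * T)⁻¹ := by
    rw [inv_pow, Real.sq_sqrt (by positivity)]
  refine ⟨fun τ => (hX.measurable (T * τ).toNNReal).const_smul (√(2 * k * T))⁻¹, fun ω => ?_, fun τ ω =>
    smul_mem_weylChamberA hpos.le (hX.mem_chamber _ ω), ?_⟩
  · have h : Continuous fun τ : ℝ => X (T * τ).toNNReal ω :=
      (hX.continuous_paths ω).comp
        (continuous_real_toNNReal.comp (continuous_const.mul continuous_id))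
    exact h.const_smul (√(2 * k * T))⁻¹
  intro F G hF hFc hFp hG hGc hFG τ hτ
  unfold scaledProcess
  obtain ⟨a, ha⟩ : ∃ a, a = (√(2 * k * T))⁻¹ := ⟨_, rfl⟩
  rw [← ha] at hpos hsq ⊢
  have h1 := hX.integral_eq (f := fun x => F (a • x)) (g := fun x => T⁻¹ * G (a • x))
    (hF.comp (contDiff_const_smul a)) (hFc.comp_smul hpos.ne')
    (fun σ x => hFp σ (a • x)) (by fun_prop) ((hGc.comp_smul hpos.ne').mul_left)
    (fun x hx => by
      beta_reduce
      rw [besselOperatorA_comp_smul k (by exact_mod_cast contDiff_infty.1 hF 2) hpos.ne',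
        hFG (smul_mem_openWeylChamberA hpos hx), hsq]
      field_simp) (T * τ).toNNReal
  rw [Real.coe_toNNReal _ (by positivity)] at h1
  rw [h1]
  simp only [smul_zero, integral_const_mul, intervalIntegral.integral_const_mul]
  have h2 := intervalIntegral.smul_integral_comp_mul_left (a := 0) (b := τ)
    (fun s => ∫ ω, G (a • X s.toNNReal ω) ∂P) T
  rw [mul_zero] at h2
  rw [← h2, smul_eq_mul, inv_mul_cancel_left₀ hT.ne']

section TimeDependent

variable {N : ℕ} {k : ℝ} {Ω : Type*} [MeasurableSpace Ω] {P : Measure Ω}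
  {U : ℝ → Ω → EuclideanSpace ℝ (Fin N)}

lemma exists_local_bound {E : Type*} [TopologicalSpace E] {H : ℝ → E → ℝ}
    (hH : Continuous (Function.uncurry H)) {K : Set E} (hK : IsCompact K)
    (hHK : ∀ τ, ∀ x ∉ K, H τ x = 0) (τ₀ : ℝ) :
    ∃ C, ∀ τ ∈ Set.Icc (τ₀ - 1) (τ₀ + 1), ∀ x, ‖H τ x‖ ≤ C := by
  obtain ⟨C, hC⟩ := ((isCompact_Icc (a := τ₀ - 1) (b := τ₀ + 1)).prod hK).exists_bound_of_continuousOn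
    hH.continuousOn
  refine ⟨max C 0, fun τ hτ x => ?_⟩
  by_cases hx : x ∈ K
  · exact (hC (τ, x) ⟨hτ, hx⟩).trans (le_max_left _ _)
  · rw [hHK τ x hx, norm_zero]; exact le_max_right _ _

lemma IsScaledBessel.aestronglyMeasurable (hU : IsScaledBessel N k P U)
    {h : EuclideanSpace ℝ (Fin N) → ℝ} (hh : Continuous h) (σ : ℝ) :
    AEStronglyMeasurable (fun ω => h (U σ ω)) P :=
  (hh.measurable.comp (hU.measurable σ)).aestronglyMeasurable

variable [IsProbabilityMeasure P]

lemma IsScaledBessel.continuous_integral (hU : IsScaledBessel N k P U)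
    {H : ℝ → EuclideanSpace ℝ (Fin N) → ℝ} (hH : Continuous (Function.uncurry H))
    {K : Set (EuclideanSpace ℝ (Fin N))} (hK : IsCompact K) (hHK : ∀ τ, ∀ x ∉ K, H τ x = 0) :
    Continuous fun q : ℝ × ℝ => ∫ ω, H q.1 (U q.2 ω) ∂P := by
  rw [continuous_iff_continuousAt]
  intro q
  obtain ⟨C, hC⟩ := exists_local_bound hH hK hHK q.1
  have hHτ : ∀ τ, Continuous (H τ) := fun τ => hH.comp (by fun_prop : Continuous fun x => (τ, x))
  refine continuousAt_of_dominated (bound := fun _ => C)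
    (.of_forall fun p => hU.aestronglyMeasurable (hHτ _) _) ?_ (integrable_const _)
    (.of_forall fun ω => ?_)
  · have : ∀ᶠ p : ℝ × ℝ in 𝓝 q, p.1 ∈ Set.Icc (q.1 - 1) (q.1 + 1) :=
      continuous_fst.continuousAt.eventually (Icc_mem_nhds (by linarith) (by linarith))
    filter_upwards [this] with p hp
    exact .of_forall fun ω => hC _ hp _
  · have := hU.continuous_paths ω
    exact (hH.comp (by fun_prop : Continuous fun p : ℝ × ℝ => (p.1, U p.2 ω))).continuousAt

lemma IsScaledBessel.dynkin_time (hU : IsScaledBessel N k P U)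
    {F F' G : ℝ → EuclideanSpace ℝ (Fin N) → ℝ} {K : Set (EuclideanSpace ℝ (Fin N))}
    (hK : IsCompact K) (hF : ∀ τ, ContDiff ℝ (⊤ : ℕ∞) (F τ)) (hFp : ∀ τ, IsPermInvariant (F τ))
    (hFc : Continuous (Function.uncurry F))
    (hF'c : Continuous (Function.uncurry F')) (hGc : Continuous (Function.uncurry G))
    (hFK : ∀ τ, ∀ x ∉ K, F τ x = 0) (hF'K : ∀ τ, ∀ x ∉ K, F' τ x = 0)
    (hGK : ∀ τ, ∀ x ∉ K, G τ x = 0) (hFF' : ∀ τ x, HasDerivAt (fun τ => F τ x) (F' τ x) τ)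
    (hFG : ∀ τ, Set.EqOn (G τ) (fun x => 1 / (2 * k) * besselOperatorA k (F τ) x)
      (openWeylChamberA N)) {s : ℝ} (hs : 0 ≤ s) :
    ∫ ω, F s (U s ω) ∂P = F 0 0 + ∫ τ in (0 : ℝ)..s, ∫ ω, (F' τ (U τ ω) + G τ (U τ ω)) ∂P := by
  have cF := hU.continuous_integral hFc hK hFK
  have cF' := hU.continuous_integral hF'c hK hF'K
  have cG := hU.continuous_integral hGc hK hGK
  have hdyn : ∀ τ σ, 0 ≤ σ → ∫ ω, F τ (U σ ω) ∂P =
      F τ 0 + ∫ σ' in (0 : ℝ)..σ, ∫ ω, G τ (U σ' ω) ∂P := fun τ σ hσ =>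
    hU.dynkin (F τ) (G τ) (hF τ) (HasCompactSupport.intro hK (hFK τ)) (hFp τ)
      (hGc.comp (by fun_prop : Continuous fun x => (τ, x)))
      (HasCompactSupport.intro hK (hGK τ)) (hFG τ) σ hσ
  have d1 : ∀ τ σ, HasDerivAt (fun τ => ∫ ω, F τ (U σ ω) ∂P) (∫ ω, F' τ (U σ ω) ∂P) τ := by
    intro τ σ
    obtain ⟨C, hC⟩ := exists_local_bound hF'c hK hF'K τ
    obtain ⟨C', hC'⟩ := exists_local_bound hFc hK hFK τ
    refine (hasDerivAt_integral_of_dominated_loc_of_deriv_le (bound := fun _ => C)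
      (Icc_mem_nhds (show τ - 1 < τ by linarith) (show τ < τ + 1 by linarith))
      (.of_forall fun τ' => hU.aestronglyMeasurable (hF τ').continuous σ) ?_
      (hU.aestronglyMeasurable (hF'c.comp (by fun_prop : Continuous fun x => (τ, x))) σ)
      (.of_forall fun ω τ' hτ' => hC τ' hτ' _) (integrable_const _)
      (.of_forall fun ω τ' _ => hFF' τ' _)).2
    exact Integrable.of_bound (hU.aestronglyMeasurable (hF τ).continuous σ) C'
      (.of_forall fun ω => hC' τ ⟨by linarith, by linarith⟩ _)
  have d2 : ∀ τ σ, 0 < σ → HasDerivAt (fun σ => ∫ ω, F τ (U σ ω) ∂P) (∫ ω, G τ (U σ ω) ∂P) σ := by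
    intro τ σ hσ
    have hc : Continuous fun σ => ∫ ω, G τ (U σ ω) ∂P :=
      cG.comp (by fun_prop : Continuous fun σ : ℝ => (τ, σ))
    have := (intervalIntegral.integral_hasDerivAt_right (hc.intervalIntegrable 0 σ)
      hc.stronglyMeasurable.stronglyMeasurableAtFilter hc.continuousAt).const_add (F τ 0)
    refine this.congr_of_eventuallyEq ?_
    filter_upwards [lt_mem_nhds hσ] with σ' hσ'
    exact hdyn τ σ' hσ'.le
  have hmain : ∀ τ ∈ Set.Ioo (0 : ℝ) s, HasDerivAt (fun τ => ∫ ω, F τ (U τ ω) ∂P)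
      ((∫ ω, F' τ (U τ ω) ∂P) + ∫ ω, G τ (U τ ω) ∂P) τ := by
    intro τ hτ
    have h := hasStrictFDerivAt_uncurry_coprod (𝕜 := ℝ) (u := (τ, τ))
      (f := fun τ σ => ∫ ω, F τ (U σ ω) ∂P)
      (f₁ := fun τ σ => ContinuousLinearMap.toSpanSingleton ℝ (∫ ω, F' τ (U σ ω) ∂P))
      (f₂ := fun τ σ => ContinuousLinearMap.toSpanSingleton ℝ (∫ ω, G τ (U σ ω) ∂P))
      (.of_forall fun v => (d1 v.1 v.2).hasFDerivAt)
      (by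
        have : ∀ᶠ v : ℝ × ℝ in 𝓝 (τ, τ), 0 < v.2 :=
          continuous_snd.continuousAt.eventually (lt_mem_nhds hτ.1)
        filter_upwards [this] with v hv
        exact (d2 v.1 v.2 hv).hasFDerivAt)
      ((ContinuousLinearMap.toSpanSingletonCLE (𝕜 := ℝ) (E := ℝ)).continuous.comp cF').continuousAt
      ((ContinuousLinearMap.toSpanSingletonCLE (𝕜 := ℝ) (E := ℝ)).continuous.comp cG).continuousAt
    have h1 : HasDerivAt (fun τ : ℝ => (τ, τ)) ((1 : ℝ), (1 : ℝ)) τ :=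
      (hasDerivAt_id τ).prodMk (hasDerivAt_id τ)
    have h2 := HasFDerivAt.comp_hasDerivAt (f := fun τ : ℝ => (τ, τ)) τ h.hasFDerivAt h1
    refine h2.congr_deriv ?_
    simp [Function.HasUncurry.uncurry]
  have hcd : ∀ {Φ : ℝ × ℝ → ℝ}, Continuous Φ → Continuous fun τ => Φ (τ, τ) := fun h =>
    h.comp (by fun_prop)
  have hfin := intervalIntegral.integral_eq_sub_of_hasDerivAt_of_le hs (hcd cF).continuousOn hmain
    (((hcd cF').add (hcd cG)).intervalIntegrable 0 s)
  have h00 := hdyn 0 0 le_rfl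
  rw [intervalIntegral.integral_same, add_zero] at h00
  rw [h00] at hfin
  have hsum : ∀ τ, ∫ ω, (F' τ (U τ ω) + G τ (U τ ω)) ∂P =
      (∫ ω, F' τ (U τ ω) ∂P) + ∫ ω, G τ (U τ ω) ∂P := by
    intro τ
    obtain ⟨C, hC⟩ := exists_local_bound hF'c hK hF'K τ
    obtain ⟨C', hC'⟩ := exists_local_bound hGc hK hGK τ
    have hτ : τ ∈ Set.Icc (τ - 1) (τ + 1) := ⟨by linarith, by linarith⟩
    exact integral_add
      (Integrable.of_bound (hU.aestronglyMeasurable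
        (hF'c.comp (by fun_prop : Continuous fun x => (τ, x))) τ) C (.of_forall fun ω => hC τ hτ _))
      (Integrable.of_bound (hU.aestronglyMeasurable
        (hGc.comp (by fun_prop : Continuous fun x => (τ, x))) τ) C' (.of_forall fun ω => hC' τ hτ _))
  simp only [hsum, hfin]
  ring

end TimeDependent

/-! ### The expectation of functions of the heat-evolved characteristic polynomial -/

/-- A smooth cutoff function that is `1` on `(-∞, R]` and `0` on `[2 R, ∞)`. -/
def cutoff (R v : ℝ) : ℝ := Real.smoothTransition (2 - R⁻¹ * v)

lemma contDiff_cutoff (R : ℝ) {n : ℕ∞} : ContDiff ℝ n (cutoff R) :=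
  Real.smoothTransition.contDiff.comp (by fun_prop)

lemma cutoff_nonneg (R v : ℝ) : 0 ≤ cutoff R v := Real.smoothTransition.nonneg _

lemma cutoff_le_one (R v : ℝ) : cutoff R v ≤ 1 := Real.smoothTransition.le_one _

lemma abs_cutoff_le_one (R v : ℝ) : |cutoff R v| ≤ 1 := by
  rw [abs_of_nonneg (cutoff_nonneg R v)]; exact cutoff_le_one R v

lemma cutoff_zero (R : ℝ) : cutoff R 0 = 1 :=
  Real.smoothTransition.one_of_one_le (by norm_num)

lemma cutoff_eq_zero {R v : ℝ} (hR : 0 < R) (hv : 2 * R ≤ v) : cutoff R v = 0 := by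
  refine Real.smoothTransition.zero_of_nonpos ?_
  rw [sub_nonpos, ← div_eq_inv_mul, le_div_iff₀ hR]
  exact hv

lemma cutoff_eventuallyEq {R v : ℝ} (hR : 0 < R) (hv : 2 * R < v) : cutoff R =ᶠ[𝓝 v] fun _ => 0 := by
  filter_upwards [lt_mem_nhds hv] with w hw
  exact cutoff_eq_zero hR hw.le

lemma deriv_cutoff_eq_zero {R v : ℝ} (hR : 0 < R) (hv : 2 * R < v) : deriv (cutoff R) v = 0 := by
  rw [(cutoff_eventuallyEq hR hv).deriv_eq, deriv_const]

lemma deriv_deriv_cutoff_eq_zero {R v : ℝ} (hR : 0 < R) (hv : 2 * R < v) :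
    deriv (deriv (cutoff R)) v = 0 := by
  have : deriv (cutoff R) =ᶠ[𝓝 v] fun _ => 0 := by
    filter_upwards [lt_mem_nhds hv] with w hw
    exact deriv_cutoff_eq_zero hR hw
  rw [this.deriv_eq, deriv_const]

lemma continuous_deriv_cutoff (R : ℝ) : Continuous (deriv (cutoff R)) :=
  (contDiff_cutoff R (n := 1)).continuous_deriv le_rfl

lemma continuous_deriv_deriv_cutoff (R : ℝ) : Continuous (deriv (deriv (cutoff R))) := by
  have h2 : ContDiff ℝ 2 (cutoff R) := contDiff_cutoff R (n := 2)
  have : ContDiff ℝ 1 (deriv (cutoff R)) :=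
    (contDiff_succ_iff_deriv (n := 1)).1 h2 |>.2.2
  exact this.continuous_deriv le_rfl

lemma exists_abs_deriv_cutoff_le : ∃ B, 0 ≤ B ∧ ∀ R, 0 < R → ∀ v, |deriv (cutoff R) v| ≤ B / R := by
  have hc : Continuous (deriv Real.smoothTransition) :=
    (Real.smoothTransition.contDiff (n := 1)).continuous_deriv le_rfl
  obtain ⟨B, hB⟩ := (isCompact_Icc (a := (0 : ℝ)) (b := 1)).exists_bound_of_continuousOn
    hc.continuousOn
  have hB0 : 0 ≤ B := (norm_nonneg _).trans (hB 0 (by simp))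
  have hB' : ∀ w, |deriv Real.smoothTransition w| ≤ B := by
    intro w
    by_cases hw : w ∈ Set.Icc (0 : ℝ) 1
    · exact hB w hw
    · rw [Set.mem_Icc, not_and_or, not_le, not_le] at hw
      have : deriv Real.smoothTransition w = 0 := by
        rcases hw with hw | hw
        · have : Real.smoothTransition =ᶠ[𝓝 w] fun _ => 0 := by
            filter_upwards [gt_mem_nhds hw] with u hu
            exact Real.smoothTransition.zero_of_nonpos hu.le
          rw [this.deriv_eq, deriv_const]
        · have : Real.smoothTransition =ᶠ[𝓝 w] fun _ => 1 := by
            filter_upwards [lt_mem_nhds hw] with u hu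
            exact Real.smoothTransition.one_of_one_le hu.le
          rw [this.deriv_eq, deriv_const]
      rw [this, abs_zero]; exact hB0
  refine ⟨B, hB0, fun R hR v => ?_⟩
  have h1 : HasDerivAt (fun v => 2 - R⁻¹ * v) (-R⁻¹) v := by
    simpa using ((hasDerivAt_id v).const_mul R⁻¹).const_sub 2
  have hd : DifferentiableAt ℝ Real.smoothTransition (2 - R⁻¹ * v) :=
    (Real.smoothTransition.contDiff (n := 1)).differentiable (by norm_num) _
  have h2 := hd.hasDerivAt.comp v h1
  have h3 : deriv (cutoff R) v = _ := h2.deriv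
  rw [h3, abs_mul, abs_neg, abs_of_pos (inv_pos.2 hR), ← div_eq_mul_inv]
  exact div_le_div_of_nonneg_right (hB' _) hR.le

section

variable {N : ℕ}

lemma continuous_heatEval (s y : ℝ) (p : Polynomial ℝ) :
    Continuous fun τ => heatEval (s - τ) y p := by
  have : Continuous fun σ => heatEval σ y p :=
    continuous_iff_continuousAt.2 fun σ => (hasDerivAt_heatEval p y σ).continuousAt
  exact this.comp (by fun_prop)

/-- The sum over `i` of the squares of the heat-evolved polynomials `∏_{j ≠ i} (X - x j)`. -/
def heatBracket (s y τ : ℝ) (x : EuclideanSpace ℝ (Fin N)) : ℝ :=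
  ∑ i, heatEval (s - τ) y (rootPoly (Finset.univ.erase i) x) ^ 2

lemma continuous_heatBracket (s y : ℝ) :
    Continuous (Function.uncurry (heatBracket (N := N) s y)) := by
  have h : ∀ i : Fin N, Continuous fun q : ℝ × EuclideanSpace ℝ (Fin N) =>
      heatEval (s - q.1) y (rootPoly (Finset.univ.erase i) q.2) ^ 2 := fun i =>
    (continuous_rootPoly _ (fun τ => heatEval (s - τ) y) (continuous_heatEval s y)).pow 2
  have e : Function.uncurry (heatBracket (N := N) s y) = fun q =>
      ∑ i, heatEval (s - q.1) y (rootPoly (Finset.univ.erase i) q.2) ^ 2 := rfl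
  rw [e]
  exact continuous_finsetSum _ fun i _ => h i

lemma heatBracket_nonneg (s y τ : ℝ) (x : EuclideanSpace ℝ (Fin N)) : 0 ≤ heatBracket s y τ x :=
  Finset.sum_nonneg fun _ _ => sq_nonneg _

lemma continuous_heatEval_rootPoly (s y : ℝ) : Continuous fun q : ℝ × EuclideanSpace ℝ (Fin N) =>
    heatEval (s - q.1) y (rootPoly Finset.univ q.2) :=
  continuous_rootPoly _ (fun τ => heatEval (s - τ) y) (continuous_heatEval s y)

/-- The part of the generator that comes from the derivatives of the cutoff function. -/
def cutoffError (k R s y : ℝ) (φ : ℝ → ℝ) (τ : ℝ) (x : EuclideanSpace ℝ (Fin N)) : ℝ :=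
  1 / (4 * k) * (-(4 * deriv φ (heatEval (s - τ) y (rootPoly Finset.univ x)) *
      (deriv (cutoff R) (‖x‖ ^ 2) *
        (∑ i, heatEval (s - τ) y (rootPoly (Finset.univ.erase i) x) * x i))) +
    φ (heatEval (s - τ) y (rootPoly Finset.univ x)) *
      (4 * deriv (deriv (cutoff R)) (‖x‖ ^ 2) * ‖x‖ ^ 2 + 2 * N * deriv (cutoff R) (‖x‖ ^ 2))) +
  (N : ℝ) * (N - 1) / 2 * φ (heatEval (s - τ) y (rootPoly Finset.univ x)) *
    deriv (cutoff R) (‖x‖ ^ 2)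

lemma isCompact_norm_sq_le (r : ℝ) : IsCompact {x : EuclideanSpace ℝ (Fin N) | ‖x‖ ^ 2 ≤ r} := by
  refine (isCompact_closedBall (0 : EuclideanSpace ℝ (Fin N)) (√r)).of_isClosed_subset
    (isClosed_le (by fun_prop) continuous_const) fun x hx => ?_
  rw [mem_closedBall_zero_iff]
  exact Real.le_sqrt_of_sq_le hx

lemma exists_abs_cutoffError_le (N : ℕ) : ∃ C' : ℝ, 0 ≤ C' ∧ ∀ R, 0 < R → ∀ s y, ∃ C, 0 ≤ C ∧
    ∀ (φ : ℝ → ℝ) (B₀ B₁ k : ℝ), (∀ u, |φ u| ≤ B₀) → (∀ u, |deriv φ u| ≤ B₁) → 0 < k →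
    ∀ τ ∈ Set.Icc (0 : ℝ) 1, ∀ x : EuclideanSpace ℝ (Fin N),
      |cutoffError k R s y φ τ x| ≤ C * (B₀ + B₁) / k + C' * B₀ / R := by
  obtain ⟨B, hB0, hB⟩ := exists_abs_deriv_cutoff_le
  refine ⟨|(N : ℝ) * (N - 1) / 2| * B, by positivity, fun R hR s y => ?_⟩
  have hK := isCompact_norm_sq_le (N := N) (2 * R)
  have hd1 := continuous_deriv_cutoff R
  have hd2 := continuous_deriv_deriv_cutoff R
  have hm : ∀ i : Fin N, Continuous fun q : ℝ × EuclideanSpace ℝ (Fin N) =>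
      heatEval (s - q.1) y (rootPoly (Finset.univ.erase i) q.2) := fun i =>
    continuous_rootPoly _ (fun τ => heatEval (s - τ) y) (continuous_heatEval s y)
  obtain ⟨C1, hC1⟩ := exists_local_bound
    (H := fun τ (x : EuclideanSpace ℝ (Fin N)) => deriv (cutoff R) (‖x‖ ^ 2) *
        (∑ i, heatEval (s - τ) y (rootPoly (Finset.univ.erase i) x) * x i))
    (by
      refine (hd1.comp (by fun_prop)).mul (continuous_finsetSum _ fun i _ => (hm i).mul ?_)
      fun_prop)
    hK (fun τ x hx => by
      rw [deriv_cutoff_eq_zero hR (by simpa using hx), zero_mul]) 0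
  obtain ⟨C2, hC2⟩ := exists_local_bound
    (H := fun _ (x : EuclideanSpace ℝ (Fin N)) =>
      (4 * deriv (deriv (cutoff R)) (‖x‖ ^ 2) * ‖x‖ ^ 2 + 2 * N * deriv (cutoff R) (‖x‖ ^ 2)))
    (by
      have h1 : Continuous fun q : ℝ × EuclideanSpace ℝ (Fin N) =>
        deriv (cutoff R) (‖q.2‖ ^ 2) := hd1.comp (by fun_prop)
      have h2 : Continuous fun q : ℝ × EuclideanSpace ℝ (Fin N) =>
        deriv (deriv (cutoff R)) (‖q.2‖ ^ 2) := hd2.comp (by fun_prop)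
      exact ((continuous_const.mul h2).mul (by fun_prop)).add (continuous_const.mul h1))
    hK (fun τ x hx => by
      rw [deriv_cutoff_eq_zero hR (by simpa using hx),
        deriv_deriv_cutoff_eq_zero hR (by simpa using hx)]
      simp) 0
  have hC1' := fun τ (hτ : τ ∈ Set.Icc (0 : ℝ) 1) =>
    hC1 τ ⟨by linarith [hτ.1], by linarith [hτ.2]⟩
  have hC2' := hC2 0 ⟨by norm_num, by norm_num⟩
  have hC1n : 0 ≤ C1 := (norm_nonneg _).trans (hC1' 0 (by simp) 0)
  have hC2n : 0 ≤ C2 := (norm_nonneg _).trans (hC2' 0)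
  refine ⟨C1 + C2, by positivity, fun φ B₀ B₁ k h0 h1 hk τ hτ x => ?_⟩
  have e1 := hC1' τ hτ x
  have e2 := hC2' x
  have e3 := hB R hR (‖x‖ ^ 2)
  have e4 := h0 (heatEval (s - τ) y (rootPoly Finset.univ x))
  have e5 := h1 (heatEval (s - τ) y (rootPoly Finset.univ x))
  rw [cutoffError]
  rw [Real.norm_eq_abs] at e1 e2
  generalize (deriv (cutoff R) (‖x‖ ^ 2) *
    (∑ i, heatEval (s - τ) y (rootPoly (Finset.univ.erase i) x) * x i)) = E1 at *
  generalize (4 * deriv (deriv (cutoff R)) (‖x‖ ^ 2) * ‖x‖ ^ 2 +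
    2 * N * deriv (cutoff R) (‖x‖ ^ 2)) = E2 at *
  generalize deriv (cutoff R) (‖x‖ ^ 2) = ψ1 at *
  generalize deriv φ (heatEval (s - τ) y (rootPoly Finset.univ x)) = φ1 at *
  generalize φ (heatEval (s - τ) y (rootPoly Finset.univ x)) = φ0 at *
  generalize (N : ℝ) * (N - 1) / 2 = M
  have hB0' : 0 ≤ B₀ := (abs_nonneg _).trans e4
  have hB1' : 0 ≤ B₁ := (abs_nonneg _).trans e5
  refine (abs_add_le _ _).trans (add_le_add ?_ ?_)
  · rw [abs_mul, abs_of_pos (by positivity : (0 : ℝ) < 1 / (4 * k))]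
    have h1 : |-(4 * φ1 * E1) + φ0 * E2| ≤ 4 * (B₁ * C1) + B₀ * C2 := by
      refine (abs_add_le _ _).trans ?_
      rw [abs_neg, abs_mul, abs_mul, abs_mul, abs_of_pos (by norm_num : (0 : ℝ) < 4), mul_assoc]
      gcongr
    have h2 : 4 * (B₁ * C1) + B₀ * C2 ≤ 4 * ((C1 + C2) * (B₀ + B₁)) := by
      have a1 := mul_nonneg hB0' hC1n
      have a2 := mul_nonneg hB0' hC2n
      have a3 := mul_nonneg hB1' hC2n
      linarith
    calc 1 / (4 * k) * |-(4 * φ1 * E1) + φ0 * E2|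
        ≤ 1 / (4 * k) * (4 * ((C1 + C2) * (B₀ + B₁))) := by gcongr; exact h1.trans h2
      _ = (C1 + C2) * (B₀ + B₁) / k := by field_simp
  · rw [abs_mul, abs_mul]
    calc |M| * |φ0| * |ψ1| ≤ |M| * B₀ * (B / R) := by gcongr
      _ = |M| * B * B₀ / R := by ring

end

section

variable {N : ℕ} {k : ℝ} {Ω : Type*} [MeasurableSpace Ω] {P : Measure Ω} [IsProbabilityMeasure P]
  {U : ℝ → Ω → EuclideanSpace ℝ (Fin N)}

lemma rootPoly_zero (N : ℕ) : rootPoly Finset.univ (0 : EuclideanSpace ℝ (Fin N)) =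
    Polynomial.X ^ N := by
  simp [rootPoly]

lemma IsScaledBessel.integral_heatEval (hk : 0 < k) (hU : IsScaledBessel N k P U) {s : ℝ}
    (hs : 0 ≤ s) (y : ℝ) {R : ℝ} (hR : 0 < R) {φ a a' : ℝ → ℝ} (hφ : ContDiff ℝ (⊤ : ℕ∞) φ)
    (ha : ∀ τ, HasDerivAt a (a' τ) τ) (ha' : Continuous a') :
    ∫ ω, a s * (φ ((rootPoly Finset.univ (U s ω)).eval y) * cutoff R (‖U s ω‖ ^ 2)) ∂P =
      a 0 * φ ((heatPoly N s).eval y) + ∫ τ in (0 : ℝ)..s, ∫ ω,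
        ((a' τ * φ (heatEval (s - τ) y (rootPoly Finset.univ (U τ ω))) +
          a τ * (1 / (4 * k) * deriv (deriv φ) (heatEval (s - τ) y (rootPoly Finset.univ (U τ ω))) *
            heatBracket s y τ (U τ ω))) * cutoff R (‖U τ ω‖ ^ 2) +
        a τ * cutoffError k R s y φ τ (U τ ω)) ∂P := by
  have hK := isCompact_norm_sq_le (N := N) (2 * R)
  have hac : Continuous a := continuous_iff_continuousAt.2 fun τ => (ha τ).continuousAt
  have hψ : ContDiff ℝ (⊤ : ℕ∞) (cutoff R) := contDiff_cutoff R
  have hφ2 : ContDiff ℝ 2 φ := by exact_mod_cast contDiff_infty.1 hφ 2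
  have hψ2 : ContDiff ℝ 2 (cutoff R) := by exact_mod_cast contDiff_infty.1 hψ 2
  have hφ' : ContDiff ℝ 1 (deriv φ) := (contDiff_succ_iff_deriv (n := 1)).1 hφ2 |>.2.2
  have hφ'' : Continuous (deriv (deriv φ)) := hφ'.continuous_deriv le_rfl
  have hd1 := continuous_deriv_cutoff R
  have hd2 := continuous_deriv_deriv_cutoff R
  have cm : Continuous fun q : ℝ × EuclideanSpace ℝ (Fin N) =>
      heatEval (s - q.1) y (rootPoly Finset.univ q.2) := continuous_heatEval_rootPoly s y
  have cmi : ∀ i : Fin N, Continuous fun q : ℝ × EuclideanSpace ℝ (Fin N) =>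
      heatEval (s - q.1) y (rootPoly (Finset.univ.erase i) q.2) := fun i =>
    continuous_rootPoly _ (fun τ => heatEval (s - τ) y) (continuous_heatEval s y)
  have cD : Continuous fun q : ℝ × EuclideanSpace ℝ (Fin N) => heatEval (s - q.1) y
      (Polynomial.derivative (Polynomial.derivative (rootPoly Finset.univ q.2))) :=
    continuous_rootPoly _ (fun τ => heatEval (s - τ) y ∘ₗ Polynomial.derivative ∘ₗ
      Polynomial.derivative) (fun p => continuous_heatEval s y _)
  have cψ : Continuous fun q : ℝ × EuclideanSpace ℝ (Fin N) => cutoff R (‖q.2‖ ^ 2) :=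
    hψ.continuous.comp (by fun_prop)
  have cψ1 : Continuous fun q : ℝ × EuclideanSpace ℝ (Fin N) => deriv (cutoff R) (‖q.2‖ ^ 2) :=
    hd1.comp (by fun_prop)
  have cψ2 : Continuous fun q : ℝ × EuclideanSpace ℝ (Fin N) =>
    deriv (deriv (cutoff R)) (‖q.2‖ ^ 2) := hd2.comp (by fun_prop)
  have cφ := hφ.continuous.comp cm
  have cφ1 := hφ'.continuous.comp cm
  have cφ2 := hφ''.comp cm
  have ca : Continuous fun q : ℝ × EuclideanSpace ℝ (Fin N) => a q.1 := hac.comp continuous_fst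
  have ca' : Continuous fun q : ℝ × EuclideanSpace ℝ (Fin N) => a' q.1 := ha'.comp continuous_fst
  have cV : Continuous fun q : ℝ × EuclideanSpace ℝ (Fin N) => ‖q.2‖ ^ 2 := by fun_prop
  have z0 : ∀ x : EuclideanSpace ℝ (Fin N), x ∉ {x : EuclideanSpace ℝ (Fin N) | ‖x‖ ^ 2 ≤ 2 * R} →
      cutoff R (‖x‖ ^ 2) = 0 := fun x hx =>
    cutoff_eq_zero hR (not_le.1 (show ¬ (‖x‖ ^ 2 ≤ 2 * R) from hx)).le
  have z1 : ∀ x : EuclideanSpace ℝ (Fin N), x ∉ {x : EuclideanSpace ℝ (Fin N) | ‖x‖ ^ 2 ≤ 2 * R} →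
      deriv (cutoff R) (‖x‖ ^ 2) = 0 := fun x hx =>
    deriv_cutoff_eq_zero hR (not_le.1 (show ¬ (‖x‖ ^ 2 ≤ 2 * R) from hx))
  have z2 : ∀ x : EuclideanSpace ℝ (Fin N), x ∉ {x : EuclideanSpace ℝ (Fin N) | ‖x‖ ^ 2 ≤ 2 * R} →
      deriv (deriv (cutoff R)) (‖x‖ ^ 2) = 0 := fun x hx =>
    deriv_deriv_cutoff_eq_zero hR (not_le.1 (show ¬ (‖x‖ ^ 2 ≤ 2 * R) from hx))
  have h := hU.dynkin_time
    (F := fun τ => polyTest (heatEval (s - τ) y) (fun u => a τ * φ u) (cutoff R))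
    (F' := fun τ x => (a' τ * φ (heatEval (s - τ) y (rootPoly Finset.univ x)) +
      a τ * (deriv φ (heatEval (s - τ) y (rootPoly Finset.univ x)) * (1 / 4 * heatEval (s - τ) y
        (Polynomial.derivative (Polynomial.derivative (rootPoly Finset.univ x)))))) *
      cutoff R (‖x‖ ^ 2))
    (G := fun τ x => a τ * polyTestGen k (heatEval (s - τ) y) φ (cutoff R) x) hK
    (fun τ => contDiff_polyTest _ (contDiff_const.mul hφ) hψ)
    (fun τ => isPermInvariant_polyTest _ _ _)
    ((ca.mul cφ).mul cψ)
    (((ca'.mul cφ).add (ca.mul (cφ1.mul (continuous_const.mul cD)))).mul cψ)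
    (ca.mul ((((continuous_const.mul (((cφ2.mul (continuous_finsetSum _ fun i _ =>
      (cmi i).pow 2)).mul cψ).sub (((continuous_const.mul cφ1).mul cψ1).mul
        (continuous_finsetSum _ fun i _ => (cmi i).mul (by fun_prop))) |>.add
        (cφ.mul (((continuous_const.mul cψ2).mul cV).add (continuous_const.mul cψ1))))).sub
      (((continuous_const.mul cD).mul cφ1).mul cψ)).add ((continuous_const.mul cφ).mul cψ1))))
    (fun τ x hx => by simp only [polyTest, z0 x hx, mul_zero])
    (fun τ x hx => by simp only [z0 x hx, mul_zero])
    (fun τ x hx => by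
      simp only [polyTestGen, z0 x hx, z1 x hx, z2 x hx, mul_zero, zero_mul, sub_zero, add_zero])
    (fun τ x => by
      have h1 : HasDerivAt (fun τ => s - τ) (-1) τ := by simpa using (hasDerivAt_id τ).const_sub s
      have h2 := (hasDerivAt_heatEval (rootPoly Finset.univ x) y (s - τ)).comp τ h1
      have h3 := ((hφ2.differentiable (by norm_num))
        (heatEval (s - τ) y (rootPoly Finset.univ x))).hasDerivAt.comp τ h2
      refine (((ha τ).mul h3).mul_const (cutoff R (‖x‖ ^ 2))).congr_deriv ?_
      simp only [Function.comp_apply]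
      ring)
    (fun τ x hx => by
      have e1 : deriv (fun u => a τ * φ u) = fun u => a τ * deriv φ u :=
        funext fun u => deriv_const_mul_field _
      have e2 : deriv (fun u => a τ * deriv φ u) = fun u => a τ * deriv (deriv φ) u :=
        funext fun u => deriv_const_mul_field _
      beta_reduce
      rw [besselOperatorA_polyTest hk _ (contDiff_const.mul hφ2) hψ2 hx, polyTestGen, polyTestGen,
        e1, e2]
      ring) hs
  have e0 : ∀ x : EuclideanSpace ℝ (Fin N), polyTest (heatEval (s - s) y) (fun u => a s * φ u)
      (cutoff R) x = a s * (φ ((rootPoly Finset.univ x).eval y) * cutoff R (‖x‖ ^ 2)) := fun x => by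
    rw [polyTest, sub_self, heatEval_zero, mul_assoc]
  simp only [e0] at h
  rw [h]
  congr 1
  · rw [polyTest, rootPoly_zero, heatEval_X_pow, sub_zero, norm_zero, zero_pow two_ne_zero,
      cutoff_zero, mul_one]
  · refine intervalIntegral.integral_congr fun τ _ => integral_congr_ae (.of_forall fun ω => ?_)
    simp only [polyTestGen, cutoffError, heatBracket]
    ring

end

/-! ### Concentration of the rescaled process -/

section

variable {N : ℕ} {k : ℝ} {Ω : Type*} [MeasurableSpace Ω] {P : Measure Ω} [IsProbabilityMeasure P]
  {U : ℝ → Ω → EuclideanSpace ℝ (Fin N)}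

lemma integrable_bounded_comp (hU : IsScaledBessel N k P U) {f : EuclideanSpace ℝ (Fin N) → ℝ}
    (hf : Continuous f) {C : ℝ} (hC : ∀ x, |f x| ≤ C) (s : ℝ) :
    Integrable (fun ω => f (U s ω)) P :=
  Integrable.of_bound (hU.aestronglyMeasurable hf s) C (.of_forall fun _ => hC _)

lemma continuous_cutoff_norm_sq (R : ℝ) :
    Continuous fun x : EuclideanSpace ℝ (Fin N) => cutoff R (‖x‖ ^ 2) :=
  (contDiff_cutoff R (n := 0)).continuous.comp (by fun_prop)

lemma IsScaledBessel.abs_integral_heatEval_sub_le (hk : 0 < k) (hU : IsScaledBessel N k P U)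
    {s : ℝ} (hs : s ∈ Set.Icc (0 : ℝ) 1) (y : ℝ) {R : ℝ} (hR : 0 < R) {φ a a' : ℝ → ℝ}
    (hφ : ContDiff ℝ (⊤ : ℕ∞) φ) (ha : ∀ τ, HasDerivAt a (a' τ) τ) (ha' : Continuous a')
    {J : ℝ → EuclideanSpace ℝ (Fin N) → ℝ} (hJ : Continuous (Function.uncurry J))
    (hJ0 : ∀ τ x, 2 * R < ‖x‖ ^ 2 → J τ x = 0)
    (hIJ : ∀ τ ∈ Set.Icc (0 : ℝ) 1, ∀ x,
      |(a' τ * φ (heatEval (s - τ) y (rootPoly Finset.univ x)) +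
          a τ * (1 / (4 * k) * deriv (deriv φ) (heatEval (s - τ) y (rootPoly Finset.univ x)) *
            heatBracket s y τ x)) * cutoff R (‖x‖ ^ 2)| ≤ J τ x)
    {A δ : ℝ} (hA : ∀ τ ∈ Set.Icc (0 : ℝ) 1, |a τ| ≤ A)
    (hδ : ∀ τ ∈ Set.Icc (0 : ℝ) 1, ∀ x, |cutoffError (N := N) k R s y φ τ x| ≤ δ) :
    |(∫ ω, a s * (φ ((rootPoly Finset.univ (U s ω)).eval y) * cutoff R (‖U s ω‖ ^ 2)) ∂P) -
      a 0 * φ ((heatPoly N s).eval y)| ≤ (∫ τ in (0 : ℝ)..s, ∫ ω, J τ (U τ ω) ∂P) + A * δ := by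
  have hK := isCompact_norm_sq_le (N := N) (2 * R)
  have hJK : ∀ τ, ∀ x ∉ {x : EuclideanSpace ℝ (Fin N) | ‖x‖ ^ 2 ≤ 2 * R}, J τ x = 0 :=
    fun τ x hx => hJ0 τ x (not_le.1 (show ¬ (‖x‖ ^ 2 ≤ 2 * R) from hx))
  have hA0 : 0 ≤ A := (abs_nonneg _).trans (hA 0 (by simp))
  have hδ0 : 0 ≤ δ := (abs_nonneg _).trans (hδ 0 (by simp) 0)
  rw [hU.integral_heatEval hk hs.1 y hR hφ ha ha', add_sub_cancel_left]
  have hcJ : Continuous fun τ => ∫ ω, J τ (U τ ω) ∂P :=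
    (hU.continuous_integral hJ hK hJK).comp (by fun_prop : Continuous fun τ : ℝ => (τ, τ))
  have hJi : ∀ τ, Integrable (fun ω => J τ (U τ ω)) P := fun τ => by
    obtain ⟨C, hC⟩ := exists_local_bound hJ hK hJK τ
    exact integrable_bounded_comp hU (hJ.comp (by fun_prop : Continuous fun x => (τ, x)))
      (hC τ ⟨by linarith, by linarith⟩) τ
  rw [← Real.norm_eq_abs]
  have hle : ‖∫ τ in (0 : ℝ)..s, ∫ ω,
        ((a' τ * φ (heatEval (s - τ) y (rootPoly Finset.univ (U τ ω))) +
          a τ * (1 / (4 * k) * deriv (deriv φ) (heatEval (s - τ) y (rootPoly Finset.univ (U τ ω))) *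
            heatBracket s y τ (U τ ω))) * cutoff R (‖U τ ω‖ ^ 2) +
        a τ * cutoffError k R s y φ τ (U τ ω)) ∂P‖ ≤
      ∫ τ in (0 : ℝ)..s, ((∫ ω, J τ (U τ ω) ∂P) + A * δ) := by
    refine intervalIntegral.norm_integral_le_of_norm_le hs.1 (.of_forall fun τ hτ => ?_)
      ((hcJ.add continuous_const).intervalIntegrable 0 s)
    have hτ' : τ ∈ Set.Icc (0 : ℝ) 1 := ⟨hτ.1.le, hτ.2.trans hs.2⟩
    have h1 : (∫ ω, J τ (U τ ω) ∂P) + A * δ = ∫ ω, (J τ (U τ ω) + A * δ) ∂P := by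
      rw [integral_add (hJi τ) (integrable_const _)]
      simp
    rw [h1]
    refine norm_integral_le_of_norm_le ((hJi τ).add (integrable_const _)) (.of_forall fun ω => ?_)
    refine (abs_add_le _ _).trans (add_le_add (hIJ τ hτ' _) ?_)
    rw [abs_mul]
    exact mul_le_mul (hA τ hτ') (hδ τ hτ' _) (abs_nonneg _) hA0
  refine hle.trans ?_
  rw [intervalIntegral.integral_add (hcJ.intervalIntegrable 0 s) (by simp)]
  simp only [intervalIntegral.integral_const, sub_zero, smul_eq_mul]
  have := mul_le_mul_of_nonneg_right hs.2 (mul_nonneg hA0 hδ0)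
  linarith

end

/-- The bounded function `u ^ 2 / (1 + u ^ 2)`. -/
def ratSq (u : ℝ) : ℝ := u ^ 2 / (1 + u ^ 2)

lemma ratSq_nonneg (u : ℝ) : 0 ≤ ratSq u := by unfold ratSq; positivity

lemma ratSq_le_one (u : ℝ) : ratSq u ≤ 1 := by
  unfold ratSq
  rw [div_le_one (by positivity)]
  linarith

lemma contDiff_ratSq {n : WithTop ℕ∞} : ContDiff ℝ n ratSq :=
  (contDiff_id.pow 2).div (contDiff_const.add (contDiff_id.pow 2)) fun u => by
    positivity

lemma ratSq_eq_zero {u : ℝ} (h : ratSq u = 0) : u = 0 := by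
  unfold ratSq at h
  have : (1 + u ^ 2) ≠ 0 := by positivity
  simpa [this] using h

lemma le_ratSq {δ u : ℝ} (hδ : 0 ≤ δ) (h : δ ≤ |u|) : δ ^ 2 / (1 + δ ^ 2) ≤ ratSq u := by
  unfold ratSq
  have : δ ^ 2 ≤ u ^ 2 := by rw [← sq_abs u]; gcongr
  rw [div_le_div_iff₀ (by positivity) (by positivity)]
  nlinarith

lemma hasDerivAt_ratSq (c u : ℝ) : HasDerivAt (fun u => ratSq (c * u))
    (c * (2 * (c * u) / (1 + (c * u) ^ 2) ^ 2)) u := by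
  have h0 : HasDerivAt (fun u => c * u) c u := by simpa using (hasDerivAt_id u).const_mul c
  have h1 := h0.pow 2
  have hne : 1 + (c * u) ^ 2 ≠ 0 := by positivity
  have h2 := h1.div (h1.const_add 1) hne
  refine h2.congr_deriv ?_
  simp only [Pi.pow_apply]
  field_simp
  push_cast
  ring

lemma hasDerivAt_deriv_ratSq (c u : ℝ) :
    HasDerivAt (fun u => c * (2 * (c * u) / (1 + (c * u) ^ 2) ^ 2))
      (c ^ 2 * ((2 - 6 * (c * u) ^ 2) / (1 + (c * u) ^ 2) ^ 3)) u := by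
  have h0 : HasDerivAt (fun u => c * u) c u := by simpa using (hasDerivAt_id u).const_mul c
  have h1 := (h0.pow 2).const_add 1
  have hne : 1 + (c * u) ^ 2 ≠ 0 := by positivity
  have h2 := ((h0.const_mul 2).div (h1.pow 2) (pow_ne_zero 2 hne)).const_mul c
  refine h2.congr_deriv ?_
  simp only [Pi.pow_apply]
  field_simp
  push_cast
  ring

lemma abs_deriv_ratSq_le {c : ℝ} (hc : 0 ≤ c) (u : ℝ) : |deriv (fun u => ratSq (c * u)) u| ≤ c := by
  rw [(hasDerivAt_ratSq c u).deriv, abs_mul, abs_of_nonneg hc]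
  refine mul_le_of_le_one_right hc ?_
  generalize c * u = v
  rw [abs_div, abs_of_pos (by positivity : 0 < (1 + v ^ 2) ^ 2), div_le_one (by positivity), abs_le]
  constructor <;> nlinarith [sq_nonneg (v - 1), sq_nonneg (v + 1), sq_nonneg (v ^ 2)]

lemma abs_deriv_deriv_ratSq_le (c u : ℝ) :
    |deriv (deriv (fun u => ratSq (c * u))) u| ≤ 6 * c ^ 2 := by
  have : deriv (fun u => ratSq (c * u)) = fun u => c * (2 * (c * u) / (1 + (c * u) ^ 2) ^ 2) :=
    funext fun u => (hasDerivAt_ratSq c u).deriv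
  rw [this, (hasDerivAt_deriv_ratSq c u).deriv, abs_mul, abs_of_nonneg (sq_nonneg c), mul_comm]
  refine mul_le_mul_of_nonneg_right ?_ (sq_nonneg c)
  generalize c * u = v
  rw [abs_div, abs_of_pos (by positivity : 0 < (1 + v ^ 2) ^ 3), div_le_iff₀ (by positivity), abs_le]
  constructor <;> nlinarith [sq_nonneg v, sq_nonneg (v ^ 2), pow_nonneg (sq_nonneg v) 3]

section

variable {N : ℕ} {Ω : ℝ≥0 → Type*} [∀ k, MeasurableSpace (Ω k)] {P : ∀ k, Measure (Ω k)}
  [∀ k, IsProbabilityMeasure (P k)] {U : ∀ k, ℝ → Ω k → EuclideanSpace ℝ (Fin N)}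

lemma integral_one_sub_cutoff_le (hU : ∀ k : ℝ≥0, 0 < k → IsScaledBessel N k (P k) (U k)) :
    ∃ C' : ℝ, 0 ≤ C' ∧ ∀ R, 0 < R → ∀ s ∈ Set.Icc (0 : ℝ) 1, ∃ C, 0 ≤ C ∧ ∀ k : ℝ≥0, 0 < k →
      ∫ ω, (1 - cutoff R (‖U k s ω‖ ^ 2)) ∂P k ≤ C / k + C' / R := by
  obtain ⟨C', hC', hC⟩ := exists_abs_cutoffError_le N
  refine ⟨C', hC', fun R hR s hs => ?_⟩
  obtain ⟨C, hC0, hC⟩ := hC R hR s 0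
  refine ⟨C, hC0, fun k hk => ?_⟩
  have hk' : (0 : ℝ) < k := hk
  have h := (hU k hk).abs_integral_heatEval_sub_le hk' hs 0 hR (φ := fun _ => 1) (a := fun _ => 1)
    (a' := fun _ => 0) (J := fun _ _ => 0) (A := 1) (δ := C / k + C' / R) contDiff_const
    (fun τ => hasDerivAt_const τ 1) continuous_const continuous_const (fun _ _ _ => rfl)
    (fun τ _ x => by simp) (fun _ _ => by simp)
    (fun τ hτ x => by
      simpa using hC (fun _ => 1) 1 0 k (fun _ => by simp) (fun _ => by simp) hk' τ hτ x)
  simp only [integral_zero, intervalIntegral.integral_zero, one_mul, zero_add, mul_one] at h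
  rw [integral_sub (integrable_const _) (integrable_bounded_comp (hU k hk)
    (continuous_cutoff_norm_sq R) (fun x => abs_cutoff_le_one R _) s)]
  have := neg_le_of_abs_le h
  simp only [integral_const, probReal_univ, smul_eq_mul, one_mul]
  linarith

lemma integral_ratSq_mul_cutoff_le (hU : ∀ k : ℝ≥0, 0 < k → IsScaledBessel N k (P k) (U k)) :
    ∃ C' : ℝ, 0 ≤ C' ∧ ∀ R, 0 < R → ∀ s ∈ Set.Icc (0 : ℝ) 1, ∀ y, (heatPoly N s).eval y = 0 →
      ∃ C, 0 ≤ C ∧ ∀ k : ℝ≥0, 0 < k → ∀ c : ℝ, 0 ≤ c →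
      ∫ ω, ratSq (c * (rootPoly Finset.univ (U k s ω)).eval y) * cutoff R (‖U k s ω‖ ^ 2) ∂P k ≤
        C * (1 + c + c ^ 2) / k + C' / R := by
  obtain ⟨C', hC', hC⟩ := exists_abs_cutoffError_le N
  refine ⟨C', hC', fun R hR s hs y hy => ?_⟩
  obtain ⟨C, hC0, hC⟩ := hC R hR s y
  have hK := isCompact_norm_sq_le (N := N) (2 * R)
  have cH : Continuous fun q : ℝ × EuclideanSpace ℝ (Fin N) =>
      heatBracket s y q.1 q.2 * cutoff R (‖q.2‖ ^ 2) :=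
    (continuous_heatBracket s y).mul ((continuous_cutoff_norm_sq R).comp continuous_snd)
  have hH0 : ∀ τ (x : EuclideanSpace ℝ (Fin N)), 2 * R < ‖x‖ ^ 2 →
      heatBracket s y τ x * cutoff R (‖x‖ ^ 2) = 0 := fun τ x hx => by
    rw [cutoff_eq_zero hR hx.le, mul_zero]
  obtain ⟨D, hD⟩ := exists_local_bound
    (H := fun τ (x : EuclideanSpace ℝ (Fin N)) => heatBracket s y τ x * cutoff R (‖x‖ ^ 2)) cH hK (fun τ x hx => hH0 τ x (by simpa using hx)) 0
  have hD0 : 0 ≤ D := (norm_nonneg _).trans (hD 0 ⟨by norm_num, by norm_num⟩ 0)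
  refine ⟨C + 2 * D, by positivity, fun k hk c hc => ?_⟩
  have hk' : (0 : ℝ) < k := hk
  have cJ : Continuous fun q : ℝ × EuclideanSpace ℝ (Fin N) =>
      3 * c ^ 2 / (2 * (k : ℝ)) * (heatBracket s y q.1 q.2 * cutoff R (‖q.2‖ ^ 2)) :=
    continuous_const.mul cH
  have h := (hU k hk).abs_integral_heatEval_sub_le hk' hs y hR (φ := fun u => ratSq (c * u))
    (a := fun _ => 1) (a' := fun _ => 0)
    (J := fun τ x => 3 * c ^ 2 / (2 * k) * (heatBracket s y τ x * cutoff R (‖x‖ ^ 2))) (A := 1)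
    (δ := C * (1 + c) / k + C' / R) (contDiff_ratSq.comp (contDiff_const.mul contDiff_id))
    (fun τ => hasDerivAt_const τ 1) continuous_const cJ
    (fun τ x hx => by rw [hH0 τ x hx, mul_zero])
    (fun τ _ x => by
      rw [zero_mul, zero_add, one_mul, abs_mul, abs_mul, abs_mul,
        abs_of_nonneg (cutoff_nonneg _ _), abs_of_nonneg (heatBracket_nonneg _ _ _ _),
        abs_of_pos (by positivity : (0 : ℝ) < 1 / (4 * k)), ← mul_assoc]
      have hg := heatBracket_nonneg s y τ x
      have hp := cutoff_nonneg R (‖x‖ ^ 2)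
      refine mul_le_mul_of_nonneg_right (mul_le_mul_of_nonneg_right ?_ hg) hp
      calc _ ≤ 1 / (4 * (k : ℝ)) * (6 * c ^ 2) := by
            gcongr; exact abs_deriv_deriv_ratSq_le c _
        _ = _ := by field_simp; ring)
    (fun _ _ => by simp)
    (fun τ hτ x => by
      simpa using hC (fun u => ratSq (c * u)) 1 c k
        (fun u => by rw [abs_of_nonneg (ratSq_nonneg _)]; exact ratSq_le_one _)
        (fun u => abs_deriv_ratSq_le hc u) hk' τ hτ x)
  simp only [one_mul, hy, mul_zero] at h
  rw [show ratSq 0 = 0 by simp [ratSq], sub_zero] at h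
  refine (le_abs_self _).trans (h.trans ?_)
  have hJ : ∫ τ in (0 : ℝ)..s, ∫ ω, 3 * c ^ 2 / (2 * (k : ℝ)) *
      (heatBracket s y τ (U k τ ω) * cutoff R (‖U k τ ω‖ ^ 2)) ∂P k ≤ 3 * c ^ 2 / (2 * k) * D := by
    have h1 : ‖∫ τ in (0 : ℝ)..s, ∫ ω, 3 * c ^ 2 / (2 * (k : ℝ)) *
      (heatBracket s y τ (U k τ ω) * cutoff R (‖U k τ ω‖ ^ 2)) ∂P k‖ ≤
        3 * c ^ 2 / (2 * k) * D * |s - 0| := by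
      refine intervalIntegral.norm_integral_le_of_norm_le_const fun τ hτ => ?_
      rw [Set.uIoc_of_le hs.1] at hτ
      refine (norm_integral_le_of_norm_le_const (C := 3 * c ^ 2 / (2 * k) * D)
        (.of_forall fun ω => ?_)).trans (by simp)
      rw [norm_mul, Real.norm_of_nonneg (by positivity : 0 ≤ 3 * c ^ 2 / (2 * (k : ℝ)))]
      exact mul_le_mul_of_nonneg_left (hD τ ⟨by linarith [hτ.1], by linarith [hτ.2, hs.2]⟩ _)
        (by positivity)
    refine (le_abs_self _).trans (h1.trans ?_)
    rw [sub_zero, abs_of_nonneg hs.1]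
    exact mul_le_of_le_one_right (by positivity) hs.2
  refine (add_le_add_left hJ _).trans ?_
  have e : (C + 2 * D) * (1 + c + c ^ 2) / k + C' / R =
      3 * c ^ 2 / (2 * k) * D + (C * (1 + c) / k + C' / R) +
        (2 * D * (1 + c) + D * c ^ 2 / 2 + C * c ^ 2) / k := by
    field_simp; ring
  rw [e]
  have : 0 ≤ (2 * D * (1 + c) + D * c ^ 2 / 2 + C * c ^ 2) / (k : ℝ) := by positivity
  linarith

end

lemma integrable_one_sub_cutoff {N : ℕ} {k : ℝ} {Ω : Type*} [MeasurableSpace Ω] {P : Measure Ω}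
    [IsProbabilityMeasure P] {U : ℝ → Ω → EuclideanSpace ℝ (Fin N)} (hU : IsScaledBessel N k P U)
    (R s : ℝ) : Integrable (fun ω => 1 - cutoff R (‖U s ω‖ ^ 2)) P :=
  (integrable_const 1).sub (integrable_bounded_comp hU (continuous_cutoff_norm_sq R)
    (fun _ => abs_cutoff_le_one R _) s)

lemma tendsto_zero_of_eventually_le {ι : Type*} {l : Filter ι} {u : ι → ℝ} (h0 : ∀ k, 0 ≤ u k)
    (h : ∀ ε > 0, ∀ᶠ k in l, u k ≤ ε) : Tendsto u l (𝓝 0) := by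
  refine tendsto_order.2 ⟨fun a ha => .of_forall fun k => ha.trans_le (h0 k), fun a ha => ?_⟩
  filter_upwards [h (a / 2) (by linarith)] with k hk
  linarith

lemma eventually_div_coe_le (C : ℝ) {ε : ℝ} (hε : 0 < ε) : ∀ᶠ k : ℝ≥0 in atTop, C / (k : ℝ) ≤ ε := by
  have : Tendsto (fun k : ℝ≥0 => C / (k : ℝ)) atTop (𝓝 0) :=
    tendsto_const_nhds.div_atTop (NNReal.tendsto_coe_atTop.2 tendsto_id)
  filter_upwards [this.eventually (gt_mem_nhds hε)] with k hk
  exact hk.le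

/-- The vector of the zeros of the `N`-th Hermite polynomial. -/
def hermiteVec (N : ℕ) : EuclideanSpace ℝ (Fin N) := WithLp.toLp 2 (hermiteRoot N)

lemma eval_heatPoly_sqrt {s : ℝ} (hs : 0 ≤ s) (N : ℕ) (i : Fin N) :
    (heatPoly N s).eval (√s * hermiteRoot N i) = 0 := by
  have := eval_heatPoly_scale N (√s) (hermiteRoot N i)
  rw [Real.sq_sqrt hs] at this
  rw [this, eval_hermiteRoot, mul_zero]

lemma eval_rootPoly {N : ℕ} (t : Finset (Fin N)) (x : EuclideanSpace ℝ (Fin N)) (y : ℝ) :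
    (rootPoly t x).eval y = ∏ i ∈ t, (y - x i) := by
  simp [rootPoly, Polynomial.eval_prod]

lemma continuous_eval_rootPoly {N : ℕ} (t : Finset (Fin N)) (y : ℝ) :
    Continuous fun x : EuclideanSpace ℝ (Fin N) => (rootPoly t x).eval y := by
  simp only [eval_rootPoly]
  fun_prop

lemma eq_of_rootPoly_eval_eq_zero {N : ℕ} {x : EuclideanSpace ℝ (Fin N)} (hx : x ∈ weylChamberA N)
    {c : ℝ} (hc : 0 < c) (h : ∀ i, (rootPoly Finset.univ x).eval (c * hermiteRoot N i) = 0) :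
    x = c • hermiteVec N := by
  have h' : ∀ i, ∃ j, x j = c * hermiteRoot N i := fun i => by
    have := h i
    rw [eval_rootPoly, Finset.prod_eq_zero_iff] at this
    obtain ⟨j, -, hj⟩ := this
    exact ⟨j, (sub_eq_zero.1 hj).symm⟩
  choose e he using h'
  have hmono : StrictMono e := fun i j hij => by
    by_contra hle
    have h1 := hx _ _ (not_lt.1 hle)
    rw [he, he] at h1
    exact absurd h1 (not_le.2 (mul_lt_mul_of_pos_left (hermiteRoot_strictMono N hij) hc))
  have hid : ∀ i, e i = i := fun i => le_antisymm hmono.apply_le hmono.le_apply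
  ext i
  have := he i
  rw [hid] at this
  simpa [hermiteVec] using this

section

variable {N : ℕ} {Ω : ℝ≥0 → Type*} [∀ k, MeasurableSpace (Ω k)] {P : ∀ k, Measure (Ω k)}
  [∀ k, IsProbabilityMeasure (P k)] {U : ∀ k, ℝ → Ω k → EuclideanSpace ℝ (Fin N)}

lemma eventually_integral_one_sub_cutoff_le
    (hU : ∀ k : ℝ≥0, 0 < k → IsScaledBessel N k (P k) (U k)) {ε : ℝ} (hε : 0 < ε) :
    ∃ R₀, 0 < R₀ ∧ ∀ R ≥ R₀, ∀ s ∈ Set.Icc (0 : ℝ) 1, ∀ᶠ k : ℝ≥0 in atTop,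
      ∫ ω, (1 - cutoff R (‖U k s ω‖ ^ 2)) ∂P k ≤ ε := by
  obtain ⟨C', hC', h⟩ := integral_one_sub_cutoff_le hU
  refine ⟨2 * C' / ε + 1, by positivity, fun R hR s hs => ?_⟩
  have hR0 : 0 < R := lt_of_lt_of_le (by positivity) hR
  obtain ⟨C, hC, h⟩ := h R hR0 s hs
  filter_upwards [eventually_div_coe_le C (half_pos hε), eventually_gt_atTop 0] with k hk hk0
  have h1 := h k hk0
  have h2 : C' / R ≤ ε / 2 := by
    rw [div_le_iff₀ hR0]
    calc C' ≤ ε / 2 * (2 * C' / ε + 1) := by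
          have : ε / 2 * (2 * C' / ε + 1) = C' + ε / 2 := by field_simp
          rw [this]; linarith
      _ ≤ _ := by gcongr
  linarith

lemma integral_ratSq_le (hU : ∀ k : ℝ≥0, 0 < k → IsScaledBessel N k (P k) (U k)) {ε : ℝ}
    (hε : 0 < ε) {s : ℝ} (hs : s ∈ Set.Icc (0 : ℝ) 1) {y : ℝ} (hy : (heatPoly N s).eval y = 0) :
    ∃ C, 0 ≤ C ∧ ∀ᶠ k : ℝ≥0 in atTop, ∀ c : ℝ, 0 ≤ c →
      ∫ ω, ratSq (c * (rootPoly Finset.univ (U k s ω)).eval y) ∂P k ≤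
        C * (1 + c + c ^ 2) / k + ε := by
  obtain ⟨R₀, hR₀, h1⟩ := eventually_integral_one_sub_cutoff_le hU (half_pos hε)
  obtain ⟨C', hC', h2⟩ := integral_ratSq_mul_cutoff_le hU
  obtain ⟨R, hR⟩ : ∃ R, R = max R₀ (2 * C' / ε + 1) := ⟨_, rfl⟩
  have hR0 : 0 < R := by rw [hR]; exact lt_max_of_lt_left hR₀
  have hR1 : 2 * C' / ε + 1 ≤ R := by rw [hR]; exact le_max_right _ _
  have h1 := h1 R (by rw [hR]; exact le_max_left _ _) s hs
  obtain ⟨C, hC, h2⟩ := h2 R hR0 s hs y hy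
  refine ⟨C, hC, ?_⟩
  filter_upwards [h1, eventually_gt_atTop 0] with k hk hk0 c hc
  have h3 : C' / R ≤ ε / 2 := by
    rw [div_le_iff₀ hR0]
    calc C' ≤ ε / 2 * (2 * C' / ε + 1) := by
          have : ε / 2 * (2 * C' / ε + 1) = C' + ε / 2 := by field_simp
          rw [this]; linarith
      _ ≤ _ := by gcongr
  have h4 := h2 k hk0 c hc
  have hcr : Continuous fun x : EuclideanSpace ℝ (Fin N) =>
      ratSq (c * (rootPoly Finset.univ x).eval y) :=
    (contDiff_ratSq (n := 0)).continuous.comp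
      (continuous_const.mul (continuous_eval_rootPoly _ _))
  have hr1 : ∀ x : EuclideanSpace ℝ (Fin N), |ratSq (c * (rootPoly Finset.univ x).eval y)| ≤ 1 :=
    fun x => by rw [abs_of_nonneg (ratSq_nonneg _)]; exact ratSq_le_one _
  have hi1 := integrable_bounded_comp (hU k hk0) hcr hr1 s
  have hi2 := integrable_bounded_comp (hU k hk0) (f := fun x =>
      ratSq (c * (rootPoly Finset.univ x).eval y) * cutoff R (‖x‖ ^ 2))
    (hcr.mul (continuous_cutoff_norm_sq R)) (C := 1) (fun x => by
      rw [abs_mul]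
      exact mul_le_one₀ (hr1 x) (abs_nonneg _) (abs_cutoff_le_one _ _)) s
  have hi3 := integrable_one_sub_cutoff (hU k hk0) R s
  have h5 : ∫ ω, ratSq (c * (rootPoly Finset.univ (U k s ω)).eval y) ∂P k ≤
      ∫ ω, (ratSq (c * (rootPoly Finset.univ (U k s ω)).eval y) * cutoff R (‖U k s ω‖ ^ 2) +
        (1 - cutoff R (‖U k s ω‖ ^ 2))) ∂P k := by
    refine integral_mono hi1 (hi2.add hi3) fun ω => ?_
    have a1 := ratSq_le_one (c * (rootPoly Finset.univ (U k s ω)).eval y)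
    have a2 := cutoff_le_one R (‖U k s ω‖ ^ 2)
    beta_reduce
    nlinarith
  rw [integral_add hi2 hi3] at h5
  linarith

/-- The rescaled process concentrates at the rescaled vector of Hermite zeros. -/
lemma tendsto_integral_abs (hU : ∀ k : ℝ≥0, 0 < k → IsScaledBessel N k (P k) (U k))
    {f : EuclideanSpace ℝ (Fin N) → ℝ} (hf : Continuous f) {B : ℝ} (hB : ∀ x, |f x| ≤ B) {s : ℝ}
    (hs : s ∈ Set.Ioc (0 : ℝ) 1) (hfs : f (√s • hermiteVec N) = 0) :
    Tendsto (fun k : ℝ≥0 => ∫ ω, |f (U k s ω)| ∂P k) atTop (𝓝 0) := by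
  have hs' : s ∈ Set.Icc (0 : ℝ) 1 := ⟨hs.1.le, hs.2⟩
  have hB0 : 0 ≤ B := (abs_nonneg _).trans (hB 0)
  obtain ⟨D, hD⟩ : ∃ D : EuclideanSpace ℝ (Fin N) → ℝ, D = fun x =>
    ∑ i, ratSq ((rootPoly Finset.univ x).eval (√s * hermiteRoot N i)) := ⟨_, rfl⟩
  have hri : ∀ i, Continuous fun x : EuclideanSpace ℝ (Fin N) =>
      ratSq ((rootPoly Finset.univ x).eval (√s * hermiteRoot N i)) := fun i =>
    (contDiff_ratSq (n := 0)).continuous.comp (continuous_eval_rootPoly _ _)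
  have hDc : Continuous D := by
    rw [hD]; exact continuous_finsetSum _ fun i _ => hri i
  have hDn : ∀ x, 0 ≤ D x := fun x => by
    rw [hD]; exact Finset.sum_nonneg fun i _ => ratSq_nonneg _
  have hDz : ∀ x ∈ weylChamberA N, D x = 0 → f x = 0 := fun x hx h0 => by
    rw [hD, Finset.sum_eq_zero_iff_of_nonneg fun i _ => ratSq_nonneg _] at h0
    rw [eq_of_rootPoly_eval_eq_zero hx (Real.sqrt_pos.2 hs.1)
      fun i => ratSq_eq_zero (h0 i (Finset.mem_univ i)), hfs]
  have hDi : Tendsto (fun k : ℝ≥0 => ∫ ω, D (U k s ω) ∂P k) atTop (𝓝 0) := by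
    have h1 : ∀ i, Tendsto (fun k : ℝ≥0 =>
        ∫ ω, ratSq ((rootPoly Finset.univ (U k s ω)).eval (√s * hermiteRoot N i)) ∂P k) atTop
        (𝓝 0) := fun i => by
      refine tendsto_zero_of_eventually_le (fun k => integral_nonneg fun ω => ratSq_nonneg _)
        fun ε hε => ?_
      obtain ⟨C, hC, h⟩ := integral_ratSq_le hU (half_pos hε) hs' (eval_heatPoly_sqrt hs.1.le N i)
      filter_upwards [h, eventually_div_coe_le (C * 3) (half_pos hε)] with k hk hk2
      have h2 := hk 1 zero_le_one
      simp only [one_mul] at h2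
      norm_num at h2
      linarith
    have h2 := tendsto_finsetSum Finset.univ fun i _ => h1 i
    simp only [Finset.sum_const_zero] at h2
    refine h2.congr' ?_
    filter_upwards [eventually_gt_atTop 0] with k hk
    rw [hD]
    refine (integral_finsetSum _ fun i _ => integrable_bounded_comp (hU k hk) (hri i) (C := 1)
      (fun x => ?_) s).symm
    rw [abs_of_nonneg (ratSq_nonneg _)]; exact ratSq_le_one _
  refine tendsto_zero_of_eventually_le (fun k => integral_nonneg fun ω => abs_nonneg _)
    fun ε hε => ?_
  obtain ⟨R, hR, h1⟩ := eventually_integral_one_sub_cutoff_le hU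
    (show 0 < ε / 3 / (B + 1) by positivity)
  have h1 := h1 R le_rfl s hs'
  -- the compactness argument
  obtain ⟨M, hM0, hM⟩ : ∃ M, 0 ≤ M ∧ ∀ x ∈ weylChamberA N, ‖x‖ ^ 2 ≤ 2 * R →
      |f x| ≤ ε / 3 + M * D x := by
    have hcl : IsClosed (weylChamberA N) := by
      simp only [weylChamberA, Set.ofPred_forall]
      refine isClosed_iInter fun i => isClosed_iInter fun j => isClosed_iInter fun _ =>
        isClosed_le (by fun_prop) (by fun_prop)
    have hS : IsCompact ({x : EuclideanSpace ℝ (Fin N) | ‖x‖ ^ 2 ≤ 2 * R} ∩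
        (weylChamberA N ∩ {x | ε / 3 ≤ |f x|})) :=
      (isCompact_norm_sq_le _).inter_right
        (hcl.inter (isClosed_le continuous_const hf.abs))
    rcases Set.eq_empty_or_nonempty ({x : EuclideanSpace ℝ (Fin N) | ‖x‖ ^ 2 ≤ 2 * R} ∩
        (weylChamberA N ∩ {x | ε / 3 ≤ |f x|})) with he | hne
    · refine ⟨0, le_rfl, fun x hx hxR => ?_⟩
      by_contra hcon
      have : x ∈ ({x : EuclideanSpace ℝ (Fin N) | ‖x‖ ^ 2 ≤ 2 * R} ∩
        (weylChamberA N ∩ {x | ε / 3 ≤ |f x|})) := ⟨hxR, hx, by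
          have := not_le.1 hcon
          simp only [zero_mul, add_zero] at this
          exact this.le⟩
      rw [he] at this
      exact this
    · obtain ⟨x₀, hx₀, hmin⟩ := hS.exists_isMinOn hne hDc.continuousOn
      have hpos : 0 < D x₀ := by
        refine lt_of_le_of_ne (hDn x₀) fun h0 => ?_
        have h2 := hDz x₀ hx₀.2.1 h0.symm
        have h3 : ε / 3 ≤ |f x₀| := hx₀.2.2
        rw [h2, abs_zero] at h3
        linarith
      refine ⟨B / D x₀, by positivity, fun x hx hxR => ?_⟩
      by_cases hfx : ε / 3 ≤ |f x|
      · have h4 : D x₀ ≤ D x := hmin ⟨hxR, hx, hfx⟩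
        have h5 : B ≤ B / D x₀ * D x := by
          rw [div_mul_eq_mul_div, le_div_iff₀ hpos]
          gcongr
        have := hB x
        linarith
      · have h5 : 0 ≤ B / D x₀ * D x := mul_nonneg (by positivity) (hDn x)
        linarith [not_le.1 hfx]
  have h2 : ∀ᶠ k : ℝ≥0 in atTop, ∫ ω, D (U k s ω) ∂P k ≤ ε / 3 / (M + 1) := by
    filter_upwards [hDi.eventually (gt_mem_nhds (show 0 < ε / 3 / (M + 1) by positivity))] with k hk
    exact hk.le
  filter_upwards [h1, h2, eventually_gt_atTop 0] with k hk1 hk2 hk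
  have hDb : ∀ x, |D x| ≤ N := fun x => by
    rw [abs_of_nonneg (hDn x), hD]
    refine (Finset.sum_le_sum fun i _ => ratSq_le_one _).trans (by simp)
  have hi1 := integrable_bounded_comp (hU k hk) hf.abs (C := B) (fun x => by
    rw [abs_abs]; exact hB x) s
  have hi2 := integrable_bounded_comp (hU k hk) hDc hDb s
  have hi3 := integrable_one_sub_cutoff (hU k hk) R s
  have hi5 : Integrable (fun ω => ε / 3 + M * D (U k s ω)) (P k) :=
    (integrable_const _).add (hi2.const_mul M)
  have hi4 : Integrable (fun ω => ε / 3 + M * D (U k s ω) + B * (1 - cutoff R (‖U k s ω‖ ^ 2)))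
    (P k) := hi5.add (hi3.const_mul B)
  have h3 : ∫ ω, |f (U k s ω)| ∂P k ≤
      ∫ ω, (ε / 3 + M * D (U k s ω) + B * (1 - cutoff R (‖U k s ω‖ ^ 2))) ∂P k := by
    refine integral_mono hi1 hi4 fun ω => ?_
    beta_reduce
    have a1 : 0 ≤ B * (1 - cutoff R (‖U k s ω‖ ^ 2)) :=
      mul_nonneg hB0 (sub_nonneg.2 (cutoff_le_one _ _))
    by_cases hV : ‖U k s ω‖ ^ 2 ≤ 2 * R
    · have := hM _ ((hU k hk).mem_chamber s ω) hV
      linarith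
    · rw [cutoff_eq_zero hR (not_le.1 hV).le]
      have := hB (U k s ω)
      have := mul_nonneg hM0 (hDn (U k s ω))
      linarith
  have h4 : ∫ ω, (ε / 3 + M * D (U k s ω) + B * (1 - cutoff R (‖U k s ω‖ ^ 2))) ∂P k =
      ε / 3 + M * (∫ ω, D (U k s ω) ∂P k) + B * ∫ ω, (1 - cutoff R (‖U k s ω‖ ^ 2)) ∂P k := by
    rw [integral_add hi5 (hi3.const_mul B),
      integral_add (integrable_const _) (hi2.const_mul M), integral_const_mul, integral_const_mul]
    simp
  rw [h4] at h3
  have h5 : M * (∫ ω, D (U k s ω) ∂P k) ≤ ε / 3 := by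
    calc _ ≤ M * (ε / 3 / (M + 1)) := by gcongr
      _ = ε / 3 * (M / (M + 1)) := by ring
      _ ≤ ε / 3 * 1 := by
          gcongr
          rw [div_le_one (by positivity)]; linarith
      _ = _ := mul_one _
  have h6 : B * ∫ ω, (1 - cutoff R (‖U k s ω‖ ^ 2)) ∂P k ≤ ε / 3 := by
    calc _ ≤ B * (ε / 3 / (B + 1)) := by gcongr
      _ = ε / 3 * (B / (B + 1)) := by ring
      _ ≤ ε / 3 * 1 := by
          gcongr
          rw [div_le_one (by positivity)]; linarith
      _ = _ := mul_one _
  linarith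

end

/-! ### The central limit theorem for the characteristic polynomial at a Hermite zero -/

lemma eventually_sqrt_div_coe_le (C : ℝ) {ε : ℝ} (hε : 0 < ε) :
    ∀ᶠ k : ℝ≥0 in atTop, C * √(2 * k) / (k : ℝ) ≤ ε := by
  have h1 : Tendsto (fun k : ℝ≥0 => √(2 * (k : ℝ))) atTop atTop :=
    Real.tendsto_sqrt_atTop.comp ((NNReal.tendsto_coe_atTop.2 tendsto_id).const_mul_atTop two_pos)
  have h2 : Tendsto (fun k : ℝ≥0 => 2 * C / √(2 * (k : ℝ))) atTop (𝓝 0) :=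
    tendsto_const_nhds.div_atTop h1
  filter_upwards [h2.eventually (gt_mem_nhds hε), eventually_gt_atTop 0] with k hk hk0
  have hk' : (0 : ℝ) < k := hk0
  have h3 : C * √(2 * k) / (k : ℝ) = 2 * C / √(2 * (k : ℝ)) := by
    rw [div_eq_div_iff hk'.ne' (by positivity), mul_assoc, Real.mul_self_sqrt (by positivity)]
    ring
  rw [h3]
  exact hk.le

lemma heatBracket_hermiteVec (n : ℕ) (i : Fin (n + 1)) {τ : ℝ} (hτ : 0 < τ) :
    heatBracket 1 (hermiteRoot (n + 1) i) τ (√τ • hermiteVec (n + 1)) =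
      hermiteBracket n (hermiteRoot (n + 1) i) τ := by
  have h := sum_heatEval_sq n i (c := √τ) (Real.sqrt_pos.2 hτ).ne'
  rw [Real.sq_sqrt hτ.le] at h
  rw [← h]
  simp [heatBracket, rootPoly, hermiteVec]

section

variable {n : ℕ} {Ω : ℝ≥0 → Type*} [∀ k, MeasurableSpace (Ω k)] {P : ∀ k, Measure (Ω k)}
  [∀ k, IsProbabilityMeasure (P k)] {U : ∀ k, ℝ → Ω k → EuclideanSpace ℝ (Fin (n + 1))}

lemma tendsto_integral_bracket_sub (hU : ∀ k : ℝ≥0, 0 < k → IsScaledBessel (n + 1) k (P k) (U k))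
    (i : Fin (n + 1)) {R : ℝ} (hR : 0 < R) :
    Tendsto (fun k : ℝ≥0 => ∫ τ in (0 : ℝ)..1, ∫ ω, |(hermiteBracket n (hermiteRoot (n + 1) i) τ -
      heatBracket 1 (hermiteRoot (n + 1) i) τ (U k τ ω)) * cutoff R (‖U k τ ω‖ ^ 2)| ∂P k) atTop
      (𝓝 0) := by
  have hK := isCompact_norm_sq_le (N := n + 1) (2 * R)
  obtain ⟨H, hH⟩ : ∃ H : ℝ → EuclideanSpace ℝ (Fin (n + 1)) → ℝ, H = fun τ x =>
    (hermiteBracket n (hermiteRoot (n + 1) i) τ - heatBracket 1 (hermiteRoot (n + 1) i) τ x) *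
      cutoff R (‖x‖ ^ 2) := ⟨_, rfl⟩
  have hHc : Continuous (Function.uncurry H) := by
    rw [hH]
    exact (((continuous_hermiteBracket n _).comp continuous_fst).sub
      (continuous_heatBracket _ _)).mul ((continuous_cutoff_norm_sq R).comp continuous_snd)
  have hHK : ∀ τ, ∀ x ∉ {x : EuclideanSpace ℝ (Fin (n + 1)) | ‖x‖ ^ 2 ≤ 2 * R}, H τ x = 0 := by
    intro τ x hx
    have hx' : ¬ ‖x‖ ^ 2 ≤ 2 * R := hx
    rw [hH]
    beta_reduce
    rw [cutoff_eq_zero hR (not_le.1 hx').le, mul_zero]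
  obtain ⟨C, hC⟩ := exists_local_bound hHc hK hHK 0
  have hC' : ∀ τ ∈ Set.Ioc (0 : ℝ) 1, ∀ x, |H τ x| ≤ C := fun τ hτ x =>
    hC τ ⟨by linarith [hτ.1], by linarith [hτ.2]⟩ x
  have h0 : ∫ τ in (0 : ℝ)..1, (0 : ℝ) = 0 := by simp
  have hfun : (fun k : ℝ≥0 => ∫ τ in (0 : ℝ)..1, ∫ ω,
      |(hermiteBracket n (hermiteRoot (n + 1) i) τ -
      heatBracket 1 (hermiteRoot (n + 1) i) τ (U k τ ω)) * cutoff R (‖U k τ ω‖ ^ 2)| ∂P k) =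
      fun k => ∫ τ in (0 : ℝ)..1, ∫ ω, |H τ (U k τ ω)| ∂P k := by rw [hH]
  rw [hfun]
  conv => enter [3, 1]; rw [← h0]
  refine intervalIntegral.tendsto_integral_filter_of_dominated_convergence (E := ℝ) (fun _ => C) ?_ ?_
    (by simp) (.of_forall fun τ hτ => ?_)
  · filter_upwards [eventually_gt_atTop 0] with k hk
    have := (hU k hk).continuous_integral (H := fun τ x => |H τ x|) hHc.abs hK
      (fun τ x hx => by rw [hHK τ x hx, abs_zero])
    have h2 : Continuous fun τ : ℝ => ∫ ω, |H τ (U k τ ω)| ∂P k :=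
      this.comp (by fun_prop : Continuous fun τ : ℝ => (τ, τ))
    exact h2.aestronglyMeasurable
  · refine .of_forall fun k => .of_forall fun τ hτ => ?_
    rw [Set.uIoc_of_le zero_le_one] at hτ
    refine (norm_integral_le_of_norm_le_const (C := C) (.of_forall fun ω => ?_)).trans (by simp)
    rw [Real.norm_eq_abs, abs_abs]
    exact hC' τ hτ _
  · rw [Set.uIoc_of_le zero_le_one] at hτ
    refine tendsto_integral_abs hU (f := H τ)
      (hHc.comp (by fun_prop : Continuous fun x => (τ, x))) (hC' τ hτ) hτ ?_
    rw [hH]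
    beta_reduce
    rw [heatBracket_hermiteVec n i hτ.1, sub_self, zero_mul]

lemma tendsto_integral_oscillating (hU : ∀ k : ℝ≥0, 0 < k → IsScaledBessel (n + 1) k (P k) (U k))
    (i : Fin (n + 1)) {θ : ℝ} {φ φ' : ℝ → ℝ} (hφ : ContDiff ℝ (⊤ : ℕ∞) φ)
    (h1 : ∀ u, HasDerivAt φ (φ' u) u) (h2 : ∀ u, HasDerivAt φ' (-θ ^ 2 * φ u) u)
    (hb0 : ∀ u, |φ u| ≤ 1) (hb1 : ∀ u, |φ' u| ≤ |θ|) :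
    Tendsto (fun k : ℝ≥0 => ∫ ω, φ (√(2 * k) *
      (rootPoly Finset.univ (U k 1 ω)).eval (hermiteRoot (n + 1) i)) ∂P k) atTop
      (𝓝 (φ 0 * Real.exp (-(θ ^ 2 / 2 *
        ∫ τ in (0 : ℝ)..1, hermiteBracket n (hermiteRoot (n + 1) i) τ)))) := by
  obtain ⟨z, hz⟩ : ∃ z, z = hermiteRoot (n + 1) i := ⟨_, rfl⟩
  have hbr := fun R hR => tendsto_integral_bracket_sub hU i (R := R) hR
  have hzero := eval_heatPoly_sqrt zero_le_one (n + 1) i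
  rw [Real.sqrt_one, one_mul] at hzero
  simp only [← hz] at hbr hzero ⊢
  have hγ := continuous_hermiteBracket n z
  obtain ⟨a, ha⟩ : ∃ a : ℝ → ℝ, a = fun τ =>
    Real.exp (θ ^ 2 / 2 * ∫ u in (0 : ℝ)..τ, hermiteBracket n z u) := ⟨_, rfl⟩
  have had : ∀ τ, HasDerivAt a (θ ^ 2 / 2 * hermiteBracket n z τ * a τ) τ := fun τ => by
    have e1 := (intervalIntegral.integral_hasDerivAt_right (hγ.intervalIntegrable 0 τ)
      hγ.stronglyMeasurable.stronglyMeasurableAtFilter hγ.continuousAt).const_mul (θ ^ 2 / 2)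
    rw [ha]
    exact e1.exp.congr_deriv (by ring)
  have hac : Continuous a := continuous_iff_continuousAt.2 fun τ => (had τ).continuousAt
  have ha0 : a 0 = 1 := by rw [ha]; simp
  have hapos : ∀ τ, 0 < a τ := fun τ => by rw [ha]; exact Real.exp_pos _
  obtain ⟨A, hA⟩ := (isCompact_Icc (a := (0 : ℝ)) (b := 1)).exists_bound_of_continuousOn
    hac.continuousOn
  have hA0 : 0 ≤ A := (norm_nonneg _).trans (hA 0 (by simp))
  have hscale : ∀ c : ℝ, ∀ u, HasDerivAt (fun u => φ (c * u)) (c * φ' (c * u)) u := fun c u => by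
    have e0 : HasDerivAt (fun u => c * u) c u := by simpa using (hasDerivAt_id u).const_mul c
    exact ((h1 (c * u)).comp u e0).congr_deriv (by ring)
  have hscale2 : ∀ c : ℝ, ∀ u, HasDerivAt (fun u => c * φ' (c * u))
      (-(θ ^ 2 * c ^ 2) * φ (c * u)) u := fun c u => by
    have e0 : HasDerivAt (fun u => c * u) c u := by simpa using (hasDerivAt_id u).const_mul c
    exact (((h2 (c * u)).comp u e0).const_mul c).congr_deriv (by ring)
  have hds : ∀ c : ℝ, deriv (fun u => φ (c * u)) = fun u => c * φ' (c * u) := fun c =>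
    funext fun u => (hscale c u).deriv
  have hds2 : ∀ c : ℝ, deriv (deriv (fun u => φ (c * u))) =
      fun u => -(θ ^ 2 * c ^ 2) * φ (c * u) := fun c => by
    rw [hds]; exact funext fun u => (hscale2 c u).deriv
  -- the limit with the exponential factor
  have hlim : Tendsto (fun k : ℝ≥0 => |a 1 * (∫ ω, φ (√(2 * k) *
      (rootPoly Finset.univ (U k 1 ω)).eval z) ∂P k) - φ 0|) atTop (𝓝 0) := by
    refine tendsto_zero_of_eventually_le (fun k => abs_nonneg _) fun ε hε => ?_
    obtain ⟨C', hC', herr⟩ := exists_abs_cutoffError_le (n + 1)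
    obtain ⟨R₀, hR₀, htail⟩ := eventually_integral_one_sub_cutoff_le hU
      (show 0 < ε / 5 / a 1 from div_pos (by positivity) (hapos 1))
    obtain ⟨R, hR⟩ : ∃ R, R = max R₀ (5 * (A * C') / ε + 1) := ⟨_, rfl⟩
    have hR0 : 0 < R := by rw [hR]; exact lt_max_of_lt_left hR₀
    have hR1 : 5 * (A * C') / ε + 1 ≤ R := by rw [hR]; exact le_max_right _ _
    have htail := htail R (by rw [hR]; exact le_max_left _ _) 1 (by simp)
    have hAC : A * C' / R ≤ ε / 5 := by
      rw [div_le_iff₀ hR0]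
      calc A * C' ≤ ε / 5 * (5 * (A * C') / ε + 1) := by
            have : ε / 5 * (5 * (A * C') / ε + 1) = A * C' + ε / 5 := by field_simp
            rw [this]; linarith
        _ ≤ _ := by gcongr
    obtain ⟨C, hC, herr⟩ := herr R hR0 1 z
    have hJ := ((hbr R hR0).const_mul (θ ^ 2 / 2 * A))
    rw [mul_zero] at hJ
    filter_upwards [htail, hJ.eventually (gt_mem_nhds (show 0 < ε / 5 by positivity)),
      eventually_div_coe_le (A * C) (show 0 < ε / 5 by positivity),
      eventually_sqrt_div_coe_le (A * C * |θ|) (show 0 < ε / 5 by positivity),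
      eventually_gt_atTop 0] with k hk1 hk2 hk3 hk4 hk
    have hk' : (0 : ℝ) < k := hk
    have hsq : √(2 * (k : ℝ)) ^ 2 = 2 * k := Real.sq_sqrt (by positivity)
    obtain ⟨c, hc⟩ : ∃ c, c = √(2 * (k : ℝ)) := ⟨_, rfl⟩
    have hc0 : 0 ≤ c := by rw [hc]; positivity
    rw [← hc] at hk4 hsq ⊢
    have hcJ : Continuous fun q : ℝ × EuclideanSpace ℝ (Fin (n + 1)) => θ ^ 2 / 2 * A *
        |(hermiteBracket n z q.1 - heatBracket 1 z q.1 q.2) * cutoff R (‖q.2‖ ^ 2)| :=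
      continuous_const.mul (((hγ.comp continuous_fst).sub (continuous_heatBracket _ _)).mul
        ((continuous_cutoff_norm_sq R).comp continuous_snd)).abs
    have hmain := (hU k hk).abs_integral_heatEval_sub_le hk' (s := 1) (by simp) z hR0
      (φ := fun u => φ (c * u)) (a := a) (a' := fun τ => θ ^ 2 / 2 * hermiteBracket n z τ * a τ)
      (J := fun τ x => θ ^ 2 / 2 * A *
        |(hermiteBracket n z τ - heatBracket 1 z τ x) * cutoff R (‖x‖ ^ 2)|) (A := A)
      (δ := C * (1 + c * |θ|) / k + C' * 1 / R)
      (hφ.comp (contDiff_const.mul contDiff_id)) had ((continuous_const.mul hγ).mul hac) hcJ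
      (fun τ x hx => by rw [cutoff_eq_zero hR0 hx.le, mul_zero, abs_zero, mul_zero])
      (fun τ hτ x => by
        rw [hds2]
        have e : (θ ^ 2 / 2 * hermiteBracket n z τ * a τ *
              φ (c * heatEval (1 - τ) z (rootPoly Finset.univ x)) +
            a τ * (1 / (4 * k) * (-(θ ^ 2 * c ^ 2) *
              φ (c * heatEval (1 - τ) z (rootPoly Finset.univ x))) * heatBracket 1 z τ x)) *
              cutoff R (‖x‖ ^ 2) =
            θ ^ 2 / 2 * (a τ * φ (c * heatEval (1 - τ) z (rootPoly Finset.univ x))) *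
              ((hermiteBracket n z τ - heatBracket 1 z τ x) * cutoff R (‖x‖ ^ 2)) := by
          rw [hsq]; field_simp; ring
        rw [e, abs_mul, abs_mul, abs_mul, abs_of_nonneg (by positivity : 0 ≤ θ ^ 2 / 2)]
        refine mul_le_mul_of_nonneg_right (mul_le_mul_of_nonneg_left ?_ (by positivity))
          (abs_nonneg _)
        calc |a τ| * |φ (c * heatEval (1 - τ) z (rootPoly Finset.univ x))| ≤ A * 1 :=
              mul_le_mul (hA τ hτ) (hb0 _) (abs_nonneg _) hA0
          _ = A := mul_one A)
      hA
      (fun τ hτ x => herr (fun u => φ (c * u)) 1 (c * |θ|) k (fun u => hb0 _)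
        (fun u => by
          rw [hds, abs_mul, abs_of_nonneg hc0]
          exact mul_le_mul_of_nonneg_left (hb1 _) hc0) hk' τ hτ x)
    simp only [ha0, hzero, mul_zero, one_mul, mul_one, integral_const_mul,
      intervalIntegral.integral_const_mul] at hmain
    have hcr : Continuous fun x : EuclideanSpace ℝ (Fin (n + 1)) =>
        φ (c * (rootPoly Finset.univ x).eval z) :=
      hφ.continuous.comp (continuous_const.mul (continuous_eval_rootPoly _ _))
    have hi1 := integrable_bounded_comp (hU k hk) hcr (fun x => hb0 _) 1
    have hi2 := integrable_bounded_comp (hU k hk) (f := fun x =>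
        φ (c * (rootPoly Finset.univ x).eval z) * cutoff R (‖x‖ ^ 2))
      (hcr.mul (continuous_cutoff_norm_sq R)) (C := 1) (fun x => by
        rw [abs_mul]
        exact mul_le_one₀ (hb0 _) (abs_nonneg _) (abs_cutoff_le_one _ _)) 1
    have hi3 := integrable_one_sub_cutoff (hU k hk) R 1
    have hdiff : |(∫ ω, φ (c * (rootPoly Finset.univ (U k 1 ω)).eval z) ∂P k) -
        ∫ ω, φ (c * (rootPoly Finset.univ (U k 1 ω)).eval z) * cutoff R (‖U k 1 ω‖ ^ 2) ∂P k| ≤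
        ∫ ω, (1 - cutoff R (‖U k 1 ω‖ ^ 2)) ∂P k := by
      rw [← integral_sub hi1 hi2, ← Real.norm_eq_abs]
      refine norm_integral_le_of_norm_le hi3 (.of_forall fun ω => ?_)
      rw [← mul_one_sub, norm_mul, Real.norm_eq_abs, Real.norm_eq_abs,
        abs_of_nonneg (sub_nonneg.2 (cutoff_le_one _ _))]
      exact mul_le_of_le_one_left (sub_nonneg.2 (cutoff_le_one _ _)) (hb0 _)
    have hdiff2 := (mul_le_mul_of_nonneg_left (hdiff.trans hk1) (hapos 1).le)
    rw [mul_div_cancel₀ _ (hapos 1).ne', ← abs_of_pos (hapos 1), ← abs_mul, mul_sub] at hdiff2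
    have e5 : A * (C * (1 + c * |θ|) / k + C' / R) =
      A * C / k + A * C * |θ| * c / k + A * C' / R := by ring
    rw [e5] at hmain
    have htri := abs_sub_le (a 1 * ∫ ω, φ (c * (rootPoly Finset.univ (U k 1 ω)).eval z) ∂P k)
      (a 1 * ∫ ω, φ (c * (rootPoly Finset.univ (U k 1 ω)).eval z) *
        cutoff R (‖U k 1 ω‖ ^ 2) ∂P k) (φ 0)
    linarith
  have hlim2 := (tendsto_sub_nhds_zero_iff.1 ((tendsto_zero_iff_abs_tendsto_zero _).2 hlim)).const_mul
    (a 1)⁻¹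
  have hfin : (a 1)⁻¹ * φ 0 = φ 0 * Real.exp (-(θ ^ 2 / 2 *
        ∫ τ in (0 : ℝ)..1, hermiteBracket n z τ)) := by
    rw [ha, Real.exp_neg, mul_comm]
  rw [hfin] at hlim2
  refine hlim2.congr fun k => ?_
  rw [inv_mul_cancel_left₀ (hapos 1).ne']

end

/-! ### The limit theorem for the extreme particles -/

lemma integral_hermiteBracket_nonneg (n : ℕ) (z : ℝ) :
    0 ≤ ∫ τ in (0 : ℝ)..1, hermiteBracket n z τ := by
  refine intervalIntegral.integral_nonneg zero_le_one fun τ hτ => ?_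
  have hτ0 := hτ.1
  have hpos := hermiteNorm_pos
  unfold hermiteBracket
  refine mul_nonneg (div_nonneg (mul_nonneg (by positivity) (hpos n).le) (by positivity))
    (Finset.sum_nonneg fun l _ => mul_nonneg (by positivity)
      (div_nonneg (sq_nonneg _) (hpos l).le))

/-- The product of the distances of the `i`-th Hermite zero to the other ones. -/
def rootGap (n : ℕ) (i : Fin (n + 1)) : ℝ :=
  ∏ j ∈ Finset.univ.erase i, (hermiteRoot (n + 1) i - hermiteRoot (n + 1) j)

lemma half_le_ratSq {u : ℝ} (h : 1 ≤ |u|) : 1 / 2 ≤ ratSq u := by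
  have := le_ratSq zero_le_one h
  norm_num at this ⊢
  exact this

lemma abs_sub_le_of_quotient {φ : ℝ → ℝ} {L : ℝ} (hφ : ∀ u, |φ u| ≤ 1)
    (hL : ∀ u v, |φ u - φ v| ≤ L * |u - v|) (hL0 : 0 ≤ L) {Q₀ Y Q A δ : ℝ} (hQ₀ : Q₀ ≠ 0)
    (hA : 0 < A) (hδ : 0 < δ) (hδ1 : δ ≤ 1 / 2) :
    |φ Y - φ (Y * Q / Q₀)| ≤ 2 * L * A * δ / |Q₀| + 2 / δ * min 1 |Q / Q₀ - 1| +
      4 * ratSq (A⁻¹ * (Y * Q)) := by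
  have h2 : |φ Y - φ (Y * Q / Q₀)| ≤ 2 := by
    have := abs_sub (φ Y) (φ (Y * Q / Q₀))
    linarith [hφ Y, hφ (Y * Q / Q₀)]
  have hQp : 0 < |Q₀| := abs_pos.2 hQ₀
  have p1 : 0 ≤ 2 * L * A * δ / |Q₀| := by positivity
  have p2 : 0 ≤ 2 / δ * min 1 |Q / Q₀ - 1| :=
    mul_nonneg (by positivity) (le_min zero_le_one (abs_nonneg _))
  have p3 := ratSq_nonneg (A⁻¹ * (Y * Q))
  by_cases h3 : δ ≤ |Q / Q₀ - 1|
  · have : 2 ≤ 2 / δ * min 1 |Q / Q₀ - 1| := by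
      rw [div_mul_eq_mul_div, le_div_iff₀ hδ]
      have := le_min (hδ1.trans (by norm_num) : δ ≤ 1) h3
      linarith
    linarith
  by_cases h4 : A ≤ |Y * Q|
  · have : 1 ≤ |A⁻¹ * (Y * Q)| := by
      rw [abs_mul, abs_of_pos (inv_pos.2 hA), ← div_eq_inv_mul, le_div_iff₀ hA, one_mul]
      exact h4
    have := half_le_ratSq this
    linarith
  rw [not_le] at h3 h4
  have h5 : 1 / 2 ≤ |Q / Q₀| := by
    have := (abs_lt.1 h3).1
    exact le_trans (by linarith) (le_abs_self _)
  have h6 : |Y| ≤ 2 * A / |Q₀| := by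
    rw [le_div_iff₀ hQp]
    have e : |Y * Q| = |Y| * |Q₀| * |Q / Q₀| := by
      rw [← abs_mul, ← abs_mul]
      congr 1
      field_simp
    rw [e] at h4
    have := mul_le_mul_of_nonneg_left h5 (mul_nonneg (abs_nonneg Y) hQp.le)
    linarith
  have h7 : |φ Y - φ (Y * Q / Q₀)| ≤ 2 * L * A * δ / |Q₀| := by
    calc _ ≤ L * |Y - Y * Q / Q₀| := hL _ _
      _ = L * (|Y| * |Q / Q₀ - 1|) := by
          rw [← abs_mul, ← abs_neg]
          congr 2
          ring
      _ ≤ L * (2 * A / |Q₀| * δ) := by gcongr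
      _ = _ := by ring
  linarith

section

variable {n : ℕ} {Ω : ℝ≥0 → Type*} [∀ k, MeasurableSpace (Ω k)] {P : ∀ k, Measure (Ω k)}
  [∀ k, IsProbabilityMeasure (P k)] {U : ∀ k, ℝ → Ω k → EuclideanSpace ℝ (Fin (n + 1))}

lemma eval_rootPoly_eq (i : Fin (n + 1)) (x : EuclideanSpace ℝ (Fin (n + 1))) (y : ℝ) :
    (rootPoly Finset.univ x).eval y =
      (y - x i) * (rootPoly (Finset.univ.erase i) x).eval y := by
  rw [rootPoly_eq_mul_erase x (Finset.mem_univ i)]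
  simp

lemma tendsto_integral_sub_quotient
    (hU : ∀ k : ℝ≥0, 0 < k → IsScaledBessel (n + 1) k (P k) (U k)) (i : Fin (n + 1)) {φ : ℝ → ℝ}
    {L : ℝ} (hφc : Continuous φ) (hφ : ∀ u, |φ u| ≤ 1) (hL : ∀ u v, |φ u - φ v| ≤ L * |u - v|)
    (hL0 : 0 ≤ L) :
    Tendsto (fun k : ℝ≥0 => |(∫ ω, φ (√(2 * k) * (hermiteRoot (n + 1) i - U k 1 ω i)) ∂P k) -
      ∫ ω, φ (√(2 * k) * (rootPoly Finset.univ (U k 1 ω)).eval (hermiteRoot (n + 1) i) /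
        rootGap n i) ∂P k|) atTop (𝓝 0) := by
  have hQ₀ : rootGap n i ≠ 0 := prod_root_sub_ne_zero n i
  have hzero := eval_heatPoly_sqrt zero_le_one (n + 1) i
  rw [Real.sqrt_one, one_mul] at hzero
  obtain ⟨Q₀, hQ₀d⟩ : ∃ Q₀, Q₀ = rootGap n i := ⟨_, rfl⟩
  obtain ⟨z, hz⟩ : ∃ z, z = hermiteRoot (n + 1) i := ⟨_, rfl⟩
  obtain ⟨g, hg⟩ : ∃ g : EuclideanSpace ℝ (Fin (n + 1)) → ℝ, g = fun x =>
    min 1 |(rootPoly (Finset.univ.erase i) x).eval z / Q₀ - 1| := ⟨_, rfl⟩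
  have hgc : Continuous g := by
    rw [hg]
    exact continuous_const.min (((continuous_eval_rootPoly _ _).div_const _).sub
      continuous_const).abs
  have hg0 : ∀ x, 0 ≤ g x := fun x => by
    rw [hg]; exact le_min zero_le_one (abs_nonneg _)
  have hg1 : ∀ x, |g x| ≤ 1 := fun x => by
    rw [abs_of_nonneg (hg0 x), hg]; exact min_le_left _ _
  have hgz : g (√1 • hermiteVec (n + 1)) = 0 := by
    rw [hg]
    beta_reduce
    rw [Real.sqrt_one, one_smul, eval_rootPoly]
    have : ∏ j ∈ Finset.univ.erase i, (z - hermiteVec (n + 1) j) = Q₀ := by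
      rw [hz, hQ₀d]; rfl
    rw [this, div_self (hQ₀d ▸ hQ₀), sub_self, abs_zero]
    exact min_eq_right zero_le_one
  have hgt := tendsto_integral_abs hU hgc hg1 (s := 1) (by simp) hgz
  simp only [abs_of_nonneg (hg0 _)] at hgt
  rw [← hQ₀d] at hQ₀ ⊢
  rw [← hz] at hzero ⊢
  have hQp : 0 < |Q₀| := abs_pos.2 hQ₀
  refine tendsto_zero_of_eventually_le (fun k => abs_nonneg _) fun ε hε => ?_
  obtain ⟨C, hC, hrat⟩ := integral_ratSq_le hU (show 0 < ε / 24 by positivity) (s := 1) (by simp)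
    hzero
  obtain ⟨A, hA⟩ : ∃ A, A = 1 + 48 * C / ε := ⟨_, rfl⟩
  have hA1 : 1 ≤ A := by
    rw [hA]
    have : 0 ≤ 48 * C / ε := by positivity
    linarith
  have hA0 : 0 < A := by linarith
  have hCA : 2 * C / A ≤ ε / 24 := by
    rw [div_le_iff₀ hA0, hA]
    have : ε / 24 * (1 + 48 * C / ε) = 2 * C + ε / 24 := by field_simp; ring
    rw [this]; linarith
  obtain ⟨δ, hδ, hδ1, hδ2⟩ : ∃ δ, 0 < δ ∧ δ ≤ 1 / 2 ∧ 2 * L * A * δ / |Q₀| ≤ ε / 6 := by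
    refine ⟨min (1 / 2) (ε / 6 * |Q₀| / (2 * L * A + 1)), lt_min (by norm_num) (by positivity),
      min_le_left _ _, ?_⟩
    rw [div_le_iff₀ hQp]
    calc 2 * L * A * min (1 / 2) (ε / 6 * |Q₀| / (2 * L * A + 1))
        ≤ 2 * L * A * (ε / 6 * |Q₀| / (2 * L * A + 1)) := by gcongr; exact min_le_right _ _
      _ = ε / 6 * |Q₀| * (2 * L * A / (2 * L * A + 1)) := by ring
      _ ≤ ε / 6 * |Q₀| * 1 := by
          gcongr
          rw [div_le_one (by positivity)]; linarith
      _ = _ := mul_one _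
  filter_upwards [hrat, eventually_div_coe_le C (show 0 < ε / 24 by positivity),
    eventually_sqrt_div_coe_le C (show 0 < ε / 24 by positivity),
    hgt.eventually (gt_mem_nhds (show 0 < ε * δ / 12 by positivity)),
    eventually_gt_atTop 0] with k hk1 hk2 hk3 hk4 hk
  have hk' : (0 : ℝ) < k := hk
  obtain ⟨c, hc⟩ : ∃ c, c = √(2 * (k : ℝ)) := ⟨_, rfl⟩
  have hc0 : 0 ≤ c := by rw [hc]; positivity
  have hsq : c ^ 2 = 2 * k := by rw [hc]; exact Real.sq_sqrt (by positivity)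
  rw [← hc] at hk3 ⊢
  have hk5 := hk1 (A⁻¹ * c) (by positivity)
  have hk6 : C * (1 + A⁻¹ * c + (A⁻¹ * c) ^ 2) / k ≤ ε / 8 := by
    have hAi : A⁻¹ ≤ 1 := inv_le_one_of_one_le₀ hA1
    have e1 : C * (1 + A⁻¹ * c + (A⁻¹ * c) ^ 2) / k =
        C / k + A⁻¹ * (C * c / k) + A⁻¹ * (2 * C / A) := by
      rw [mul_pow, hsq]; field_simp
    have e2 : A⁻¹ * (C * c / k) ≤ 1 * (C * c / k) := by gcongr
    have e3 : A⁻¹ * (2 * C / A) ≤ 1 * (2 * C / A) := by gcongr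
    rw [e1]; linarith
  have hcY : Continuous fun x : EuclideanSpace ℝ (Fin (n + 1)) => φ (c * (z - x i)) :=
    hφc.comp (by fun_prop)
  have hcW : Continuous fun x : EuclideanSpace ℝ (Fin (n + 1)) =>
      φ (c * (rootPoly Finset.univ x).eval z / Q₀) :=
    hφc.comp ((continuous_const.mul (continuous_eval_rootPoly _ _)).div_const _)
  have hcr : Continuous fun x : EuclideanSpace ℝ (Fin (n + 1)) =>
      ratSq (A⁻¹ * c * (rootPoly Finset.univ x).eval z) :=
    (contDiff_ratSq (n := 0)).continuous.comp
      (continuous_const.mul (continuous_eval_rootPoly _ _))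
  have i1 := integrable_bounded_comp (hU k hk) hcY (fun x => hφ _) 1
  have i2 := integrable_bounded_comp (hU k hk) hcW (fun x => hφ _) 1
  have i3 := integrable_bounded_comp (hU k hk) hgc hg1 1
  have i4 := integrable_bounded_comp (hU k hk) hcr (C := 1)
    (fun x => by rw [abs_of_nonneg (ratSq_nonneg _)]; exact ratSq_le_one _) 1
  have i5 : Integrable (fun ω => 2 * L * A * δ / |Q₀| + 2 / δ * g (U k 1 ω)) (P k) :=
    (integrable_const _).add (i3.const_mul _)
  have i6 := i4.const_mul 4
  have hle : |(∫ ω, φ (c * (z - U k 1 ω i)) ∂P k) -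
      ∫ ω, φ (c * (rootPoly Finset.univ (U k 1 ω)).eval z / Q₀) ∂P k| ≤
      ∫ ω, (2 * L * A * δ / |Q₀| + 2 / δ * g (U k 1 ω) +
        4 * ratSq (A⁻¹ * c * (rootPoly Finset.univ (U k 1 ω)).eval z)) ∂P k := by
    rw [← integral_sub i1 i2, ← Real.norm_eq_abs]
    refine norm_integral_le_of_norm_le (i5.add i6) (.of_forall fun ω => ?_)
    have := abs_sub_le_of_quotient hφ hL hL0 (Y := c * (z - U k 1 ω i))
      (Q := (rootPoly (Finset.univ.erase i) (U k 1 ω)).eval z) hQ₀ hA0 hδ hδ1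
    rw [mul_assoc c, ← eval_rootPoly_eq, ← mul_assoc A⁻¹] at this
    rw [hg]
    exact this
  rw [integral_add i5 i6, integral_add (integrable_const _) (i3.const_mul _), integral_const_mul,
    integral_const_mul] at hle
  simp only [integral_const, probReal_univ, smul_eq_mul, one_mul] at hle
  have e4 : 2 / δ * ∫ ω, g (U k 1 ω) ∂P k ≤ ε / 6 := by
    calc _ ≤ 2 / δ * (ε * δ / 12) := by gcongr
      _ = ε / 6 := by field_simp; norm_num
  linarith

lemma tendsto_charFun_particle
    (hU : ∀ k : ℝ≥0, 0 < k → IsScaledBessel (n + 1) k (P k) (U k)) (i : Fin (n + 1)) (θ : ℝ) :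
    Tendsto (fun k : ℝ≥0 => ∫ ω, Complex.exp (θ * (√(2 * k) *
      (U k 1 ω i - hermiteRoot (n + 1) i) : ℝ) * Complex.I) ∂P k) atTop
      (𝓝 (Complex.exp (-(hermiteVariance (n + 1) (hermiteRoot (n + 1) i) * θ ^ 2 / 2 : ℝ)))) := by
  have hQ₀ : rootGap n i ≠ 0 := prod_root_sub_ne_zero n i
  have hv := hermiteVariance_eq_integral n i
  have hexp : -((-θ / rootGap n i) ^ 2 / 2 *
      ∫ τ in (0 : ℝ)..1, hermiteBracket n (hermiteRoot (n + 1) i) τ) =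
      -(hermiteVariance (n + 1) (hermiteRoot (n + 1) i) * θ ^ 2 / 2) := by
    rw [hv, rootGap]; ring
  have hsub : ∀ φ φ' : ℝ → ℝ, ContDiff ℝ (⊤ : ℕ∞) φ → (∀ u, HasDerivAt φ (φ' u) u) →
      (∀ u, HasDerivAt φ' (-φ u) u) → (∀ u, |φ u| ≤ 1) → (∀ u, |φ' u| ≤ 1) →
      (∀ u v, |φ u - φ v| ≤ |u - v|) →
      Tendsto (fun k : ℝ≥0 => ∫ ω, φ (θ * (√(2 * k) * (U k 1 ω i - hermiteRoot (n + 1) i))) ∂P k)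
        atTop (𝓝 (φ 0 *
          Real.exp (-(hermiteVariance (n + 1) (hermiteRoot (n + 1) i) * θ ^ 2 / 2)))) := by
    intro φ φ' hφs h1 h2 hb hb' hlip
    have e0 : ∀ c u : ℝ, HasDerivAt (fun u => c * u) c u := fun c u => by
      simpa using (hasDerivAt_id u).const_mul c
    have hosc := tendsto_integral_oscillating hU i (θ := -θ / rootGap n i)
      (φ := fun u => φ (-θ / rootGap n i * u))
      (φ' := fun u => -θ / rootGap n i * φ' (-θ / rootGap n i * u))
      (hφs.comp (contDiff_const.mul contDiff_id))
      (fun u => ((h1 _).comp u (e0 _ u)).congr_deriv (by ring))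
      (fun u => (((h2 _).comp u (e0 _ u)).const_mul _).congr_deriv (by ring))
      (fun u => hb _) (fun u => by
        rw [abs_mul]
        exact mul_le_of_le_one_right (abs_nonneg _) (hb' _))
    have hquo := tendsto_integral_sub_quotient hU i (φ := fun u => φ (-θ * u)) (L := |θ|)
      (hφs.continuous.comp (by fun_prop)) (fun u => hb _)
      (fun u v => by
        refine (hlip _ _).trans (le_of_eq ?_)
        rw [← mul_sub, abs_mul, abs_neg]) (abs_nonneg _)
    rw [hexp, mul_zero] at hosc
    have h3 := ((tendsto_zero_iff_abs_tendsto_zero _).2 hquo).add hosc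
    rw [zero_add] at h3
    refine h3.congr fun k => ?_
    have e1 : ∀ ω, φ (-θ / rootGap n i * (√(2 * k) *
        (rootPoly Finset.univ (U k 1 ω)).eval (hermiteRoot (n + 1) i))) =
        φ (-θ * (√(2 * k) * (rootPoly Finset.univ (U k 1 ω)).eval (hermiteRoot (n + 1) i) /
          rootGap n i)) := fun ω => by
      congr 1; ring
    have e2 : ∀ ω, φ (-θ * (√(2 * k) * (hermiteRoot (n + 1) i - U k 1 ω i))) =
        φ (θ * (√(2 * k) * (U k 1 ω i - hermiteRoot (n + 1) i))) := fun ω => by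
      congr 1; ring
    simp only [e1, e2]
    ring
  have hcos := hsub Real.cos (fun u => -Real.sin u) Real.contDiff_cos Real.hasDerivAt_cos
    (fun u => (Real.hasDerivAt_sin u).neg) Real.abs_cos_le_one
    (fun u => by rw [abs_neg]; exact Real.abs_sin_le_one u) Real.abs_cos_sub_cos_le
  have hsin := hsub Real.sin Real.cos Real.contDiff_sin Real.hasDerivAt_sin
    Real.hasDerivAt_cos Real.abs_sin_le_one Real.abs_cos_le_one Real.abs_sin_sub_sin_le
  rw [Real.cos_zero, one_mul] at hcos
  rw [Real.sin_zero, zero_mul] at hsin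
  have h4 := ((Complex.continuous_ofReal.tendsto _).comp hcos).add
    (((Complex.continuous_ofReal.tendsto _).comp hsin).mul_const Complex.I)
  rw [Complex.ofReal_zero, zero_mul, add_zero, Complex.ofReal_exp, Complex.ofReal_neg] at h4
  refine h4.congr' ?_
  filter_upwards [eventually_gt_atTop 0] with k hk
  have hcl : Continuous fun x : EuclideanSpace ℝ (Fin (n + 1)) =>
    θ * (√(2 * k) * (x i - hermiteRoot (n + 1) i)) := by fun_prop
  have i1 := integrable_bounded_comp (hU k hk) (Real.continuous_cos.comp hcl)
    (fun x => Real.abs_cos_le_one _) 1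
  have i2 := integrable_bounded_comp (hU k hk) (Real.continuous_sin.comp hcl)
    (fun x => Real.abs_sin_le_one _) 1
  simp only [Function.comp_apply] at i1 i2 ⊢
  rw [← integral_complex_ofReal, ← integral_complex_ofReal, ← integral_mul_const,
    ← integral_add i1.ofReal (i2.ofReal.mul_const _)]
  refine integral_congr_ae (.of_forall fun ω => ?_)
  beta_reduce
  rw [← Complex.ofReal_mul, Complex.exp_mul_I, Complex.ofReal_cos, Complex.ofReal_sin]

end

lemma hermiteVariance_nonneg (n : ℕ) (i : Fin (n + 1)) :
    0 ≤ hermiteVariance (n + 1) (hermiteRoot (n + 1) i) := by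
  rw [hermiteVariance_eq_integral]
  exact div_nonneg (integral_hermiteBracket_nonneg n _) (sq_nonneg _)

lemma tendsto_of_tendsto_charFun {ι : Type*} {l : Filter ι} [l.IsCountablyGenerated]
    {μ : ι → ProbabilityMeasure ℝ} {ν : ProbabilityMeasure ℝ}
    (h : ∀ t, Tendsto (fun k => charFun (μ k : Measure ℝ) t) l (𝓝 (charFun (ν : Measure ℝ) t))) :
    Tendsto μ l (𝓝 ν) :=
  tendsto_of_seq_tendsto fun _ hx =>
    ProbabilityMeasure.tendsto_iff_tendsto_charFun.2 fun t => (h t).comp hx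

/-- The normal distribution with mean `0` and variance `v`, as a probability measure. -/
def centeredGaussian (v : ℝ) : ProbabilityMeasure ℝ := ⟨gaussianReal 0 v.toNNReal, inferInstance⟩

lemma charFun_centeredGaussian (v t : ℝ) : charFun (centeredGaussian v : Measure ℝ) t =
    Complex.exp (-((v.toNNReal : ℝ) * t ^ 2 / 2 : ℝ)) := by
  have : (centeredGaussian v : Measure ℝ) = gaussianReal 0 v.toNNReal := rfl
  rw [this, charFun_gaussianReal]
  congr 1
  push_cast
  ring

lemma tendsto_centeredGaussian {v : ℕ → ℝ} {w : ℝ} (h : Tendsto v atTop (𝓝 w)) :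
    Tendsto (fun n => centeredGaussian (v n)) atTop (𝓝 (centeredGaussian w)) := by
  refine tendsto_of_tendsto_charFun fun t => ?_
  simp only [charFun_centeredGaussian]
  have h1 : Continuous fun v : ℝ => Complex.exp (-((v.toNNReal : ℝ) * t ^ 2 / 2 : ℝ)) := by
    fun_prop
  exact (h1.tendsto w).comp h

/-- The limit in distribution of the `r`-th largest particle as `k → ∞`. -/
lemma tendstoInDistribution_particle {N r : ℕ} (hr : 1 ≤ r) (hN : r ≤ N) {Ω : ℝ≥0 → Type*}
    [∀ k, MeasurableSpace (Ω k)] {P : ∀ k, Measure (Ω k)} [∀ k, IsProbabilityMeasure (P k)]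
    {X : ∀ k, ℝ≥0 → Ω k → EuclideanSpace ℝ (Fin N)}
    (hX : ∀ k : ℝ≥0, IsBesselProcessA N k (P k) (X k)) {t : ℝ≥0} (ht : 0 < t) :
    TendstoInDistribution
      (fun (k : ℝ≥0) (ω : Ω k) => (N : ℝ) ^ (1 / 6 : ℝ) * √(2 * (k : ℝ)) *
        (X k t ω ⟨N - r, by omega⟩ / √(2 * (k : ℝ) * (t : ℝ)) - hermiteZero N r))
      atTop (fun x : ℝ => x) (fun k => P k)
      (centeredGaussian (edgeScale N ^ 2 * hermiteVariance N (hermiteZero N r)) : Measure ℝ) := by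
  obtain ⟨n, rfl⟩ : ∃ n, N = n + 1 := ⟨N - 1, by omega⟩
  have hU : ∀ k : ℝ≥0, 0 < k → IsScaledBessel (n + 1) k (P k) (scaledProcess (X k) k t) :=
    fun k hk => (hX k).isScaledBessel (NNReal.coe_pos.2 hk) (NNReal.coe_pos.2 ht)
  have hcoord : ∀ k ω, scaledProcess (X k) k t 1 ω ⟨n + 1 - r, by omega⟩ =
      X k t ω ⟨n + 1 - r, by omega⟩ / √(2 * (k : ℝ) * (t : ℝ)) := fun k ω => by
    rw [scaledProcess, mul_one, Real.toNNReal_coe, PiLp.smul_apply, smul_eq_mul, div_eq_inv_mul]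
  have hmeas : ∀ k : ℝ≥0, Measurable fun ω : Ω k => ((n + 1 : ℕ) : ℝ) ^ (1 / 6 : ℝ) *
      √(2 * (k : ℝ)) * (X k t ω ⟨n + 1 - r, by omega⟩ / √(2 * (k : ℝ) * (t : ℝ)) -
        hermiteZero (n + 1) r) := fun k => by
    have h1 := (hX k).measurable t
    have hm : ∀ i, Measurable fun x : EuclideanSpace ℝ (Fin (n + 1)) => x i := by fun_prop
    have h2 : Measurable fun ω : Ω k => X k t ω ⟨n + 1 - r, by omega⟩ := (hm _).comp h1
    fun_prop
  refine ⟨fun k => (hmeas k).aemeasurable, aemeasurable_id', tendsto_of_tendsto_charFun fun θ => ?_⟩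
  have hlim := tendsto_charFun_particle hU ⟨n + 1 - r, by omega⟩ (edgeScale (n + 1) * θ)
  rw [← hermiteZero_eq hr hN] at hlim
  have hvar : 0 ≤ hermiteVariance (n + 1) (hermiteZero (n + 1) r) := by
    rw [hermiteZero_eq hr hN]; exact hermiteVariance_nonneg n _
  have hlimit : charFun (((centeredGaussian (edgeScale (n + 1) ^ 2 *
      hermiteVariance (n + 1) (hermiteZero (n + 1) r)) : ProbabilityMeasure ℝ) : Measure ℝ).map
        fun x : ℝ => x) θ = Complex.exp (-(hermiteVariance (n + 1) (hermiteZero (n + 1) r) *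
          (edgeScale (n + 1) * θ) ^ 2 / 2 : ℝ)) := by
    rw [Measure.map_id', charFun_centeredGaussian, Real.coe_toNNReal _ (by positivity)]
    congr 3
    ring
  rw [ProbabilityMeasure.coe_mk, hlimit]
  refine hlim.congr fun k => ?_
  rw [ProbabilityMeasure.coe_mk, charFun_apply_real, integral_map (hmeas k).aemeasurable
    (by fun_prop)]
  refine integral_congr_ae (.of_forall fun ω => ?_)
  beta_reduce
  rw [hcoord, edgeScale]
  congr 2
  push_cast
  ring

theorem theorem1p1 :
    (∀ r : ℕ, ∀ hr : 1 ≤ r,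
      -- the limit theorem for the `r`-th largest particle
      (∀ (Ω : ℕ → ℝ≥0 → Type*) [∀ N k, MeasurableSpace (Ω N k)]
        (P : ∀ N k, Measure (Ω N k)) [∀ N k, IsProbabilityMeasure (P N k)]
        (X : ∀ N k, ℝ≥0 → Ω N k → EuclideanSpace ℝ (Fin N)),
        (∀ N, r ≤ N → ∀ k : ℝ≥0, IsBesselProcessA N k (P N k) (X N k)) →
        ∀ t : ℝ≥0, 0 < t →
          ∃ ν : ℕ → ProbabilityMeasure ℝ,
            (∀ N, ∀ hN : r ≤ N,
              TendstoInDistribution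
                (fun (k : ℝ≥0) (ω : Ω N k) =>
                  (N : ℝ) ^ (1 / 6 : ℝ) * √(2 * (k : ℝ)) *
                    (X N k t ω ⟨N - r, by omega⟩ / √(2 * (k : ℝ) * (t : ℝ)) - hermiteZero N r))
                atTop (fun x : ℝ => x) (fun k => P N k) (ν N : Measure ℝ)) ∧
            Tendsto ν atTop
              (𝓝 (⟨gaussianReal 0 (edgeVariance r).toNNReal, inferInstance⟩ :
                ProbabilityMeasure ℝ))) ∧
      -- the variance is a convergent integral
      IntegrableOn (edgeIntegrand r) (Set.Ioi 0) ∧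
      -- asymptotics of the `r`-th largest Hermite zero
      (fun N : ℕ => hermiteZero N r / √(2 * (N : ℝ))
          - (1 - |airyZero r| / (2 * (N : ℝ) ^ (2 / 3 : ℝ))))
        =O[atTop] (fun N : ℕ => ((N : ℝ))⁻¹)) ∧
    -- the numerical values, up to three decimals
    edgeVariance 1 ∈ Set.Ico (0.834 : ℝ) 0.835 ∧
    edgeVariance 2 ∈ Set.Ico (0.582 : ℝ) 0.583 ∧
    edgeVariance 3 ∈ Set.Ico (0.472 : ℝ) 0.473 ∧
    edgeVariance 4 ∈ Set.Ico (0.407 : ℝ) 0.408 ∧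
    Tendsto edgeVariance atTop (𝓝 0) := by
  refine ⟨fun r hr => ⟨?_, integrableOn_edgeIntegrand hr, hermiteZero_isBigO hr⟩,
    edgeVariance_one_mem, edgeVariance_two_mem, edgeVariance_three_mem, edgeVariance_four_mem,
    tendsto_edgeVariance⟩
  intro Ω _ P _ X hX t ht
  exact ⟨fun N => centeredGaussian (edgeScale N ^ 2 * hermiteVariance N (hermiteZero N r)),
    fun N hN => tendstoInDistribution_particle hr hN (hX N hN) ht,
    tendsto_centeredGaussian (tendsto_hermiteVariance hr)⟩

end
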